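/- For real parameters $\omega,s\neq 0$ and $n\in\{0,1,2,\dots\}\cup\{\infty\}$ let $(P_nf)(\tau)=\sum_{|\ell|\le n}\hat f_\ell\,\mathrm e^{\mathrm i\ell\tau}$ be the truncated Fourier series of a $2\pi$-periodic function $f$, with $\hat f_\ell=\frac1{2\pi}\int_0^{2\pi}f(\tau)\mathrm e^{-\mathrm i\ell\tau}\,\mathrm d\tau$ and $P_\infty=\mathrm{id}$, and let $G'(u)=-u+u^3$. The modulated traveling-wave equation of Galerkin order $n$ is the system $$u_\xi=v,\qquad v_\xi=P_nG'(u)+\theta,\qquad \theta_\xi=w,\qquad w_\xi=sv-\omega u_\tau$$ for functions of $(\xi,\tau)\in\mathbb R^2$ that are $2\pi$-periodic in $\tau$; for $n=\infty$ it is equivalent to $\omega u_\tau=-(u_{\xi\xi}+u-u^3)_{\xi\xi}+su_\xi$. A solution is a classical ($C^1$) solution $(u,v,\theta,w)$ defined for all $\xi\in\mathbb R$; it is called bounded if $\sup|u|<\infty$. Along solutions the quantity $$I=\frac1{2\pi}\int_0^{2\pi}(w-su)\,\mathrm d\tau$$ does not depend on $\xi$. Let $\mathcal A_n(I)$ be the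 set of all $u$ that belong to a bounded solution with this value of $I$, and let $\|u\|_{BC^k}=\max_{i+j\le k}\sup_{\xi,\tau}|\partial_\xi^i\partial_\tau^ju|$. (i) There is a function $C(\omega,s,n,I,k)\in[0,\infty)$, defined for $\omega,s\in\mathbb R\setminus\{0\}$, $n\in\mathbb N\cup\{\infty\}$, $I\in\mathbb R$, $k\in\mathbb N$, that is jointly continuous (with $\mathbb N\cup\{\infty\}$ the one-point compactification of $\mathbb N$, and $k$ discrete), and so bounded in $n\le\infty$ for fixed $\omega,s,I,k$, such that every $u\in\mathcal A_n(I)$ is $C^\infty$ and satisfies $$\|u\|_{BC^k}\le C(\omega,s,n,I,k)\qquad\text{for all }k\in\mathbb N.$$ (ii) For all $\omega,s\neq0$, all real $I_1,I_2$, all $n_0\le\infty$ and all $k\in\mathbb N$, the union $$\bigcup_{I\in[I_1,I_2],\ n_0\le n\le\infty}\mathcal A_n(I)$$ is precompact (has compact closure) in $C^k_{\mathrm{loc}}(\mathbb R\times S^1)$, $S^1=\mathbb R/2\pi\mathbb Z$, that is, with respect to uniform convergence on compact sets of all partial derivatives of order at most $k$. In particular every $\mathcal A_n(I)$ is precompact.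 -/

import Mathlib

open Set Filter Topology
open scoped NNReal ENNReal

noncomputable section

namespace ModulatedWave

/-- The Fourier coefficient `(2π)⁻¹ ∫₀^{2π} f(τ) e^{-iℓτ} dτ` of a `2π`-periodic function. -/
def fourierCoef (f : ℝ → ℝ) (l : ℤ) : ℂ :=
  ((2 * Real.pi : ℝ) : ℂ)⁻¹ *
    ∫ τ in (0 : ℝ)..(2 * Real.pi), (f τ : ℂ) * Complex.exp (-(Complex.I * l * τ))

/-- The truncated Fourier series `∑_{|ℓ| ≤ n} f̂_ℓ e^{iℓτ}`. For real `f` the sum is real, so that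
taking the real part only changes the type. -/
def fourierTrunc (n : ℕ) (f : ℝ → ℝ) (τ : ℝ) : ℝ :=
  (∑ l ∈ Finset.Icc (-(n : ℤ)) (n : ℤ), fourierCoef f l * Complex.exp (Complex.I * l * τ)).re

/-- The Galerkin projection `P_n`, `n ≤ ∞`, with `P_∞ = id`. -/
def galerkin (n : ℕ∞) (f : ℝ → ℝ) : ℝ → ℝ :=
  if n = ⊤ then f else fourierTrunc n.toNat f

/-- `G'(u) = -u + u³`, the derivative of `G(u) = -u²/2 + u⁴/4`. -/
def dG (u : ℝ) : ℝ := -u + u ^ 3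

/-- Classical (that is, `C¹`) solutions `(u, v, θ, w)(ξ, τ)`, `2π`-periodic in `τ` and defined for
all `ξ ∈ ℝ`, of the modulated traveling-wave equation of Galerkin order `n ≤ ∞`
`u_ξ = v`, `v_ξ = P_n G'(u) + θ`, `θ_ξ = w`, `w_ξ = s v - ω u_τ`. -/
structure IsSolution (ω s : ℝ) (n : ℕ∞) (u v θ w : ℝ → ℝ → ℝ) : Prop where
  contDiff_u : ContDiff ℝ 1 (Function.uncurry u)
  contDiff_v : ContDiff ℝ 1 (Function.uncurry v)
  contDiff_θ : ContDiff ℝ 1 (Function.uncurry θ)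
  contDiff_w : ContDiff ℝ 1 (Function.uncurry w)
  periodic_u : ∀ ξ, Function.Periodic (u ξ) (2 * Real.pi)
  periodic_v : ∀ ξ, Function.Periodic (v ξ) (2 * Real.pi)
  periodic_θ : ∀ ξ, Function.Periodic (θ ξ) (2 * Real.pi)
  periodic_w : ∀ ξ, Function.Periodic (w ξ) (2 * Real.pi)
  eq_u : ∀ ξ τ, deriv (fun x => u x τ) ξ = v ξ τ
  eq_v : ∀ ξ τ, deriv (fun x => v x τ) ξ = galerkin n (fun σ => dG (u ξ σ)) τ + θ ξ τ
  eq_θ : ∀ ξ τ, deriv (fun x => θ x τ) ξ = w ξ τ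
  eq_w : ∀ ξ τ, deriv (fun x => w x τ) ξ = s * v ξ τ - ω * deriv (u ξ) τ

/-- The quantity `I = (2π)⁻¹ ∫₀^{2π} (w - s u) dτ`, evaluated at `ξ`. -/
def firstIntegral (s : ℝ) (u w : ℝ → ℝ → ℝ) (ξ : ℝ) : ℝ :=
  (2 * Real.pi)⁻¹ * ∫ τ in (0 : ℝ)..(2 * Real.pi), (w ξ τ - s * u ξ τ)

/-- The set `𝒜_n(I)` of bounded solutions with first integral `I`. The first integral is conserved,
so that it does not matter at which `ξ` it is evaluated. -/
def boundedSolutions (ω s : ℝ) (n : ℕ∞) (I : ℝ) : Set (ℝ → ℝ → ℝ) :=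
  {u | ∃ v θ w : ℝ → ℝ → ℝ, IsSolution ω s n u v θ w ∧ (∃ M : ℝ, ∀ ξ τ, |u ξ τ| ≤ M) ∧
    ∃ ξ, firstIntegral s u w ξ = I}

/-- The mixed partial derivative `∂_ξ^i ∂_τ^j u`. -/
def mixedDeriv (i j : ℕ) (u : ℝ → ℝ → ℝ) (ξ τ : ℝ) : ℝ :=
  iteratedDeriv i (fun x => iteratedDeriv j (u x) τ) ξ

/-- The norm `‖u‖_{BC^k} = max_{i + j ≤ k} sup |∂_ξ^i ∂_τ^j u|` of a `k` times continuously
differentiable function, with value `∞` if one of these derivatives is unbounded. -/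
def bcNorm (k : ℕ) (u : ℝ → ℝ → ℝ) : ℝ≥0∞ :=
  ⨆ (i : ℕ) (j : ℕ) (_ : i + j ≤ k) (ξ : ℝ) (τ : ℝ), ‖mixedDeriv i j u ξ τ‖ₑ

/-- The space `C^k_loc(ℝ × S¹)`: `C^k` functions of `(ξ, τ)` that are `2π`-periodic in `τ`. -/
def CkLoc (k : ℕ) : Type :=
  {u : ℝ → ℝ → ℝ // ContDiff ℝ k (Function.uncurry u) ∧
    ∀ ξ, Function.Periodic (u ξ) (2 * Real.pi)}

/-- All partial derivatives of order at most `k`, in the spaces of functions on `ℝ × ℝ` with the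
topology of uniform convergence on compact sets. -/
def CkLoc.jet {k : ℕ} (u : CkLoc k) (p : {p : ℕ × ℕ // p.1 + p.2 ≤ k}) :
    UniformOnFun (ℝ × ℝ) ℝ {K : Set (ℝ × ℝ) | IsCompact K} :=
  UniformOnFun.ofFun _ (fun x => mixedDeriv p.1.1 p.1.2 u.1 x.1 x.2)

/-- The topology of `C^k_loc`: uniform convergence on compact sets of all partial derivatives of
order at most `k`. -/
instance (k : ℕ) : TopologicalSpace (CkLoc k) :=
  TopologicalSpace.induced CkLoc.jet inferInstance

end ModulatedWave

end

/-! Two facts carry the theorem, both uniform in `n`: a sup bound of `u` in terms of `|ω|`, `|ω|⁻¹`,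
`|s|`, `|s|⁻¹`, `|I|` (`SmoothSol.exists_bound`), and the control of all derivatives by a sup bound
(`SolFamily.regular_u`).

Regularity. The mode `l` in `τ` solves a linear ODE in `ξ` forced by the mode of `P_n G'(u)`.
Testing it with the conjugate of `û_l` and a slowly varying weight, the real part controls `v_ξ` and
the imaginary part controls `|ω l| |û_l|²`. Hence `û_l` gains a factor `|l|^(-1/4)` over the forcing
(`exists_gain`). Apply this to the differences `u(τ + h) - u(τ)`: `G'` is Lipschitz on the range of
`u`, so high modes are absorbed by the gain while low modes are `O(h)`. This gives Fourier decay of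
order one for `G'(u)` (`exists_coef_dG_le`), and then order 5/4 for `u`. Above order one such decay
is stable under products, so the gain iterates to rapid decay. The equations finally trade
`ξ`-derivatives for `τ`-derivatives and products. The projection does no harm: it acts mode by mode,
and the modes `|l| > n` of a bounded solution vanish because they are not forced.

A priori bound. The Lyapunov function `V` satisfies `V_ξ = ∫ w² dτ` (`hasDerivAt_lyapunov`). If a
weighted integral of `w²` near a point is at most `K`, then `u`, `v`, `θ`, `v_ξ` are bounded near
that point in terms of `K` and the parameters (`exists_localBound`). The reason is that `ω u_τ = s
u_ξ - w_ξ` is a transport equation with error `w`: averages of `u` along a characteristic that winds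
once around the circle are controlled by `w` and `I`, and this pins down the otherwise free function
`θ(0, τ)` in the energy identity. A bounded solution has bounded monotone `V`, so the dissipation
near `ξ = ±∞` becomes at most one; the local bound then bounds the limits of `V`, hence `V`, hence
the dissipation everywhere, and a second use of the local bound gives `|u| ≤ M`.

Conclusion. All solutions with parameters in a box form one family with uniform derivative bounds
(`regular_solutionBox`). A continuous selection over the size of the box gives `C`, and the
Arzelà-Ascoli theorem for jets gives precompactness. -/

noncomputable section

namespace ModulatedWave

open MeasureTheory

/-! ### Fourier coefficients of periodic functions and the Galerkin projection. -/

section Fourier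

open intervalIntegral

/-- The derivative of a parametric integral over a compact interval. -/
theorem hasDerivAt_intervalIntegral_param {E : Type*} [NormedAddCommGroup E] [NormedSpace ℝ E]
    {F F' : ℝ → ℝ → E} (a b : ℝ) (hF : ∀ x, Continuous (F x))
    (hF' : Continuous (Function.uncurry F'))
    (hd : ∀ x t, HasDerivAt (fun y => F y t) (F' x t) x) (x₀ : ℝ) :
    HasDerivAt (fun x => ∫ t in a..b, F x t) (∫ t in a..b, F' x₀ t) x₀ := by
  obtain ⟨K, hK⟩ := (IsCompact.prod (isCompact_Icc (a := x₀ - 1) (b := x₀ + 1))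
    (isCompact_uIcc (a := a) (b := b))).exists_bound_of_continuousOn hF'.continuousOn
  refine (hasDerivAt_integral_of_dominated_loc_of_deriv_le (μ := volume)
    (bound := fun _ => K) (s := Icc (x₀ - 1) (x₀ + 1)) (Icc_mem_nhds (by linarith) (by linarith))
    (Eventually.of_forall fun x => (hF x).aestronglyMeasurable)
    ((hF x₀).intervalIntegrable _ _) ?_ ?_ (by simp) ?_).2
  · exact (hF'.comp (Continuous.prodMk_right x₀)).aestronglyMeasurable
  · refine Eventually.of_forall fun t ht x hx => hK (x, t) ⟨hx, uIoc_subset_uIcc ht⟩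
  · exact Eventually.of_forall fun t _ x _ => hd x t

theorem norm_exp_I_mul (l : ℤ) (τ : ℝ) : ‖Complex.exp (Complex.I * l * τ)‖ = 1 := by
  have : Complex.I * l * τ = ((l * τ : ℝ) : ℂ) * Complex.I := by push_cast; ring
  rw [this, Complex.norm_exp_ofReal_mul_I]

theorem norm_exp_neg_I_mul (l : ℤ) (τ : ℝ) : ‖Complex.exp (-(Complex.I * l * τ))‖ = 1 := by
  have : -(Complex.I * l * τ) = ((-(l * τ) : ℝ) : ℂ) * Complex.I := by push_cast; ring
  rw [this, Complex.norm_exp_ofReal_mul_I]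

theorem continuous_coef_integrand {f : ℝ → ℝ} (hf : Continuous f) (l : ℤ) :
    Continuous fun τ : ℝ => (f τ : ℂ) * Complex.exp (-(Complex.I * l * τ)) := by fun_prop

theorem norm_fourierCoef_le {f : ℝ → ℝ} {M : ℝ} (h : ∀ τ, |f τ| ≤ M) (l : ℤ) :
    ‖fourierCoef f l‖ ≤ M := by
  have h2 := Real.two_pi_pos
  rw [fourierCoef, norm_mul, norm_inv, Complex.norm_real, Real.norm_of_nonneg h2.le]
  have := norm_integral_le_of_norm_le_const (a := (0 : ℝ)) (b := 2 * Real.pi)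
    (f := fun τ : ℝ => (f τ : ℂ) * Complex.exp (-(Complex.I * l * τ))) (C := M) (by
      intro τ _
      rw [norm_mul, norm_exp_neg_I_mul, mul_one, Complex.norm_real]
      exact h τ)
  rw [sub_zero, abs_of_pos h2] at this
  rw [inv_mul_le_iff₀ h2]
  linarith [this]

theorem fourierCoef_add {f g : ℝ → ℝ} (hf : Continuous f) (hg : Continuous g) (l : ℤ) :
    fourierCoef (fun τ => f τ + g τ) l = fourierCoef f l + fourierCoef g l := by
  simp only [fourierCoef]
  rw [← mul_add, ← intervalIntegral.integral_add ((continuous_coef_integrand hf l).intervalIntegrable _ _)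
    ((continuous_coef_integrand hg l).intervalIntegrable _ _)]
  congr 2; funext τ; push_cast; ring

theorem fourierCoef_const_mul (c : ℝ) (f : ℝ → ℝ) (l : ℤ) :
    fourierCoef (fun τ => c * f τ) l = c * fourierCoef f l := by
  simp only [fourierCoef]
  rw [mul_left_comm (c : ℂ), ← intervalIntegral.integral_const_mul (c : ℂ)]
  congr 2; ext τ; push_cast; ring

theorem fourierCoef_neg (f : ℝ → ℝ) (l : ℤ) :
    fourierCoef (fun τ => -f τ) l = -fourierCoef f l := by
  have := fourierCoef_const_mul (-1) f l
  simpa using this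

theorem fourierCoef_sub {f g : ℝ → ℝ} (hf : Continuous f) (hg : Continuous g) (l : ℤ) :
    fourierCoef (fun τ => f τ - g τ) l = fourierCoef f l - fourierCoef g l := by
  have := fourierCoef_add hf (g := fun τ => -g τ) hg.neg l
  simp only [sub_eq_add_neg]
  rw [this, fourierCoef_neg]

theorem periodic_exp (l : ℤ) :
    Function.Periodic (fun τ : ℝ => Complex.exp (-(Complex.I * l * τ))) (2 * Real.pi) := by
  intro τ
  have : -(Complex.I * l * ((τ + 2 * Real.pi : ℝ) : ℂ)) =
      -(Complex.I * l * τ) + ((-l : ℤ) : ℂ) * (2 * Real.pi * Complex.I) := by push_cast; ring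
  simp only [this]
  rw [Complex.exp_add, Complex.exp_int_mul_two_pi_mul_I, mul_one]

theorem fourierCoef_shift {f : ℝ → ℝ} (hp : Function.Periodic f (2 * Real.pi)) (h : ℝ) (l : ℤ) :
    fourierCoef (fun τ => f (τ + h)) l = Complex.exp (Complex.I * l * h) * fourierCoef f l := by
  simp only [fourierCoef]
  rw [mul_left_comm (Complex.exp _), ← intervalIntegral.integral_const_mul (Complex.exp _)]
  congr 1
  set G : ℝ → ℂ := fun τ => Complex.exp (Complex.I * l * h) *
    ((f τ : ℂ) * Complex.exp (-(Complex.I * l * τ))) with hG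
  have hGp : Function.Periodic G (2 * Real.pi) := by
    intro τ
    have h1 := periodic_exp l τ
    simp only [hG] at h1 ⊢
    rw [hp τ, h1]
  have e1 : ∀ τ, (f (τ + h) : ℂ) * Complex.exp (-(Complex.I * l * τ)) = G (τ + h) := by
    intro τ
    simp only [hG]
    rw [mul_left_comm, ← Complex.exp_add]
    congr 2; push_cast; ring
  simp only [e1]
  rw [integral_comp_add_right (f := G), zero_add, add_comm (2 * Real.pi) h,
    hGp.intervalIntegral_add_eq h 0, zero_add]

theorem fourierCoef_conj (f : ℝ → ℝ) (l : ℤ) :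
    fourierCoef f (-l) = (starRingEnd ℂ) (fourierCoef f l) := by
  simp only [fourierCoef]
  rw [map_mul, ← intervalIntegral_conj]
  congr 1
  · rw [map_inv₀, Complex.conj_ofReal]
  · congr 1; ext τ
    rw [map_mul, Complex.conj_ofReal, ← Complex.exp_conj]
    congr 2
    simp

section Circle

variable {f : ℝ → ℝ}

/-- The continuous function on the circle defined by a continuous periodic function. -/
def toCircleMap (hc : Continuous f) (hp : Function.Periodic f (2 * Real.pi)) :
    C(AddCircle (2 * Real.pi), ℂ) where
  toFun := Function.Periodic.lift (f := fun τ => (f τ : ℂ)) (c := 2 * Real.pi)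
    (fun τ => by simp [hp τ])
  continuous_toFun := by
    refine continuous_coinduced_dom.mpr ?_
    exact Complex.continuous_ofReal.comp hc

theorem toCircleMap_coe (hc : Continuous f) (hp : Function.Periodic f (2 * Real.pi)) (τ : ℝ) :
    toCircleMap hc hp (τ : AddCircle (2 * Real.pi)) = f τ := rfl

instance fact_two_pi_pos : Fact (0 < 2 * Real.pi) := ⟨Real.two_pi_pos⟩

theorem fourier_two_pi (l : ℤ) (τ : ℝ) :
    fourier l (τ : AddCircle (2 * Real.pi)) = Complex.exp (Complex.I * l * τ) := by
  rw [fourier_coe_apply]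
  congr 1
  have : (Real.pi : ℂ) ≠ 0 := by exact_mod_cast Real.pi_ne_zero
  push_cast
  field_simp

theorem fourierCoeff_toCircleMap (hc : Continuous f) (hp : Function.Periodic f (2 * Real.pi))
    (l : ℤ) : fourierCoeff (toCircleMap hc hp) l = fourierCoef f l := by
  rw [fourierCoeff_eq_intervalIntegral _ _ 0, fourierCoef, zero_add, one_div, Complex.real_smul]
  push_cast
  congr 2; ext τ
  rw [fourier_two_pi, toCircleMap_coe, smul_eq_mul, mul_comm]
  congr 2; push_cast; ring

theorem hasSum_fourier (hc : Continuous f) (hp : Function.Periodic f (2 * Real.pi))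
    (hs : Summable fun l => ‖fourierCoef f l‖) (τ : ℝ) :
    HasSum (fun l => fourierCoef f l * Complex.exp (Complex.I * l * τ)) (f τ : ℂ) := by
  have h1 : Summable (fourierCoeff (toCircleMap hc hp)) := by
    refine Summable.of_norm ?_
    simpa only [fourierCoeff_toCircleMap] using hs
  have := has_pointwise_sum_fourier_series_of_summable h1 (τ : AddCircle (2 * Real.pi))
  simpa only [fourierCoeff_toCircleMap, toCircleMap_coe, fourier_two_pi, smul_eq_mul] using this

theorem parseval (hc : Continuous f) :
    HasSum (fun l => ‖fourierCoef f l‖ ^ 2)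
      ((2 * Real.pi)⁻¹ * ∫ τ in (0 : ℝ)..(2 * Real.pi), f τ ^ 2) := by
  have hm : MemLp (fun τ => (f τ : ℂ)) 2 (volume.restrict (Ioc 0 (2 * Real.pi))) := by
    obtain ⟨K, hK⟩ := (isCompact_Icc (a := (0 : ℝ)) (b := 2 * Real.pi)).exists_bound_of_continuousOn
      hc.continuousOn
    refine MemLp.of_bound (C := K) (by fun_prop) ?_
    refine (ae_restrict_iff' measurableSet_Ioc).2 (Eventually.of_forall fun τ hτ => ?_)
    simpa using hK τ (Ioc_subset_Icc_self hτ)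
  have h1 := hasSum_sq_fourierCoeffOn Real.two_pi_pos hm
  have h2 : ∀ l, fourierCoeffOn Real.two_pi_pos (fun τ => (f τ : ℂ)) l = fourierCoef f l := by
    intro l
    rw [fourierCoeffOn_eq_integral, fourierCoef, sub_zero, one_div, Complex.real_smul]
    push_cast
    congr 2; ext τ
    refine (mul_comm _ _).trans (congrArg _ ?_)
    rw [fourier_two_pi]
    congr 1; push_cast; ring
  simp only [h2, sub_zero, smul_eq_mul] at h1
  convert h1 using 3
  ext τ
  simp

end Circle

theorem hasSum_of_eq {ι : Type*} {f g : ι → ℂ} {a b : ℂ} (h : HasSum f a) (hf : ∀ m, f m = g m)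
    (hab : a = b) : HasSum g b := by
  obtain rfl : f = g := funext hf
  subst hab
  exact h

/-- The Fourier coefficients of a product are given by convolution. -/
theorem hasSum_fourierCoef_mul {f g : ℝ → ℝ} (hf : Continuous f)
    (hp : Function.Periodic f (2 * Real.pi)) (hs : Summable fun l => ‖fourierCoef f l‖)
    (hg : Continuous g) (l : ℤ) :
    HasSum (fun m => fourierCoef f m * fourierCoef g (l - m))
      (fourierCoef (fun τ => f τ * g τ) l) := by
  obtain ⟨K, hK⟩ := (isCompact_uIcc (a := (0 : ℝ)) (b := 2 * Real.pi)).exists_bound_of_continuousOn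
      hg.continuousOn
  have key := intervalIntegral.hasSum_integral_of_dominated_convergence (μ := volume)
    (a := (0 : ℝ)) (b := 2 * Real.pi)
    (F := fun (m : ℤ) (τ : ℝ) => fourierCoef f m *
      ((g τ : ℂ) * Complex.exp (-(Complex.I * (l - m : ℤ) * τ))))
    (f := fun τ => ((f τ * g τ : ℝ) : ℂ) * Complex.exp (-(Complex.I * l * τ)))
    (bound := fun m _ => ‖fourierCoef f m‖ * K)
    (fun m => ((continuous_coef_integrand hg (l - m)).const_mul _).aestronglyMeasurable)
    (fun m => Eventually.of_forall fun τ hτ => by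
      rw [norm_mul, norm_mul, norm_exp_neg_I_mul, mul_one, Complex.norm_real]
      exact mul_le_mul_of_nonneg_left (hK τ (uIoc_subset_uIcc hτ)) (norm_nonneg _))
    (Eventually.of_forall fun τ _ => hs.mul_right K)
    (by simp)
    (Eventually.of_forall fun τ _ => by
      have h1 := (hasSum_fourier hf hp hs τ).mul_right
        ((g τ : ℂ) * Complex.exp (-(Complex.I * l * τ)))
      refine hasSum_of_eq h1 (fun m => ?_) ?_
      · rw [mul_assoc, mul_left_comm (Complex.exp _) (g τ : ℂ), ← Complex.exp_add]
        congr 3; push_cast; ring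
      · push_cast; ring)
  have := key.mul_left ((2 * Real.pi : ℝ) : ℂ)⁻¹
  refine hasSum_of_eq this (fun m => ?_) (by rw [fourierCoef])
  rw [intervalIntegral.integral_const_mul, fourierCoef, fourierCoef]
  ring

/-- The Fourier coefficient of an exponential sum. -/
theorem integral_exp_mul_exp (m l : ℤ) :
    ((2 * Real.pi : ℝ) : ℂ)⁻¹ * ∫ τ in (0 : ℝ)..(2 * Real.pi),
      Complex.exp (Complex.I * m * τ) * Complex.exp (-(Complex.I * l * τ)) =
    if m = l then 1 else 0 := by
  have h := congrFun (fourierCoeff_fourier (T := 2 * Real.pi) m) l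
  rw [fourierCoeff_eq_intervalIntegral _ _ 0, zero_add, one_div, Complex.real_smul] at h
  simp only [fourier_two_pi, smul_eq_mul, Pi.single_apply] at h
  simp only [eq_comm (a := m)]
  rw [← h]
  push_cast
  congr 2; ext τ
  rw [mul_comm]
  congr 2; ring

/-- Conjugation exchanges the terms of `l` and `-l`, and the range of summation is symmetric. -/
theorem fourierTrunc_ofReal (n : ℕ) (f : ℝ → ℝ) (τ : ℝ) :
    (fourierTrunc n f τ : ℂ) =
      ∑ l ∈ Finset.Icc (-(n : ℤ)) (n : ℤ), fourierCoef f l * Complex.exp (Complex.I * l * τ) := by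
  rw [fourierTrunc]
  apply Complex.conj_eq_iff_re.1
  rw [map_sum]
  refine Finset.sum_nbij' (fun l => -l) (fun l => -l) ?_ ?_ ?_ ?_ ?_
  · intro l hl; rw [Finset.mem_Icc] at hl ⊢; omega
  · intro l hl; rw [Finset.mem_Icc] at hl ⊢; omega
  · intro l _; simp
  · intro l _; simp
  · intro l _
    rw [map_mul, fourierCoef_conj, ← Complex.exp_conj]
    congr 2
    simp

theorem continuous_fourierTrunc (n : ℕ) (f : ℝ → ℝ) : Continuous (fourierTrunc n f) := by
  unfold fourierTrunc
  refine Complex.continuous_re.comp ?_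
  refine continuous_finsetSum _ fun l _ => by fun_prop

theorem periodic_fourierTrunc (n : ℕ) (f : ℝ → ℝ) :
    Function.Periodic (fourierTrunc n f) (2 * Real.pi) := by
  intro τ
  unfold fourierTrunc
  congr 1
  refine Finset.sum_congr rfl fun l _ => ?_
  have := periodic_exp (-l) τ
  simp only [Int.cast_neg, mul_neg, neg_mul, neg_neg] at this
  rw [this]

theorem fourierCoef_fourierTrunc (n : ℕ) (f : ℝ → ℝ) (l : ℤ) :
    fourierCoef (fourierTrunc n f) l = if |l| ≤ n then fourierCoef f l else 0 := by
  rw [fourierCoef]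
  simp only [fourierTrunc_ofReal, Finset.sum_mul]
  rw [intervalIntegral.integral_finsetSum (fun m _ => by
    apply Continuous.intervalIntegrable; fun_prop), Finset.mul_sum]
  have : ∀ m ∈ Finset.Icc (-(n : ℤ)) (n : ℤ), ((2 * Real.pi : ℝ) : ℂ)⁻¹ *
      (∫ τ in (0 : ℝ)..(2 * Real.pi), fourierCoef f m * Complex.exp (Complex.I * m * τ) *
        Complex.exp (-(Complex.I * l * τ))) = if m = l then fourierCoef f m else 0 := by
    intro m _
    simp only [mul_assoc (fourierCoef f m)]
    rw [intervalIntegral.integral_const_mul, mul_left_comm, integral_exp_mul_exp]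
    split_ifs <;> simp
  rw [Finset.sum_congr rfl this, Finset.sum_ite_eq']
  simp only [Finset.mem_Icc, abs_le]

theorem continuous_galerkin (n : ℕ∞) {f : ℝ → ℝ} (hf : Continuous f) :
    Continuous (galerkin n f) := by
  unfold galerkin; split_ifs
  · exact hf
  · exact continuous_fourierTrunc _ _

theorem periodic_galerkin (n : ℕ∞) {f : ℝ → ℝ} (hf : Function.Periodic f (2 * Real.pi)) :
    Function.Periodic (galerkin n f) (2 * Real.pi) := by
  unfold galerkin; split_ifs
  · exact hf
  · exact periodic_fourierTrunc _ _

theorem fourierCoef_galerkin (n : ℕ∞) (f : ℝ → ℝ) (l : ℤ) :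
    fourierCoef (galerkin n f) l = if (l.natAbs : ℕ∞) ≤ n then fourierCoef f l else 0 := by
  unfold galerkin
  by_cases h : n = ⊤
  · simp [h]
  · lift n to ℕ using h
    simp only [ENat.natCast_ne_top, if_false, ENat.toNat_natCast, fourierCoef_fourierTrunc, Nat.cast_le]
    congr 1
    apply propext
    rw [Int.abs_eq_natAbs]
    omega

theorem norm_fourierCoef_galerkin_le (n : ℕ∞) (f : ℝ → ℝ) (l : ℤ) :
    ‖fourierCoef (galerkin n f) l‖ ≤ ‖fourierCoef f l‖ := by
  rw [fourierCoef_galerkin]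
  split_ifs
  · exact le_rfl
  · simp

theorem fourierCoef_of_hasDerivAt {f f' : ℝ → ℝ} (hd : ∀ τ, HasDerivAt f (f' τ) τ)
    (hc : Continuous f') (hp : Function.Periodic f (2 * Real.pi)) (l : ℤ) :
    fourierCoef f' l = Complex.I * l * fourierCoef f l := by
  have h1 := intervalIntegral.integral_mul_deriv_eq_deriv_mul (a := (0 : ℝ)) (b := 2 * Real.pi)
    (u := fun τ : ℝ => Complex.exp (-(Complex.I * l * τ)))
    (u' := fun τ : ℝ => Complex.exp (-(Complex.I * l * τ)) * (-(Complex.I * l)))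
    (v := fun τ => (f τ : ℂ)) (v' := fun τ => (f' τ : ℂ))
    (fun τ _ => by
      have : HasDerivAt (fun τ : ℝ => -(Complex.I * l * (τ : ℂ))) (-(Complex.I * l)) τ := by
        have := ((hasDerivAt_id (τ : ℂ)).const_mul (Complex.I * l)).neg.comp_ofReal
        simpa using this
      exact this.cexp)
    (fun τ _ => (hd τ).ofReal_comp)
    (by apply Continuous.intervalIntegrable; fun_prop)
    (by apply Continuous.intervalIntegrable; fun_prop)
  have h2 := periodic_exp l 0
  have h3 := hp 0
  simp only [zero_add] at h2 h3
  rw [h2, h3, sub_self, zero_sub, ← intervalIntegral.integral_neg] at h1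
  simp only [fourierCoef]
  rw [mul_left_comm (Complex.I * l), ← intervalIntegral.integral_const_mul (Complex.I * l)]
  congr 1
  rw [show (fun τ : ℝ => (f' τ : ℂ) * Complex.exp (-(Complex.I * l * τ))) =
    fun τ : ℝ => Complex.exp (-(Complex.I * l * τ)) * (f' τ : ℂ) from by funext τ; ring]
  rw [h1]
  congr 1; funext τ; ring

theorem hasDerivAt_fourierCoef {F F' : ℝ → ℝ → ℝ} (hF : ∀ x, Continuous (F x))
    (hF' : Continuous (Function.uncurry F'))
    (hd : ∀ x t, HasDerivAt (fun y => F y t) (F' x t) x) (l : ℤ) (x : ℝ) :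
    HasDerivAt (fun x => fourierCoef (F x) l) (fourierCoef (F' x) l) x := by
  unfold fourierCoef
  refine HasDerivAt.const_mul _ ?_
  refine hasDerivAt_intervalIntegral_param
    (F := fun x t => (F x t : ℂ) * Complex.exp (-(Complex.I * l * t)))
    (F' := fun x t => (F' x t : ℂ) * Complex.exp (-(Complex.I * l * t))) _ _ ?_ ?_ ?_ x
  · intro x; have := hF x; fun_prop
  · simp only [Function.uncurry_def] at hF' ⊢; fun_prop
  · intro x t
    exact (hd x t).ofReal_comp.mul_const _

theorem continuous_fourierCoef {F : ℝ → ℝ → ℝ} (hF : Continuous (Function.uncurry F)) (l : ℤ) :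
    Continuous fun x => fourierCoef (F x) l := by
  unfold fourierCoef
  refine Continuous.const_mul ?_ _
  apply intervalIntegral.continuous_parametric_intervalIntegral_of_continuous'
    (f := fun x t => (F x t : ℂ) * Complex.exp (-(Complex.I * l * t)))
  simp only [Function.uncurry_def] at hF ⊢; fun_prop

end Fourier

/-! ### Bounded functions and slowly varying integrable weights on the line. -/

/-- Bounded continuous functions on the line. -/
def BddCont {E : Type*} [NormedAddCommGroup E] (f : ℝ → E) : Prop :=
  Continuous f ∧ ∃ C : ℝ, ∀ x, ‖f x‖ ≤ C

namespace BddCont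

variable {E : Type*} [NormedAddCommGroup E]

theorem const (c : E) : BddCont fun _ : ℝ => c := ⟨continuous_const, ‖c‖, fun _ => le_rfl⟩

theorem add {f g : ℝ → E} (hf : BddCont f) (hg : BddCont g) : BddCont fun x => f x + g x := by
  obtain ⟨hf, C, hC⟩ := hf
  obtain ⟨hg, D, hD⟩ := hg
  exact ⟨hf.add hg, C + D, fun x => (norm_add_le _ _).trans (add_le_add (hC x) (hD x))⟩

theorem neg {f : ℝ → E} (hf : BddCont f) : BddCont fun x => -f x := by
  obtain ⟨hf, C, hC⟩ := hf
  exact ⟨hf.neg, C, fun x => by rw [norm_neg]; exact hC x⟩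

theorem sub {f g : ℝ → E} (hf : BddCont f) (hg : BddCont g) : BddCont fun x => f x - g x := by
  simp only [sub_eq_add_neg]; exact hf.add hg.neg

theorem mul {A : Type*} [NormedRing A] {f g : ℝ → A} (hf : BddCont f) (hg : BddCont g) :
    BddCont fun x => f x * g x := by
  obtain ⟨hf, C, hC⟩ := hf
  obtain ⟨hg, D, hD⟩ := hg
  exact ⟨hf.mul hg, C * D, fun x => (norm_mul_le _ _).trans
    (mul_le_mul (hC x) (hD x) (norm_nonneg _) ((norm_nonneg _).trans (hC x)))⟩

theorem ofReal {f : ℝ → ℝ} (hf : BddCont f) : BddCont fun x => (f x : ℂ) := by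
  obtain ⟨hf, C, hC⟩ := hf
  exact ⟨by fun_prop, C, fun x => by rw [Complex.norm_real]; exact hC x⟩

theorem conj {f : ℝ → ℂ} (hf : BddCont f) : BddCont fun x => (starRingEnd ℂ) (f x) := by
  obtain ⟨hf, C, hC⟩ := hf
  exact ⟨by fun_prop, C, fun x => by rw [RCLike.norm_conj]; exact hC x⟩

theorem re {f : ℝ → ℂ} (hf : BddCont f) : BddCont fun x => (f x).re := by
  obtain ⟨hf, C, hC⟩ := hf
  exact ⟨by fun_prop, C, fun x => (Complex.abs_re_le_norm _).trans (hC x)⟩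

theorem im {f : ℝ → ℂ} (hf : BddCont f) : BddCont fun x => (f x).im := by
  obtain ⟨hf, C, hC⟩ := hf
  exact ⟨by fun_prop, C, fun x => (Complex.abs_im_le_norm _).trans (hC x)⟩

theorem norm {f : ℝ → E} (hf : BddCont f) : BddCont fun x => ‖f x‖ := by
  obtain ⟨hf, C, hC⟩ := hf
  exact ⟨by fun_prop, C, fun x => by rw [norm_norm]; exact hC x⟩

theorem norm_sq {f : ℝ → E} (hf : BddCont f) : BddCont fun x => ‖f x‖ ^ 2 := by
  simp only [pow_two]; exact hf.norm.mul hf.norm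

end BddCont

/-- The weight `1 / (1 + ε² x²)`. -/
def cauchyWeight (ε x : ℝ) : ℝ := (1 + ε ^ 2 * x ^ 2)⁻¹

theorem cauchyWeight_pos (ε x : ℝ) : 0 < cauchyWeight ε x := by
  unfold cauchyWeight; positivity

theorem cauchyWeight_le_one (ε x : ℝ) : cauchyWeight ε x ≤ 1 := by
  unfold cauchyWeight
  exact inv_le_one_of_one_le₀ (by nlinarith [mul_nonneg (sq_nonneg ε) (sq_nonneg x)])

theorem continuous_cauchyWeight (ε : ℝ) : Continuous (cauchyWeight ε) := by
  unfold cauchyWeight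
  exact Continuous.inv₀ (by fun_prop) (fun x => by positivity)

theorem integrable_cauchyWeight {ε : ℝ} (hε : 0 < ε) : Integrable (cauchyWeight ε) := by
  have := integrable_inv_one_add_sq.comp_mul_left' hε.ne'
  change Integrable fun x => cauchyWeight ε x
  simpa only [cauchyWeight, mul_pow] using this

theorem tendsto_cauchyWeight {ε : ℝ} (hε : 0 < ε) {l : Filter ℝ}
    (hl : Tendsto (fun x : ℝ => x ^ 2) l atTop) : Tendsto (cauchyWeight ε) l (𝓝 0) := by
  unfold cauchyWeight
  refine tendsto_inv_atTop_zero.comp ?_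
  exact tendsto_atTop_add_const_left _ _ (hl.const_mul_atTop (by positivity))

theorem tendsto_sq_atTop : Tendsto (fun x : ℝ => x ^ 2) atTop atTop :=
  tendsto_pow_atTop two_ne_zero

theorem tendsto_sq_atBot : Tendsto (fun x : ℝ => x ^ 2) atBot atTop := by
  have := tendsto_sq_atTop.comp tendsto_neg_atBot_atTop
  simpa [Function.comp_def] using this

/-- The logarithmic derivative of `cauchyWeight`. -/
def cauchyWeight₁ (ε x : ℝ) : ℝ := -2 * ε ^ 2 * x * cauchyWeight ε x

/-- The quotient of the second derivative of `cauchyWeight` by `cauchyWeight`. -/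
def cauchyWeight₂ (ε x : ℝ) : ℝ :=
  -2 * ε ^ 2 * cauchyWeight ε x + 8 * ε ^ 4 * x ^ 2 * cauchyWeight ε x ^ 2

theorem cauchyWeight_mul (ε x : ℝ) : cauchyWeight ε x * (1 + ε ^ 2 * x ^ 2) = 1 := by
  unfold cauchyWeight
  exact inv_mul_cancel₀ (by positivity)

theorem hasDerivAt_cauchyWeight (ε x : ℝ) :
    HasDerivAt (cauchyWeight ε) (cauchyWeight ε x * cauchyWeight₁ ε x) x := by
  have h1 : HasDerivAt (fun x : ℝ => 1 + ε ^ 2 * x ^ 2) (ε ^ 2 * (2 * x)) x := by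
    simpa using ((hasDerivAt_pow 2 x).const_mul (ε ^ 2)).const_add 1
  have h2 := h1.inv (by positivity)
  refine h2.congr_deriv ?_
  unfold cauchyWeight₁ cauchyWeight
  field_simp

theorem hasDerivAt_cauchyWeight_mul (ε x : ℝ) :
    HasDerivAt (fun x => cauchyWeight ε x * cauchyWeight₁ ε x)
      (cauchyWeight ε x * cauchyWeight₂ ε x) x := by
  have h := hasDerivAt_cauchyWeight ε x
  have h1 : HasDerivAt (cauchyWeight₁ ε)
      (-2 * ε ^ 2 * cauchyWeight ε x + -2 * ε ^ 2 * x * (cauchyWeight ε x * cauchyWeight₁ ε x)) x := by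
    have := ((hasDerivAt_id x).const_mul (-2 * ε ^ 2)).mul h
    refine this.congr_deriv ?_
    simp
  refine (h.mul h1).congr_deriv ?_
  unfold cauchyWeight₂ cauchyWeight₁
  ring

/-- This and the next bound make the weight slowly varying: each of its derivatives costs a factor
`ε`, so that all terms with a differentiated weight can be absorbed. -/
theorem abs_cauchyWeight₁_le {ε : ℝ} (hε : 0 < ε) (x : ℝ) : |cauchyWeight₁ ε x| ≤ ε := by
  have h := cauchyWeight_mul ε x
  have hp := cauchyWeight_pos ε x
  unfold cauchyWeight₁
  rw [abs_le]
  constructor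
  · nlinarith [mul_nonneg (mul_nonneg hε.le hp.le) (sq_nonneg (1 - ε * x))]
  · nlinarith [mul_nonneg (mul_nonneg hε.le hp.le) (sq_nonneg (1 + ε * x))]

theorem abs_cauchyWeight₂_le (ε x : ℝ) :
    |cauchyWeight₂ ε x| ≤ 10 * ε ^ 2 := by
  have h := cauchyWeight_mul ε x
  have hp := cauchyWeight_pos ε x
  have h1 := cauchyWeight_le_one ε x
  have h2 : cauchyWeight₂ ε x =
      ε ^ 2 * (-2 * cauchyWeight ε x + 8 * (1 - cauchyWeight ε x) * cauchyWeight ε x) := by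
    unfold cauchyWeight₂
    linear_combination (8 * ε ^ 2 * cauchyWeight ε x) * h
  rw [h2, abs_mul, abs_of_nonneg (sq_nonneg ε), mul_comm]
  refine mul_le_mul_of_nonneg_right ?_ (sq_nonneg ε)
  rw [abs_le]
  constructor <;> nlinarith

theorem bddCont_cauchyWeight₁ {ε : ℝ} (hε : 0 < ε) : BddCont (cauchyWeight₁ ε) :=
  ⟨by have := continuous_cauchyWeight ε; unfold cauchyWeight₁; fun_prop, ε,
    fun x => abs_cauchyWeight₁_le hε x⟩

theorem bddCont_cauchyWeight₂ (ε : ℝ) : BddCont (cauchyWeight₂ ε) :=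
  ⟨by have := continuous_cauchyWeight ε; unfold cauchyWeight₂; fun_prop, 10 * ε ^ 2,
    fun x => abs_cauchyWeight₂_le ε x⟩

theorem BddCont.integrable_mul {k b : ℝ → ℝ} (hb : BddCont b) (hk : Integrable k) :
    Integrable fun x => k x * b x := by
  obtain ⟨hc, C, hC⟩ := hb
  exact hk.mul_bdd hc.aestronglyMeasurable (Eventually.of_forall hC)

theorem BddCont.tendsto_mul {k b : ℝ → ℝ} (hb : BddCont b) {l : Filter ℝ}
    (hk : Tendsto k l (𝓝 0)) : Tendsto (fun x => k x * b x) l (𝓝 0) := by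
  obtain ⟨hc, C, hC⟩ := hb
  exact hk.zero_mul_isBoundedUnder_le (isBoundedUnder_of ⟨C, hC⟩)

/-- If `f ≤ Ψ' + h` with `Ψ` vanishing at infinity, then `∫ f ≤ ∫ h`. -/
theorem integral_le_of_le_deriv_add {Ψ Ψ' f h : ℝ → ℝ} (hd : ∀ x, HasDerivAt Ψ (Ψ' x) x)
    (ht : Tendsto Ψ atTop (𝓝 0)) (hb : Tendsto Ψ atBot (𝓝 0)) (hi : Integrable Ψ')
    (hf : Integrable f) (hh : Integrable h) (hle : ∀ x, f x ≤ Ψ' x + h x) :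
    ∫ x, f x ≤ ∫ x, h x := by
  have h0 := integral_of_hasDerivAt_of_tendsto hd hi hb ht
  calc ∫ x, f x ≤ ∫ x, (Ψ' x + h x) := integral_mono hf (hi.add hh) hle
    _ = ∫ x, h x := by rw [integral_add hi hh, h0]; simp

/-! ### The linear ODE of a single Fourier mode. -/

/-- The Fourier modes of the modulated traveling-wave equation. -/
structure ModeODE (ω s : ℝ) (l : ℤ) (g u v θ w : ℝ → ℂ) : Prop where
  hg : Continuous g
  hu : ∀ x, HasDerivAt u (v x) x
  hv : ∀ x, HasDerivAt v (g x + θ x) x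
  hθ : ∀ x, HasDerivAt θ (w x) x
  hw : ∀ x, HasDerivAt w (s * v x - ω * (Complex.I * l * u x)) x

namespace ModeODE

variable {ω s : ℝ} {l : ℤ} {g u v θ w : ℝ → ℂ}

theorem shift (h : ModeODE ω s l g u v θ w) (a : ℝ) :
    ModeODE ω s l (fun x => g (x + a)) (fun x => u (x + a)) (fun x => v (x + a))
      (fun x => θ (x + a)) (fun x => w (x + a)) where
  hg := by have := h.hg; fun_prop
  hu x := (h.hu (x + a)).comp_add_const x a
  hv x := (h.hv (x + a)).comp_add_const x a
  hθ x := (h.hθ (x + a)).comp_add_const x a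
  hw x := (h.hw (x + a)).comp_add_const x a

theorem norm_sub_le_of_deriv {f f' P P' : ℝ → ℂ} {B : ℝ} (hf : ∀ x, HasDerivAt f (f' x) x)
    (hP : ∀ x, HasDerivAt P (P' x) x) (h0 : f 0 = P 0)
    (hB : ∀ x ∈ Icc (0 : ℝ) 3, ‖f' x - P' x‖ ≤ B) :
    ∀ x ∈ Icc (0 : ℝ) 3, ‖f x - P x‖ ≤ 3 * B := by
  intro x hx
  have hB0 : 0 ≤ B := (norm_nonneg _).trans (hB 0 ⟨le_rfl, by norm_num⟩)
  have := norm_image_sub_le_of_norm_deriv_le_segment' (f := fun x => f x - P x)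
    (f' := fun x => f' x - P' x) (a := 0) (b := 3) (C := B)
    (fun x _ => ((hf x).sub (hP x)).hasDerivWithinAt)
    (fun x hx => hB x (Ico_subset_Icc_self hx)) x hx
  simp only [h0, sub_self, sub_zero] at this
  nlinarith [hx.2]

/-- Since `w - s u` has a bounded derivative, `w` is nearly constant on `[0, 3]`. Integrating three
times, `u` is nearly the cubic polynomial with Taylor coefficients `u 0`, `v 0`, `θ 0 / 2`, `w 0 /
6`. As `u` is bounded, its values at 1, 2, 3 bound these coefficients. Only the bounds of `u` and
`g` enter, and one power of `|l|` is lost. -/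
theorem bound_at_zero (h : ModeODE ω s l g u v θ w) {R A : ℝ} (hR : 1 ≤ R) (hω : |ω| ≤ R)
    (hs : |s| ≤ R) (hu : ∀ x, ‖u x‖ ≤ A) (hg : ∀ x, ‖g x‖ ≤ A) :
    ‖v 0‖ ≤ 920 * R * (1 + |(l : ℝ)|) * A ∧ ‖θ 0‖ ≤ 920 * R * (1 + |(l : ℝ)|) * A ∧
      ‖w 0‖ ≤ 920 * R * (1 + |(l : ℝ)|) * A := by
  have hA : 0 ≤ A := (norm_nonneg _).trans (hu 0)
  set L : ℝ := |(l : ℝ)| with hL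
  have hL0 : 0 ≤ L := abs_nonneg _
  set B : ℝ := 3 * R * (1 + L) * A with hB
  have hsA : ∀ x, ‖(s : ℂ) * u x‖ ≤ R * A := fun x => by
    rw [norm_mul, Complex.norm_real]
    exact mul_le_mul hs (hu x) (norm_nonneg _) (by linarith)
  have h1 : ∀ x ∈ Icc (0 : ℝ) 3, ‖w x - w 0‖ ≤ B := by
    intro x hx
    have := norm_sub_le_of_deriv (f := fun x => w x - s * u x)
      (f' := fun x => s * v x - ω * (Complex.I * l * u x) - s * v x)
      (P := fun _ => w 0 - s * u 0) (P' := fun _ => 0) (B := R * (L * A))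
      (fun x => (h.hw x).sub ((h.hu x).const_mul _)) (fun x => hasDerivAt_const _ _) rfl
      (fun x _ => by
        rw [sub_zero, sub_right_comm, sub_self, zero_sub, norm_neg, norm_mul, norm_mul, norm_mul,
          Complex.norm_real, Complex.norm_I, one_mul, Complex.norm_intCast]
        exact mul_le_mul hω (mul_le_mul_of_nonneg_left (hu x) hL0) (by positivity) (by linarith))
      x hx
    have e : w x - w 0 = (w x - s * u x - (w 0 - s * u 0)) + (s * u x - s * u 0) := by ring
    rw [e]
    have h2 := norm_add_le (w x - s * u x - (w 0 - s * u 0)) (s * u x - s * u 0)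
    have h3 := norm_sub_le ((s : ℂ) * u x) (s * u 0)
    have h4 : 0 ≤ R * A := by positivity
    have e2 : B = 3 * (R * (L * A)) + 3 * (R * A) := by rw [hB]; ring
    linarith [hsA x, hsA 0]
  have hid : ∀ x : ℝ, HasDerivAt (fun x : ℝ => (x : ℂ)) 1 x := fun x =>
    (hasDerivAt_id x).ofReal_comp
  have hsq : ∀ x : ℝ, HasDerivAt (fun x : ℝ => (x : ℂ) ^ 2) (2 * x) x := fun x => by
    exact ((hid x).fun_pow 2).congr_deriv (by simp)
  have hcb : ∀ x : ℝ, HasDerivAt (fun x : ℝ => (x : ℂ) ^ 3) (3 * x ^ 2) x := fun x => by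
    exact ((hid x).fun_pow 3).congr_deriv (by simp)
  have h2 := norm_sub_le_of_deriv (f := θ) (P := fun x => θ 0 + x * w 0) (P' := fun _ => w 0)
    h.hθ (fun x => by simpa using ((hid x).mul_const (w 0)).const_add (θ 0)) (by simp) h1
  have h3 := norm_sub_le_of_deriv (f := v) (P := fun x => v 0 + x * θ 0 + x ^ 2 * (w 0 / 2))
    (P' := fun x => θ 0 + x * w 0) (B := A + 3 * B)
    h.hv (fun x => by
      have := (((hid x).mul_const (θ 0)).const_add (v 0)).add ((hsq x).mul_const (w 0 / 2))
      exact this.congr_deriv (by ring)) (by simp) (fun x hx => by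
      rw [add_sub_assoc]
      exact (norm_add_le _ _).trans (add_le_add (hg x) (h2 x hx)))
  have h4 := norm_sub_le_of_deriv (f := u)
    (P := fun x => u 0 + x * v 0 + x ^ 2 * (θ 0 / 2) + x ^ 3 * (w 0 / 6))
    (P' := fun x => v 0 + x * θ 0 + x ^ 2 * (w 0 / 2)) (B := 3 * (A + 3 * B))
    h.hu (fun x => by
      have := ((((hid x).mul_const (v 0)).const_add (u 0)).add
        ((hsq x).mul_const (θ 0 / 2))).add ((hcb x).mul_const (w 0 / 6))
      exact this.congr_deriv (by ring)) (by simp) h3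
  set E : ℝ := 11 * A + 27 * B with hE
  have key : ∀ x ∈ Icc (0 : ℝ) 3,
      ‖(x : ℂ) * v 0 + x ^ 2 * (θ 0 / 2) + x ^ 3 * (w 0 / 6)‖ ≤ E := by
    intro x hx
    have e : (x : ℂ) * v 0 + x ^ 2 * (θ 0 / 2) + x ^ 3 * (w 0 / 6) =
      (u x - u 0) - (u x - (u 0 + x * v 0 + x ^ 2 * (θ 0 / 2) + x ^ 3 * (w 0 / 6))) := by ring
    rw [e]
    have a1 := norm_sub_le (u x - u 0)
      (u x - (u 0 + x * v 0 + x ^ 2 * (θ 0 / 2) + x ^ 3 * (w 0 / 6)))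
    have a2 := norm_sub_le (u x) (u 0)
    linarith [h4 x hx, hu x, hu 0]
  have k1 := key 1 (by norm_num)
  have k2 := key 2 (by norm_num)
  have k3 := key 3 (by norm_num)
  push_cast at k1 k2 k3
  set e1 : ℂ := 1 * v 0 + 1 ^ 2 * (θ 0 / 2) + 1 ^ 3 * (w 0 / 6) with he1
  set e2 : ℂ := 2 * v 0 + 2 ^ 2 * (θ 0 / 2) + 2 ^ 3 * (w 0 / 6) with he2
  set e3 : ℂ := 3 * v 0 + 3 ^ 2 * (θ 0 / 2) + 3 ^ 3 * (w 0 / 6) with he3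
  have hcomb : ∀ (c1 c2 c3 : ℝ), |c1| + |c2| + |c3| ≤ 10 →
      ‖(c1 : ℂ) * e1 + c2 * e2 + c3 * e3‖ ≤ 10 * E := by
    intro c1 c2 c3 hc
    have a := norm_add_le ((c1 : ℂ) * e1 + c2 * e2) (c3 * e3)
    have b := norm_add_le ((c1 : ℂ) * e1) (c2 * e2)
    simp only [norm_mul, Complex.norm_real, Real.norm_eq_abs] at a b
    have m1 := mul_le_mul_of_nonneg_left k1 (abs_nonneg c1)
    have m2 := mul_le_mul_of_nonneg_left k2 (abs_nonneg c2)
    have m3 := mul_le_mul_of_nonneg_left k3 (abs_nonneg c3)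
    have hE0 : 0 ≤ E := (norm_nonneg _).trans k1
    have := mul_le_mul_of_nonneg_right hc hE0
    nlinarith
  have hfin : 10 * E ≤ 920 * R * (1 + L) * A := by
    have : A ≤ R * (1 + L) * A := by
      have : 1 ≤ R * (1 + L) := by nlinarith
      nlinarith
    rw [hE, hB]; nlinarith
  refine ⟨?_, ?_, ?_⟩
  -- The three triples of coefficients invert the linear system that gives `e1`, `e2`, `e3` in terms
  -- of `v 0`, `θ 0`, `w 0`.
  · have := hcomb 3 (-3 / 2) (1 / 3) (by norm_num [abs_of_nonneg, abs_of_neg])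
    refine le_trans (le_of_eq ?_) (this.trans hfin)
    congr 1; rw [he1, he2, he3]; push_cast; ring
  · have := hcomb (-5) 4 (-1) (by norm_num)
    refine le_trans (le_of_eq ?_) (this.trans hfin)
    congr 1; rw [he1, he2, he3]; push_cast; ring
  · have := hcomb 3 (-3) 1 (by norm_num)
    refine le_trans (le_of_eq ?_) (this.trans hfin)
    congr 1; rw [he1, he2, he3]; push_cast; ring

theorem bound (h : ModeODE ω s l g u v θ w) {R A : ℝ} (hR : 1 ≤ R) (hω : |ω| ≤ R)
    (hs : |s| ≤ R) (hu : ∀ x, ‖u x‖ ≤ A) (hg : ∀ x, ‖g x‖ ≤ A) (a : ℝ) :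
    ‖v a‖ ≤ 920 * R * (1 + |(l : ℝ)|) * A ∧ ‖θ a‖ ≤ 920 * R * (1 + |(l : ℝ)|) * A ∧
      ‖w a‖ ≤ 920 * R * (1 + |(l : ℝ)|) * A := by
  have := (h.shift a).bound_at_zero hR hω hs (fun x => hu _) (fun x => hg _)
  simpa only [zero_add] using this

end ModeODE

/-! ### Weighted energy estimates for a single mode. -/

/-- The integral of `f` against the weight `cauchyWeight ε`. -/
def cauchyInt (ε : ℝ) (f : ℝ → ℝ) : ℝ := ∫ x, cauchyWeight ε x * f x

section cauchyInt

variable {ε : ℝ}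

theorem cauchyInt_add (hε : 0 < ε) {f g : ℝ → ℝ} (hf : BddCont f) (hg : BddCont g) :
    cauchyInt ε (fun x => f x + g x) = cauchyInt ε f + cauchyInt ε g := by
  unfold cauchyInt
  rw [← integral_add (hf.integrable_mul (integrable_cauchyWeight hε))
    (hg.integrable_mul (integrable_cauchyWeight hε))]
  simp only [mul_add]

theorem cauchyInt_const_mul (c : ℝ) (f : ℝ → ℝ) :
    cauchyInt ε (fun x => c * f x) = c * cauchyInt ε f := by
  unfold cauchyInt
  rw [← integral_const_mul]
  congr 1; ext x; ring

theorem cauchyInt_nonneg {f : ℝ → ℝ} (hf : ∀ x, 0 ≤ f x) : 0 ≤ cauchyInt ε f :=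
  integral_nonneg fun x => mul_nonneg (cauchyWeight_pos ε x).le (hf x)

theorem cauchyInt_le_of_le_deriv_add (hε : 0 < ε) {φ φ' f h : ℝ → ℝ}
    (hd : ∀ x, HasDerivAt (fun x => cauchyWeight ε x * φ x) (cauchyWeight ε x * φ' x) x)
    (hφ : BddCont φ) (hφ' : BddCont φ') (hf : BddCont f) (hh : BddCont h)
    (hle : ∀ x, f x ≤ φ' x + h x) : cauchyInt ε f ≤ cauchyInt ε h := by
  refine integral_le_of_le_deriv_add hd
    (hφ.tendsto_mul (tendsto_cauchyWeight hε tendsto_sq_atTop))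
    (hφ.tendsto_mul (tendsto_cauchyWeight hε tendsto_sq_atBot))
    (hφ'.integrable_mul (integrable_cauchyWeight hε))
    (hf.integrable_mul (integrable_cauchyWeight hε))
    (hh.integrable_mul (integrable_cauchyWeight hε)) fun x => ?_
  rw [← mul_add]
  exact mul_le_mul_of_nonneg_left (hle x) (cauchyWeight_pos ε x).le

/-- The weight equals one at 0 and the weighted function vanishes at `-∞`, so its value at 0 is the
integral of its derivative over the left half-line. -/
theorem weighted_eval_zero_le (hε : 0 < ε) {φ φ' h : ℝ → ℝ}
    (hd : ∀ x, HasDerivAt (fun x => cauchyWeight ε x * φ x) (cauchyWeight ε x * φ' x) x)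
    (hφ : BddCont φ) (hφ' : BddCont φ') (hh : BddCont h)
    (hle : ∀ x, |φ' x| ≤ h x) : φ 0 ≤ cauchyInt ε h := by
  have hi := hφ'.integrable_mul (integrable_cauchyWeight hε)
  have hi2 := hh.integrable_mul (integrable_cauchyWeight hε)
  have h1 := integral_Iic_of_hasDerivAt_of_tendsto (a := 0) (m := 0)
    (hd 0).continuousAt.continuousWithinAt (fun x _ => hd x) hi.integrableOn
    (hφ.tendsto_mul (tendsto_cauchyWeight hε tendsto_sq_atBot))
  have h0 : cauchyWeight ε 0 = 1 := by simp [cauchyWeight]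
  rw [h0, one_mul, sub_zero] at h1
  rw [← h1]
  calc ∫ x in Iic 0, cauchyWeight ε x * φ' x ≤ ∫ x in Iic 0, cauchyWeight ε x * h x :=
        integral_mono hi.integrableOn hi2.integrableOn fun x =>
          mul_le_mul_of_nonneg_left ((le_abs_self _).trans (hle x)) (cauchyWeight_pos ε x).le
    _ ≤ ∫ x, cauchyWeight ε x * h x := setIntegral_le_integral hi2
        (Eventually.of_forall fun x =>
          mul_nonneg (cauchyWeight_pos ε x).le ((abs_nonneg _).trans (hle x)))

end cauchyInt

theorem hasDerivAt_re {F : ℝ → ℂ} {F' : ℂ} {x : ℝ} (h : HasDerivAt F F' x) :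
    HasDerivAt (fun x => (F x).re) F'.re x :=
  Complex.reCLM.hasFDerivAt.comp_hasDerivAt x h

theorem hasDerivAt_im {F : ℝ → ℂ} {F' : ℂ} {x : ℝ} (h : HasDerivAt F F' x) :
    HasDerivAt (fun x => (F x).im) F'.im x :=
  Complex.imCLM.hasFDerivAt.comp_hasDerivAt x h

theorem hasDerivAt_conj {F : ℝ → ℂ} {F' : ℂ} {x : ℝ} (h : HasDerivAt F F' x) :
    HasDerivAt (fun x => (starRingEnd ℂ) (F x)) ((starRingEnd ℂ) F') x := h.star

namespace ModeODE

variable {ω s : ℝ} {l : ℤ} {g u v θ w : ℝ → ℂ} {ε R : ℝ}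

/-- These are the terms in which the weight is differentiated; `q - c` stands for `θ = v_ξ - g`. The
hypothesis `ε ≤ 1` turns `ε²` into `ε`. -/
theorem norm_lower_order_le (hε : 0 < ε) (hε1 : ε ≤ 1) (x : ℝ) (a b q c : ℂ) :
    ‖((cauchyWeight₂ ε x : ℂ) * a + 2 * cauchyWeight₁ ε x * b) * (q - c)‖ ≤
      10 * ε * (‖a‖ ^ 2 + ‖b‖ ^ 2 + ‖q‖ ^ 2 + ‖c‖ ^ 2) := by
  have h1 := abs_cauchyWeight₁_le hε x
  have h2 := abs_cauchyWeight₂_le ε x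
  have h3 : ‖(cauchyWeight₂ ε x : ℂ) * a + 2 * cauchyWeight₁ ε x * b‖ ≤
      10 * ε * (‖a‖ + ‖b‖) := by
    refine (norm_add_le _ _).trans ?_
    rw [norm_mul, norm_mul, norm_mul, Complex.norm_real, Complex.norm_real, Real.norm_eq_abs,
      Real.norm_eq_abs, Complex.norm_ofNat]
    have e1 : |cauchyWeight₂ ε x| * ‖a‖ ≤ (10 * ε) * ‖a‖ :=
      mul_le_mul_of_nonneg_right (by nlinarith) (norm_nonneg a)
    have e2 : 2 * |cauchyWeight₁ ε x| * ‖b‖ ≤ (10 * ε) * ‖b‖ :=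
      mul_le_mul_of_nonneg_right (by nlinarith) (norm_nonneg b)
    linarith
  rw [norm_mul]
  have h4 := norm_sub_le q c
  calc _ ≤ (10 * ε * (‖a‖ + ‖b‖)) * (‖q‖ + ‖c‖) :=
        mul_le_mul h3 h4 (norm_nonneg _) (by positivity)
    _ ≤ _ := by
        have : (‖a‖ + ‖b‖) * (‖q‖ + ‖c‖) ≤ ‖a‖ ^ 2 + ‖b‖ ^ 2 + ‖q‖ ^ 2 + ‖c‖ ^ 2 := by
          nlinarith [sq_nonneg (‖a‖ - ‖b‖), sq_nonneg (‖q‖ - ‖c‖),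
            sq_nonneg (‖a‖ + ‖b‖ - ‖q‖ - ‖c‖)]
        nlinarith [mul_le_mul_of_nonneg_left this (by positivity : 0 ≤ 10 * ε)]

section Energy

open scoped ComplexConjugate

/-- With the weight `κ`, the flux is `κ ū w - (κ ū)' θ`. As `w = θ_ξ`, its derivative is `κ ū w_ξ -
(κ ū)'' θ`: two integrations by parts that bring the fourth order equation, tested with `κ ū`, into
the form of a product of second derivatives. -/
theorem hasDerivAt_flux (h : ModeODE ω s l g u v θ w) (x : ℝ) :
    HasDerivAt (fun x => (cauchyWeight ε x : ℂ) * (conj (u x) * w x -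
        cauchyWeight₁ ε x * (conj (u x) * θ x) - conj (v x) * θ x))
      ((cauchyWeight ε x : ℂ) * (conj (u x) * (s * v x - ω * (Complex.I * l * u x)) -
        (cauchyWeight₂ ε x * conj (u x) + 2 * cauchyWeight₁ ε x * conj (v x)) * θ x -
        conj (g x + θ x) * θ x)) x := by
  have d0 := (hasDerivAt_cauchyWeight ε x).ofReal_comp
  have d1 := (hasDerivAt_cauchyWeight_mul ε x).ofReal_comp
  have du := hasDerivAt_conj (h.hu x)
  have dv := hasDerivAt_conj (h.hv x)
  have key := ((d0.mul (du.mul (h.hw x))).sub (d1.mul (du.mul (h.hθ x)))).sub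
    (d0.mul (dv.mul (h.hθ x)))
  refine (key.congr_deriv ?_).congr_of_eventuallyEq (Eventually.of_forall fun y => ?_)
  · simp only [Pi.mul_apply]; push_cast; ring
  · simp only [Pi.sub_apply, Pi.mul_apply]; push_cast; ring

theorem hasDerivAt_weighted_conj_mul (h : ModeODE ω s l g u v θ w) {f f' : ℝ → ℂ}
    (hf : ∀ x, HasDerivAt f (f' x) x) (x : ℝ) :
    HasDerivAt (fun x => (cauchyWeight ε x : ℂ) * (conj (u x) * f x))
      ((cauchyWeight ε x : ℂ) * (cauchyWeight₁ ε x * (conj (u x) * f x) + conj (v x) * f x +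
        conj (u x) * f' x)) x := by
  have d0 := (hasDerivAt_cauchyWeight ε x).ofReal_comp
  have du := hasDerivAt_conj (h.hu x)
  refine (d0.mul (du.mul (hf x))).congr_deriv ?_
  simp only [Pi.mul_apply]; push_cast; ring

/-- The real part of the flux identity. The term `i ω l |u|²` drops out, `s ū v` is the derivative
of `s |u|² / 2` in its real part, and `conj q θ = |q|² - conj q g` with `q = v_ξ`. So `q` is bounded
by `g` up to terms of order `ε`. -/
theorem cauchyInt_deriv_le (h : ModeODE ω s l g u v θ w) (hε : 0 < ε) (hε1 : ε ≤ 1)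
    (hs : |s| ≤ R) (bu : BddCont u) (bv : BddCont v) (bθ : BddCont θ) (bw : BddCont w)
    (bg : BddCont g) :
    cauchyInt ε (fun x => ‖g x + θ x‖ ^ 2) ≤
      cauchyInt ε (fun x => (1 / 2) * (‖g x + θ x‖ ^ 2 + ‖g x‖ ^ 2) +
        10 * ε * (‖u x‖ ^ 2 + ‖v x‖ ^ 2 + ‖g x + θ x‖ ^ 2 + ‖g x‖ ^ 2) +
        R / 2 * ε * ‖u x‖ ^ 2) := by
  have b1 := (bddCont_cauchyWeight₁ hε).ofReal
  have b2 := (bddCont_cauchyWeight₂ ε).ofReal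
  have bs : BddCont fun _ : ℝ => (s : ℂ) / 2 := BddCont.const _
  have bc : ∀ c : ℂ, BddCont fun _ : ℝ => c := fun c => BddCont.const c
  have bc' : ∀ c : ℝ, BddCont fun _ : ℝ => c := fun c => BddCont.const c
  refine cauchyInt_le_of_le_deriv_add hε
    (φ := fun x => (-(conj (u x) * w x - cauchyWeight₁ ε x * (conj (u x) * θ x) -
      conj (v x) * θ x) + s / 2 * (conj (u x) * u x)).re)
    (φ' := fun x => (-(conj (u x) * (s * v x - ω * (Complex.I * l * u x)) -
        (cauchyWeight₂ ε x * conj (u x) + 2 * cauchyWeight₁ ε x * conj (v x)) * θ x -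
        conj (g x + θ x) * θ x) + s / 2 * (cauchyWeight₁ ε x * (conj (u x) * u x) +
        conj (v x) * u x + conj (u x) * v x)).re) (fun x => ?_) ?_ ?_ ?_ ?_ (fun x => ?_)
  · have := hasDerivAt_re (((h.hasDerivAt_flux (ε := ε) x).neg).add
      ((h.hasDerivAt_weighted_conj_mul (ε := ε) h.hu x).const_mul ((s : ℂ) / 2)))
    refine (this.congr_deriv ?_).congr_of_eventuallyEq (Eventually.of_forall fun y => ?_)
    · rw [← Complex.re_ofReal_mul]; congr 1; ring
    · simp only [Pi.add_apply, Pi.neg_apply]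
      rw [← Complex.re_ofReal_mul]; congr 1; ring
  · exact ((((bu.conj.mul bw).sub (b1.mul (bu.conj.mul bθ))).sub (bv.conj.mul bθ)).neg.add
      (bs.mul (bu.conj.mul bu))).re
  · exact ((((bu.conj.mul (((bc s).mul bv).sub ((bc ω).mul ((bc _).mul bu)))).sub
      (((b2.mul bu.conj).add (((bc 2).mul b1).mul bv.conj)).mul bθ)).sub
      ((bg.add bθ).conj.mul bθ)).neg.add
      (bs.mul (((b1.mul (bu.conj.mul bu)).add (bv.conj.mul bu)).add (bu.conj.mul bv)))).re
  · exact (bg.add bθ).norm_sq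
  · exact (((bc' _).mul ((bg.add bθ).norm_sq.add bg.norm_sq)).add
      ((bc' _).mul (((bu.norm_sq.add bv.norm_sq).add (bg.add bθ).norm_sq).add bg.norm_sq))).add
      ((bc' _).mul bu.norm_sq)
  · set q := g x + θ x with hq
    have hθ : θ x = q - g x := by rw [hq]; ring
    have e1 := norm_lower_order_le hε hε1 x (conj (u x)) (conj (v x)) q (g x)
    rw [← hθ, RCLike.norm_conj, RCLike.norm_conj] at e1
    have e2 := (Complex.abs_re_le_norm _).trans e1
    have e3 : |(conj q * g x).re| ≤ ‖q‖ * ‖g x‖ := by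
      refine (Complex.abs_re_le_norm _).trans ?_
      rw [norm_mul, RCLike.norm_conj]
    have e4 : -(s / 2 * cauchyWeight₁ ε x) ≤ R / 2 * ε := by
      refine (neg_le_abs _).trans ?_
      rw [abs_mul, abs_div, abs_two]
      exact mul_le_mul (by linarith) (abs_cauchyWeight₁_le hε x) (abs_nonneg _)
        (by linarith [abs_nonneg s])
    have e5 := mul_le_mul_of_nonneg_right e4 (sq_nonneg ‖u x‖)
    have id1 : ‖q‖ ^ 2 = (-(conj (u x) * (s * v x - ω * (Complex.I * l * u x)) -
        (cauchyWeight₂ ε x * conj (u x) + 2 * cauchyWeight₁ ε x * conj (v x)) * θ x -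
        conj q * θ x) + s / 2 * (cauchyWeight₁ ε x * (conj (u x) * u x) +
        conj (v x) * u x + conj (u x) * v x)).re - s / 2 * cauchyWeight₁ ε x * ‖u x‖ ^ 2 -
        ((cauchyWeight₂ ε x * conj (u x) + 2 * cauchyWeight₁ ε x * conj (v x)) * θ x).re +
        (conj q * g x).re := by
      rw [hθ]
      rw [← Complex.normSq_eq_norm_sq, ← Complex.normSq_eq_norm_sq]
      simp [Complex.normSq_apply]
      ring
    have := abs_le.1 e2
    have := abs_le.1 e3
    nlinarith [sq_nonneg (‖q‖ - ‖g x‖)]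

/-- The imaginary part of the flux identity, which retains `ω l |u|²`; the sign `σ` makes this term
positive. The term `s ū v` no longer vanishes, and is split so that its `u` part is small against
`|ω l| |u|²`. -/
theorem cauchyInt_mode_le (h : ModeODE ω s l g u v θ w) (hε : 0 < ε) (hε1 : ε ≤ 1)
    (hR : 1 ≤ R) (hs : |s| ≤ R) (bu : BddCont u) (bv : BddCont v) (bθ : BddCont θ)
    (bw : BddCont w) (bg : BddCont g) :
    cauchyInt ε (fun x => |ω * l| * ‖u x‖ ^ 2) ≤
      cauchyInt ε (fun x => 1 / (4 * R) * ‖u x‖ ^ 2 + R ^ 3 * ‖v x‖ ^ 2 +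
        (1 / 2) * (‖g x + θ x‖ ^ 2 + ‖g x‖ ^ 2) +
        10 * ε * (‖u x‖ ^ 2 + ‖v x‖ ^ 2 + ‖g x + θ x‖ ^ 2 + ‖g x‖ ^ 2)) := by
  have b1 := (bddCont_cauchyWeight₁ hε).ofReal
  have b2 := (bddCont_cauchyWeight₂ ε).ofReal
  have bc : ∀ c : ℂ, BddCont fun _ : ℝ => c := fun c => BddCont.const c
  have bc' : ∀ c : ℝ, BddCont fun _ : ℝ => c := fun c => BddCont.const c
  obtain ⟨σ, hσ, hσ1⟩ : ∃ σ : ℝ, |ω * l| = σ * (ω * l) ∧ |σ| = 1 := by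
    rcases le_total 0 (ω * l) with h | h
    · exact ⟨1, by rw [abs_of_nonneg h, one_mul], abs_one⟩
    · exact ⟨-1, by rw [abs_of_nonpos h]; ring, by simp⟩
  refine cauchyInt_le_of_le_deriv_add hε
    (φ := fun x => (((-σ : ℝ) : ℂ) * (conj (u x) * w x - cauchyWeight₁ ε x * (conj (u x) * θ x) -
      conj (v x) * θ x)).im)
    (φ' := fun x => (((-σ : ℝ) : ℂ) * (conj (u x) * (s * v x - ω * (Complex.I * l * u x)) -
        (cauchyWeight₂ ε x * conj (u x) + 2 * cauchyWeight₁ ε x * conj (v x)) * θ x -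
        conj (g x + θ x) * θ x)).im) (fun x => ?_) ?_ ?_ ?_ ?_ (fun x => ?_)
  · have := hasDerivAt_im ((h.hasDerivAt_flux (ε := ε) x).const_mul ((-σ : ℝ) : ℂ))
    refine (this.congr_deriv ?_).congr_of_eventuallyEq (Eventually.of_forall fun y => ?_)
    · rw [← Complex.im_ofReal_mul]; congr 1; ring
    · dsimp only
      rw [← Complex.im_ofReal_mul]; congr 1; ring
  · exact ((bc _).mul (((bu.conj.mul bw).sub (b1.mul (bu.conj.mul bθ))).sub
      (bv.conj.mul bθ))).im
  · exact ((bc _).mul (((bu.conj.mul (((bc s).mul bv).sub ((bc ω).mul ((bc _).mul bu)))).sub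
      (((b2.mul bu.conj).add (((bc 2).mul b1).mul bv.conj)).mul bθ)).sub
      ((bg.add bθ).conj.mul bθ))).im
  · exact (bc' _).mul bu.norm_sq
  · exact ((((bc' _).mul bu.norm_sq).add ((bc' _).mul bv.norm_sq)).add
      ((bc' _).mul ((bg.add bθ).norm_sq.add bg.norm_sq))).add
      ((bc' _).mul (((bu.norm_sq.add bv.norm_sq).add (bg.add bθ).norm_sq).add bg.norm_sq))
  · set q := g x + θ x with hq
    have hθ : θ x = q - g x := by rw [hq]; ring
    have e1 := norm_lower_order_le hε hε1 x (conj (u x)) (conj (v x)) q (g x)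
    rw [← hθ, RCLike.norm_conj, RCLike.norm_conj] at e1
    have e2 : |σ * ((cauchyWeight₂ ε x * conj (u x) + 2 * cauchyWeight₁ ε x * conj (v x)) *
        θ x).im| ≤ 10 * ε * (‖u x‖ ^ 2 + ‖v x‖ ^ 2 + ‖q‖ ^ 2 + ‖g x‖ ^ 2) := by
      rw [abs_mul, hσ1, one_mul]
      exact (Complex.abs_im_le_norm _).trans e1
    have e3 : |σ * (conj q * g x).im| ≤ ‖q‖ * ‖g x‖ := by
      rw [abs_mul, hσ1, one_mul]
      refine (Complex.abs_im_le_norm _).trans ?_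
      rw [norm_mul, RCLike.norm_conj]
    have e4 : |σ * (s * (conj (u x) * v x).im)| ≤ R * (‖u x‖ * ‖v x‖) := by
      rw [abs_mul, hσ1, one_mul, abs_mul]
      refine mul_le_mul hs ((Complex.abs_im_le_norm _).trans ?_) (abs_nonneg _) (by linarith)
      rw [norm_mul, RCLike.norm_conj]
    have e5 : R * (‖u x‖ * ‖v x‖) ≤ 1 / (4 * R) * ‖u x‖ ^ 2 + R ^ 3 * ‖v x‖ ^ 2 := by
      have hR0 : 0 < R := by linarith
      have : 1 / (4 * R) * ‖u x‖ ^ 2 + R ^ 3 * ‖v x‖ ^ 2 - R * (‖u x‖ * ‖v x‖) =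
          1 / (4 * R) * (‖u x‖ - 2 * R ^ 2 * ‖v x‖) ^ 2 := by field_simp; ring
      have h2 : 0 ≤ 1 / (4 * R) * (‖u x‖ - 2 * R ^ 2 * ‖v x‖) ^ 2 := by positivity
      linarith
    have id1 : |ω * l| * ‖u x‖ ^ 2 =
        (((-σ : ℝ) : ℂ) * (conj (u x) * (s * v x - ω * (Complex.I * l * u x)) -
        (cauchyWeight₂ ε x * conj (u x) + 2 * cauchyWeight₁ ε x * conj (v x)) * θ x -
        conj q * θ x)).im + σ * (s * (conj (u x) * v x).im) -
        σ * ((cauchyWeight₂ ε x * conj (u x) + 2 * cauchyWeight₁ ε x * conj (v x)) * θ x).im +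
        σ * (conj q * g x).im := by
      rw [hσ, hθ, ← Complex.normSq_eq_norm_sq]
      simp [Complex.normSq_apply]
      ring
    have := abs_le.1 e2
    have := abs_le.1 e3
    have := abs_le.1 e4
    nlinarith [sq_nonneg (‖q‖ - ‖g x‖)]

/-- Integration of `(ū v)' = |v|² + ū q`, where `q = v_ξ`. -/
theorem cauchyInt_interpolate_le (h : ModeODE ω s l g u v θ w) (hε : 0 < ε)
    {μ : ℝ} (hμ : 0 < μ) (bu : BddCont u) (bv : BddCont v) (bθ : BddCont θ) (bg : BddCont g) :
    cauchyInt ε (fun x => ‖v x‖ ^ 2) ≤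
      cauchyInt ε (fun x => ε / 2 * (‖u x‖ ^ 2 + ‖v x‖ ^ 2) + μ / 2 * ‖u x‖ ^ 2 +
        1 / (2 * μ) * ‖g x + θ x‖ ^ 2) := by
  have b1 := (bddCont_cauchyWeight₁ hε).ofReal
  have bc' : ∀ c : ℝ, BddCont fun _ : ℝ => c := fun c => BddCont.const c
  refine cauchyInt_le_of_le_deriv_add hε
    (φ := fun x => (conj (u x) * v x).re)
    (φ' := fun x => (cauchyWeight₁ ε x * (conj (u x) * v x) + conj (v x) * v x +
        conj (u x) * (g x + θ x)).re) (fun x => ?_) ?_ ?_ ?_ ?_ (fun x => ?_)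
  · have := hasDerivAt_re (h.hasDerivAt_weighted_conj_mul (ε := ε) h.hv x)
    simpa only [Complex.re_ofReal_mul] using this
  · exact (bu.conj.mul bv).re
  · exact (((b1.mul (bu.conj.mul bv)).add (bv.conj.mul bv)).add (bu.conj.mul (bg.add bθ))).re
  · exact bv.norm_sq
  · exact (((bc' _).mul (bu.norm_sq.add bv.norm_sq)).add ((bc' _).mul bu.norm_sq)).add
      ((bc' _).mul (bg.add bθ).norm_sq)
  · set q := g x + θ x with hq
    have e3 : |(conj (u x) * q).re| ≤ ‖u x‖ * ‖q‖ := by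
      refine (Complex.abs_re_le_norm _).trans ?_
      rw [norm_mul, RCLike.norm_conj]
    have e4 : |cauchyWeight₁ ε x * (conj (u x) * v x).re| ≤ ε * (‖u x‖ * ‖v x‖) := by
      rw [abs_mul]
      refine mul_le_mul (abs_cauchyWeight₁_le hε x) ((Complex.abs_re_le_norm _).trans ?_)
        (abs_nonneg _) hε.le
      rw [norm_mul, RCLike.norm_conj]
    have e5 : ‖u x‖ * ‖q‖ ≤ μ / 2 * ‖u x‖ ^ 2 + 1 / (2 * μ) * ‖q‖ ^ 2 := by
      have : μ / 2 * ‖u x‖ ^ 2 + 1 / (2 * μ) * ‖q‖ ^ 2 - ‖u x‖ * ‖q‖ =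
          1 / (2 * μ) * (μ * ‖u x‖ - ‖q‖) ^ 2 := by field_simp; ring
      have h2 : 0 ≤ 1 / (2 * μ) * (μ * ‖u x‖ - ‖q‖) ^ 2 := by positivity
      linarith
    have id1 : ‖v x‖ ^ 2 = (cauchyWeight₁ ε x * (conj (u x) * v x) + conj (v x) * v x +
        conj (u x) * q).re - cauchyWeight₁ ε x * (conj (u x) * v x).re -
        (conj (u x) * q).re := by
      rw [← Complex.normSq_eq_norm_sq]
      simp [Complex.normSq_apply]
      ring
    have := abs_le.1 e3
    have := abs_le.1 e4
    nlinarith [mul_nonneg hε.le (sq_nonneg (‖u x‖ - ‖v x‖))]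

theorem norm_sq_eval_zero_le (h : ModeODE ω s l g u v θ w) (hε : 0 < ε)
    {μ : ℝ} (hμ : 0 < μ) (bu : BddCont u) (bv : BddCont v) :
    ‖u 0‖ ^ 2 ≤ cauchyInt ε (fun x => (ε + μ) * ‖u x‖ ^ 2 + 1 / μ * ‖v x‖ ^ 2) := by
  have b1 := (bddCont_cauchyWeight₁ hε).ofReal
  have bc' : ∀ c : ℝ, BddCont fun _ : ℝ => c := fun c => BddCont.const c
  have e0 : ∀ x, ‖u x‖ ^ 2 = (conj (u x) * u x).re := fun x => by
    rw [← Complex.normSq_eq_norm_sq]; simp [Complex.normSq_apply]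
  rw [e0 0]
  refine weighted_eval_zero_le hε
    (φ := fun x => (conj (u x) * u x).re)
    (φ' := fun x => (cauchyWeight₁ ε x * (conj (u x) * u x) + conj (v x) * u x +
        conj (u x) * v x).re) (fun x => ?_) ?_ ?_ ?_ (fun x => ?_)
  · have := hasDerivAt_re (h.hasDerivAt_weighted_conj_mul (ε := ε) h.hu x)
    simpa only [Complex.re_ofReal_mul] using this
  · exact (bu.conj.mul bu).re
  · exact (((b1.mul (bu.conj.mul bu)).add (bv.conj.mul bu)).add (bu.conj.mul bv)).re
  · exact ((bc' _).mul bu.norm_sq).add ((bc' _).mul bv.norm_sq)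
  · refine (Complex.abs_re_le_norm _).trans ((norm_add₃_le).trans ?_)
    simp only [norm_mul, RCLike.norm_conj, Complex.norm_real, Real.norm_eq_abs]
    have h1 := abs_cauchyWeight₁_le hε x
    have e5 : 2 * (‖u x‖ * ‖v x‖) ≤ μ * ‖u x‖ ^ 2 + 1 / μ * ‖v x‖ ^ 2 := by
      have : μ * ‖u x‖ ^ 2 + 1 / μ * ‖v x‖ ^ 2 - 2 * (‖u x‖ * ‖v x‖) =
          1 / μ * (μ * ‖u x‖ - ‖v x‖) ^ 2 := by field_simp; ring
      have h2 : 0 ≤ 1 / μ * (μ * ‖u x‖ - ‖v x‖) ^ 2 := by positivity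
      linarith
    nlinarith [mul_le_mul_of_nonneg_right h1 (mul_nonneg (norm_nonneg (u x)) (norm_nonneg (u x)))]

end Energy

/-- Here `A`, `D`, `B`, `G` are the weighted integrals of `|u|²`, `|v|²`, `|v_ξ|²`, `|g|²`. By `i1`,
`B` is bounded by `G`; by `i3`, `D` is bounded by `B` and a small multiple of `A`; inserting both in
`i2` bounds `L A` by `G`, up to lower order terms proportional to the sum of all four. -/
theorem energy_arith {R A D B G L ω : ℝ} (hR : 1 ≤ R) (hω : R⁻¹ ≤ |ω|) (hL1 : 1 ≤ L)
    (hA : 0 ≤ A) (hD : 0 ≤ D) (hB : 0 ≤ B) (hG : 0 ≤ G)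
    (i1 : B ≤ 1 / 2 * (B + G) + 10 * (1 / (1448 * R ^ 8 * R)) * (A + D + B + G) +
      R / 2 * (1 / (1448 * R ^ 8 * R)) * A)
    (i2 : |ω| * L * A ≤ 1 / (4 * R) * A + R ^ 3 * D + 1 / 2 * (B + G) +
      10 * (1 / (1448 * R ^ 8 * R)) * (A + D + B + G))
    (i3 : D ≤ (1 / (1448 * R ^ 8 * R)) / 2 * (A + D) + 1 / (16 * R ^ 4) / 2 * A +
      1 / (2 * (1 / (16 * R ^ 4))) * B) :
    L * A ≤ 280 * (R ^ 8 * G) ∧ D ≤ 72 * (R ^ 8 * G) := by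
  set P : ℝ := R ^ 8 with hP
  have hR0 : 0 < R := by linarith
  have hP1 : 1 ≤ P := one_le_pow₀ hR
  have hRP : R ≤ P := by
    calc R = R ^ 1 := (pow_one R).symm
      _ ≤ R ^ 8 := pow_le_pow_right₀ hR (by norm_num)
  have hR4 : R ^ 4 ≤ P := pow_le_pow_right₀ hR (by norm_num)
  have hR31 : 1 ≤ R ^ 3 := one_le_pow₀ hR
  set ε : ℝ := 1 / (1448 * P * R) with hε
  have hε0 : 0 < ε := by positivity
  have hε1 : ε ≤ 1 := by
    rw [hε, div_le_one (by positivity)]; nlinarith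
  set S : ℝ := A + D + B + G with hS
  set E : ℝ := ε * S with hE
  have hE0 : 0 ≤ E := by positivity
  have hAE : ε * A ≤ E := mul_le_mul_of_nonneg_left (by linarith) hε0.le
  have hADE : ε * (A + D) ≤ E := mul_le_mul_of_nonneg_left (by linarith) hε0.le
  have j1 : B ≤ G + 21 * (R * E) := by
    have : R / 2 * ε * A ≤ R * E / 2 := by
      have := mul_le_mul_of_nonneg_left hAE hR0.le
      linarith
    have e : 10 * ε * (A + D + B + G) = 10 * E := by rw [hE, hS]; ring
    have : E ≤ R * E := le_mul_of_one_le_left hE0 hR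
    linarith
  have j3 : D ≤ E / 2 + A / (32 * R ^ 4) + 8 * (R ^ 4 * B) := by
    have e1 : 1 / (16 * R ^ 4) / 2 * A = A / (32 * R ^ 4) := by field_simp; ring
    have e2 : 1 / (2 * (1 / (16 * R ^ 4))) * B = 8 * (R ^ 4 * B) := by field_simp; ring
    rw [e1, e2] at i3
    linarith
  have j2 : L * A ≤ 12 * (P * B) + P * G + 15 * (P * E) := by
    have m1 : L * A ≤ R * (|ω| * L * A) := by
      have : 1 ≤ R * |ω| := by
        have := mul_le_mul_of_nonneg_left hω hR0.le
        rwa [mul_inv_cancel₀ hR0.ne'] at this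
      have h2 : 0 ≤ L * A := by positivity
      calc L * A ≤ (R * |ω|) * (L * A) := le_mul_of_one_le_left h2 this
        _ = _ := by ring
    have m2 := mul_le_mul_of_nonneg_left i2 hR0.le
    have m3 := mul_le_mul_of_nonneg_left j3 (by positivity : 0 ≤ R ^ 4)
    have e : 10 * ε * (A + D + B + G) = 10 * E := by rw [hE, hS]; ring
    rw [e] at m2
    have e1 : R * (1 / (4 * R) * A + R ^ 3 * D + 1 / 2 * (B + G) + 10 * E) =
      A / 4 + R ^ 4 * D + R * B / 2 + R * G / 2 + 10 * (R * E) := by field_simp; ring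
    have e2 : R ^ 4 * (E / 2 + A / (32 * R ^ 4) + 8 * (R ^ 4 * B)) =
      R ^ 4 * E / 2 + A / 32 + 8 * (P * B) := by rw [hP]; field_simp
    rw [e1] at m2
    rw [e2] at m3
    have n1 := mul_le_mul_of_nonneg_right hRP hB
    have n2 := mul_le_mul_of_nonneg_right hRP hG
    have n3 := mul_le_mul_of_nonneg_right hRP hE0
    have n4 := mul_le_mul_of_nonneg_right hR4 hE0
    have n5 : A ≤ L * A := le_mul_of_one_le_left hA hL1
    have n6 : 0 ≤ P * B := by positivity
    have n7 : 0 ≤ P * G := by positivity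
    have n8 : 0 ≤ P * E := by positivity
    linarith
  have n5 : A ≤ L * A := le_mul_of_one_le_left hA hL1
  have j4 : S ≤ 36 * (P * G) + 724 * (P * (R * E)) := by
    have d1 : A / (32 * R ^ 4) ≤ A := div_le_self hA (by nlinarith [one_le_pow₀ hR (n := 4)])
    have d2 := mul_le_mul_of_nonneg_right hR4 hB
    have d3 := mul_le_mul_of_nonneg_left j1 (by positivity : 0 ≤ P)
    have d4 : B ≤ P * B := le_mul_of_one_le_left hB hP1
    have d5 : G ≤ P * G := le_mul_of_one_le_left hG hP1
    have d6 : E ≤ P * E := le_mul_of_one_le_left hE0 hP1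
    have d7 : P * E ≤ P * (R * E) :=
      mul_le_mul_of_nonneg_left (le_mul_of_one_le_left hE0 hR) (by positivity)
    have d8 : 0 ≤ P * (R * E) := by positivity
    linarith
  -- This fixes the constant 1448 in the weight parameter: the lower order terms amount to half of
  -- `S` and are absorbed.
  have j5 : 724 * (P * (R * E)) = S / 2 := by
    rw [hE, hε]; field_simp; ring
  have j6 : S ≤ 72 * (P * G) := by linarith
  have j7 : R * E ≤ G := by
    have : P * (R * E) ≤ P * G := by
      have : 0 ≤ P * G := by positivity
      linarith
    exact le_of_mul_le_mul_left this (by positivity)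
  have j8 : L * A ≤ 280 * (P * G) := by
    have d3 := mul_le_mul_of_nonneg_left j1 (by positivity : 0 ≤ P)
    have d4 := mul_le_mul_of_nonneg_left j7 (by positivity : 0 ≤ P)
    have d7 : P * E ≤ P * (R * E) :=
      mul_le_mul_of_nonneg_left (le_mul_of_one_le_left hE0 hR) (by positivity)
    linarith
  exact ⟨j8, by linarith⟩

/-- Bounded solutions of the mode equation with `l ≠ 0` gain a negative power of `|l|`. -/
theorem norm_sq_le_of_bdd {R : ℝ} (hR : 1 ≤ R) : ∃ ε > 0, ∃ C ≥ 0, ∀ (ω s : ℝ) (l : ℤ)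
    (g u v θ w : ℝ → ℂ), R⁻¹ ≤ |ω| → |ω| ≤ R → |s| ≤ R → l ≠ 0 → ModeODE ω s l g u v θ w →
    BddCont u → BddCont g → ∀ a, ‖u a‖ ^ 2 ≤
      C / √|(l : ℝ)| * cauchyInt ε (fun x => ‖g (x + a)‖ ^ 2) := by
  set P : ℝ := R ^ 8 with hP
  have hR0 : 0 < R := by linarith
  have hP1 : 1 ≤ P := one_le_pow₀ hR
  have hRP : R ≤ P := by
    calc R = R ^ 1 := (pow_one R).symm
      _ ≤ R ^ 8 := pow_le_pow_right₀ hR (by norm_num)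
  have hR4 : R ^ 4 ≤ P := pow_le_pow_right₀ hR (by norm_num)
  have hR31 : 1 ≤ R ^ 3 := one_le_pow₀ hR
  set ε : ℝ := 1 / (1448 * P * R) with hε
  have hε0 : 0 < ε := by positivity
  have hε1 : ε ≤ 1 := by
    rw [hε, div_le_one (by positivity)]; nlinarith
  refine ⟨ε, hε0, 632 * P * R, by positivity, ?_⟩
  intro ω s l g u v θ w hω hωR hs hl h bu bg a
  obtain ⟨uc, A0, hA0⟩ := bu
  obtain ⟨gc, G0, hG0⟩ := bg
  -- Boundedness of `u` and `g` gives that of `v`, `θ`, `w`, which is needed for the boundary terms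
  -- at infinity to vanish. The size of these bounds does not enter the result.
  have hb := h.bound hR hωR hs (A := max A0 G0) (fun x => (hA0 x).trans (le_max_left _ _))
    (fun x => (hG0 x).trans (le_max_right _ _))
  have bv : BddCont v :=
    ⟨continuous_iff_continuousAt.2 fun x => (h.hv x).continuousAt, _, fun x => (hb x).1⟩
  have bθ : BddCont θ :=
    ⟨continuous_iff_continuousAt.2 fun x => (h.hθ x).continuousAt, _, fun x => (hb x).2.1⟩
  have bw : BddCont w :=
    ⟨continuous_iff_continuousAt.2 fun x => (h.hw x).continuousAt, _, fun x => (hb x).2.2⟩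
  have sh : ∀ {f : ℝ → ℂ}, BddCont f → BddCont fun x => f (x + a) := fun ⟨hc, C, hC⟩ =>
    ⟨hc.comp (continuous_add_const a), C, fun x => hC _⟩
  replace h := h.shift a
  have bu : BddCont fun x => u (x + a) := sh ⟨uc, A0, hA0⟩
  have bg : BddCont fun x => g (x + a) := sh ⟨gc, G0, hG0⟩
  replace bv := sh bv
  replace bθ := sh bθ
  replace bw := sh bw
  have bc : ∀ c : ℝ, BddCont fun _ : ℝ => c := fun c => BddCont.const c
  set q : ℝ → ℂ := fun x => g (x + a) + θ (x + a) with hq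
  have bq : BddCont q := bg.add bθ
  have i1 := h.cauchyInt_deriv_le hε0 hε1 hs bu bv bθ bw bg
  have i2 := h.cauchyInt_mode_le hε0 hε1 hR hs bu bv bθ bw bg
  have i3 := h.cauchyInt_interpolate_le hε0 (μ := 1 / (16 * R ^ 4)) (by positivity) bu bv bθ bg
  have hL1 : (1 : ℝ) ≤ |(l : ℝ)| := by
    rw [← Int.cast_abs]; exact_mod_cast Int.one_le_abs hl
  -- The choice `μ = √|l|` balances `√|l| ∫|u|²`, where `|l| ∫|u|²` is under control, against
  -- `|l|^(-1/2) ∫|v|²`. Both have size `|l|^(-1/2)`.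
  have i4 := h.norm_sq_eval_zero_le hε0 (μ := √|(l : ℝ)|)
    (Real.sqrt_pos.2 (by linarith)) bu bv
  change cauchyInt ε (fun x => ‖q x‖ ^ 2) ≤ cauchyInt ε (fun x => (1 / 2) * (‖q x‖ ^ 2 + _) +
    10 * ε * (_ + _ + ‖q x‖ ^ 2 + _) + _) at i1
  change _ ≤ cauchyInt ε (fun x => _ + _ + (1 / 2) * (‖q x‖ ^ 2 + _) +
    10 * ε * (_ + _ + ‖q x‖ ^ 2 + _)) at i2
  change _ ≤ cauchyInt ε (fun x => _ + _ + _ * ‖q x‖ ^ 2) at i3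
  have nu := bu.norm_sq
  have nv := bv.norm_sq
  have ng := bg.norm_sq
  have nq := bq.norm_sq
  rw [cauchyInt_add hε0 (((bc _).mul (nq.add ng)).add ((bc _).mul (((nu.add nv).add nq).add ng)))
    ((bc _).mul nu), cauchyInt_add hε0 ((bc _).mul (nq.add ng))
    ((bc _).mul (((nu.add nv).add nq).add ng)), cauchyInt_const_mul, cauchyInt_const_mul,
    cauchyInt_const_mul, cauchyInt_add hε0 nq ng, cauchyInt_add hε0 ((nu.add nv).add nq) ng,
    cauchyInt_add hε0 (nu.add nv) nq, cauchyInt_add hε0 nu nv] at i1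
  rw [cauchyInt_add hε0 ((((bc _).mul nu).add ((bc _).mul nv)).add ((bc _).mul (nq.add ng)))
    ((bc _).mul (((nu.add nv).add nq).add ng)), cauchyInt_add hε0 (((bc _).mul nu).add
    ((bc _).mul nv)) ((bc _).mul (nq.add ng)), cauchyInt_add hε0 ((bc _).mul nu) ((bc _).mul nv),
    cauchyInt_const_mul, cauchyInt_const_mul,
    cauchyInt_const_mul, cauchyInt_const_mul, cauchyInt_const_mul,
    cauchyInt_add hε0 nq ng, cauchyInt_add hε0 ((nu.add nv).add nq) ng,
    cauchyInt_add hε0 (nu.add nv) nq, cauchyInt_add hε0 nu nv] at i2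
  rw [cauchyInt_add hε0 (((bc _).mul (nu.add nv)).add ((bc _).mul nu)) ((bc _).mul nq),
    cauchyInt_add hε0 ((bc _).mul (nu.add nv)) ((bc _).mul nu), cauchyInt_const_mul,
    cauchyInt_const_mul, cauchyInt_const_mul, cauchyInt_add hε0 nu nv] at i3
  rw [cauchyInt_add hε0 ((bc _).mul nu) ((bc _).mul nv), cauchyInt_const_mul,
    cauchyInt_const_mul, zero_add] at i4
  have hA : 0 ≤ cauchyInt ε (fun x => ‖u (x + a)‖ ^ 2) := cauchyInt_nonneg fun x => sq_nonneg _
  have hD : 0 ≤ cauchyInt ε (fun x => ‖v (x + a)‖ ^ 2) := cauchyInt_nonneg fun x => sq_nonneg _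
  have hB : 0 ≤ cauchyInt ε (fun x => ‖q x‖ ^ 2) := cauchyInt_nonneg fun x => sq_nonneg _
  have hG : 0 ≤ cauchyInt ε (fun x => ‖g (x + a)‖ ^ 2) := cauchyInt_nonneg fun x => sq_nonneg _
  set A := cauchyInt ε (fun x => ‖u (x + a)‖ ^ 2)
  set D := cauchyInt ε (fun x => ‖v (x + a)‖ ^ 2)
  set B := cauchyInt ε (fun x => ‖q x‖ ^ 2)
  set G := cauchyInt ε (fun x => ‖g (x + a)‖ ^ 2)
  set L : ℝ := |(l : ℝ)|
  obtain ⟨j8, jD⟩ := energy_arith hR hω hL1 hA hD hB hG i1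
    (by rw [abs_mul] at i2; exact i2) i3
  have hsL : 1 ≤ √L := Real.one_le_sqrt.2 hL1
  have hsL0 : 0 < √L := by linarith
  have hsq : √L * √L = L := Real.mul_self_sqrt (by linarith)
  have k1 : (ε + √L) * A ≤ 560 * (P * G) / √L := by
    rw [le_div_iff₀ hsL0]
    have : (ε + √L) * √L ≤ 2 * L := by nlinarith
    calc (ε + √L) * A * √L = (ε + √L) * √L * A := by ring
      _ ≤ 2 * L * A := mul_le_mul_of_nonneg_right this hA
      _ ≤ _ := by linarith
  have k2 : 1 / √L * D ≤ 72 * (P * G) / √L := by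
    rw [one_div_mul_eq_div]
    exact div_le_div_of_nonneg_right jD hsL0.le
  have k3 : 632 * (P * G) / √L ≤ 632 * P * R / √L * G := by
    rw [div_mul_eq_mul_div]
    refine div_le_div_of_nonneg_right ?_ hsL0.le
    have : 0 ≤ P * G := by positivity
    nlinarith
  have k4 : 632 * (P * G) / √L = 560 * (P * G) / √L + 72 * (P * G) / √L := by ring
  linarith

end ModeODE

/-! ### Partial derivatives, and the passage from a solution to its modes. -/

section Partial

variable {f : ℝ → ℝ → ℝ}

theorem continuous_uncurry_left (hf : Continuous (Function.uncurry f)) (ξ : ℝ) :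
    Continuous (f ξ) := hf.comp (Continuous.prodMk_right ξ)

theorem hasDerivAt_fst_of_contDiff (hf : ContDiff ℝ 1 (Function.uncurry f)) (ξ τ : ℝ) :
    HasDerivAt (fun x => f x τ) (deriv (fun x => f x τ) ξ) ξ := by
  have : ContDiff ℝ 1 fun x => f x τ := hf.comp (contDiff_id.prodMk contDiff_const)
  exact (this.differentiable one_ne_zero ξ).hasDerivAt

theorem hasDerivAt_snd_of_contDiff (hf : ContDiff ℝ 1 (Function.uncurry f)) (ξ τ : ℝ) :
    HasDerivAt (f ξ) (deriv (f ξ) τ) τ := by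
  have : ContDiff ℝ 1 fun x => f ξ x := hf.comp (contDiff_const.prodMk contDiff_id)
  exact (this.differentiable one_ne_zero τ).hasDerivAt

theorem continuous_deriv_fst_of_contDiff (hf : ContDiff ℝ 1 (Function.uncurry f)) :
    Continuous (Function.uncurry fun ξ τ => deriv (fun x => f x τ) ξ) := by
  have h : (Function.uncurry fun ξ τ => deriv (fun x => f x τ) ξ) =
      fun p : ℝ × ℝ => fderiv ℝ (Function.uncurry f) p (1, 0) := by
    ext ⟨ξ, τ⟩
    have h1 := (hf.differentiable one_ne_zero (ξ, τ)).hasFDerivAt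
    have h2 : HasDerivAt (fun x : ℝ => (x, τ)) ((1 : ℝ), (0 : ℝ)) ξ :=
      (hasDerivAt_id ξ).prodMk (hasDerivAt_const ξ τ)
    exact (h1.comp_hasDerivAt ξ h2).deriv
  rw [h]
  exact (hf.continuous_fderiv one_ne_zero).clm_apply continuous_const

theorem continuous_deriv_snd_of_contDiff (hf : ContDiff ℝ 1 (Function.uncurry f)) :
    Continuous (Function.uncurry fun ξ τ => deriv (f ξ) τ) := by
  have h : (Function.uncurry fun ξ τ => deriv (f ξ) τ) =
      fun p : ℝ × ℝ => fderiv ℝ (Function.uncurry f) p (0, 1) := by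
    ext ⟨ξ, τ⟩
    have h1 := (hf.differentiable one_ne_zero (ξ, τ)).hasFDerivAt
    have h2 : HasDerivAt (fun x : ℝ => (ξ, x)) ((0 : ℝ), (1 : ℝ)) τ :=
      (hasDerivAt_const τ ξ).prodMk (hasDerivAt_id τ)
    exact (h1.comp_hasDerivAt τ h2).deriv
  rw [h]
  exact (hf.continuous_fderiv one_ne_zero).clm_apply continuous_const

end Partial

theorem continuous_dG : Continuous dG := by unfold dG; fun_prop

namespace IsSolution

variable {ω s : ℝ} {n : ℕ∞} {u v θ w : ℝ → ℝ → ℝ}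

theorem continuous_dG_comp (h : IsSolution ω s n u v θ w) :
    Continuous (Function.uncurry fun ξ τ => dG (u ξ τ)) :=
  continuous_dG.comp h.contDiff_u.continuous

theorem periodic_dG_comp (h : IsSolution ω s n u v θ w) (ξ : ℝ) :
    Function.Periodic (fun τ => dG (u ξ τ)) (2 * Real.pi) := fun τ => by
  simp only [h.periodic_u ξ τ]

theorem continuous_galerkin_coef (h : IsSolution ω s n u v θ w) (l : ℤ) :
    Continuous fun ξ => fourierCoef (galerkin n fun σ => dG (u ξ σ)) l := by
  simp only [fourierCoef_galerkin]
  split_ifs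
  · exact continuous_fourierCoef h.continuous_dG_comp l
  · exact continuous_const

theorem modeODE (h : IsSolution ω s n u v θ w) (l : ℤ) :
    ModeODE ω s l (fun ξ => fourierCoef (galerkin n fun σ => dG (u ξ σ)) l)
      (fun ξ => fourierCoef (u ξ) l) (fun ξ => fourierCoef (v ξ) l)
      (fun ξ => fourierCoef (θ ξ) l) (fun ξ => fourierCoef (w ξ) l) where
  hg := h.continuous_galerkin_coef l
  hu ξ := by
    have := hasDerivAt_fourierCoef (fun x => continuous_uncurry_left h.contDiff_u.continuous x)
      (continuous_deriv_fst_of_contDiff h.contDiff_u)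
      (hasDerivAt_fst_of_contDiff h.contDiff_u) l ξ
    simpa only [h.eq_u] using this
  hv ξ := by
    have := hasDerivAt_fourierCoef (fun x => continuous_uncurry_left h.contDiff_v.continuous x)
      (continuous_deriv_fst_of_contDiff h.contDiff_v)
      (hasDerivAt_fst_of_contDiff h.contDiff_v) l ξ
    simp only [h.eq_v] at this
    rwa [fourierCoef_add (continuous_galerkin n
      (continuous_uncurry_left h.continuous_dG_comp ξ))
      (continuous_uncurry_left h.contDiff_θ.continuous ξ)] at this
  hθ ξ := by
    have := hasDerivAt_fourierCoef (fun x => continuous_uncurry_left h.contDiff_θ.continuous x)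
      (continuous_deriv_fst_of_contDiff h.contDiff_θ)
      (hasDerivAt_fst_of_contDiff h.contDiff_θ) l ξ
    simpa only [h.eq_θ] using this
  hw ξ := by
    have := hasDerivAt_fourierCoef (fun x => continuous_uncurry_left h.contDiff_w.continuous x)
      (continuous_deriv_fst_of_contDiff h.contDiff_w)
      (hasDerivAt_fst_of_contDiff h.contDiff_w) l ξ
    have cu := continuous_uncurry_left (continuous_deriv_snd_of_contDiff h.contDiff_u) ξ
    have cv := continuous_uncurry_left h.contDiff_v.continuous ξ
    simp only [h.eq_w] at this
    rwa [fourierCoef_sub (cv.const_mul s) (cu.const_mul ω), fourierCoef_const_mul,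
      fourierCoef_const_mul, fourierCoef_of_hasDerivAt
        (hasDerivAt_snd_of_contDiff h.contDiff_u ξ) cu (h.periodic_u ξ)] at this

end IsSolution

theorem abs_dG_sub_le {M a b : ℝ} (ha : |a| ≤ M) (hb : |b| ≤ M) :
    |dG a - dG b| ≤ (1 + 3 * M ^ 2) * |a - b| := by
  have e : dG a - dG b = (-1 + (a ^ 2 + a * b + b ^ 2)) * (a - b) := by unfold dG; ring
  rw [e, abs_mul]
  refine mul_le_mul_of_nonneg_right ?_ (abs_nonneg _)
  have h1 : a ^ 2 ≤ M ^ 2 := sq_le_sq' (by linarith [abs_le.1 ha]) (abs_le.1 ha).2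
  have h2 : b ^ 2 ≤ M ^ 2 := sq_le_sq' (by linarith [abs_le.1 hb]) (abs_le.1 hb).2
  rw [abs_le]
  constructor <;> nlinarith [sq_nonneg (a - b), sq_nonneg (a + b)]

theorem abs_dG_le {M a : ℝ} (ha : |a| ≤ M) : |dG a| ≤ (1 + 3 * M ^ 2) * M := by
  have hM : 0 ≤ M := (abs_nonneg _).trans ha
  have := abs_dG_sub_le ha (b := 0) (by simpa using hM)
  simp only [dG, sub_zero, ne_eq, OfNat.ofNat_ne_zero, not_false_eq_true, zero_pow, neg_zero,
    add_zero] at this ⊢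
  exact this.trans (mul_le_mul_of_nonneg_left ha (by positivity))

/-- The mean over a period. -/
theorem mean_le_of_le {f : ℝ → ℝ} {A : ℝ} (hf : Continuous f) (h : ∀ τ, f τ ≤ A) :
    (2 * Real.pi)⁻¹ * ∫ τ in (0 : ℝ)..(2 * Real.pi), f τ ≤ A := by
  have h2 := Real.two_pi_pos
  rw [inv_mul_le_iff₀ h2]
  have := intervalIntegral.integral_mono_on (a := (0 : ℝ)) (b := 2 * Real.pi) h2.le
    (hf.intervalIntegrable _ _) ((continuous_const (y := A)).intervalIntegrable (μ := volume) _ _)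
    (fun x _ => h x)
  simpa using this

theorem mean_mono {f g : ℝ → ℝ} (hf : Continuous f) (hg : Continuous g) (h : ∀ τ, f τ ≤ g τ) :
    (2 * Real.pi)⁻¹ * ∫ τ in (0 : ℝ)..(2 * Real.pi), f τ ≤
      (2 * Real.pi)⁻¹ * ∫ τ in (0 : ℝ)..(2 * Real.pi), g τ := by
  have h2 := Real.two_pi_pos
  refine mul_le_mul_of_nonneg_left ?_ (inv_nonneg.2 h2.le)
  exact intervalIntegral.integral_mono_on (a := (0 : ℝ)) (b := 2 * Real.pi) h2.le
    (hf.intervalIntegrable _ _) (hg.intervalIntegrable _ _) (fun x _ => h x)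

theorem norm_exp_sub_one_le (l : ℤ) (h : ℝ) :
    ‖Complex.exp (Complex.I * l * h) - 1‖ ≤ |(l : ℝ)| * |h| := by
  have := Real.norm_exp_I_mul_ofReal_sub_one_le (x := l * h)
  rw [Real.norm_eq_abs, abs_mul] at this
  convert this using 4
  push_cast; ring

/-- The difference `f(τ + h) - f(τ)`. -/
theorem fourierCoef_diff {f : ℝ → ℝ} (hf : Continuous f)
    (hp : Function.Periodic f (2 * Real.pi)) (h : ℝ) (l : ℤ) :
    fourierCoef (fun τ => f (τ + h) - f τ) l =
      (Complex.exp (Complex.I * l * h) - 1) * fourierCoef f l := by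
  rw [fourierCoef_sub (f := fun τ => f (τ + h)) (hf.comp (continuous_add_const h)) hf, fourierCoef_shift hp]
  ring

theorem sum_norm_sq_le {f : ℝ → ℝ} (hf : Continuous f) (F : Finset ℤ) :
    ∑ l ∈ F, ‖fourierCoef f l‖ ^ 2 ≤
      (2 * Real.pi)⁻¹ * ∫ τ in (0 : ℝ)..(2 * Real.pi), f τ ^ 2 :=
  sum_le_hasSum F (fun _ _ => sq_nonneg _) (parseval hf)

theorem cauchyInt_mono {ε : ℝ} (hε : 0 < ε) {f h : ℝ → ℝ} (hf : BddCont f) (hh : BddCont h)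
    (hle : ∀ x, f x ≤ h x) : cauchyInt ε f ≤ cauchyInt ε h :=
  integral_mono (hf.integrable_mul (integrable_cauchyWeight hε))
    (hh.integrable_mul (integrable_cauchyWeight hε)) fun x =>
      mul_le_mul_of_nonneg_left (hle x) (cauchyWeight_pos ε x).le

theorem BddCont.sum {ι E : Type*} [NormedAddCommGroup E] {f : ι → ℝ → E} (F : Finset ι)
    (hf : ∀ i ∈ F, BddCont (f i)) : BddCont fun x => ∑ i ∈ F, f i x := by
  classical
  induction F using Finset.induction_on with
  | empty => simpa using BddCont.const (0 : E)
  | insert a F ha ih =>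
    simp only [Finset.sum_insert ha]
    exact (hf a (Finset.mem_insert_self _ _)).add
      (ih fun i hi => hf i (Finset.mem_insert_of_mem hi))

theorem cauchyInt_sum {ι : Type*} {ε : ℝ} (hε : 0 < ε) {f : ι → ℝ → ℝ} (F : Finset ι)
    (hf : ∀ i ∈ F, BddCont (f i)) :
    cauchyInt ε (fun x => ∑ i ∈ F, f i x) = ∑ i ∈ F, cauchyInt ε (f i) := by
  unfold cauchyInt
  simp only [Finset.mul_sum]
  exact integral_finsetSum _ fun i hi => (hf i hi).integrable_mul (integrable_cauchyWeight hε)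

/-! ### The gain in negative powers of the mode number, and decay of order one. -/

section Gain

variable {ω s : ℝ} {n : ℕ∞} {u v θ w : ℝ → ℝ → ℝ} {R M : ℝ}

theorem IsSolution.bddCont_coef (h : IsSolution ω s n u v θ w) (hM : ∀ ξ τ, |u ξ τ| ≤ M)
    (l : ℤ) : BddCont fun ξ => fourierCoef (u ξ) l :=
  ⟨continuous_fourierCoef h.contDiff_u.continuous l, M, fun ξ => norm_fourierCoef_le (hM ξ) l⟩

theorem IsSolution.bddCont_galerkin_coef (h : IsSolution ω s n u v θ w)
    (hM : ∀ ξ τ, |u ξ τ| ≤ M) (l : ℤ) :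
    BddCont fun ξ => fourierCoef (galerkin n fun σ => dG (u ξ σ)) l :=
  ⟨h.continuous_galerkin_coef l, (1 + 3 * M ^ 2) * M, fun ξ =>
    (norm_fourierCoef_galerkin_le n _ l).trans
      (norm_fourierCoef_le (fun τ => abs_dG_le (hM ξ τ)) l)⟩

/-- The gain of a quarter of a derivative, with constants depending on `R` only. -/
theorem exists_gain (hR : 1 ≤ R) : ∃ ε > 0, ∃ C ≥ 0, ∀ (ω s : ℝ) (n : ℕ∞)
    (u v θ w : ℝ → ℝ → ℝ) (M : ℝ), R⁻¹ ≤ |ω| → |ω| ≤ R → |s| ≤ R → IsSolution ω s n u v θ w →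
    (∀ ξ τ, |u ξ τ| ≤ M) → ∀ l : ℤ, l ≠ 0 → ∀ ξ, ‖fourierCoef (u ξ) l‖ ^ 2 ≤
      C / √|(l : ℝ)| *
        cauchyInt ε (fun x => ‖fourierCoef (galerkin n fun σ => dG (u (x + ξ) σ)) l‖ ^ 2) := by
  obtain ⟨ε, hε, C, hC, h⟩ := ModeODE.norm_sq_le_of_bdd hR
  exact ⟨ε, hε, C, hC, fun ω s n u v θ w M h1 h2 h3 hs hM l hl ξ =>
    h ω s l _ _ _ _ _ h1 h2 h3 hl (hs.modeODE l) (hs.bddCont_coef hM l)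
      (hs.bddCont_galerkin_coef hM l) ξ⟩

/-- The modes with `|l| > n` of a bounded solution vanish. -/
theorem IsSolution.fourierCoef_eq_zero (h : IsSolution ω s n u v θ w) (hω : ω ≠ 0)
    (hM : ∀ ξ τ, |u ξ τ| ≤ M) {l : ℤ} (hl : ¬ (l.natAbs : ℕ∞) ≤ n) (ξ : ℝ) :
    fourierCoef (u ξ) l = 0 := by
  set R : ℝ := 1 + |ω| + |ω|⁻¹ + |s| with hR
  have h0 : 0 < |ω| := abs_pos.2 hω
  have h0' : 0 < |ω|⁻¹ := inv_pos.2 h0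
  have h1 := abs_nonneg s
  obtain ⟨ε, hε, C, hC, hg⟩ := exists_gain (R := R) (by linarith)
  have hl0 : l ≠ 0 := by rintro rfl; simp at hl
  have := hg ω s n u v θ w M (by
    rw [inv_le_comm₀ (by linarith) h0]; linarith) (by linarith) (by linarith) h hM l hl0 ξ
  -- The forcing has no modes with `|l| > n`, so the right-hand side of the gain inequality is zero.
  simp only [fourierCoef_galerkin, hl, if_false, norm_zero, ne_eq, OfNat.ofNat_ne_zero,
    not_false_eq_true, zero_pow, cauchyInt, mul_zero, integral_zero] at this
  have h3 : ‖fourierCoef (u ξ) l‖ = 0 := by nlinarith [norm_nonneg (fourierCoef (u ξ) l)]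
  exact norm_eq_zero.1 h3

/-- An `H¹` bound in `τ` for the nonlinearity along bounded solutions. -/
theorem exists_coef_dG_le (hR : 1 ≤ R) (hM0 : 0 ≤ M) : ∃ K ≥ 0, ∀ (ω s : ℝ) (n : ℕ∞)
    (u v θ w : ℝ → ℝ → ℝ), R⁻¹ ≤ |ω| → |ω| ≤ R → |s| ≤ R → IsSolution ω s n u v θ w →
    (∀ ξ τ, |u ξ τ| ≤ M) → ∀ (l : ℤ) (ξ : ℝ),
      |(l : ℝ)| * ‖fourierCoef (fun τ => dG (u ξ τ)) l‖ ≤ K := by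
  obtain ⟨ε, hε, C, hC, hgain⟩ := exists_gain hR
  set W : ℝ := cauchyInt ε (fun _ => 1) with hW
  have hW0 : 0 ≤ W := cauchyInt_nonneg fun _ => zero_le_one
  set Λ : ℝ := 1 + 3 * M ^ 2 with hΛ
  have hΛ0 : 0 ≤ Λ := by positivity
  -- Beyond the frequency `N` the gain beats the Lipschitz constant `Λ` of the nonlinearity on `[-M,
  -- M]`.
  obtain ⟨N, hN1, hN⟩ : ∃ N : ℕ, 1 ≤ N ∧ C / √(N : ℝ) * (Λ ^ 2 * W) ≤ 1 / 2 := by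
    have ht : Tendsto (fun N : ℕ => C / √(N : ℝ) * (Λ ^ 2 * W)) atTop (𝓝 0) := by
      have h1 : Tendsto (fun N : ℕ => √(N : ℝ)) atTop atTop :=
        Real.tendsto_sqrt_atTop.comp tendsto_natCast_atTop_atTop
      have := (h1.const_div_atTop C).mul_const (Λ ^ 2 * W)
      simpa using this
    obtain ⟨N, hN⟩ := ((ht.eventually (ge_mem_nhds (by norm_num : (0 : ℝ) < 1 / 2))).and
      (eventually_ge_atTop 1)).exists
    exact ⟨N, hN.2, hN.1⟩
  refine ⟨Λ * N * M * Real.pi, by positivity, ?_⟩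
  intro ω s n u v θ w h1 h2 h3 hsol hM l₀ ξ₀
  have cu : ∀ ξ, Continuous (u ξ) := continuous_uncurry_left hsol.contDiff_u.continuous
  have cg : ∀ ξ, Continuous fun τ => dG (u ξ τ) := continuous_uncurry_left hsol.continuous_dG_comp
  have key : ∀ h : ℝ, ∀ ξ, (2 * Real.pi)⁻¹ *
      ∫ τ in (0 : ℝ)..(2 * Real.pi), (u ξ (τ + h) - u ξ τ) ^ 2 ≤ 2 * (N * h * M) ^ 2 := by
    intro h
    set q : ℝ → ℝ := fun ξ => (2 * Real.pi)⁻¹ *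
      ∫ τ in (0 : ℝ)..(2 * Real.pi), (u ξ (τ + h) - u ξ τ) ^ 2 with hq
    have cd : ∀ ξ, Continuous fun τ => u ξ (τ + h) - u ξ τ := fun ξ =>
      ((cu ξ).comp (continuous_add_const h)).sub (cu ξ)
    have cdg : ∀ ξ, Continuous fun τ => dG (u ξ (τ + h)) - dG (u ξ τ) := fun ξ =>
      ((cg ξ).comp (continuous_add_const h)).sub (cg ξ)
    have hqb : BddAbove (range q) := by
      refine ⟨(2 * M) ^ 2, ?_⟩
      rintro _ ⟨ξ, rfl⟩
      refine mean_le_of_le ((cd ξ).pow 2) fun τ => ?_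
      refine sq_le_sq' ?_ ?_ <;> linarith [abs_le.1 (hM ξ (τ + h)), abs_le.1 (hM ξ τ)]
    -- The supremum is finite because `u` is bounded. It is needed because the gain inequality at
    -- one `ξ` involves the forcing at all `ξ`; a bound of the form `Q ≤ ... + Q / 2` can then be
    -- solved for `Q`.
    set Q : ℝ := ⨆ ξ, q ξ with hQ
    have hqQ : ∀ ξ, q ξ ≤ Q := fun ξ => le_ciSup hqb ξ
    set E : ℤ → ℝ := fun l => ‖Complex.exp (Complex.I * l * h) - 1‖ ^ 2 with hE
    have hE0 : ∀ l, 0 ≤ E l := fun l => sq_nonneg _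
    have hsumg : ∀ ξ (F : Finset ℤ), ∑ l ∈ F,
        E l * ‖fourierCoef (galerkin n fun σ => dG (u ξ σ)) l‖ ^ 2 ≤ Λ ^ 2 * Q := by
      intro ξ F
      calc _ ≤ ∑ l ∈ F, ‖fourierCoef (fun τ => dG (u ξ (τ + h)) - dG (u ξ τ)) l‖ ^ 2 := by
            refine Finset.sum_le_sum fun l _ => ?_
            rw [fourierCoef_diff (f := fun τ => dG (u ξ τ)) (cg ξ) (hsol.periodic_dG_comp ξ),
              norm_mul, mul_pow]
            exact mul_le_mul_of_nonneg_left (pow_le_pow_left₀ (norm_nonneg _)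
              (norm_fourierCoef_galerkin_le n _ l) 2) (hE0 l)
        _ ≤ _ := sum_norm_sq_le (cdg ξ) F
        _ ≤ (2 * Real.pi)⁻¹ * ∫ τ in (0 : ℝ)..(2 * Real.pi),
            Λ ^ 2 * (u ξ (τ + h) - u ξ τ) ^ 2 := by
            refine mean_mono ((cdg ξ).pow 2) (((cd ξ).pow 2).const_mul _) fun τ => ?_
            rw [← mul_pow, ← sq_abs, ← sq_abs (Λ * _), abs_mul, abs_of_nonneg hΛ0]
            exact pow_le_pow_left₀ (abs_nonneg _) (abs_dG_sub_le (hM _ _) (hM _ _)) 2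
        _ = Λ ^ 2 * q ξ := by
            rw [intervalIntegral.integral_const_mul]; ring
        _ ≤ _ := mul_le_mul_of_nonneg_left (hqQ ξ) (by positivity)
    have hstep : ∀ ξ, q ξ ≤ (N * h * M) ^ 2 + 1 / 2 * Q := by
      intro ξ
      have hQ0 : 0 ≤ Q := (mul_nonneg (by positivity)
        (intervalIntegral.integral_nonneg Real.two_pi_pos.le fun _ _ => sq_nonneg _)).trans (hqQ ξ)
      have hp := parseval (cd ξ)
      refine hasSum_le_of_sum_le hp fun F => ?_
      have ecoef : ∀ l, ‖fourierCoef (fun τ => u ξ (τ + h) - u ξ τ) l‖ ^ 2 =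
          E l * ‖fourierCoef (u ξ) l‖ ^ 2 := fun l => by
        rw [fourierCoef_diff (cu ξ) (hsol.periodic_u ξ), norm_mul, mul_pow]
      simp only [ecoef]
      -- Low modes satisfy `|e^{ilh} - 1| ≤ N |h|` and are bounded by Parseval; high modes are
      -- bounded by the gain.
      rw [← Finset.sum_filter_add_sum_filter_not F (fun l : ℤ => |l| ≤ N)]
      refine add_le_add ?_ ?_
      · calc _ ≤ ∑ l ∈ F with |l| ≤ (N : ℤ), (N * h) ^ 2 * ‖fourierCoef (u ξ) l‖ ^ 2 := by
              refine Finset.sum_le_sum fun l hl => ?_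
              refine mul_le_mul_of_nonneg_right ?_ (sq_nonneg _)
              rw [hE, ← sq_abs (N * h), abs_mul, Nat.abs_cast]
              refine pow_le_pow_left₀ (norm_nonneg _) ((norm_exp_sub_one_le l h).trans ?_) 2
              refine mul_le_mul_of_nonneg_right ?_ (abs_nonneg _)
              have := (Finset.mem_filter.1 hl).2
              rw [← Int.cast_abs]; exact_mod_cast this
          _ = (N * h) ^ 2 * ∑ l ∈ F with |l| ≤ (N : ℤ), ‖fourierCoef (u ξ) l‖ ^ 2 := by
              rw [Finset.mul_sum]
          _ ≤ (N * h) ^ 2 * M ^ 2 := by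
              refine mul_le_mul_of_nonneg_left ((sum_norm_sq_le (cu ξ) _).trans ?_) (sq_nonneg _)
              refine mean_le_of_le ((cu ξ).pow 2) fun τ => ?_
              exact sq_le_sq' (abs_le.1 (hM ξ τ)).1 (abs_le.1 (hM ξ τ)).2
          _ = _ := by ring
      · have bg : ∀ l, BddCont fun x => E l *
            ‖fourierCoef (galerkin n fun σ => dG (u (x + ξ) σ)) l‖ ^ 2 := fun l => by
          obtain ⟨hc, B, hB⟩ := hsol.bddCont_galerkin_coef hM l
          exact (BddCont.const (E l)).mul (BddCont.norm_sq
            ⟨hc.comp (continuous_add_const ξ), B, fun x => hB _⟩)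
        calc _ ≤ ∑ l ∈ F with ¬ |l| ≤ (N : ℤ), C / √(N : ℝ) * cauchyInt ε (fun x => E l *
              ‖fourierCoef (galerkin n fun σ => dG (u (x + ξ) σ)) l‖ ^ 2) := by
              refine Finset.sum_le_sum fun l hl => ?_
              have hlN := (Finset.mem_filter.1 hl).2
              have hl0 : l ≠ 0 := by rintro rfl; simp at hlN
              have := hgain ω s n u v θ w M h1 h2 h3 hsol hM l hl0 ξ
              rw [cauchyInt_const_mul, mul_left_comm]
              refine mul_le_mul_of_nonneg_left (this.trans ?_) (hE0 l)
              refine mul_le_mul_of_nonneg_right ?_ (cauchyInt_nonneg fun _ => sq_nonneg _)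
              have hN0 : (0 : ℝ) < N := by exact_mod_cast hN1
              refine div_le_div_of_nonneg_left hC (Real.sqrt_pos.2 hN0) (Real.sqrt_le_sqrt ?_)
              push Not at hlN
              rw [← Int.cast_abs]; exact_mod_cast hlN.le
          _ = C / √(N : ℝ) * cauchyInt ε (fun x => ∑ l ∈ F with ¬ |l| ≤ (N : ℤ), E l *
              ‖fourierCoef (galerkin n fun σ => dG (u (x + ξ) σ)) l‖ ^ 2) := by
              rw [cauchyInt_sum hε _ fun l _ => bg l, Finset.mul_sum]
          _ ≤ C / √(N : ℝ) * cauchyInt ε (fun x => Λ ^ 2 * Q * 1) := by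
              refine mul_le_mul_of_nonneg_left ?_ (by positivity)
              refine cauchyInt_mono hε (BddCont.sum _ fun l _ => bg l) (BddCont.const _) fun x => ?_
              rw [mul_one]
              exact hsumg (x + ξ) _
          _ = C / √(N : ℝ) * (Λ ^ 2 * W) * Q := by rw [cauchyInt_const_mul]; ring
          _ ≤ _ := mul_le_mul_of_nonneg_right hN hQ0
    have hQle : Q ≤ (N * h * M) ^ 2 + 1 / 2 * Q := ciSup_le hstep
    intro ξ
    linarith [hqQ ξ]
  rcases eq_or_ne l₀ 0 with rfl | hl0
  · simp; positivity
  -- For this `h` the multiplier `e^{i l₀ h} - 1` equals -2, so the `O(h²)` bound of the mean square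
  -- of the difference becomes a bound of order `1 / |l₀|` of the single mode `l₀`.
  set h : ℝ := Real.pi / l₀ with hh
  have hl0' : (l₀ : ℝ) ≠ 0 := by exact_mod_cast hl0
  have e1 : Complex.exp (Complex.I * l₀ * h) = -1 := by
    have : Complex.I * l₀ * h = Real.pi * Complex.I := by
      have : (l₀ : ℂ) ≠ 0 := by exact_mod_cast hl0
      rw [hh]; push_cast; field_simp
    rw [this, Complex.exp_pi_mul_I]
  have cd : Continuous fun τ => u ξ₀ (τ + h) - u ξ₀ τ :=
      ((cu ξ₀).comp (continuous_add_const h)).sub (cu ξ₀)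
  have cdg : Continuous fun τ => dG (u ξ₀ (τ + h)) - dG (u ξ₀ τ) :=
      ((cg ξ₀).comp (continuous_add_const h)).sub (cg ξ₀)
  have e2 := sum_norm_sq_le cdg {l₀}
  rw [Finset.sum_singleton, fourierCoef_diff (f := fun τ => dG (u ξ₀ τ)) (cg ξ₀)
    (hsol.periodic_dG_comp ξ₀), e1] at e2
  have e3 : (2 * Real.pi)⁻¹ * ∫ τ in (0 : ℝ)..(2 * Real.pi),
      (dG (u ξ₀ (τ + h)) - dG (u ξ₀ τ)) ^ 2 ≤ Λ ^ 2 * (2 * (N * h * M) ^ 2) := by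
    refine (mean_mono (cdg.pow 2) ((cd.pow 2).const_mul (Λ ^ 2)) fun τ => ?_).trans ?_
    · simp only [Pi.pow_apply]
      rw [← mul_pow, ← sq_abs, ← sq_abs (Λ * _), abs_mul, abs_of_nonneg hΛ0]
      exact pow_le_pow_left₀ (abs_nonneg _) (abs_dG_sub_le (hM _ _) (hM _ _)) 2
    · rw [intervalIntegral.integral_const_mul, mul_left_comm]
      exact mul_le_mul_of_nonneg_left (key h ξ₀) (by positivity)
  have e4 := e2.trans e3
  rw [norm_mul, show ‖(-1 - 1 : ℂ)‖ = 2 by norm_num] at e4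
  set x := ‖fourierCoef (fun τ => dG (u ξ₀ τ)) l₀‖ with hx
  have hx0 : 0 ≤ x := norm_nonneg _
  have e5 : x ^ 2 ≤ (Λ * N * h * M) ^ 2 := by nlinarith
  have e6 : (|(l₀ : ℝ)| * x) ^ 2 ≤ (Λ * N * M * Real.pi) ^ 2 := by
    have : (Λ * N * M * Real.pi) ^ 2 = |(l₀ : ℝ)| ^ 2 * (Λ * N * h * M) ^ 2 := by
      rw [sq_abs, hh]; field_simp
    rw [this, mul_pow]
    exact mul_le_mul_of_nonneg_left e5 (sq_nonneg _)
  exact (pow_le_pow_iff_left₀ (by positivity) (by positivity) two_ne_zero).1 e6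

end Gain

/-! ### Uniform Fourier decay in families of functions. -/

/-- The weight `(1 + |l|)^(-β)`. -/
def decayWeight (β : ℝ) (l : ℤ) : ℝ := (1 + |(l : ℝ)|) ^ (-β)

theorem one_le_one_add_abs (l : ℤ) : 1 ≤ 1 + |(l : ℝ)| := by linarith [abs_nonneg (l : ℝ)]

theorem decayWeight_pos (β : ℝ) (l : ℤ) : 0 < decayWeight β l :=
  Real.rpow_pos_of_pos (by linarith [one_le_one_add_abs l]) _

theorem decayWeight_anti {β γ : ℝ} (h : β ≤ γ) (l : ℤ) : decayWeight γ l ≤ decayWeight β l :=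
  Real.rpow_le_rpow_of_exponent_le (one_le_one_add_abs l) (by linarith)

theorem one_add_abs_mul_decayWeight (β : ℝ) (l : ℤ) :
    (1 + |(l : ℝ)|) * decayWeight (β + 1) l = decayWeight β l := by
  have h := one_le_one_add_abs l
  unfold decayWeight
  rw [show -β = 1 + -(β + 1) by ring, Real.rpow_add (by linarith), Real.rpow_one]

theorem summable_decayWeight {β : ℝ} (h : 1 < β) : Summable (decayWeight β) := by
  refine Summable.of_norm_bounded_eventually (Real.summable_abs_int_rpow h) ?_
  have : ({0}ᶜ : Set ℤ) ∈ (cofinite : Filter ℤ) := (Set.finite_singleton (0 : ℤ)).compl_mem_cofinite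
  filter_upwards [this] with l hl
  have hl0 : 0 < |(l : ℝ)| := abs_pos.2 (by exact_mod_cast hl)
  rw [Real.norm_of_nonneg (decayWeight_pos β l).le]
  exact Real.rpow_le_rpow_of_nonpos hl0 (by linarith) (by linarith)

/-- The larger of `|m|` and `|l - m|` is at least `|l| / 2`, so the corresponding weight is at most
`2 ^ β` times the weight of `l`. -/
theorem decayWeight_mul_le {β : ℝ} (h : 0 ≤ β) (l m : ℤ) :
    decayWeight β m * decayWeight β (l - m) ≤
      2 ^ β * decayWeight β l * (decayWeight β m + decayWeight β (l - m)) := by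
  have key : ∀ a b : ℤ, |(b : ℝ)| ≤ |(a : ℝ)| → |(l : ℝ)| ≤ |(a : ℝ)| + |(b : ℝ)| →
      decayWeight β a ≤ 2 ^ β * decayWeight β l := by
    intro a b hab hl
    unfold decayWeight
    rw [Real.rpow_neg (by positivity), Real.rpow_neg (by positivity), ← div_eq_mul_inv,
      inv_eq_one_div, div_le_div_iff₀ (by positivity) (by positivity), one_mul,
      ← Real.mul_rpow (by positivity) (by positivity)]
    exact Real.rpow_le_rpow (by positivity) (by linarith) h
  have hl : |(l : ℝ)| ≤ |(m : ℝ)| + |((l - m : ℤ) : ℝ)| := by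
    have := abs_add_le (m : ℝ) ((l - m : ℤ) : ℝ)
    push_cast at this ⊢
    simpa using this
  have p1 := decayWeight_pos β m
  have p2 := decayWeight_pos β (l - m)
  have p3 : 0 < 2 ^ β * decayWeight β l := mul_pos (by positivity) (decayWeight_pos β l)
  rcases le_total |((l - m : ℤ) : ℝ)| |(m : ℝ)| with hc | hc
  · have := key m (l - m) hc hl
    nlinarith
  · have := key (l - m) m hc (by linarith)
    nlinarith

section Families

variable {ι : Type*}

/-- Uniform decay of the Fourier coefficients in `τ` of a family of functions of `(ξ, τ)`. -/
def FourierDecay (β : ℝ) (f : ι → ℝ → ℝ → ℝ) : Prop :=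
  ∃ C : ℝ, 0 ≤ C ∧ ∀ i ξ l, ‖fourierCoef (f i ξ) l‖ ≤ C * decayWeight β l

/-- Families of continuous functions of `(ξ, τ)` that are periodic in `τ`. -/
def PerFamily (f : ι → ℝ → ℝ → ℝ) : Prop :=
  ∀ i, Continuous (Function.uncurry (f i)) ∧ ∀ ξ, Function.Periodic (f i ξ) (2 * Real.pi)

theorem FourierDecay.mono {β γ : ℝ} {f : ι → ℝ → ℝ → ℝ} (h : FourierDecay γ f) (hβ : β ≤ γ) :
    FourierDecay β f := by
  obtain ⟨C, hC, h⟩ := h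
  exact ⟨C, hC, fun i ξ l => (h i ξ l).trans (mul_le_mul_of_nonneg_left (decayWeight_anti hβ l) hC)⟩

theorem FourierDecay.summable {β : ℝ} {f : ι → ℝ → ℝ → ℝ} (h : FourierDecay β f) (hβ : 1 < β)
    (i : ι) (ξ : ℝ) : Summable fun l => ‖fourierCoef (f i ξ) l‖ := by
  obtain ⟨C, hC, h⟩ := h
  exact Summable.of_nonneg_of_le (fun _ => norm_nonneg _) (h i ξ)
    ((summable_decayWeight hβ).mul_left C)

theorem PerFamily.cont {f : ι → ℝ → ℝ → ℝ} (h : PerFamily f) (i : ι) (ξ : ℝ) :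
    Continuous (f i ξ) := continuous_uncurry_left (h i).1 ξ

theorem FourierDecay.add {β : ℝ} {f g : ι → ℝ → ℝ → ℝ} (hf : FourierDecay β f)
    (hg : FourierDecay β g) (pf : PerFamily f) (pg : PerFamily g) :
    FourierDecay β fun i ξ τ => f i ξ τ + g i ξ τ := by
  obtain ⟨C, hC, hf⟩ := hf
  obtain ⟨D, hD, hg⟩ := hg
  refine ⟨C + D, add_nonneg hC hD, fun i ξ l => ?_⟩
  rw [fourierCoef_add (pf.cont i ξ) (pg.cont i ξ), add_mul]
  exact (norm_add_le _ _).trans (add_le_add (hf i ξ l) (hg i ξ l))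

theorem FourierDecay.const_mul {β K : ℝ} {f : ι → ℝ → ℝ → ℝ} (hf : FourierDecay β f) {c : ι → ℝ}
    (hc : ∀ i, |c i| ≤ K) : FourierDecay β fun i ξ τ => c i * f i ξ τ := by
  obtain ⟨C, hC, hf⟩ := hf
  refine ⟨|K| * C, by positivity, fun i ξ l => ?_⟩
  rw [fourierCoef_const_mul, norm_mul, Complex.norm_real, mul_assoc]
  exact mul_le_mul ((hc i).trans (le_abs_self _)) (hf i ξ l) (norm_nonneg _) (abs_nonneg _)

/-- The convolution of the weights is bounded by a multiple of the weight, by `decayWeight_mul_le`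
and summability; the latter needs `1 < β`. -/
theorem FourierDecay.mul {β : ℝ} (hβ : 1 < β) {f g : ι → ℝ → ℝ → ℝ} (hf : FourierDecay β f)
    (hg : FourierDecay β g) (pf : PerFamily f) (pg : PerFamily g) :
    FourierDecay β fun i ξ τ => f i ξ τ * g i ξ τ := by
  have hsum := fun i ξ => hf.summable hβ i ξ
  obtain ⟨C, hC, hf⟩ := hf
  obtain ⟨D, hD, hg⟩ := hg
  set S : ℝ := ∑' m, decayWeight β m with hS
  have hs := summable_decayWeight hβ
  have hS0 : 0 ≤ S := tsum_nonneg fun m => (decayWeight_pos β m).le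
  refine ⟨C * D * (2 ^ β * (2 * S)), by positivity, fun i ξ l => ?_⟩
  have h1 := hasSum_fourierCoef_mul (pf.cont i ξ) ((pf i).2 ξ) (hsum i ξ) (pg.cont i ξ) l
  have hsh : HasSum (fun m => decayWeight β (l - m)) S :=
    (Equiv.subLeft l).hasSum_iff.2 hs.hasSum
  have h2 : HasSum (fun m => C * D * (2 ^ β * decayWeight β l *
      (decayWeight β m + decayWeight β (l - m))))
      (C * D * (2 ^ β * decayWeight β l * (S + S))) :=
    ((hs.hasSum.add hsh).mul_left _).mul_left _
  rw [← h1.tsum_eq]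
  refine (tsum_of_norm_bounded h2 fun m => ?_).trans (le_of_eq (by ring))
  rw [norm_mul]
  calc _ ≤ (C * decayWeight β m) * (D * decayWeight β (l - m)) :=
        mul_le_mul (hf i ξ m) (hg i ξ _) (norm_nonneg _)
          (mul_nonneg hC (decayWeight_pos β m).le)
    _ = C * D * (decayWeight β m * decayWeight β (l - m)) := by ring
    _ ≤ _ := mul_le_mul_of_nonneg_left (decayWeight_mul_le (by linarith) l m) (by positivity)

theorem FourierDecay.galerkin {β : ℝ} {f : ι → ℝ → ℝ → ℝ} (hf : FourierDecay β f)
    (n : ι → ℕ∞) : FourierDecay β fun i ξ τ => galerkin (n i) (f i ξ) τ := by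
  obtain ⟨C, hC, hf⟩ := hf
  exact ⟨C, hC, fun i ξ l => (norm_fourierCoef_galerkin_le (n i) (f i ξ) l).trans (hf i ξ l)⟩

theorem PerFamily.add {f g : ι → ℝ → ℝ → ℝ} (pf : PerFamily f) (pg : PerFamily g) :
    PerFamily fun i ξ τ => f i ξ τ + g i ξ τ := fun i =>
  ⟨(pf i).1.add (pg i).1, fun ξ τ => by simp only [(pf i).2 ξ τ, (pg i).2 ξ τ]⟩

theorem PerFamily.mul {f g : ι → ℝ → ℝ → ℝ} (pf : PerFamily f) (pg : PerFamily g) :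
    PerFamily fun i ξ τ => f i ξ τ * g i ξ τ := fun i =>
  ⟨(pf i).1.mul (pg i).1, fun ξ τ => by simp only [(pf i).2 ξ τ, (pg i).2 ξ τ]⟩

theorem PerFamily.const_mul {f : ι → ℝ → ℝ → ℝ} (pf : PerFamily f) (c : ι → ℝ) :
    PerFamily fun i ξ τ => c i * f i ξ τ := fun i =>
  ⟨(pf i).1.const_mul (c i), fun ξ τ => by simp only [(pf i).2 ξ τ]⟩

theorem continuous_uncurry_galerkin (n : ℕ∞) {f : ℝ → ℝ → ℝ}
    (hf : Continuous (Function.uncurry f)) :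
    Continuous (Function.uncurry fun ξ τ => galerkin n (f ξ) τ) := by
  unfold galerkin
  split_ifs with h
  · exact hf
  · unfold fourierTrunc
    simp only [Function.uncurry_def]
    refine Complex.continuous_re.comp (continuous_finsetSum _ fun l _ => ?_)
    exact ((continuous_fourierCoef hf l).comp continuous_fst).mul (by fun_prop)

theorem PerFamily.galerkin {f : ι → ℝ → ℝ → ℝ} (pf : PerFamily f) (n : ι → ℕ∞) :
    PerFamily fun i ξ τ => galerkin (n i) (f i ξ) τ := fun i =>
  ⟨continuous_uncurry_galerkin (n i) (pf i).1, fun ξ => periodic_galerkin (n i) ((pf i).2 ξ)⟩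

/-- The partial derivative in `ξ` of a family. -/
def dξ (f : ι → ℝ → ℝ → ℝ) : ι → ℝ → ℝ → ℝ := fun i ξ τ => deriv (fun x => f i x τ) ξ

/-- The partial derivative in `τ` of a family. -/
def dτ (f : ι → ℝ → ℝ → ℝ) : ι → ℝ → ℝ → ℝ := fun i ξ τ => deriv (f i ξ) τ

/-- Families of periodic functions whose Fourier coefficients decay rapidly and uniformly. -/
def RapidDecay (f : ι → ℝ → ℝ → ℝ) : Prop := PerFamily f ∧ ∀ β, FourierDecay β f

namespace RapidDecay

variable {f g : ι → ℝ → ℝ → ℝ}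

theorem add (hf : RapidDecay f) (hg : RapidDecay g) :
    RapidDecay fun i ξ τ => f i ξ τ + g i ξ τ :=
  ⟨hf.1.add hg.1, fun β => (hf.2 β).add (hg.2 β) hf.1 hg.1⟩

/-- The order is raised to `max β 2` because products need an order above one. -/
theorem mul (hf : RapidDecay f) (hg : RapidDecay g) :
    RapidDecay fun i ξ τ => f i ξ τ * g i ξ τ :=
  ⟨hf.1.mul hg.1, fun β => ((hf.2 (max β 2)).mul (lt_max_of_lt_right one_lt_two) (hg.2 _)
    hf.1 hg.1).mono (le_max_left _ _)⟩

theorem const_mul (hf : RapidDecay f) {c : ι → ℝ} {K : ℝ} (hc : ∀ i, |c i| ≤ K) :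
    RapidDecay fun i ξ τ => c i * f i ξ τ :=
  ⟨hf.1.const_mul c, fun β => (hf.2 β).const_mul hc⟩

theorem galerkin (hf : RapidDecay f) (n : ι → ℕ∞) :
    RapidDecay fun i ξ τ => galerkin (n i) (f i ξ) τ :=
  ⟨hf.1.galerkin n, fun β => (hf.2 β).galerkin n⟩

theorem hasSum (hf : RapidDecay f) (i : ι) (ξ τ : ℝ) :
    HasSum (fun l => fourierCoef (f i ξ) l * Complex.exp (Complex.I * l * τ)) (f i ξ τ : ℂ) :=
  hasSum_fourier (hf.1.cont i ξ) ((hf.1 i).2 ξ) ((hf.2 2).summable one_lt_two i ξ) τ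

theorem bounded (hf : RapidDecay f) : ∃ B : ℝ, ∀ i ξ τ, |f i ξ τ| ≤ B := by
  obtain ⟨C, hC, h⟩ := hf.2 2
  refine ⟨C * ∑' l, decayWeight 2 l, fun i ξ τ => ?_⟩
  have h1 := hf.hasSum i ξ τ
  have h2 := ((summable_decayWeight one_lt_two).hasSum).mul_left C
  have := tsum_of_norm_bounded h2 (f := fun l => fourierCoef (f i ξ) l *
    Complex.exp (Complex.I * l * τ)) fun l => by
      rw [norm_mul, norm_exp_I_mul, mul_one]; exact h i ξ l
  rwa [h1.tsum_eq, Complex.norm_real] at this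

theorem hasDerivAt_exp (l : ℤ) (τ : ℝ) :
    HasDerivAt (fun τ : ℝ => Complex.exp (Complex.I * l * τ))
      (Complex.exp (Complex.I * l * τ) * (Complex.I * l)) τ := by
  have : HasDerivAt (fun τ : ℝ => Complex.I * l * (τ : ℂ)) (Complex.I * l) τ := by
    have := ((hasDerivAt_id (τ : ℂ)).const_mul (Complex.I * l)).comp_ofReal
    simpa using this
  exact this.cexp

/-- The `τ`-derivative as a Fourier series. -/
theorem hasDerivAt_series (hf : RapidDecay f) (i : ι) (ξ τ : ℝ) :
    HasDerivAt (f i ξ) (∑' l, fourierCoef (f i ξ) l *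
      (Complex.exp (Complex.I * l * τ) * (Complex.I * l))).re τ := by
  obtain ⟨C, hC, h⟩ := hf.2 (2 + 1)
  have key := hasDerivAt_tsum (u := fun l => C * decayWeight 2 l)
    (g := fun (l : ℤ) (τ : ℝ) => fourierCoef (f i ξ) l * Complex.exp (Complex.I * l * τ))
    (g' := fun (l : ℤ) (τ : ℝ) => fourierCoef (f i ξ) l *
      (Complex.exp (Complex.I * l * τ) * (Complex.I * l)))
    ((summable_decayWeight one_lt_two).mul_left C)
    (fun l τ => (hasDerivAt_exp l τ).const_mul _)
    (fun l τ => by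
      rw [norm_mul, norm_mul, norm_exp_I_mul, one_mul, norm_mul, Complex.norm_I, one_mul,
        Complex.norm_intCast, ← one_add_abs_mul_decayWeight]
      calc _ ≤ (C * decayWeight (2 + 1) l) * (1 + |(l : ℝ)|) :=
            mul_le_mul (h i ξ l) (by linarith) (abs_nonneg _)
              (mul_nonneg hC (decayWeight_pos _ l).le)
        _ = _ := by ring)
    (y₀ := 0) (hf.hasSum i ξ 0).summable τ
  have h2 := hasDerivAt_re key
  refine h2.congr_of_eventuallyEq (Eventually.of_forall fun y => ?_)
  dsimp only
  rw [(hf.hasSum i ξ y).tsum_eq, Complex.ofReal_re]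

theorem dτ_eq (hf : RapidDecay f) (i : ι) (ξ τ : ℝ) :
    dτ f i ξ τ = (∑' l, fourierCoef (f i ξ) l *
      (Complex.exp (Complex.I * l * τ) * (Complex.I * l))).re :=
  (hf.hasDerivAt_series i ξ τ).deriv

theorem hasDerivAt_dτ (hf : RapidDecay f) (i : ι) (ξ τ : ℝ) :
    HasDerivAt (f i ξ) (dτ f i ξ τ) τ := by
  rw [hf.dτ_eq]; exact hf.hasDerivAt_series i ξ τ

/-- One order of decay pays for the factor `l` of a `τ`-derivative, and the remaining order 2 is
summable. -/
theorem norm_coef_mul_le {C : ℝ} {f : ℝ → ℝ} {l : ℤ} (hC : 0 ≤ C)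
    (h : ‖fourierCoef f l‖ ≤ C * decayWeight (2 + 1) l) (τ : ℝ) :
    ‖fourierCoef f l * (Complex.exp (Complex.I * l * τ) * (Complex.I * l))‖ ≤
      C * decayWeight 2 l := by
  rw [norm_mul, norm_mul, norm_exp_I_mul, one_mul, norm_mul, Complex.norm_I, one_mul,
    Complex.norm_intCast, ← one_add_abs_mul_decayWeight]
  calc _ ≤ (C * decayWeight (2 + 1) l) * (1 + |(l : ℝ)|) :=
        mul_le_mul h (by linarith) (abs_nonneg _) (mul_nonneg hC (decayWeight_pos _ l).le)
    _ = _ := by ring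

theorem dτ (hf : RapidDecay f) : RapidDecay (dτ f) := by
  have hc : ∀ i, Continuous (Function.uncurry (ModulatedWave.dτ f i)) := by
    intro i
    obtain ⟨C, hC, h⟩ := hf.2 (2 + 1)
    have : Function.uncurry (ModulatedWave.dτ f i) = fun p : ℝ × ℝ =>
        (∑' l, fourierCoef (f i p.1) l *
          (Complex.exp (Complex.I * l * p.2) * (Complex.I * l))).re := by
      ext ⟨ξ, τ⟩; exact hf.dτ_eq i ξ τ
    rw [this]
    refine Complex.continuous_re.comp (continuous_tsum (fun l => ?_)
      ((summable_decayWeight one_lt_two).mul_left C) fun l p => norm_coef_mul_le hC (h i p.1 l) p.2)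
    exact ((continuous_fourierCoef (hf.1 i).1 l).comp continuous_fst).mul (by fun_prop)
  refine ⟨fun i => ⟨hc i, fun ξ τ => ?_⟩, fun β => ?_⟩
  · simp only [hf.dτ_eq]
    congr 2
    ext l
    congr 2
    have := periodic_exp (-l) τ
    simp only [Int.cast_neg, mul_neg, neg_mul, neg_neg] at this
    exact this
  · obtain ⟨C, hC, h⟩ := hf.2 (β + 1)
    refine ⟨C, hC, fun i ξ l => ?_⟩
    rw [fourierCoef_of_hasDerivAt (hf.hasDerivAt_dτ i ξ) (continuous_uncurry_left (hc i) ξ)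
      ((hf.1 i).2 ξ), norm_mul, norm_mul, Complex.norm_I, one_mul, Complex.norm_intCast,
      ← one_add_abs_mul_decayWeight]
    calc _ ≤ (1 + |(l : ℝ)|) * (C * decayWeight (β + 1) l) :=
          mul_le_mul (by linarith) (h i ξ l) (norm_nonneg _) (by positivity)
      _ = _ := by ring

end RapidDecay

/-! ### Uniform smoothness in both variables. -/

/-- `k` derivatives in `ξ` with rapidly decaying Fourier coefficients. -/
def UnifReg : ℕ → (ι → ℝ → ℝ → ℝ) → Prop
  | 0, f => RapidDecay f
  | k + 1, f => RapidDecay f ∧ (∀ i ξ τ, DifferentiableAt ℝ (fun x => f i x τ) ξ) ∧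
      UnifReg k (dξ f)

namespace UnifReg

variable {f g : ι → ℝ → ℝ → ℝ} {k : ℕ}

theorem rapidDecay : ∀ {k : ℕ} {f : ι → ℝ → ℝ → ℝ}, UnifReg k f → RapidDecay f
  | 0, _, h => h
  | _ + 1, _, h => h.1

theorem of_succ : ∀ {k : ℕ} {f : ι → ℝ → ℝ → ℝ}, UnifReg (k + 1) f → UnifReg k f
  | 0, _, h => h.1
  | _ + 1, _, h => ⟨h.1, h.2.1, of_succ h.2.2⟩

theorem dξ_eq {f' : ι → ℝ → ℝ → ℝ} (h : ∀ i ξ τ, HasDerivAt (fun x => f i x τ) (f' i ξ τ) ξ) :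
    dξ f = f' := by
  ext i ξ τ; exact (h i ξ τ).deriv

theorem succ {f' : ι → ℝ → ℝ → ℝ} (hf : RapidDecay f)
    (h : ∀ i ξ τ, HasDerivAt (fun x => f i x τ) (f' i ξ τ) ξ) (hf' : UnifReg k f') :
    UnifReg (k + 1) f :=
  ⟨hf, fun i ξ τ => (h i ξ τ).differentiableAt, by rwa [dξ_eq h]⟩

theorem hasDerivAt (h : UnifReg (k + 1) f) (i : ι) (ξ τ : ℝ) :
    HasDerivAt (fun x => f i x τ) (dξ f i ξ τ) ξ := (h.2.1 i ξ τ).hasDerivAt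

theorem add : ∀ {k : ℕ} {f g : ι → ℝ → ℝ → ℝ}, UnifReg k f → UnifReg k g →
    UnifReg k fun i ξ τ => f i ξ τ + g i ξ τ
  | 0, _, _, hf, hg => RapidDecay.add hf hg
  | _ + 1, _, _, hf, hg => succ (RapidDecay.add hf.1 hg.1)
      (fun i ξ τ => (hf.hasDerivAt i ξ τ).add (hg.hasDerivAt i ξ τ)) (add hf.2.2 hg.2.2)

theorem const_mul {c : ι → ℝ} {K : ℝ} (hc : ∀ i, |c i| ≤ K) :
    ∀ {k : ℕ} {f : ι → ℝ → ℝ → ℝ}, UnifReg k f → UnifReg k fun i ξ τ => c i * f i ξ τ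
  | 0, _, hf => RapidDecay.const_mul hf hc
  | _ + 1, _, hf => succ (RapidDecay.const_mul hf.1 hc)
      (fun i ξ τ => (hf.hasDerivAt i ξ τ).const_mul (c i)) (const_mul hc hf.2.2)

theorem mul : ∀ {k : ℕ} {f g : ι → ℝ → ℝ → ℝ}, UnifReg k f → UnifReg k g →
    UnifReg k fun i ξ τ => f i ξ τ * g i ξ τ
  | 0, _, _, hf, hg => RapidDecay.mul hf hg
  | _ + 1, _, _, hf, hg => succ (RapidDecay.mul hf.1 hg.1)
      (fun i ξ τ => (hf.hasDerivAt i ξ τ).mul (hg.hasDerivAt i ξ τ))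
      (add (mul hf.2.2 (of_succ hg)) (mul (of_succ hf) hg.2.2))

/-- The projection acts in `τ` only. It is the identity or a finite sum over modes, so it commutes
with the `ξ`-derivative. -/
theorem hasDerivAt_galerkin (n : ℕ∞) {f f' : ℝ → ℝ → ℝ} (hc : ∀ ξ, Continuous (f ξ))
    (hf' : Continuous (Function.uncurry f'))
    (h : ∀ ξ τ, HasDerivAt (fun x => f x τ) (f' ξ τ) ξ) (ξ τ : ℝ) :
    HasDerivAt (fun x => ModulatedWave.galerkin n (f x) τ)
      (ModulatedWave.galerkin n (f' ξ) τ) ξ := by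
  unfold ModulatedWave.galerkin
  split_ifs with hn
  · exact h ξ τ
  · unfold fourierTrunc
    refine hasDerivAt_re (HasDerivAt.fun_sum fun l _ => ?_)
    exact (hasDerivAt_fourierCoef hc hf' h l ξ).mul_const _

theorem galerkin (n : ι → ℕ∞) : ∀ {k : ℕ} {f : ι → ℝ → ℝ → ℝ}, UnifReg k f →
    UnifReg k fun i ξ τ => ModulatedWave.galerkin (n i) (f i ξ) τ
  | 0, _, hf => RapidDecay.galerkin hf n
  | _ + 1, _, hf => succ (RapidDecay.galerkin hf.1 n)
      (fun i ξ τ => hasDerivAt_galerkin (n i) (fun ξ => hf.1.1.cont i ξ)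
        (hf.2.2.rapidDecay.1 i).1 (hf.hasDerivAt i) ξ τ) (galerkin n hf.2.2)

/-- Differentiating the Fourier series of `dτ f` in `ξ` term by term shows that the two derivatives
commute. No second order differentiability is assumed. -/
theorem hasDerivAt_dτ (hf : RapidDecay f) (hf' : RapidDecay g)
    (h : ∀ i ξ τ, HasDerivAt (fun x => f i x τ) (g i ξ τ) ξ) (i : ι) (ξ τ : ℝ) :
    HasDerivAt (fun x => dτ f i x τ) (dτ g i ξ τ) ξ := by
  obtain ⟨C, hC, hg⟩ := hf'.2 (2 + 1)
  obtain ⟨D, hD, hb⟩ := hf.2 (2 + 1)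
  have key := hasDerivAt_tsum (u := fun l => C * decayWeight 2 l)
    (g := fun (l : ℤ) (x : ℝ) => fourierCoef (f i x) l *
      (Complex.exp (Complex.I * l * τ) * (Complex.I * l)))
    (g' := fun (l : ℤ) (x : ℝ) => fourierCoef (g i x) l *
      (Complex.exp (Complex.I * l * τ) * (Complex.I * l)))
    ((summable_decayWeight one_lt_two).mul_left C)
    (fun l x => (hasDerivAt_fourierCoef (fun ξ => hf.1.cont i ξ) (hf'.1 i).1 (h i) l x).mul_const _)
    (fun l x => RapidDecay.norm_coef_mul_le hC (hg i x l) τ)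
    (y₀ := 0) (Summable.of_norm_bounded ((summable_decayWeight one_lt_two).mul_left D)
      fun l => RapidDecay.norm_coef_mul_le hD (hb i 0 l) τ) ξ
  rw [hf'.dτ_eq]
  exact (hasDerivAt_re key).congr_of_eventuallyEq (Eventually.of_forall fun y => hf.dτ_eq i y τ)

theorem dτ : ∀ {k : ℕ} {f : ι → ℝ → ℝ → ℝ}, UnifReg k f → UnifReg k (dτ f)
  | 0, _, hf => RapidDecay.dτ hf
  | _ + 1, _, hf => succ (RapidDecay.dτ hf.1)
      (hasDerivAt_dτ hf.1 hf.2.2.rapidDecay hf.hasDerivAt) (dτ hf.2.2)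

end UnifReg

theorem hasFDerivAt_uncurry_of_partials {f f₁ f₂ : ℝ → ℝ → ℝ}
    (c₁ : Continuous (Function.uncurry f₁)) (c₂ : Continuous (Function.uncurry f₂))
    (h₁ : ∀ ξ τ, HasDerivAt (fun x => f x τ) (f₁ ξ τ) ξ)
    (h₂ : ∀ ξ τ, HasDerivAt (f ξ) (f₂ ξ τ) τ) (p : ℝ × ℝ) :
    HasFDerivAt (Function.uncurry f) (f₁ p.1 p.2 • ContinuousLinearMap.fst ℝ ℝ ℝ +
      f₂ p.1 p.2 • ContinuousLinearMap.snd ℝ ℝ ℝ) p := by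
  have d1 : Continuous (Function.uncurry fun ξ τ => f₁ ξ τ • ContinuousLinearMap.id ℝ ℝ) :=
    c₁.smul continuous_const
  have d2 : Continuous (Function.uncurry fun ξ τ => f₂ ξ τ • ContinuousLinearMap.id ℝ ℝ) :=
    c₂.smul continuous_const
  have key := hasStrictFDerivAt_uncurry_coprod (u := p) (f := f)
    (f₁ := fun ξ τ => f₁ ξ τ • ContinuousLinearMap.id ℝ ℝ)
    (f₂ := fun ξ τ => f₂ ξ τ • ContinuousLinearMap.id ℝ ℝ)
    (Eventually.of_forall fun q => ?_) (Eventually.of_forall fun q => ?_)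
    d1.continuousAt d2.continuousAt
  · refine key.hasFDerivAt.congr_fderiv ?_
    ext <;> simp [Function.HasUncurry.uncurry]
  · refine (h₁ q.1 q.2).hasFDerivAt.congr_fderiv ?_
    ext; simp [Function.HasUncurry.uncurry]
  · refine (h₂ q.1 q.2).hasFDerivAt.congr_fderiv ?_
    ext; simp [Function.HasUncurry.uncurry]

/-- Families of smooth functions with uniform bounds on all derivatives. -/
def Regular (f : ι → ℝ → ℝ → ℝ) : Prop := ∀ k, UnifReg k f

namespace Regular

variable {f g : ι → ℝ → ℝ → ℝ}

theorem rapidDecay (h : Regular f) : RapidDecay f := h 0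

theorem dξ (h : Regular f) : Regular (dξ f) := fun k => (h (k + 1)).2.2

theorem dτ (h : Regular f) : Regular (dτ f) := fun k => (h k).dτ

theorem hasDerivAt_fst (h : Regular f) (i : ι) (ξ τ : ℝ) :
    HasDerivAt (fun x => f i x τ) (ModulatedWave.dξ f i ξ τ) ξ := (h 1).hasDerivAt i ξ τ

theorem hasDerivAt_snd (h : Regular f) (i : ι) (ξ τ : ℝ) :
    HasDerivAt (f i ξ) (ModulatedWave.dτ f i ξ τ) τ := h.rapidDecay.hasDerivAt_dτ i ξ τ

theorem continuous (h : Regular f) (i : ι) : Continuous (Function.uncurry (f i)) :=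
  (h.rapidDecay.1 i).1

theorem hasFDerivAt (h : Regular f) (i : ι) (p : ℝ × ℝ) :
    HasFDerivAt (Function.uncurry (f i))
      ((ModulatedWave.dξ f i p.1 p.2) • ContinuousLinearMap.fst ℝ ℝ ℝ +
        (ModulatedWave.dτ f i p.1 p.2) • ContinuousLinearMap.snd ℝ ℝ ℝ) p :=
  hasFDerivAt_uncurry_of_partials (h.dξ.continuous i) (h.dτ.continuous i)
    (h.hasDerivAt_fst i) (h.hasDerivAt_snd i) p

theorem contDiff_nat : ∀ (n : ℕ) {f : ι → ℝ → ℝ → ℝ}, Regular f → ∀ i : ι,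
    ContDiff ℝ n (Function.uncurry (f i))
  | 0, _, h, i => contDiff_zero.2 (h.continuous i)
  | n + 1, f, h, i => by
    have h1 := contDiff_nat n h.dξ i
    have h2 := contDiff_nat n h.dτ i
    push_cast
    rw [contDiff_succ_iff_hasFDerivAt]
    exact ⟨_, (h1.smul contDiff_const).add (h2.smul contDiff_const), h.hasFDerivAt i⟩

theorem contDiff (h : Regular f) (i : ι) :
    ContDiff ℝ ((⊤ : ℕ∞) : WithTop ℕ∞) (Function.uncurry (f i)) :=
  contDiff_infty.2 fun n => contDiff_nat n h i

theorem mixedDeriv_eq (f : ι → ℝ → ℝ → ℝ) (a b : ℕ) (i : ι) :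
    mixedDeriv a b (f i) = (ModulatedWave.dξ^[a] (ModulatedWave.dτ^[b] f)) i := by
  have h1 : ∀ b ξ, iteratedDeriv b (f i ξ) = (ModulatedWave.dτ^[b] f) i ξ := by
    intro b
    induction b with
    | zero => intro ξ; simp
    | succ b ih =>
      intro ξ
      rw [iteratedDeriv_succ, ih, Function.iterate_succ_apply']
      rfl
  ext ξ τ
  unfold mixedDeriv
  simp only [h1]
  set g := ModulatedWave.dτ^[b] f
  have h2 : ∀ a, iteratedDeriv a (fun x => g i x τ) = fun x => (ModulatedWave.dξ^[a] g) i x τ := by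
    intro a
    induction a with
    | zero => simp
    | succ a ih =>
      rw [iteratedDeriv_succ, ih, Function.iterate_succ_apply']
      rfl
  rw [h2]

theorem iterate_dξ (h : Regular f) :
    ∀ a, Regular (ModulatedWave.dξ^[a] f)
  | 0 => h
  | a + 1 => by rw [Function.iterate_succ_apply']; exact (h.iterate_dξ a).dξ

theorem iterate_dτ (h : Regular f) :
    ∀ a, Regular (ModulatedWave.dτ^[a] f)
  | 0 => h
  | a + 1 => by rw [Function.iterate_succ_apply']; exact (h.iterate_dτ a).dτ

theorem dτ_iterate_dξ (h : Regular f) :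
    ∀ a, ModulatedWave.dτ (ModulatedWave.dξ^[a] f) = ModulatedWave.dξ^[a] (ModulatedWave.dτ f)
  | 0 => rfl
  | a + 1 => by
    have r := h.iterate_dξ a
    rw [Function.iterate_succ_apply', Function.iterate_succ_apply', ← h.dτ_iterate_dξ a]
    funext i ξ τ
    exact (UnifReg.hasDerivAt_dτ r.rapidDecay r.dξ.rapidDecay r.hasDerivAt_fst i ξ τ).deriv.symm

theorem exists_mixedDeriv_le (h : Regular f) (a b : ℕ) :
    ∃ B : ℝ, ∀ i ξ τ, |mixedDeriv a b (f i) ξ τ| ≤ B := by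
  obtain ⟨B, hB⟩ := ((h.iterate_dτ b).iterate_dξ a).rapidDecay.bounded
  exact ⟨B, fun i ξ τ => by rw [mixedDeriv_eq]; exact hB i ξ τ⟩

end Regular

end Families

/-! ### Bootstrap: bounded families of solutions are uniformly smooth. -/

/-- Families of solutions that are bounded by `M`, with parameters bounded by `R`. -/
structure SolFamily {ι : Type*} (R M : ℝ) (ω s : ι → ℝ) (n : ι → ℕ∞)
    (u v θ w : ι → ℝ → ℝ → ℝ) : Prop where
  hR : 1 ≤ R
  le_ω i : R⁻¹ ≤ |ω i|
  ω_le i : |ω i| ≤ R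
  s_le i : |s i| ≤ R
  sol i : IsSolution (ω i) (s i) (n i) (u i) (v i) (θ i) (w i)
  bdd i ξ τ : |u i ξ τ| ≤ M

namespace SolFamily

variable {ι : Type*} {R M : ℝ} {ω s : ι → ℝ} {n : ι → ℕ∞} {u v θ w : ι → ℝ → ℝ → ℝ}

theorem perFamily_u (h : SolFamily R M ω s n u v θ w) : PerFamily u := fun i =>
  ⟨(h.sol i).contDiff_u.continuous, (h.sol i).periodic_u⟩

theorem fourierDecay_dG (h : SolFamily R M ω s n u v θ w) {β : ℝ} (hβ : 1 < β)
    (hu : FourierDecay β u) : FourierDecay β fun i ξ τ => dG (u i ξ τ) := by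
  have p := h.perFamily_u
  have h3 := (hu.const_mul (c := fun _ => (-1 : ℝ)) (K := 1) (by simp)).add
    (hu.mul hβ (hu.mul hβ hu p p) p (p.mul p)) (p.const_mul _) (p.mul (p.mul p))
  convert h3 using 4
  unfold dG; ring

/-- The squared weight is `(1 + |l|)^(-1/2)`, and `1 + |l| ≤ 4 |l|` for `l ≠ 0`. -/
theorem inv_sqrt_le (l : ℤ) (hl : l ≠ 0) : 1 / √|(l : ℝ)| ≤ 2 * (decayWeight (1 / 4) l) ^ 2 := by
  have h1 : 1 ≤ |(l : ℝ)| := by exact_mod_cast Int.one_le_abs hl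
  have h2 : decayWeight (1 / 4) l ^ 2 = 1 / √(1 + |(l : ℝ)|) := by
    unfold decayWeight
    rw [← Real.rpow_natCast, ← Real.rpow_mul (by positivity), Real.sqrt_eq_rpow,
      one_div (_ ^ (1 / 2 : ℝ)), ← Real.rpow_neg (by positivity)]
    norm_num
  rw [h2, mul_one_div, div_le_div_iff₀ (by positivity) (by positivity), one_mul]
  have : √(1 + |(l : ℝ)|) ≤ √(2 ^ 2 * |(l : ℝ)|) := Real.sqrt_le_sqrt (by linarith)
  rwa [Real.sqrt_mul (by norm_num), Real.sqrt_sq (by norm_num)] at this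

theorem decayWeight_add (β γ : ℝ) (l : ℤ) :
    decayWeight (β + γ) l = decayWeight β l * decayWeight γ l := by
  unfold decayWeight
  rw [← Real.rpow_add (by positivity)]
  congr 1; ring

/-- The gain inequality bounds the square of a mode, so `1 / √|l|` amounts to decay of order 1/4.
The mode `l = 0` has no gain and is bounded by `M`. -/
theorem gain (h : SolFamily R M ω s n u v θ w) {β : ℝ}
    (hg : FourierDecay β fun i ξ τ => dG (u i ξ τ)) : FourierDecay (β + 1 / 4) u := by
  obtain ⟨ε, hε, C, hC, hgain⟩ := exists_gain h.hR
  obtain ⟨D, hD, hg⟩ := hg.galerkin n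
  set W : ℝ := cauchyInt ε (fun _ => 1) with hW
  have hW0 : 0 ≤ W := cauchyInt_nonneg fun _ => zero_le_one
  refine ⟨√(2 * C * W) * D + |M|, by positivity, fun i ξ l => ?_⟩
  have hd := decayWeight_pos (β + 1 / 4) l
  rcases eq_or_ne l 0 with rfl | hl
  · have h1 := norm_fourierCoef_le (fun τ => h.bdd i ξ τ) 0
    have h2 : decayWeight (β + 1 / 4) 0 = 1 := by simp [decayWeight]
    rw [h2, mul_one]
    exact h1.trans ((le_abs_self M).trans (le_add_of_nonneg_left (by positivity)))
  · have h1 := hgain (ω i) (s i) (n i) (u i) (v i) (θ i) (w i) M (h.le_ω i) (h.ω_le i) (h.s_le i)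
      (h.sol i) (h.bdd i) l hl ξ
    have h2 : cauchyInt ε (fun x => ‖fourierCoef (ModulatedWave.galerkin (n i)
        fun σ => dG (u i (x + ξ) σ)) l‖ ^ 2) ≤ (D * decayWeight β l) ^ 2 * W := by
      rw [hW, ← cauchyInt_const_mul]
      refine cauchyInt_mono hε ?_ (BddCont.const _) fun x => ?_
      · have := ((h.sol i).bddCont_galerkin_coef (h.bdd i) l).norm_sq
        refine ⟨this.1.comp (continuous_add_const ξ), ?_⟩
        obtain ⟨B, hB⟩ := this.2
        exact ⟨B, fun x => hB (x + ξ)⟩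
      · rw [mul_one]
        exact pow_le_pow_left₀ (norm_nonneg _) (hg i (x + ξ) l) 2
    have h3 : ‖fourierCoef (u i ξ) l‖ ^ 2 ≤
        (√(2 * C * W) * D * decayWeight (β + 1 / 4) l) ^ 2 := by
      rw [mul_pow, mul_pow, Real.sq_sqrt (by positivity), decayWeight_add]
      calc _ ≤ C / √|(l : ℝ)| * ((D * decayWeight β l) ^ 2 * W) :=
            h1.trans (mul_le_mul_of_nonneg_left h2 (by positivity))
        _ = (1 / √|(l : ℝ)|) * (C * ((D * decayWeight β l) ^ 2 * W)) := by ring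
        _ ≤ (2 * (decayWeight (1 / 4) l) ^ 2) * (C * ((D * decayWeight β l) ^ 2 * W)) :=
            mul_le_mul_of_nonneg_right (inv_sqrt_le l hl) (by positivity)
        _ = _ := by ring
    have h4 := abs_le_of_sq_le_sq h3 (by positivity)
    rw [abs_of_nonneg (norm_nonneg _)] at h4
    exact h4.trans (mul_le_mul_of_nonneg_right (le_add_of_nonneg_right (abs_nonneg _)) hd.le)

/-- The start of the bootstrap. The sup bound of the nonlinearity supplies the 1 in `1 + |l|`, and
`exists_coef_dG_le` supplies `|l|`. -/
theorem fourierDecay_one (h : SolFamily R M ω s n u v θ w) :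
    FourierDecay 1 fun i ξ τ => dG (u i ξ τ) := by
  by_cases hM : 0 ≤ M
  swap
  · exact ⟨0, le_rfl, fun i => absurd ((abs_nonneg _).trans (h.bdd i 0 0)) hM⟩
  obtain ⟨K, hK, hK'⟩ := exists_coef_dG_le h.hR hM
  have hB0 : 0 ≤ (1 + 3 * M ^ 2) * M := by positivity
  refine ⟨(1 + 3 * M ^ 2) * M + K, by positivity, fun i ξ l => ?_⟩
  have h1 := hK' (ω i) (s i) (n i) (u i) (v i) (θ i) (w i) (h.le_ω i) (h.ω_le i) (h.s_le i)
    (h.sol i) (h.bdd i) l ξ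
  have h2 := norm_fourierCoef_le (fun τ => abs_dG_le (h.bdd i ξ τ)) l
  have hd : decayWeight 1 l = (1 + |(l : ℝ)|)⁻¹ := by
    unfold decayWeight; rw [Real.rpow_neg_one]
  rw [hd, ← div_eq_mul_inv, le_div_iff₀ (by positivity)]
  linarith

/-- The first gain reaches order 5/4. From there on the order exceeds one, the nonlinearity inherits
the decay of `u`, and each round adds 1/4. -/
theorem rapidDecay_u (h : SolFamily R M ω s n u v θ w) : RapidDecay u := by
  have key : ∀ k : ℕ, FourierDecay (5 / 4 + k / 4) u := by
    intro k
    induction k with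
    | zero => exact (h.gain h.fourierDecay_one).mono (by norm_num)
    | succ k ih =>
      exact (h.gain (h.fourierDecay_dG (by have : (0 : ℝ) ≤ k := k.cast_nonneg; linarith)
        ih)).mono (by push_cast; linarith)
  refine ⟨h.perFamily_u, fun β => ?_⟩
  obtain ⟨k, hk⟩ := exists_nat_ge (4 * β)
  exact (key k).mono (by linarith)

theorem rapidDecay_dG (h : SolFamily R M ω s n u v θ w) :
    RapidDecay fun i ξ τ => dG (u i ξ τ) :=
  ⟨fun i => ⟨(h.sol i).continuous_dG_comp, (h.sol i).periodic_dG_comp⟩, fun β =>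
    (h.fourierDecay_dG (lt_max_of_lt_right one_lt_two) (h.rapidDecay_u.2 (max β 2))).mono
      (le_max_left _ _)⟩

/-- `ModeODE.bound` costs one order of decay, which is harmless after rapid decay of `u` is known.
-/
theorem fourierDecay_vθw (h : SolFamily R M ω s n u v θ w) (β : ℝ) :
    FourierDecay β v ∧ FourierDecay β θ ∧ FourierDecay β w := by
  obtain ⟨C, hC, hu⟩ := h.rapidDecay_u.2 (β + 1)
  obtain ⟨D, hD, hg⟩ := (h.rapidDecay_dG.2 (β + 1)).galerkin n
  have hR := h.hR
  have key : ∀ i ξ l, ‖fourierCoef (v i ξ) l‖ ≤ 920 * R * (C + D) * decayWeight β l ∧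
      ‖fourierCoef (θ i ξ) l‖ ≤ 920 * R * (C + D) * decayWeight β l ∧
      ‖fourierCoef (w i ξ) l‖ ≤ 920 * R * (C + D) * decayWeight β l := by
    intro i ξ l
    have hd := (decayWeight_pos (β + 1) l).le
    have := ModeODE.bound ((h.sol i).modeODE l) (A := (C + D) * decayWeight (β + 1) l) h.hR
      (h.ω_le i) (h.s_le i)
      (fun x => (hu i x l).trans (mul_le_mul_of_nonneg_right (by linarith) hd))
      (fun x => (hg i x l).trans (mul_le_mul_of_nonneg_right (by linarith) hd)) ξ
    have e : 920 * R * (1 + |(l : ℝ)|) * ((C + D) * decayWeight (β + 1) l) =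
        920 * R * (C + D) * decayWeight β l := by
      rw [← one_add_abs_mul_decayWeight β l]; ring
    rwa [e] at this
  have hK : 0 ≤ 920 * R * (C + D) := by positivity
  exact ⟨⟨_, hK, fun i ξ l => (key i ξ l).1⟩, ⟨_, hK, fun i ξ l => (key i ξ l).2.1⟩,
    ⟨_, hK, fun i ξ l => (key i ξ l).2.2⟩⟩

theorem hasDerivAt_u (h : SolFamily R M ω s n u v θ w) (i : ι) (ξ τ : ℝ) :
    HasDerivAt (fun x => u i x τ) (v i ξ τ) ξ :=
  ((h.sol i).eq_u ξ τ) ▸ hasDerivAt_fst_of_contDiff (h.sol i).contDiff_u ξ τ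

theorem hasDerivAt_v (h : SolFamily R M ω s n u v θ w) (i : ι) (ξ τ : ℝ) :
    HasDerivAt (fun x => v i x τ)
      (galerkin (n i) (fun σ => dG (u i ξ σ)) τ + θ i ξ τ) ξ :=
  ((h.sol i).eq_v ξ τ) ▸ hasDerivAt_fst_of_contDiff (h.sol i).contDiff_v ξ τ

theorem hasDerivAt_θ (h : SolFamily R M ω s n u v θ w) (i : ι) (ξ τ : ℝ) :
    HasDerivAt (fun x => θ i x τ) (w i ξ τ) ξ :=
  ((h.sol i).eq_θ ξ τ) ▸ hasDerivAt_fst_of_contDiff (h.sol i).contDiff_θ ξ τ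

theorem hasDerivAt_w (h : SolFamily R M ω s n u v θ w) (i : ι) (ξ τ : ℝ) :
    HasDerivAt (fun x => w i x τ) (s i * v i ξ τ + -ω i * dτ u i ξ τ) ξ := by
  have := ((h.sol i).eq_w ξ τ) ▸ hasDerivAt_fst_of_contDiff (h.sol i).contDiff_w ξ τ
  exact this.congr_deriv (by unfold dτ; ring)

theorem unifReg_dG {k : ℕ} (hu : UnifReg k u) : UnifReg k fun i ξ τ => dG (u i ξ τ) := by
  have h3 := (hu.const_mul (c := fun _ => (-1 : ℝ)) (K := 1) (by simp)).add (hu.mul (hu.mul hu))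
  convert h3 using 4
  unfold dG; ring

/-- Each equation expresses a `ξ`-derivative by quantities that already have `k` regular
`ξ`-derivatives; the term `u_τ` in the last equation costs no `ξ`-regularity. -/
theorem unifReg (h : SolFamily R M ω s n u v θ w) (k : ℕ) :
    UnifReg k u ∧ UnifReg k v ∧ UnifReg k θ ∧ UnifReg k w := by
  have h0 : RapidDecay v ∧ RapidDecay θ ∧ RapidDecay w :=
    ⟨⟨fun i => ⟨(h.sol i).contDiff_v.continuous, (h.sol i).periodic_v⟩,
        fun β => (h.fourierDecay_vθw β).1⟩,
      ⟨fun i => ⟨(h.sol i).contDiff_θ.continuous, (h.sol i).periodic_θ⟩,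
        fun β => (h.fourierDecay_vθw β).2.1⟩,
      ⟨fun i => ⟨(h.sol i).contDiff_w.continuous, (h.sol i).periodic_w⟩,
        fun β => (h.fourierDecay_vθw β).2.2⟩⟩
  induction k with
  | zero => exact ⟨h.rapidDecay_u, h0⟩
  | succ k ih =>
    obtain ⟨hu, hv, hθ, hw⟩ := ih
    exact ⟨UnifReg.succ h.rapidDecay_u h.hasDerivAt_u hv,
      UnifReg.succ h0.1 h.hasDerivAt_v (((unifReg_dG hu).galerkin n).add hθ),
      UnifReg.succ h0.2.1 h.hasDerivAt_θ hw,
      UnifReg.succ h0.2.2 h.hasDerivAt_w ((hv.const_mul h.s_le).add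
        (hu.dτ.const_mul (K := R) (c := fun i => -ω i) fun i => by
          rw [abs_neg]; exact h.ω_le i))⟩

theorem regular_u (h : SolFamily R M ω s n u v θ w) : Regular u := fun k => (h.unifReg k).1

theorem regular_v (h : SolFamily R M ω s n u v θ w) : Regular v := fun k => (h.unifReg k).2.1

theorem regular_θ (h : SolFamily R M ω s n u v θ w) : Regular θ := fun k => (h.unifReg k).2.2.1

theorem regular_w (h : SolFamily R M ω s n u v θ w) : Regular w := fun k => (h.unifReg k).2.2.2

theorem regular_dG (h : SolFamily R M ω s n u v θ w) : Regular fun i ξ τ => dG (u i ξ τ) :=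
  fun k => unifReg_dG (h.regular_u k)

theorem regular_galerkin (h : SolFamily R M ω s n u v θ w) :
    Regular fun i ξ τ => galerkin (n i) (fun σ => dG (u i ξ σ)) τ :=
  fun k => (h.regular_dG k).galerkin n

end SolFamily

/-! ### The identities of a bounded solution that enter the a priori bound. -/

/-- Bounded continuous functions of `(ξ, τ)`. -/
def BddCont₂ (f : ℝ → ℝ → ℝ) : Prop :=
  Continuous (Function.uncurry f) ∧ ∃ B : ℝ, ∀ ξ τ, |f ξ τ| ≤ B

/-- The properties of a bounded solution, with its first integral, that enter the a priori bound;
`g` is `P_n G'(u)`, and `uτ`, `vτ`, `gξ` are derivatives. -/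
structure SmoothSol (ω s I : ℝ) (u v θ w g uτ vτ gξ : ℝ → ℝ → ℝ) : Prop where
  bc_u : BddCont₂ u
  bc_v : BddCont₂ v
  bc_θ : BddCont₂ θ
  bc_w : BddCont₂ w
  bc_g : BddCont₂ g
  bc_uτ : BddCont₂ uτ
  bc_vτ : BddCont₂ vτ
  bc_gξ : BddCont₂ gξ
  per_u ξ : Function.Periodic (u ξ) (2 * Real.pi)
  per_v ξ : Function.Periodic (v ξ) (2 * Real.pi)
  per_w ξ : Function.Periodic (w ξ) (2 * Real.pi)
  u_ξ ξ τ : HasDerivAt (fun x => u x τ) (v ξ τ) ξ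
  v_ξ ξ τ : HasDerivAt (fun x => v x τ) (g ξ τ + θ ξ τ) ξ
  θ_ξ ξ τ : HasDerivAt (fun x => θ x τ) (w ξ τ) ξ
  w_ξ ξ τ : HasDerivAt (fun x => w x τ) (s * v ξ τ - ω * uτ ξ τ) ξ
  g_ξ ξ τ : HasDerivAt (fun x => g x τ) (gξ ξ τ) ξ
  uτ_ξ ξ τ : HasDerivAt (fun x => uτ x τ) (vτ ξ τ) ξ
  u_τ ξ τ : HasDerivAt (u ξ) (uτ ξ τ) τ
  v_τ ξ τ : HasDerivAt (v ξ) (vτ ξ τ) τ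
  integral_u_g x ξ : ∫ τ in (0 : ℝ)..(2 * Real.pi), u x τ * g ξ τ =
    ∫ τ in (0 : ℝ)..(2 * Real.pi), u x τ * dG (u ξ τ)
  integral_v_g ξ : ∫ τ in (0 : ℝ)..(2 * Real.pi), v ξ τ * g ξ τ =
    ∫ τ in (0 : ℝ)..(2 * Real.pi), v ξ τ * dG (u ξ τ)
  integral_uτ_g ξ : ∫ τ in (0 : ℝ)..(2 * Real.pi), uτ ξ τ * g ξ τ = 0
  integral_g_sq ξ : ∫ τ in (0 : ℝ)..(2 * Real.pi), g ξ τ ^ 2 ≤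
    ∫ τ in (0 : ℝ)..(2 * Real.pi), dG (u ξ τ) ^ 2
  integral_gξ_sq ξ : ∫ τ in (0 : ℝ)..(2 * Real.pi), gξ ξ τ ^ 2 ≤
    ∫ τ in (0 : ℝ)..(2 * Real.pi), ((-1 + 3 * u ξ τ ^ 2) * v ξ τ) ^ 2
  mean ξ : ∫ τ in (0 : ℝ)..(2 * Real.pi), (w ξ τ - s * u ξ τ) = 2 * Real.pi * I

theorem SmoothSol.shift {ω s I : ℝ} {u v θ w g uτ vτ gξ : ℝ → ℝ → ℝ}
    (h : SmoothSol ω s I u v θ w g uτ vτ gξ) (a : ℝ) :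
    SmoothSol ω s I (fun ξ => u (ξ + a)) (fun ξ => v (ξ + a)) (fun ξ => θ (ξ + a))
      (fun ξ => w (ξ + a)) (fun ξ => g (ξ + a)) (fun ξ => uτ (ξ + a)) (fun ξ => vτ (ξ + a))
      (fun ξ => gξ (ξ + a)) := by
  have bc : ∀ {f : ℝ → ℝ → ℝ}, BddCont₂ f → BddCont₂ fun ξ => f (ξ + a) := by
    rintro f ⟨hc, B, hB⟩
    refine ⟨hc.comp (f := fun p : ℝ × ℝ => (p.1 + a, p.2)) (by fun_prop), B, fun ξ τ => hB _ _⟩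
  exact {
    bc_u := bc h.bc_u
    bc_v := bc h.bc_v
    bc_θ := bc h.bc_θ
    bc_w := bc h.bc_w
    bc_g := bc h.bc_g
    bc_uτ := bc h.bc_uτ
    bc_vτ := bc h.bc_vτ
    bc_gξ := bc h.bc_gξ
    per_u := fun ξ => h.per_u _
    per_v := fun ξ => h.per_v _
    per_w := fun ξ => h.per_w _
    u_ξ := fun ξ τ => (h.u_ξ (ξ + a) τ).comp_add_const ξ a
    v_ξ := fun ξ τ => (h.v_ξ (ξ + a) τ).comp_add_const ξ a
    θ_ξ := fun ξ τ => (h.θ_ξ (ξ + a) τ).comp_add_const ξ a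
    w_ξ := fun ξ τ => (h.w_ξ (ξ + a) τ).comp_add_const ξ a
    g_ξ := fun ξ τ => (h.g_ξ (ξ + a) τ).comp_add_const ξ a
    uτ_ξ := fun ξ τ => (h.uτ_ξ (ξ + a) τ).comp_add_const ξ a
    u_τ := fun ξ τ => h.u_τ _ τ
    v_τ := fun ξ τ => h.v_τ _ τ
    integral_u_g := fun x ξ => h.integral_u_g _ _
    integral_v_g := fun ξ => h.integral_v_g _
    integral_uτ_g := fun ξ => h.integral_uτ_g _
    integral_g_sq := fun ξ => h.integral_g_sq _
    integral_gξ_sq := fun ξ => h.integral_gξ_sq _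
    mean := fun ξ => h.mean _ }

theorem integral_eq_fourierCoef_zero (f : ℝ → ℝ) :
    ((∫ τ in (0 : ℝ)..(2 * Real.pi), f τ : ℝ) : ℂ) = 2 * Real.pi * fourierCoef f 0 := by
  have : ((2 * Real.pi : ℝ) : ℂ) ≠ 0 := by exact_mod_cast Real.two_pi_pos.ne'
  unfold fourierCoef
  push_cast at this ⊢
  rw [mul_inv_cancel_left₀ this]
  simp only [mul_zero, zero_mul, neg_zero, Complex.exp_zero, mul_one]
  exact intervalIntegral.integral_ofReal.symm

/-- Functions whose modes with `|l| > n` vanish do not see the projection. -/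
theorem integral_mul_galerkin (n : ℕ∞) {f h : ℝ → ℝ} (hf : Continuous f)
    (hp : Function.Periodic f (2 * Real.pi)) (hs : Summable fun l => ‖fourierCoef f l‖)
    (hh : Continuous h) (hn : ∀ l : ℤ, ¬ (l.natAbs : ℕ∞) ≤ n → fourierCoef f l = 0) :
    ∫ τ in (0 : ℝ)..(2 * Real.pi), f τ * galerkin n h τ =
      ∫ τ in (0 : ℝ)..(2 * Real.pi), f τ * h τ := by
  have h1 := hasSum_fourierCoef_mul hf hp hs (continuous_galerkin n hh) 0
  have h2 := hasSum_fourierCoef_mul hf hp hs hh 0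
  have e : fourierCoef (fun τ => f τ * galerkin n h τ) 0 = fourierCoef (fun τ => f τ * h τ) 0 := by
    rw [← h1.tsum_eq, ← h2.tsum_eq]
    refine tsum_congr fun m => ?_
    rw [fourierCoef_galerkin]
    by_cases hm : (m.natAbs : ℕ∞) ≤ n
    · rw [if_pos (by simpa using hm)]
    · rw [hn m hm, zero_mul, zero_mul]
  have := integral_eq_fourierCoef_zero fun τ => f τ * galerkin n h τ
  rw [e, ← integral_eq_fourierCoef_zero] at this
  exact_mod_cast this

theorem integral_galerkin_sq_le (n : ℕ∞) {h : ℝ → ℝ} (hh : Continuous h) :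
    ∫ τ in (0 : ℝ)..(2 * Real.pi), galerkin n h τ ^ 2 ≤
      ∫ τ in (0 : ℝ)..(2 * Real.pi), h τ ^ 2 := by
  have := hasSum_le (fun l => pow_le_pow_left₀ (norm_nonneg _)
    (norm_fourierCoef_galerkin_le n h l) 2) (parseval (continuous_galerkin n hh)) (parseval hh)
  exact le_of_mul_le_mul_left this (inv_pos.2 Real.two_pi_pos)

theorem hasDerivAt_dG (x : ℝ) : HasDerivAt dG (-1 + 3 * x ^ 2) x := by
  have := (hasDerivAt_id x).neg.add ((hasDerivAt_id x).fun_pow 3)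
  exact this.congr_deriv (by simp)

/-- The primitive `-x²/2 + x⁴/4` of `dG`. -/
def potential (x : ℝ) : ℝ := -x ^ 2 / 2 + x ^ 4 / 4

theorem hasDerivAt_potential (x : ℝ) : HasDerivAt potential (dG x) x := by
  have := ((hasDerivAt_id x).fun_pow 2).neg.div_const 2 |>.add
    (((hasDerivAt_id x).fun_pow 4).div_const 4)
  exact this.congr_deriv (by simp [dG]; ring)

theorem integral_deriv_periodic {F F' : ℝ → ℝ} (hF : ∀ τ, HasDerivAt F (F' τ) τ)
    (hF' : Continuous F') (hp : Function.Periodic F (2 * Real.pi)) :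
    ∫ τ in (0 : ℝ)..(2 * Real.pi), F' τ = 0 := by
  rw [intervalIntegral.integral_eq_sub_of_hasDerivAt (fun τ _ => hF τ)
    (hF'.intervalIntegrable _ _)]
  have := hp 0
  rw [zero_add] at this
  rw [this, sub_self]

/-- In the mode `l = 0` the `τ`-derivative disappears, so `w - s u` has derivative zero. -/
theorem IsSolution.firstIntegral_const {ω s : ℝ} {n : ℕ∞} {u v θ w : ℝ → ℝ → ℝ}
    (h : IsSolution ω s n u v θ w) (ξ x : ℝ) :
    firstIntegral s u w ξ = firstIntegral s u w x := by
  have m := h.modeODE 0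
  have hd : ∀ x, HasDerivAt (fun x => fourierCoef (w x) 0 - s * fourierCoef (u x) 0) 0 x :=
    fun x => ((m.hw x).sub ((m.hu x).const_mul _)).congr_deriv (by simp)
  have hc := is_const_of_deriv_eq_zero (fun x => (hd x).differentiableAt)
    (fun x => (hd x).deriv) ξ x
  have e : ∀ x, ((firstIntegral s u w x : ℝ) : ℂ) =
      fourierCoef (w x) 0 - s * fourierCoef (u x) 0 := by
    intro x
    rw [← fourierCoef_const_mul, ← fourierCoef_sub
      (continuous_uncurry_left h.contDiff_w.continuous x)
      ((continuous_uncurry_left h.contDiff_u.continuous x).const_mul s)]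
    have h2 : (2 * Real.pi : ℂ) ≠ 0 := by exact_mod_cast Real.two_pi_pos.ne'
    have := integral_eq_fourierCoef_zero fun τ => w x τ - s * u x τ
    unfold firstIntegral
    rw [Complex.ofReal_mul, this]
    push_cast
    rw [inv_mul_cancel_left₀ h2]
  simp only [← e] at hc
  exact_mod_cast hc

theorem RapidDecay.bddCont₂ {ι : Type*} {f : ι → ℝ → ℝ → ℝ} (h : RapidDecay f) (i : ι) :
    BddCont₂ (f i) := by
  obtain ⟨B, hB⟩ := h.bounded
  exact ⟨(h.1 i).1, B, hB i⟩

/-- The regularity theory is used qualitatively here: it justifies differentiations and integrations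
by parts, while `SmoothSol` records no bound that depends on `M`. -/
theorem IsSolution.exists_smoothSol {ω s I : ℝ} {n : ℕ∞} {u v θ w : ℝ → ℝ → ℝ}
    (h : IsSolution ω s n u v θ w) (hω : ω ≠ 0) {M : ℝ} (hM : ∀ ξ τ, |u ξ τ| ≤ M) {ξ₀ : ℝ}
    (hI : firstIntegral s u w ξ₀ = I) :
    ∃ g uτ vτ gξ, SmoothSol ω s I u v θ w g uτ vτ gξ := by
  have h0 : 0 < |ω| := abs_pos.2 hω
  have h0' : 0 < |ω|⁻¹ := inv_pos.2 h0
  have h1 := abs_nonneg s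
  set R : ℝ := 1 + |ω| + |ω|⁻¹ + |s| with hR
  have F : SolFamily R M (fun _ : Unit => ω) (fun _ => s) (fun _ => n) (fun _ => u) (fun _ => v)
      (fun _ => θ) (fun _ => w) :=
    { hR := by linarith
      le_ω := fun _ => inv_le_of_inv_le₀ h0 (by linarith)
      ω_le := fun _ => by linarith
      s_le := fun _ => by linarith
      sol := fun _ => h
      bdd := fun _ => hM }
  have ru := F.regular_u
  have rv := F.regular_v
  have rg := F.regular_galerkin
  have hdξ : (dξ fun _ : Unit => u) = fun _ => v := UnifReg.dξ_eq F.hasDerivAt_u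
  -- The modes above `n` of `u`, hence those of `v` and `u_τ`, vanish. In integrals against these
  -- functions `P_n G'(u)` may therefore be replaced by `G'(u)`.
  have zu : ∀ l : ℤ, ¬ (l.natAbs : ℕ∞) ≤ n → ∀ ξ, fourierCoef (u ξ) l = 0 :=
    fun l hl ξ => h.fourierCoef_eq_zero hω hM hl ξ
  have zv : ∀ l : ℤ, ¬ (l.natAbs : ℕ∞) ≤ n → ∀ ξ, fourierCoef (v ξ) l = 0 := by
    intro l hl ξ
    have e := (h.modeODE l).hu ξ
    have : (fun ξ => fourierCoef (u ξ) l) = fun _ => 0 := funext fun x => zu l hl x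
    rw [this] at e
    exact e.unique (hasDerivAt_const ξ 0)
  have cdG := fun ξ => continuous_uncurry_left h.continuous_dG_comp ξ
  have cu := fun ξ => ru.rapidDecay.1.cont () ξ
  have cuτ := fun ξ => ru.dτ.rapidDecay.1.cont () ξ
  have cv := fun ξ => rv.rapidDecay.1.cont () ξ
  have su : ∀ ξ, Summable fun l => ‖fourierCoef (u ξ) l‖ :=
    fun ξ => (ru.rapidDecay.2 2).summable one_lt_two () ξ
  have hdGξ : ∀ ξ τ, HasDerivAt (fun x => dG (u x τ)) ((-1 + 3 * u ξ τ ^ 2) * v ξ τ) ξ :=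
    fun ξ τ => HasDerivAt.comp (h₂ := dG) (h := fun x => u x τ) ξ (hasDerivAt_dG (u ξ τ))
      (F.hasDerivAt_u () ξ τ)
  have cdGξ : Continuous (Function.uncurry fun ξ τ => (-1 + 3 * u ξ τ ^ 2) * v ξ τ) := by
    have a := h.contDiff_u.continuous
    have b := h.contDiff_v.continuous
    simp only [Function.uncurry_def] at a b ⊢
    fun_prop
  have hgξ := UnifReg.hasDerivAt_galerkin n cdG cdGξ hdGξ
  have hdξg : (dξ fun (_ : Unit) ξ τ => galerkin n (fun σ => dG (u ξ σ)) τ) =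
      fun _ ξ τ => galerkin n (fun τ => (-1 + 3 * u ξ τ ^ 2) * v ξ τ) τ :=
    UnifReg.dξ_eq fun _ => hgξ
  refine ⟨fun ξ τ => galerkin n (fun σ => dG (u ξ σ)) τ, dτ (fun _ : Unit => u) (),
    dτ (fun _ : Unit => v) (), fun ξ τ => galerkin n (fun τ => (-1 + 3 * u ξ τ ^ 2) * v ξ τ) τ, ?_⟩
  exact {
    bc_u := ru.rapidDecay.bddCont₂ ()
    bc_v := rv.rapidDecay.bddCont₂ ()
    bc_θ := F.regular_θ.rapidDecay.bddCont₂ ()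
    bc_w := F.regular_w.rapidDecay.bddCont₂ ()
    bc_g := rg.rapidDecay.bddCont₂ ()
    bc_uτ := ru.dτ.rapidDecay.bddCont₂ ()
    bc_vτ := rv.dτ.rapidDecay.bddCont₂ ()
    bc_gξ := by
      have := rg.dξ.rapidDecay.bddCont₂ ()
      rwa [hdξg] at this
    per_u := h.periodic_u
    per_v := h.periodic_v
    per_w := h.periodic_w
    u_ξ := F.hasDerivAt_u ()
    v_ξ := F.hasDerivAt_v ()
    θ_ξ := F.hasDerivAt_θ ()
    w_ξ := fun ξ τ => (F.hasDerivAt_w () ξ τ).congr_deriv (by ring)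
    g_ξ := hgξ
    uτ_ξ := UnifReg.hasDerivAt_dτ ru.rapidDecay rv.rapidDecay F.hasDerivAt_u ()
    u_τ := ru.hasDerivAt_snd ()
    v_τ := rv.hasDerivAt_snd ()
    integral_u_g := fun x ξ =>
      integral_mul_galerkin n (cu x) (h.periodic_u x) (su x) (cdG ξ) fun l hl => zu l hl x
    integral_v_g := fun ξ => integral_mul_galerkin n (cv ξ) (h.periodic_v ξ)
      ((rv.rapidDecay.2 2).summable one_lt_two () ξ) (cdG ξ) fun l hl => zv l hl ξ
    integral_uτ_g := fun ξ => by
      rw [integral_mul_galerkin n (cuτ ξ) ((ru.dτ.rapidDecay.1 ()).2 ξ)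
        ((ru.dτ.rapidDecay.2 2).summable one_lt_two () ξ) (cdG ξ) fun l hl => by
          rw [fourierCoef_of_hasDerivAt (ru.hasDerivAt_snd () ξ) (cuτ ξ) (h.periodic_u ξ),
            zu l hl ξ, mul_zero]]
      -- After removal of the projection the integrand is the `τ`-derivative of the periodic
      -- function `potential (u ξ τ)`.
      refine integral_deriv_periodic (F := fun τ => potential (u ξ τ))
        (fun τ => ((hasDerivAt_potential (u ξ τ)).comp τ (ru.hasDerivAt_snd () ξ τ)).congr_deriv
          (mul_comm _ _)) ((cuτ ξ).mul (cdG ξ)) fun τ => by simp only [h.periodic_u ξ τ]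
    integral_g_sq := fun ξ => integral_galerkin_sq_le n (cdG ξ)
    integral_gξ_sq := fun ξ => integral_galerkin_sq_le n (continuous_uncurry_left cdGξ ξ)
    mean := fun ξ => by
      rw [← hI, h.firstIntegral_const ξ₀ ξ]
      unfold firstIntegral
      rw [mul_inv_cancel_left₀ Real.two_pi_pos.ne'] }

/-! ### Weighted integrals over lines and over the strip. -/

namespace BddCont₂

variable {f g : ℝ → ℝ → ℝ}

theorem exists_pos (hf : BddCont₂ f) : ∃ B : ℝ, 0 ≤ B ∧ ∀ ξ τ, |f ξ τ| ≤ B := by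
  obtain ⟨B, hB⟩ := hf.2
  exact ⟨B, (abs_nonneg _).trans (hB 0 0), hB⟩

theorem const (c : ℝ) : BddCont₂ fun _ _ => c := ⟨continuous_const, |c|, fun _ _ => le_rfl⟩

theorem add (hf : BddCont₂ f) (hg : BddCont₂ g) : BddCont₂ fun ξ τ => f ξ τ + g ξ τ := by
  obtain ⟨A, hA⟩ := hf.2
  obtain ⟨B, hB⟩ := hg.2
  exact ⟨hf.1.add hg.1, A + B, fun ξ τ =>
    (abs_add_le _ _).trans (add_le_add (hA ξ τ) (hB ξ τ))⟩

theorem mul (hf : BddCont₂ f) (hg : BddCont₂ g) : BddCont₂ fun ξ τ => f ξ τ * g ξ τ := by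
  obtain ⟨A, hA0, hA⟩ := hf.exists_pos
  obtain ⟨B, hB⟩ := hg.2
  exact ⟨hf.1.mul hg.1, A * B, fun ξ τ => by
    rw [abs_mul]; exact mul_le_mul (hA ξ τ) (hB ξ τ) (abs_nonneg _) hA0⟩

theorem neg (hf : BddCont₂ f) : BddCont₂ fun ξ τ => -f ξ τ := by
  obtain ⟨A, hA⟩ := hf.2
  exact ⟨hf.1.neg, A, fun ξ τ => by rw [abs_neg]; exact hA ξ τ⟩

theorem sub (hf : BddCont₂ f) (hg : BddCont₂ g) : BddCont₂ fun ξ τ => f ξ τ - g ξ τ := by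
  simpa only [sub_eq_add_neg] using hf.add hg.neg

theorem pow (hf : BddCont₂ f) (n : ℕ) : BddCont₂ fun ξ τ => f ξ τ ^ n := by
  obtain ⟨A, hA⟩ := hf.2
  exact ⟨hf.1.pow n, A ^ n, fun ξ τ => by
    rw [abs_pow]; exact pow_le_pow_left₀ (abs_nonneg _) (hA ξ τ) n⟩

theorem const_mul (hf : BddCont₂ f) (c : ℝ) : BddCont₂ fun ξ τ => c * f ξ τ :=
  (const c).mul hf

theorem dG (hf : BddCont₂ f) : BddCont₂ fun ξ τ => dG (f ξ τ) := hf.neg.add (hf.pow 3)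

theorem slice (hf : BddCont₂ f) (x : ℝ) : BddCont₂ fun _ τ => f x τ := by
  obtain ⟨A, hA⟩ := hf.2
  exact ⟨hf.1.comp (f := fun p : ℝ × ℝ => (x, p.2)) (by fun_prop), A, fun _ τ => hA x τ⟩

end BddCont₂

/-- Continuous functions of `(ξ, τ)` with quadratic decay in `ξ`. -/
def Decays (F : ℝ → ℝ → ℝ) : Prop :=
  Continuous (Function.uncurry F) ∧ ∃ B : ℝ, ∀ ξ τ, |F ξ τ| ≤ B * (1 + ξ ^ 2)⁻¹

/-- Continuous weights with quadratic decay. -/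
def IsWeight (φ : ℝ → ℝ) : Prop := Continuous φ ∧ ∃ B : ℝ, ∀ x, |φ x| ≤ B * (1 + x ^ 2)⁻¹

theorem IsWeight.mul {φ : ℝ → ℝ} (hφ : IsWeight φ) {f : ℝ → ℝ → ℝ} (hf : BddCont₂ f) :
    Decays fun ξ τ => φ ξ * f ξ τ := by
  obtain ⟨A, hA⟩ := hφ.2
  obtain ⟨B, hB0, hB⟩ := hf.exists_pos
  refine ⟨(hφ.1.comp continuous_fst).mul hf.1, A * B, fun ξ τ => ?_⟩
  rw [abs_mul]
  calc _ ≤ (A * (1 + ξ ^ 2)⁻¹) * B :=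
        mul_le_mul (hA ξ) (hB ξ τ) (abs_nonneg _) ((abs_nonneg _).trans (hA ξ))
    _ = _ := by ring

namespace Decays

variable {F G : ℝ → ℝ → ℝ}

theorem add (hF : Decays F) (hG : Decays G) : Decays fun ξ τ => F ξ τ + G ξ τ := by
  obtain ⟨A, hA⟩ := hF.2
  obtain ⟨B, hB⟩ := hG.2
  exact ⟨hF.1.add hG.1, A + B, fun ξ τ => by
    rw [add_mul]; exact (abs_add_le _ _).trans (add_le_add (hA ξ τ) (hB ξ τ))⟩

theorem const_mul (hF : Decays F) (c : ℝ) : Decays fun ξ τ => c * F ξ τ := by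
  obtain ⟨A, hA⟩ := hF.2
  exact ⟨hF.1.const_mul c, |c| * A, fun ξ τ => by
    rw [abs_mul, mul_assoc]; exact mul_le_mul_of_nonneg_left (hA ξ τ) (abs_nonneg _)⟩

theorem neg (hF : Decays F) : Decays fun ξ τ => -F ξ τ := by
  simpa using hF.const_mul (-1)

theorem sub (hF : Decays F) (hG : Decays G) : Decays fun ξ τ => F ξ τ - G ξ τ := by
  simpa only [sub_eq_add_neg] using hF.add hG.neg

theorem mul_bdd (hF : Decays F) (hG : BddCont₂ G) : Decays fun ξ τ => F ξ τ * G ξ τ := by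
  obtain ⟨A, hA⟩ := hF.2
  obtain ⟨B, hB0, hB⟩ := hG.exists_pos
  refine ⟨hF.1.mul hG.1, A * B, fun ξ τ => ?_⟩
  rw [abs_mul]
  calc _ ≤ (A * (1 + ξ ^ 2)⁻¹) * B :=
        mul_le_mul (hA ξ τ) (hB ξ τ) (abs_nonneg _) ((abs_nonneg _).trans (hA ξ τ))
    _ = _ := by ring

theorem integrable (hF : Decays F) (τ : ℝ) : Integrable fun ξ => F ξ τ := by
  obtain ⟨B, hB⟩ := hF.2
  have hc : Continuous fun ξ => F ξ τ := hF.1.comp (Continuous.prodMk_left τ)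
  exact (integrable_inv_one_add_sq.const_mul B).mono' hc.aestronglyMeasurable
    (Eventually.of_forall fun ξ => hB ξ τ)

theorem tendsto_atBot (hF : Decays F) (τ : ℝ) : Tendsto (fun ξ => F ξ τ) atBot (𝓝 0) := by
  obtain ⟨B, hB⟩ := hF.2
  refine squeeze_zero_norm (fun ξ => hB ξ τ) ?_
  have h : Tendsto (fun x : ℝ => 1 + x ^ 2) atBot atTop :=
    tendsto_atTop_add_const_left _ _ tendsto_sq_atBot
  simpa using (tendsto_inv_atTop_zero.comp h).const_mul B

end Decays

/-- The integral over `ξ`. -/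
def lineInt (F : ℝ → ℝ → ℝ) (τ : ℝ) : ℝ := ∫ ξ, F ξ τ

/-- The integral over `ξ` and one period in `τ`. -/
def stripInt (F : ℝ → ℝ → ℝ) : ℝ := ∫ τ in (0 : ℝ)..(2 * Real.pi), lineInt F τ

theorem Decays.bddCont₂_lineInt {F : ℝ → ℝ → ℝ} (hF : Decays F) :
    BddCont₂ fun _ τ => lineInt F τ := by
  obtain ⟨B, hB⟩ := hF.2
  have hc : Continuous (lineInt F) :=
    continuous_of_dominated (F := fun τ ξ => F ξ τ) (bound := fun ξ => B * (1 + ξ ^ 2)⁻¹)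
      (fun τ => (hF.integrable τ).aestronglyMeasurable)
      (fun τ => Eventually.of_forall fun ξ => hB ξ τ)
      (integrable_inv_one_add_sq.const_mul B)
      (Eventually.of_forall fun ξ => continuous_uncurry_left hF.1 ξ)
  exact ⟨hc.comp continuous_snd, ∫ ξ : ℝ, B * (1 + ξ ^ 2)⁻¹, fun _ τ =>
    norm_integral_le_of_norm_le (f := fun ξ => F ξ τ) (integrable_inv_one_add_sq.const_mul B)
      (Eventually.of_forall fun ξ => hB ξ τ)⟩

theorem Decays.continuous_lineInt {F : ℝ → ℝ → ℝ} (hF : Decays F) : Continuous (lineInt F) :=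
  continuous_uncurry_left hF.bddCont₂_lineInt.1 0

/-- Positive linear functionals on functions with quadratic decay. -/
structure PosLinear (L : (ℝ → ℝ → ℝ) → ℝ) : Prop where
  add {F G} : Decays F → Decays G → L (fun ξ τ => F ξ τ + G ξ τ) = L F + L G
  const_mul (c : ℝ) (F : ℝ → ℝ → ℝ) : L (fun ξ τ => c * F ξ τ) = c * L F
  mono {F G} : Decays F → Decays G → (∀ ξ τ, F ξ τ ≤ G ξ τ) → L F ≤ L G

theorem posLinear_lineInt (τ : ℝ) : PosLinear fun F => lineInt F τ where
  add hF hG := integral_add (hF.integrable τ) (hG.integrable τ)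
  const_mul c _ := integral_const_mul c _
  mono hF hG h := integral_mono (hF.integrable τ) (hG.integrable τ) fun ξ => h ξ τ

theorem posLinear_stripInt : PosLinear stripInt where
  add {F G} hF hG := by
    unfold stripInt
    rw [← intervalIntegral.integral_add (hF.continuous_lineInt.intervalIntegrable _ _)
      (hG.continuous_lineInt.intervalIntegrable _ _)]
    exact intervalIntegral.integral_congr fun τ _ => (posLinear_lineInt τ).add hF hG
  const_mul c _ := by
    unfold stripInt
    rw [← intervalIntegral.integral_const_mul]
    exact intervalIntegral.integral_congr fun τ _ => (posLinear_lineInt τ).const_mul c _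
  mono hF hG h := intervalIntegral.integral_mono_on Real.two_pi_pos.le
    (hF.continuous_lineInt.intervalIntegrable _ _) (hG.continuous_lineInt.intervalIntegrable _ _)
    fun τ _ => (posLinear_lineInt τ).mono hF hG h

namespace PosLinear

variable {L : (ℝ → ℝ → ℝ) → ℝ} {F G F₁ F₂ F₃ F₄ F₅ : ℝ → ℝ → ℝ}

theorem congr {F G : ℝ → ℝ → ℝ} (h : ∀ ξ τ, F ξ τ = G ξ τ) : L F = L G := by
  rw [show F = G from funext fun ξ => funext fun τ => h ξ τ]

theorem neg (hL : PosLinear L) (F) : L (fun ξ τ => -F ξ τ) = -L F := by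
  simpa using hL.const_mul (-1) F

theorem nonneg (hL : PosLinear L) (hF : Decays F) (h : ∀ ξ τ, 0 ≤ F ξ τ) : 0 ≤ L F := by
  have h1 := hL.const_mul 0 F
  have h2 := hL.mono (hF.const_mul 0) hF (fun ξ τ => by simpa using h ξ τ)
  rwa [h1, zero_mul] at h2

theorem le₁ (hL : PosLinear L) (a : ℝ) (hF : Decays F) (h₁ : Decays F₁)
    (h : ∀ ξ τ, F ξ τ ≤ a * F₁ ξ τ) : L F ≤ a * L F₁ := by
  rw [← hL.const_mul]
  exact hL.mono hF (h₁.const_mul a) h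

theorem le₂ (hL : PosLinear L) (a b : ℝ) (hF : Decays F) (h₁ : Decays F₁) (h₂ : Decays F₂)
    (h : ∀ ξ τ, F ξ τ ≤ a * F₁ ξ τ + b * F₂ ξ τ) : L F ≤ a * L F₁ + b * L F₂ := by
  rw [← hL.const_mul, ← hL.const_mul, ← hL.add (h₁.const_mul a) (h₂.const_mul b)]
  exact hL.mono hF ((h₁.const_mul a).add (h₂.const_mul b)) h

theorem le₃ (hL : PosLinear L) (a b c : ℝ) (hF : Decays F) (h₁ : Decays F₁) (h₂ : Decays F₂)
    (h₃ : Decays F₃) (h : ∀ ξ τ, F ξ τ ≤ a * F₁ ξ τ + b * F₂ ξ τ + c * F₃ ξ τ) :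
    L F ≤ a * L F₁ + b * L F₂ + c * L F₃ := by
  rw [← hL.const_mul, ← hL.const_mul, ← hL.const_mul, ← hL.add (h₁.const_mul a) (h₂.const_mul b),
    ← hL.add ((h₁.const_mul a).add (h₂.const_mul b)) (h₃.const_mul c)]
  exact hL.mono hF (((h₁.const_mul a).add (h₂.const_mul b)).add (h₃.const_mul c)) h

end PosLinear

theorem Decays.integrable_prod {F : ℝ → ℝ → ℝ} (hF : Decays F) (a b : ℝ) :
    Integrable (Function.uncurry F) (volume.prod (volume.restrict (Ioc a b))) := by
  obtain ⟨B, hB⟩ := hF.2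
  have h1 : Integrable (fun p : ℝ × ℝ => (B * (1 + p.1 ^ 2)⁻¹) * (1 : ℝ))
      (volume.prod (volume.restrict (Ioc a b))) :=
    (integrable_inv_one_add_sq.const_mul B).mul_prod (integrable_const (1 : ℝ))
  refine h1.mono' hF.1.aestronglyMeasurable (Eventually.of_forall fun p => ?_)
  rw [mul_one]
  exact hB p.1 p.2

/-- Fubini's theorem on the strip. -/
theorem stripInt_eq {F : ℝ → ℝ → ℝ} (hF : Decays F) :
    stripInt F = ∫ ξ, ∫ τ in (0 : ℝ)..(2 * Real.pi), F ξ τ := by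
  unfold stripInt lineInt
  simp only [intervalIntegral.integral_of_le Real.two_pi_pos.le]
  exact (integral_integral_swap (hF.integrable_prod _ _)).symm

theorem Decays.integrable_periodInt {F : ℝ → ℝ → ℝ} (hF : Decays F) :
    Integrable fun ξ => ∫ τ in (0 : ℝ)..(2 * Real.pi), F ξ τ := by
  simp only [intervalIntegral.integral_of_le Real.two_pi_pos.le]
  exact (hF.integrable_prod _ _).integral_prod_left

/-- Weighted comparison of integrals over a period. -/
theorem stripInt_weight_le {φ : ℝ → ℝ} (hφ : IsWeight φ) (h0 : ∀ x, 0 ≤ φ x) {f g : ℝ → ℝ → ℝ}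
    (hf : BddCont₂ f) (hg : BddCont₂ g)
    (h : ∀ ξ, ∫ τ in (0 : ℝ)..(2 * Real.pi), f ξ τ ≤ ∫ τ in (0 : ℝ)..(2 * Real.pi), g ξ τ) :
    stripInt (fun ξ τ => φ ξ * f ξ τ) ≤ stripInt fun ξ τ => φ ξ * g ξ τ := by
  rw [stripInt_eq (hφ.mul hf), stripInt_eq (hφ.mul hg)]
  refine integral_mono (hφ.mul hf).integrable_periodInt (hφ.mul hg).integrable_periodInt
    fun ξ => ?_
  simp only [intervalIntegral.integral_const_mul]
  exact mul_le_mul_of_nonneg_left (h ξ) (h0 ξ)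

theorem stripInt_weight_congr {φ : ℝ → ℝ} (hφ : IsWeight φ) {f g : ℝ → ℝ → ℝ}
    (hf : BddCont₂ f) (hg : BddCont₂ g)
    (h : ∀ ξ, ∫ τ in (0 : ℝ)..(2 * Real.pi), f ξ τ = ∫ τ in (0 : ℝ)..(2 * Real.pi), g ξ τ) :
    stripInt (fun ξ τ => φ ξ * f ξ τ) = stripInt fun ξ τ => φ ξ * g ξ τ := by
  rw [stripInt_eq (hφ.mul hf), stripInt_eq (hφ.mul hg)]
  simp only [intervalIntegral.integral_const_mul, h]

theorem lineInt_deriv {F F' : ℝ → ℝ → ℝ} (hF : Decays F) (hF' : Decays F')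
    (h : ∀ ξ τ, HasDerivAt (fun x => F x τ) (F' ξ τ) ξ) (τ : ℝ) : lineInt F' τ = 0 :=
  integral_eq_zero_of_hasDerivAt_of_integrable (fun ξ => h ξ τ) (hF'.integrable τ)
    (hF.integrable τ)

theorem stripInt_deriv {F F' : ℝ → ℝ → ℝ} (hF : Decays F) (hF' : Decays F')
    (h : ∀ ξ τ, HasDerivAt (fun x => F x τ) (F' ξ τ) ξ) : stripInt F' = 0 := by
  unfold stripInt
  simp only [lineInt_deriv hF hF' h]
  simp

/-- A pointwise bound by an integral of a bound of the derivative. -/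
theorem le_lineInt_of_deriv_le {F F' H : ℝ → ℝ → ℝ} (hF : Decays F) (hF' : Decays F')
    (h : ∀ ξ τ, HasDerivAt (fun x => F x τ) (F' ξ τ) ξ) (hH : Decays H)
    (h0 : ∀ ξ τ, 0 ≤ H ξ τ) (hle : ∀ ξ τ, F' ξ τ ≤ H ξ τ) (ξ τ : ℝ) :
    F ξ τ ≤ lineInt H τ := by
  have h1 := integral_Iic_of_hasDerivAt_of_tendsto' (a := ξ) (fun x _ => h x τ)
    (hF'.integrable τ).integrableOn (hF.tendsto_atBot τ)
  rw [sub_zero] at h1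
  rw [← h1]
  calc _ ≤ ∫ x in Iic ξ, H x τ :=
        integral_mono (hF'.integrable τ).integrableOn (hH.integrable τ).integrableOn
          fun x => hle x τ
    _ ≤ _ := setIntegral_le_integral (hH.integrable τ) (Eventually.of_forall fun x => h0 x τ)

theorem hasDerivAt_lineInt {F F' : ℝ → ℝ → ℝ} (hF : Decays F) (hF' : Decays F')
    (h : ∀ ξ τ, HasDerivAt (F ξ) (F' ξ τ) τ) (τ : ℝ) :
    HasDerivAt (lineInt F) (lineInt F' τ) τ := by
  obtain ⟨B, hB⟩ := hF'.2
  exact (hasDerivAt_integral_of_dominated_loc_of_deriv_le (F := fun τ ξ => F ξ τ)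
    (F' := fun τ ξ => F' ξ τ) (bound := fun ξ => B * (1 + ξ ^ 2)⁻¹) (s := univ) univ_mem
    (Eventually.of_forall fun τ => (hF.integrable τ).aestronglyMeasurable)
    (hF.integrable τ) (hF'.integrable τ).aestronglyMeasurable
    (Eventually.of_forall fun ξ τ _ => hB ξ τ)
    (integrable_inv_one_add_sq.const_mul B)
    (Eventually.of_forall fun ξ τ _ => h ξ τ)).2

/-- A periodic function is bounded by its mean and the integral of a bound of its derivative. -/
theorem le_mean_add_integral {N N' H : ℝ → ℝ} (hN : ∀ τ, HasDerivAt N (N' τ) τ)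
    (hp : Function.Periodic N (2 * Real.pi)) (hN' : Continuous N') (hH : Continuous H)
    (h : ∀ τ, |N' τ| ≤ H τ) (τ : ℝ) :
    N τ ≤ (2 * Real.pi)⁻¹ * (∫ t in (0 : ℝ)..(2 * Real.pi), N t) +
      ∫ t in (0 : ℝ)..(2 * Real.pi), H t := by
  have hpi := Real.two_pi_pos
  obtain ⟨x, hx, hxτ⟩ := hp.exists_mem_Ico₀ hpi τ
  rw [hxτ]
  set J := ∫ t in (0 : ℝ)..(2 * Real.pi), H t with hJ
  -- Two values on one period differ by at most the integral of `H`. Averaging over `y` yields the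
  -- mean.
  have key : ∀ y ∈ Icc (0 : ℝ) (2 * Real.pi), N x - J ≤ N y := by
    intro y hy
    have h1 : ∫ t in y..x, N' t = N x - N y :=
      intervalIntegral.integral_eq_sub_of_hasDerivAt (fun t _ => hN t)
        (hN'.intervalIntegrable _ _)
    have h2 : |∫ t in y..x, N' t| ≤ |∫ t in y..x, H t| :=
      intervalIntegral.norm_integral_le_abs_of_norm_le (f := N') (g := H)
        (Eventually.of_forall fun t => h t) (hH.intervalIntegrable _ _)
    have h3 : |∫ t in y..x, H t| ≤ J := by
      have hH0 : ∀ t, 0 ≤ H t := fun t => (abs_nonneg _).trans (h t)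
      rw [hJ]
      have hsub : ∀ a b, 0 ≤ a → a ≤ b → b ≤ 2 * Real.pi → |∫ t in a..b, H t| ≤
          ∫ t in (0 : ℝ)..(2 * Real.pi), H t := by
        intro a b ha hab hb
        rw [abs_of_nonneg (intervalIntegral.integral_nonneg hab fun t _ => hH0 t)]
        exact intervalIntegral.integral_mono_interval ha hab hb
          (Eventually.of_forall hH0) (hH.intervalIntegrable _ _)
      rcases le_total y x with hyx | hyx
      · exact hsub y x hy.1 hyx hx.2.le
      · rw [intervalIntegral.integral_symm, abs_neg]
        exact hsub x y hx.1 hyx hy.2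
    have := (le_abs_self _).trans (h2.trans h3)
    linarith
  have cN : Continuous N := continuous_iff_continuousAt.2 fun τ => (hN τ).continuousAt
  have h4 : ∫ t in (0 : ℝ)..(2 * Real.pi), (N x - J) ≤ ∫ t in (0 : ℝ)..(2 * Real.pi), N t :=
    intervalIntegral.integral_mono_on hpi.le (continuous_const.intervalIntegrable _ _)
      (cN.intervalIntegrable _ _) key
  rw [intervalIntegral.integral_const, smul_eq_mul, sub_zero] at h4
  have h5 := mul_le_mul_of_nonneg_left h4 (inv_pos.2 hpi).le
  rw [inv_mul_cancel_left₀ hpi.ne'] at h5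
  linarith

/-! ### Polynomial weights and their averages along characteristics. -/

/-- The weight `(1 + x²)^(-j)`. -/
def wt (j : ℕ) (x : ℝ) : ℝ := ((1 + x ^ 2)⁻¹) ^ j

/-- The derivative of `wt j`. -/
def wt' (j : ℕ) (x : ℝ) : ℝ := -(2 * j * x) * wt (j + 1) x

/-- The second derivative of `wt j`. -/
def wt'' (j : ℕ) (x : ℝ) : ℝ := -(2 * j) * wt (j + 1) x + -(2 * j * x) * wt' (j + 1) x

section wt

variable (j : ℕ) (x : ℝ)

theorem wt_pos : 0 < wt j x := by unfold wt; positivity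

theorem wt_zero : wt 0 x = 1 := by simp [wt]

theorem wt_add (i j : ℕ) (x : ℝ) : wt (i + j) x = wt i x * wt j x := pow_add _ _ _

theorem wt_anti {i j : ℕ} (h : i ≤ j) (x : ℝ) : wt j x ≤ wt i x :=
  pow_le_pow_of_le_one (by positivity)
    (inv_le_one_of_one_le₀ (by linarith [sq_nonneg x])) h

theorem wt_le_one : wt j x ≤ 1 := (wt_anti (Nat.zero_le j) x).trans_eq (wt_zero x)

theorem wt_apply_zero : wt j 0 = 1 := by simp [wt]

theorem one_add_sq_mul_wt : (1 + x ^ 2) * wt (j + 1) x = wt j x := by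
  have : 1 + x ^ 2 ≠ 0 := by positivity
  unfold wt
  rw [pow_succ (1 + x ^ 2)⁻¹ j, mul_comm, mul_assoc, inv_mul_cancel₀ this, mul_one]

theorem continuous_wt : Continuous (wt j) := by
  unfold wt
  exact (Continuous.inv₀ (by fun_prop) fun x => by positivity).pow j

theorem continuous_wt' : Continuous (wt' j) := by
  have := continuous_wt (j + 1)
  unfold wt'; fun_prop

theorem hasDerivAt_wt : HasDerivAt (wt j) (wt' j x) x := by
  have h0 : 1 + x ^ 2 ≠ 0 := by positivity
  have h1 : HasDerivAt (fun x : ℝ => 1 + x ^ 2) (2 * x) x :=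
    (((hasDerivAt_id x).fun_pow 2).const_add 1).congr_deriv (by simp)
  have h2 := (h1.fun_inv h0).fun_pow j
  refine h2.congr_deriv ?_
  unfold wt' wt
  rcases j with _ | j
  · simp
  · have : (1 + x ^ 2)⁻¹ ^ (j + 1 + 1) = (1 + x ^ 2)⁻¹ ^ j * ((1 + x ^ 2)⁻¹ * (1 + x ^ 2)⁻¹) := by
      ring
    rw [this]
    simp only [Nat.add_sub_cancel]
    push_cast
    field_simp

theorem hasDerivAt_wt' : HasDerivAt (wt' j) (wt'' j x) x := by
  have h1 : HasDerivAt (fun x : ℝ => -(2 * j * x)) (-(2 * j)) x := by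
    exact ((hasDerivAt_id x).const_mul (2 * (j : ℝ))).neg.congr_deriv (by simp)
  exact h1.mul (hasDerivAt_wt (j + 1) x)

theorem abs_wt'_le : |wt' j x| ≤ j * wt j x := by
  have h := wt_pos (j + 1) x
  have h2 : 2 * |x| ≤ 1 + x ^ 2 := by nlinarith [sq_nonneg (|x| - 1), sq_abs x]
  rw [wt', abs_mul, abs_neg, abs_mul, abs_mul, abs_of_pos h, Nat.abs_cast, abs_two,
    ← one_add_sq_mul_wt j x]
  calc _ = j * ((2 * |x|) * wt (j + 1) x) := by ring
    _ ≤ _ := by gcongr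

theorem abs_wt''_le : |wt'' j x| ≤ (2 * j + 4 * j * (j + 1)) * wt (j + 1) x := by
  have h := wt_pos (j + 1) x
  have h' := wt_pos (j + 2) x
  have h3 : |-(2 * j * x) * wt' (j + 1) x| ≤ 4 * j * (j + 1) * wt (j + 1) x := by
    have e : -(2 * j * x) * wt' (j + 1) x = 4 * j * (j + 1) * (x ^ 2 * wt (j + 2) x) := by
      unfold wt'; push_cast; ring
    have h4 := one_add_sq_mul_wt (j + 1) x
    rw [e, abs_of_nonneg (by positivity)]
    gcongr
    nlinarith
  have h5 : |-(2 * (j : ℝ)) * wt (j + 1) x| = 2 * j * wt (j + 1) x := by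
    rw [abs_mul, abs_neg, abs_of_pos h, abs_of_nonneg (by positivity)]
  refine (abs_add_le _ _).trans ?_
  rw [h5, add_mul]; linarith

theorem isWeight_wt {j : ℕ} (hj : 1 ≤ j) : IsWeight (wt j) :=
  ⟨continuous_wt j, 1, fun x => by
    rw [abs_of_pos (wt_pos j x), one_mul]
    simpa [wt] using wt_anti hj x⟩

theorem isWeight_wt' {j : ℕ} (hj : 1 ≤ j) : IsWeight (wt' j) :=
  ⟨continuous_wt' j, j, fun x => (abs_wt'_le j x).trans (by
    have := wt_anti hj x
    gcongr
    simpa [wt] using this)⟩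

theorem isWeight_wt'' : IsWeight (wt'' j) :=
  ⟨by
    have h1 := continuous_wt (j + 1)
    have h2 := continuous_wt' (j + 1)
    unfold wt''; fun_prop, _, fun x => (abs_wt''_le j x).trans (by
    have := wt_anti (Nat.le_add_left 1 j) x
    gcongr
    simpa [wt] using this)⟩

/-- Peetre's inequality `1 + x² ≤ 2 (1 + y²) (1 + (x - y)²)`: translates of the weight are
comparable to it. -/
theorem wt_shift_le (j : ℕ) {y q : ℝ} (hq : 2 * (1 + y ^ 2) ≤ q) (x : ℝ) :
    wt j (x - y) ≤ q ^ j * wt j x := by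
  unfold wt
  rw [← mul_pow]
  refine pow_le_pow_left₀ (by positivity) ?_ j
  rw [← div_eq_mul_inv, inv_eq_one_div, div_le_div_iff₀ (by positivity) (by positivity), one_mul]
  have h1 : 1 + x ^ 2 ≤ 2 * (1 + y ^ 2) * (1 + (x - y) ^ 2) := by
    nlinarith [sq_nonneg (x - 2 * y), sq_nonneg (y * (x - y))]
  exact h1.trans (mul_le_mul_of_nonneg_right hq (by positivity))

theorem le_wt_shift (j : ℕ) {y q : ℝ} (hq : 2 * (1 + y ^ 2) ≤ q) (x : ℝ) :
    wt j x ≤ q ^ j * wt j (x - y) := by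
  have := wt_shift_le j (y := -y) (q := q) (by simpa using hq) (x - y)
  simpa using this

end wt

/-- A primitive of `wt 3`. -/
def wtPrim (x : ℝ) : ℝ := ∫ t in (0 : ℝ)..x, wt 3 t

theorem hasDerivAt_wtPrim (x : ℝ) : HasDerivAt wtPrim (wt 3 x) x :=
  (continuous_wt 3).integral_hasStrictDerivAt 0 x |>.hasDerivAt

/-- The average `∫₀ᵗ wt 3 (x - p r) dr` of translates of `wt 3`. -/
def avgWt (p t x : ℝ) : ℝ := (wtPrim x - wtPrim (x - p * t)) / p

section avgWt

variable {p : ℝ}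

theorem hasDerivAt_avgWt_left (hp : p ≠ 0) (t x : ℝ) :
    HasDerivAt (fun t => avgWt p t x) (wt 3 (x - p * t)) t := by
  have h1 : HasDerivAt (fun t => x - p * t) (-p) t :=
    (((hasDerivAt_id t).const_mul p).const_sub x).congr_deriv (by simp)
  have h2 := ((HasDerivAt.comp (h₂ := wtPrim) t (hasDerivAt_wtPrim _) h1).const_sub
    (wtPrim x)).div_const p
  refine h2.congr_deriv ?_
  field_simp

theorem hasDerivAt_avgWt (t x : ℝ) :
    HasDerivAt (avgWt p t) ((wt 3 x - wt 3 (x - p * t)) / p) x :=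
  ((hasDerivAt_wtPrim x).sub ((hasDerivAt_wtPrim (x - p * t)).comp_sub_const x (p * t))).div_const p

theorem continuous_avgWt (t : ℝ) : Continuous (avgWt p t) :=
  continuous_iff_continuousAt.2 fun x => (hasDerivAt_avgWt t x).continuousAt

theorem avgWt_zero (x : ℝ) : avgWt p 0 x = 0 := by simp [avgWt]

/-- The mean value theorem. -/
theorem exists_avgWt_eq (hp : p ≠ 0) (t x : ℝ) :
    ∃ r, |r| ≤ |t| ∧ avgWt p t x = t * wt 3 (x - p * r) := by
  have h := hasDerivAt_avgWt_left hp (x := x)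
  rcases lt_trichotomy t 0 with ht | rfl | ht
  · obtain ⟨r, hr, e⟩ := exists_hasDerivAt_eq_slope (fun t => avgWt p t x) _ ht
      (fun y _ => (h y).continuousAt.continuousWithinAt) fun y _ => h y
    refine ⟨r, by rw [abs_of_neg ht, abs_of_neg hr.2]; linarith [hr.1], ?_⟩
    rw [e, avgWt_zero]
    have := ht.ne
    field_simp
    ring
  · exact ⟨0, le_rfl, by simp [avgWt_zero]⟩
  · obtain ⟨r, hr, e⟩ := exists_hasDerivAt_eq_slope (fun t => avgWt p t x) _ ht
      (fun y _ => (h y).continuousAt.continuousWithinAt) fun y _ => h y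
    refine ⟨r, by rw [abs_of_pos ht, abs_of_pos hr.1]; exact hr.2.le, ?_⟩
    rw [e, avgWt_zero]
    have := ht.ne'
    field_simp
    ring

theorem abs_avgWt_le (hp : p ≠ 0) {t b : ℝ} (ht : |t| ≤ b) (x : ℝ) :
    |avgWt p t x| ≤ b * (2 * (1 + (p * b) ^ 2)) ^ 3 * wt 3 x := by
  obtain ⟨r, hr, e⟩ := exists_avgWt_eq hp t x
  have hb : 0 ≤ b := (abs_nonneg t).trans ht
  rw [e, abs_mul, abs_of_pos (wt_pos _ _), mul_assoc]
  have h2 : (p * r) ^ 2 ≤ (p * b) ^ 2 := by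
    rw [mul_pow, mul_pow]
    have : r ^ 2 ≤ b ^ 2 := sq_le_sq' (by linarith [abs_le.1 (hr.trans ht)])
      (abs_le.1 (hr.trans ht)).2
    gcongr
  exact mul_le_mul ht (wt_shift_le 3 (by linarith) x) (wt_pos _ _).le hb

/-- The average over `0 ≤ t ≤ 1` is the value at one translate by at most `|p|`, so it is comparable
to `wt 3` from both sides. -/
theorem le_avgWt_one (hp : p ≠ 0) (x : ℝ) : wt 3 x ≤ (2 * (1 + p ^ 2)) ^ 3 * avgWt p 1 x := by
  obtain ⟨r, hr, e⟩ := exists_avgWt_eq hp 1 x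
  rw [abs_one] at hr
  rw [e, one_mul]
  refine le_wt_shift 3 ?_ x
  have : r ^ 2 ≤ 1 := by rw [← sq_abs]; exact pow_le_one₀ (abs_nonneg r) hr
  rw [mul_pow]
  nlinarith [sq_nonneg p]

theorem avgWt_one_le (hp : p ≠ 0) (x : ℝ) : avgWt p 1 x ≤ (2 * (1 + p ^ 2)) ^ 3 * wt 3 x := by
  have := (le_abs_self _).trans (abs_avgWt_le hp (t := 1) (b := 1) (by simp) x)
  simpa using this

theorem avgWt_one_pos (hp : p ≠ 0) (x : ℝ) : 0 < avgWt p 1 x := by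
  obtain ⟨r, -, e⟩ := exists_avgWt_eq hp 1 x
  rw [e, one_mul]
  exact wt_pos _ _

theorem isWeight_avgWt (hp : p ≠ 0) (t : ℝ) : IsWeight (avgWt p t) :=
  ⟨continuous_avgWt t, _, fun x => (abs_avgWt_le hp le_rfl x).trans (by
    have := wt_anti (show 1 ≤ 3 by norm_num) x
    gcongr
    simpa [wt] using this)⟩

theorem IsWeight.shift {φ : ℝ → ℝ} (h : IsWeight φ) (y : ℝ) : IsWeight fun x => φ (x - y) := by
  obtain ⟨B, hB⟩ := h.2
  have hB0 : 0 ≤ B := by simpa using (abs_nonneg _).trans (hB 0)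
  refine ⟨h.1.comp (by fun_prop), B * (2 * (1 + y ^ 2)), fun x => (hB _).trans ?_⟩
  have := wt_shift_le 1 (y := y) le_rfl x
  simp only [wt, pow_one] at this
  rw [mul_assoc]
  gcongr

theorem IsWeight.const_mul {φ : ℝ → ℝ} (h : IsWeight φ) (c : ℝ) : IsWeight fun x => c * φ x := by
  obtain ⟨B, hB⟩ := h.2
  refine ⟨h.1.const_mul c, |c| * B, fun x => ?_⟩
  rw [abs_mul, mul_assoc]
  exact mul_le_mul_of_nonneg_left (hB x) (abs_nonneg c)

theorem IsWeight.sub {φ ψ : ℝ → ℝ} (h : IsWeight φ) (h' : IsWeight ψ) :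
    IsWeight fun x => φ x - ψ x := by
  obtain ⟨B, hB⟩ := h.2
  obtain ⟨B', hB'⟩ := h'.2
  refine ⟨h.1.sub h'.1, B + B', fun x => ?_⟩
  rw [add_mul]
  exact (abs_sub _ _).trans (add_le_add (hB x) (hB' x))

theorem isWeight_avgWt' (t : ℝ) : IsWeight fun x => (wt 3 x - wt 3 (x - p * t)) / p := by
  have h3 := isWeight_wt (show 1 ≤ 3 by norm_num)
  simpa only [div_eq_inv_mul] using (h3.sub (h3.shift (p * t))).const_mul p⁻¹

end avgWt

/-! ### Control of averages of `u` through the transport equation. -/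

namespace SmoothSol

variable {ω s I : ℝ} {u v θ w g uτ vτ gξ : ℝ → ℝ → ℝ}

/-- Integration by parts in `ω u_τ = (s u - w)_ξ`. -/
theorem lineInt_avgWt_uτ (h : SmoothSol ω s I u v θ w g uτ vτ gξ) {p : ℝ}
    (hp : p ≠ 0) (t τ : ℝ) :
    ω * lineInt (fun ξ τ => avgWt p t ξ * uτ ξ τ) τ =
      -lineInt (fun ξ τ => (wt 3 ξ - wt 3 (ξ - p * t)) / p * (s * u ξ τ - w ξ τ)) τ := by
  have hz : BddCont₂ fun ξ τ => s * u ξ τ - w ξ τ := (h.bc_u.const_mul s).sub h.bc_w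
  have d1 := (isWeight_avgWt' (p := p) t).mul hz
  have d2 := ((isWeight_avgWt hp t).mul h.bc_uτ).const_mul ω
  have key := lineInt_deriv ((isWeight_avgWt hp t).mul hz) (d1.add d2) (fun ξ τ => by
    have := (hasDerivAt_avgWt (p := p) t ξ).mul (((h.u_ξ ξ τ).const_mul s).sub (h.w_ξ ξ τ))
    exact this.congr_deriv (by simp only [Pi.sub_apply]; ring)) τ
  rw [(posLinear_lineInt τ).add d1 d2, (posLinear_lineInt τ).const_mul] at key
  linarith

theorem periodic_lineInt {F : ℝ → ℝ → ℝ} (h : ∀ ξ, Function.Periodic (F ξ) (2 * Real.pi)) :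
    Function.Periodic (lineInt F) (2 * Real.pi) := fun τ => by
  unfold lineInt
  simp only [h _ τ]

/-- Averages of `u` are controlled by `w` and the first integral. -/
theorem abs_lineInt_avgWt_u_le (h : SmoothSol ω s I u v θ w g uτ vτ gξ) (hω : ω ≠ 0)
    (hs : s ≠ 0) {p : ℝ} (hp : p = 2 * Real.pi * s / ω) (τ : ℝ) :
    |lineInt (fun ξ τ => avgWt p 1 ξ * u ξ τ) τ| ≤
      |I / s| * (∫ ξ, wt 3 ξ) + (2 * |s|)⁻¹ * (2 * (1 + p ^ 2)) ^ 3 *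
        ((∫ ξ, wt 3 ξ) + (2 * Real.pi)⁻¹ * stripInt fun ξ τ => wt 3 ξ * w ξ τ ^ 2) := by
  have hpi := Real.two_pi_pos
  have hp0 : p ≠ 0 := by rw [hp]; positivity
  have hk := isWeight_wt (show 1 ≤ 3 by norm_num)
  set q : ℝ := (2 * (1 + p ^ 2)) ^ 3 with hq
  set c : ℝ := ∫ ξ, wt 3 ξ with hc
  set Z : ℝ → ℝ := lineInt fun ξ τ => wt 3 ξ * (u ξ τ - s⁻¹ * w ξ τ) with hZ
  set S : ℝ → ℝ := lineInt fun ξ τ => wt 3 ξ * w ξ τ ^ 2 with hS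
  have bz : BddCont₂ fun ξ τ => u ξ τ - s⁻¹ * w ξ τ := h.bc_u.sub (h.bc_w.const_mul _)
  have cZ : Continuous Z := (hk.mul bz).continuous_lineInt
  have cS : Continuous S := (hk.mul (h.bc_w.pow 2)).continuous_lineInt
  -- The characteristics of `s u_ξ - ω u_τ = w_ξ` move by `p = 2 π s / ω` in `ξ` while `τ` decreases
  -- by one period. As `t` runs from 0 to 1, `G` accumulates `u` along them, up to errors in `w`.
  -- Its derivative consists of a fixed function `Z` evaluated at a moving `τ` and a term in `w`.
  set G : ℝ → ℝ := fun t => lineInt (fun ξ τ => avgWt p t ξ * u ξ τ) (τ - 2 * Real.pi * t) with hG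
  set G' : ℝ → ℝ := fun t => Z (τ - 2 * Real.pi * t) +
    s⁻¹ * lineInt (fun ξ τ => wt 3 (ξ - p * t) * w ξ τ) (τ - 2 * Real.pi * t) with hG'
  have bshift : ∀ {b t : ℝ}, |t| ≤ b → (p * t) ^ 2 ≤ (p * b) ^ 2 := by
    intro b t ht
    rw [mul_pow, mul_pow]
    have : t ^ 2 ≤ b ^ 2 := sq_le_sq' (by linarith [abs_le.1 ht]) (abs_le.1 ht).2
    gcongr
  have hderiv : ∀ t ∈ Ioo (-1 : ℝ) 2, HasDerivAt G (G' t) t := by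
    intro t ht
    obtain ⟨Bu, hBu0, hBu⟩ := h.bc_u.exists_pos
    obtain ⟨Bτ, hBτ0, hBτ⟩ := h.bc_uτ.exists_pos
    set q₂ : ℝ := (2 * (1 + (p * 2) ^ 2)) ^ 3 with hq₂
    have dom : ∀ ξ, ∀ r ∈ Ioo (-1 : ℝ) 2, ‖wt 3 (ξ - p * r) * u ξ (τ - 2 * Real.pi * r) +
        avgWt p r ξ * (-(2 * Real.pi) * uτ ξ (τ - 2 * Real.pi * r))‖ ≤
        (q₂ * Bu + 2 * q₂ * (2 * Real.pi * Bτ)) * wt 3 ξ := by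
      intro ξ r hr
      have hr2 : |r| ≤ 2 := abs_le.2 ⟨by linarith [hr.1], hr.2.le⟩
      have h1 : wt 3 (ξ - p * r) ≤ q₂ * wt 3 ξ :=
        wt_shift_le 3 (by linarith [bshift hr2]) ξ
      have h2 := abs_avgWt_le hp0 hr2 ξ
      rw [Real.norm_eq_abs]
      refine (abs_add_le _ _).trans ?_
      rw [abs_mul, abs_mul (avgWt p r ξ), abs_mul (-(2 * Real.pi)), abs_neg, abs_of_pos hpi,
        abs_of_pos (wt_pos _ _)]
      have hw := wt_pos 3 ξ
      have a1 : wt 3 (ξ - p * r) * |u ξ (τ - 2 * Real.pi * r)| ≤ (q₂ * wt 3 ξ) * Bu :=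
        mul_le_mul h1 (hBu _ _) (abs_nonneg _) (by positivity)
      have a2 : |avgWt p r ξ| * (2 * Real.pi * |uτ ξ (τ - 2 * Real.pi * r)|) ≤
          (2 * q₂ * wt 3 ξ) * (2 * Real.pi * Bτ) :=
        mul_le_mul h2 (mul_le_mul_of_nonneg_left (hBτ _ _) hpi.le) (by positivity)
          (by positivity)
      linarith
    have iw : Integrable (wt 3) := by
      have := (hk.mul (BddCont₂.const 1)).integrable 0
      simpa using this
    have d0 := (isWeight_avgWt hp0 t).mul h.bc_u
    have d1 := (hk.shift (p * t)).mul h.bc_u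
    have d2 := (isWeight_avgWt hp0 t).mul h.bc_uτ
    have key := (hasDerivAt_integral_of_dominated_loc_of_deriv_le (𝕜 := ℝ) (μ := volume)
      (F := fun t ξ => avgWt p t ξ * u ξ (τ - 2 * Real.pi * t))
      (F' := fun t ξ => wt 3 (ξ - p * t) * u ξ (τ - 2 * Real.pi * t) +
        avgWt p t ξ * (-(2 * Real.pi) * uτ ξ (τ - 2 * Real.pi * t)))
      (s := Ioo (-1 : ℝ) 2) (x₀ := t) (Ioo_mem_nhds ht.1 ht.2)
      (Eventually.of_forall fun r =>
        (((isWeight_avgWt hp0 r).mul h.bc_u).integrable _).aestronglyMeasurable)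
      (d0.integrable _)
      ((d1.add ((isWeight_avgWt hp0 t).mul (h.bc_uτ.const_mul _))).integrable
        _).aestronglyMeasurable
      (Eventually.of_forall fun ξ => dom ξ) (iw.const_mul _)
      (Eventually.of_forall fun ξ r _ => by
        have e : HasDerivAt (fun r => τ - 2 * Real.pi * r) (-(2 * Real.pi)) r :=
          (((hasDerivAt_id r).const_mul (2 * Real.pi)).const_sub τ).congr_deriv (by simp)
        have e2 := HasDerivAt.comp (h₂ := u ξ) r (h.u_τ ξ _) e
        exact ((hasDerivAt_avgWt_left hp0 r ξ).mul e2).congr_deriv (by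
          simp only [Function.comp_apply]; ring))).2
    refine key.congr_deriv ?_
    have L := posLinear_lineInt (τ - 2 * Real.pi * t)
    have e1 := h.lineInt_avgWt_uτ hp0 t (τ - 2 * Real.pi * t)
    have e2 : lineInt (fun ξ τ => wt 3 (ξ - p * t) * u ξ τ +
        -(2 * Real.pi) * (avgWt p t ξ * uτ ξ τ)) (τ - 2 * Real.pi * t) =
        lineInt (fun ξ τ => wt 3 (ξ - p * t) * u ξ τ) (τ - 2 * Real.pi * t) +
        -(2 * Real.pi) * lineInt (fun ξ τ => avgWt p t ξ * uτ ξ τ) (τ - 2 * Real.pi * t) := by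
      rw [L.add d1 (d2.const_mul _), L.const_mul]
    have dw := (hk.shift (p * t)).mul h.bc_w
    have dz := (isWeight_avgWt' (p := p) t).mul ((h.bc_u.const_mul s).sub h.bc_w)
    have e3 : lineInt (fun ξ τ => wt 3 ξ * (u ξ τ - s⁻¹ * w ξ τ)) (τ - 2 * Real.pi * t) +
        s⁻¹ * lineInt (fun ξ τ => wt 3 (ξ - p * t) * w ξ τ) (τ - 2 * Real.pi * t) =
        lineInt (fun ξ τ => wt 3 (ξ - p * t) * u ξ τ) (τ - 2 * Real.pi * t) +
        (p / s) * lineInt (fun ξ τ => (wt 3 ξ - wt 3 (ξ - p * t)) / p * (s * u ξ τ - w ξ τ))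
          (τ - 2 * Real.pi * t) := by
      rw [← L.const_mul, ← L.const_mul, ← L.add (hk.mul bz) (dw.const_mul _),
        ← L.add d1 (dz.const_mul _)]
      refine PosLinear.congr (L := fun F => lineInt F (τ - 2 * Real.pi * t)) fun ξ τ => ?_
      field_simp
      ring
    have e4 : (p / s) * lineInt (fun ξ τ => (wt 3 ξ - wt 3 (ξ - p * t)) / p * (s * u ξ τ - w ξ τ))
        (τ - 2 * Real.pi * t) =
        -(2 * Real.pi) * lineInt (fun ξ τ => avgWt p t ξ * uτ ξ τ) (τ - 2 * Real.pi * t) := by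
      have : p / s = 2 * Real.pi / ω := by rw [hp]; field_simp
      rw [this, ← neg_eq_iff_eq_neg.2 e1]
      field_simp
    rw [hG', hZ]
    dsimp only
    rw [e3, e4, ← e2]
    unfold lineInt
    refine integral_congr_ae (Eventually.of_forall fun ξ => ?_)
    dsimp only
    ring
  have hGc : ContinuousOn G (Icc 0 1) := fun t ht =>
    (hderiv t ⟨by linarith [ht.1], by linarith [ht.2]⟩).continuousAt.continuousWithinAt
  -- Uses `|w| ≤ (1 + w²) / 2`, which keeps the bound in terms of the dissipation.
  have hwbd : ∀ t ∈ Ioo (0 : ℝ) 1, |s⁻¹ * lineInt (fun ξ τ => wt 3 (ξ - p * t) * w ξ τ)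
      (τ - 2 * Real.pi * t)| ≤ (2 * |s|)⁻¹ * q * (c + S (τ - 2 * Real.pi * t)) := by
    intro t ht
    have L := posLinear_lineInt (τ - 2 * Real.pi * t)
    have ht1 : |t| ≤ 1 := abs_le.2 ⟨by linarith [ht.1], ht.2.le⟩
    have hq1 : ∀ ξ, wt 3 (ξ - p * t) ≤ q * wt 3 ξ := fun ξ =>
      wt_shift_le 3 (by have := bshift ht1; simp only [mul_one] at this; linarith) ξ
    have dw := (hk.shift (p * t)).mul h.bc_w
    have d1 := hk.mul (BddCont₂.const 1)
    have d2 := hk.mul (h.bc_w.pow 2)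
    have ec : lineInt (fun ξ _ => wt 3 ξ * 1) (τ - 2 * Real.pi * t) = c := by
      simp [lineInt, hc]
    have pt : ∀ ξ x, |wt 3 (ξ - p * t) * w ξ x| ≤
        q / 2 * (wt 3 ξ * 1) + q / 2 * (wt 3 ξ * w ξ x ^ 2) := by
      intro ξ x
      rw [abs_mul, abs_of_pos (wt_pos _ _)]
      have h1 : |w ξ x| ≤ (1 + w ξ x ^ 2) / 2 := by
        nlinarith [sq_nonneg (|w ξ x| - 1), sq_abs (w ξ x)]
      calc _ ≤ (q * wt 3 ξ) * ((1 + w ξ x ^ 2) / 2) :=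
            mul_le_mul (hq1 ξ) h1 (abs_nonneg _) (mul_nonneg (by positivity) (wt_pos _ _).le)
        _ = _ := by ring
    have u1 := L.le₂ (q / 2) (q / 2) dw d1 d2 (fun ξ x => (le_abs_self _).trans (pt ξ x))
    have u2 := L.le₂ (q / 2) (q / 2) dw.neg d1 d2 (fun ξ x => (neg_le_abs _).trans (pt ξ x))
    rw [L.neg] at u2
    simp only [ec] at u1 u2
    rw [abs_mul, abs_inv, mul_inv]
    have u3 : |lineInt (fun ξ τ => wt 3 (ξ - p * t) * w ξ τ) (τ - 2 * Real.pi * t)| ≤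
        q / 2 * (c + S (τ - 2 * Real.pi * t)) := abs_le.2 ⟨by linarith, by linarith⟩
    calc _ ≤ |s|⁻¹ * (q / 2 * (c + S (τ - 2 * Real.pi * t))) := by gcongr
      _ = _ := by ring
  have avg : ∀ F : ℝ → ℝ, Function.Periodic F (2 * Real.pi) →
      ∫ t in (0 : ℝ)..1, F (τ - 2 * Real.pi * t) =
        (2 * Real.pi)⁻¹ * ∫ t in (0 : ℝ)..(2 * Real.pi), F t := by
    intro F hF
    rw [intervalIntegral.integral_comp_sub_mul _ hpi.ne', smul_eq_mul]
    congr 1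
    have := hF.intervalIntegral_add_eq (τ - 2 * Real.pi) 0
    simpa using this
  have perZ : Function.Periodic Z (2 * Real.pi) := periodic_lineInt fun ξ τ => by
    simp only [h.per_u ξ τ, h.per_w ξ τ]
  have perS : Function.Periodic S (2 * Real.pi) := periodic_lineInt fun ξ τ => by
    simp only [h.per_w ξ τ]
  -- The integral of `Z` over one period in `τ` is prescribed by the first integral, since the
  -- integrand is a multiple of `w - s u`. This is where `I` enters the bounds.
  have iZ : ∫ t in (0 : ℝ)..(2 * Real.pi), Z t = 2 * Real.pi * (-(I / s) * c) := by
    have e := stripInt_eq (hk.mul bz)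
    have e2 : ∀ ξ, ∫ τ in (0 : ℝ)..(2 * Real.pi), wt 3 ξ * (u ξ τ - s⁻¹ * w ξ τ) =
        (-(I / s) * (2 * Real.pi)) * wt 3 ξ := by
      intro ξ
      have m := h.mean ξ
      have e3 : ∀ τ, wt 3 ξ * (u ξ τ - s⁻¹ * w ξ τ) =
          (-(s⁻¹) * wt 3 ξ) * (w ξ τ - s * u ξ τ) := fun τ => by field_simp; ring
      simp only [e3]
      rw [intervalIntegral.integral_const_mul, m]
      ring
    simp only [e2] at e
    rw [integral_const_mul, ← hc] at e
    exact e.trans (by ring)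
  have fin : ∀ ε : ℝ, |ε| = 1 → ε * G 1 ≤ |I / s| * c + (2 * |s|)⁻¹ * q *
      (c + (2 * Real.pi)⁻¹ * stripInt fun ξ τ => wt 3 ξ * w ξ τ ^ 2) := by
    intro ε hε
    have k1 := intervalIntegral.sub_le_integral_of_hasDeriv_right_of_le (a := (0 : ℝ)) (b := 1)
      (g := fun t => ε * G t) (g' := fun t => ε * G' t)
      (φ := fun t => ε * Z (τ - 2 * Real.pi * t) +
        (2 * |s|)⁻¹ * q * (c + S (τ - 2 * Real.pi * t))) zero_le_one
      (continuousOn_const.mul hGc)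
      (fun t ht => ((hderiv t ⟨by linarith [ht.1], by linarith [ht.2]⟩).const_mul
        ε).hasDerivWithinAt)
      (Continuous.integrableOn_Icc (by fun_prop))
      (fun t ht => by
        have := hwbd t ht
        rw [hG']
        dsimp only
        rw [mul_add]
        have h2 := le_abs_self (ε * (s⁻¹ * lineInt (fun ξ τ => wt 3 (ξ - p * t) * w ξ τ)
          (τ - 2 * Real.pi * t)))
        rw [abs_mul ε, hε, one_mul] at h2
        linarith)
    have G0 : G 0 = 0 := by simp [hG, avgWt_zero, lineInt]
    rw [G0, mul_zero, sub_zero, intervalIntegral.integral_add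
      (Continuous.intervalIntegrable (by fun_prop) _ _)
      (Continuous.intervalIntegrable (by fun_prop) _ _), intervalIntegral.integral_const_mul,
      intervalIntegral.integral_const_mul, intervalIntegral.integral_add
      (Continuous.intervalIntegrable (by fun_prop) _ _)
      (Continuous.intervalIntegrable (by fun_prop) _ _), avg Z perZ, avg S perS, iZ,
      inv_mul_cancel_left₀ hpi.ne'] at k1
    simp only [intervalIntegral.integral_const, sub_zero, one_smul] at k1
    have c0 : 0 ≤ c := integral_nonneg fun ξ => (wt_pos 3 ξ).le
    have k2 : ε * (-(I / s) * c) ≤ |I / s| * c := by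
      have := le_abs_self (ε * (-(I / s) * c))
      rwa [abs_mul, hε, one_mul, abs_mul, abs_neg, abs_of_nonneg c0] at this
    have k3 : stripInt (fun ξ τ => wt 3 ξ * w ξ τ ^ 2) =
      ∫ t in (0 : ℝ)..(2 * Real.pi), S t := rfl
    rw [k3]
    linarith
  -- At `t = 1` the argument `τ - 2 π` is `τ` again, by periodicity.
  have G1 : G 1 = lineInt (fun ξ τ => avgWt p 1 ξ * u ξ τ) τ := by
    have per : Function.Periodic (lineInt fun ξ τ => avgWt p 1 ξ * u ξ τ) (2 * Real.pi) :=
      periodic_lineInt fun ξ τ => by simp only [h.per_u ξ τ]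
    rw [hG]
    dsimp only
    rw [mul_one, per.sub_eq]
  rw [← G1]
  exact abs_le.2 ⟨by linarith [fin (-1) (by simp)], by linarith [fin 1 (by simp)]⟩

end SmoothSol

namespace PosLinear

variable {L : (ℝ → ℝ → ℝ) → ℝ} {F F₁ F₂ F₃ F₄ : ℝ → ℝ → ℝ}

theorem eq₂ (hL : PosLinear L) (a b : ℝ) (h₁ : Decays F₁) (h₂ : Decays F₂)
    (h : ∀ ξ τ, F ξ τ = a * F₁ ξ τ + b * F₂ ξ τ) : L F = a * L F₁ + b * L F₂ := by
  rw [congr (L := L) h, hL.add (h₁.const_mul a) (h₂.const_mul b), hL.const_mul, hL.const_mul]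

theorem eq₃ (hL : PosLinear L) (a b c : ℝ) (h₁ : Decays F₁) (h₂ : Decays F₂) (h₃ : Decays F₃)
    (h : ∀ ξ τ, F ξ τ = a * F₁ ξ τ + b * F₂ ξ τ + c * F₃ ξ τ) :
    L F = a * L F₁ + b * L F₂ + c * L F₃ := by
  rw [congr (L := L) h, hL.add ((h₁.const_mul a).add (h₂.const_mul b)) (h₃.const_mul c),
    hL.const_mul, hL.eq₂ a b h₁ h₂ fun _ _ => rfl]

theorem eq₄ (hL : PosLinear L) (a b c d : ℝ) (h₁ : Decays F₁) (h₂ : Decays F₂) (h₃ : Decays F₃)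
    (h₄ : Decays F₄) (h : ∀ ξ τ, F ξ τ = a * F₁ ξ τ + b * F₂ ξ τ + c * F₃ ξ τ + d * F₄ ξ τ) :
    L F = a * L F₁ + b * L F₂ + c * L F₃ + d * L F₄ := by
  rw [congr (L := L) h, hL.add (((h₁.const_mul a).add (h₂.const_mul b)).add (h₃.const_mul c))
    (h₄.const_mul d), hL.const_mul, hL.eq₃ a b c h₁ h₂ h₃ fun _ _ => rfl]

end PosLinear

theorem young {a : ℝ} (ha : 0 < a) (x y : ℝ) : |x * y| ≤ a / 2 * x ^ 2 + a⁻¹ / 2 * y ^ 2 := by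
  have h1 : a / 2 * x ^ 2 + a⁻¹ / 2 * y ^ 2 - x * y = (2 * a)⁻¹ * (a * x - y) ^ 2 := by
    field_simp; ring
  have h2 : a / 2 * x ^ 2 + a⁻¹ / 2 * y ^ 2 + x * y = (2 * a)⁻¹ * (a * x + y) ^ 2 := by
    field_simp; ring
  have h3 : 0 ≤ (2 * a)⁻¹ * (a * x - y) ^ 2 := by positivity
  have h4 : 0 ≤ (2 * a)⁻¹ * (a * x + y) ^ 2 := by positivity
  exact abs_le.2 ⟨by linarith, by linarith⟩

theorem lineInt_wt_mul (j : ℕ) (m : ℝ → ℝ) (τ : ℝ) :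
    lineInt (fun ξ τ => wt j ξ * m τ) τ = (∫ ξ, wt j ξ) * m τ := integral_mul_const _ _

theorem stripInt_wt_mul (j : ℕ) (m : ℝ → ℝ) :
    stripInt (fun ξ τ => wt j ξ * m τ) =
      (∫ ξ, wt j ξ) * ∫ τ in (0 : ℝ)..(2 * Real.pi), m τ := by
  unfold stripInt
  simp only [lineInt_wt_mul]
  exact intervalIntegral.integral_const_mul _ _

theorem stripInt_wt (j : ℕ) : stripInt (fun ξ _ => wt j ξ * 1) = 2 * Real.pi * ∫ ξ, wt j ξ := by
  rw [stripInt_wt_mul j fun _ => 1]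
  simp [mul_comm]

theorem integrable_wt {j : ℕ} (hj : 1 ≤ j) : Integrable (wt j) := by
  simpa using ((isWeight_wt hj).mul (BddCont₂.const 1)).integrable 0

theorem integral_wt_pos {j : ℕ} (hj : 1 ≤ j) : 0 < ∫ ξ, wt j ξ :=
  integral_pos_of_integrable_nonneg_nonzero (x := 0) (continuous_wt j) (integrable_wt hj)
    (fun x => (wt_pos j x).le) (wt_pos j 0).ne'

theorem integral_wt_one : ∫ ξ, wt 1 ξ = Real.pi := by
  simp [wt]

/-! ### Local energy estimates in terms of the dissipation. -/

namespace SmoothSol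

variable {ω s I : ℝ} {u v θ w g uτ vτ gξ : ℝ → ℝ → ℝ}

/-- The equation tested with `ρ u`. -/
theorem stripInt_energy (h : SmoothSol ω s I u v θ w g uτ vτ gξ) {ρ ρ' : ℝ → ℝ} (hρ : IsWeight ρ)
    (hρ' : IsWeight ρ') (hd : ∀ x, HasDerivAt ρ (ρ' x) x) :
    stripInt (fun ξ τ => ρ ξ * v ξ τ ^ 2) + stripInt (fun ξ τ => ρ ξ * u ξ τ ^ 4) =
      stripInt (fun ξ τ => ρ ξ * u ξ τ ^ 2) - stripInt (fun ξ τ => ρ' ξ * (u ξ τ * v ξ τ)) -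
        stripInt (fun ξ τ => ρ ξ * (u ξ τ * θ ξ τ)) := by
  have L := posLinear_stripInt
  have d1 := hρ'.mul (h.bc_u.mul h.bc_v)
  have d2 := hρ.mul (h.bc_v.pow 2)
  have d3 := hρ.mul (h.bc_u.mul h.bc_g)
  have d4 := hρ.mul (h.bc_u.mul h.bc_θ)
  have e1 := stripInt_deriv (hρ.mul (h.bc_u.mul h.bc_v)) (((d1.add d2).add d3).add d4)
    (fun ξ τ => ((hd ξ).mul ((h.u_ξ ξ τ).mul (h.v_ξ ξ τ))).congr_deriv
      (by simp only [Pi.mul_apply]; ring))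
  rw [L.add ((d1.add d2).add d3) d4, L.add (d1.add d2) d3, L.add d1 d2,
    stripInt_weight_congr hρ (h.bc_u.mul h.bc_g) (h.bc_u.mul h.bc_u.dG)
      (fun ξ => h.integral_u_g ξ ξ),
    L.eq₂ (-1) 1 (hρ.mul (h.bc_u.pow 2)) (hρ.mul (h.bc_u.pow 4))
      (F := fun ξ τ => ρ ξ * (u ξ τ * dG (u ξ τ))) fun ξ τ => by unfold dG; ring] at e1
  linarith

/-- The function `θ(0, τ)` tested with an average of `u`. -/
theorem integral_wt_mul_stripInt_θ (h : SmoothSol ω s I u v θ w g uτ vτ gξ) {ρ : ℝ → ℝ}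
    (hρ : IsWeight ρ) {m : ℝ → ℝ} (hm : m = lineInt fun ξ τ => ρ ξ * u ξ τ) :
    (∫ ξ, wt 6 ξ) * stripInt (fun ξ τ => ρ ξ * (u ξ τ * θ 0 τ)) =
      -stripInt (fun ξ τ => wt' 6 ξ * (m τ * v ξ τ)) -
        stripInt (fun ξ τ => wt 6 ξ * (m τ * dG (u ξ τ))) -
        stripInt (fun ξ τ => wt 6 ξ * (m τ * (θ ξ τ - θ 0 τ))) := by
  have L := posLinear_stripInt
  have k6 := isWeight_wt (show 1 ≤ 6 by norm_num)
  have bm : BddCont₂ fun _ τ => m τ := by rw [hm]; exact (hρ.mul h.bc_u).bddCont₂_lineInt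
  have b0 := h.bc_θ.slice 0
  have d1 := (isWeight_wt' (show 1 ≤ 6 by norm_num)).mul (bm.mul h.bc_v)
  have d2 := k6.mul (bm.mul h.bc_g)
  have d3 := k6.mul (bm.mul b0)
  have d4 := k6.mul (bm.mul (h.bc_θ.sub b0))
  have e1 := stripInt_deriv (k6.mul (bm.mul h.bc_v)) (((d1.add d2).add d3).add d4)
    (fun ξ τ => ((hasDerivAt_wt 6 ξ).mul ((h.v_ξ ξ τ).const_mul (m τ))).congr_deriv (by ring))
  have e2 : stripInt (fun ξ τ => wt 6 ξ * (m τ * θ 0 τ)) =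
      (∫ ξ, wt 6 ξ) * stripInt (fun ξ τ => ρ ξ * (u ξ τ * θ 0 τ)) := by
    rw [stripInt_wt_mul 6 fun τ => m τ * θ 0 τ]
    congr 1
    unfold stripInt
    refine intervalIntegral.integral_congr fun τ _ => ?_
    rw [hm]
    unfold lineInt
    rw [← integral_mul_const]
    simp only [mul_assoc]
  -- Writes `m` as an average of slices `u(x, ·)`, each of which is fixed by `P_n`. This allows the
  -- replacement of `g` by `G'(u)`, although `u` and `g` are taken at different points `x` and `ξ`;
  -- for this reason `integral_u_g` has two arguments.
  have e3 : ∀ f : ℝ → ℝ, ∫ τ in (0 : ℝ)..(2 * Real.pi), m τ * f τ =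
      stripInt fun x τ => ρ x * (u x τ * f τ) := by
    intro f
    unfold stripInt
    refine intervalIntegral.integral_congr fun τ _ => ?_
    rw [hm]
    unfold lineInt
    rw [← integral_mul_const]
    simp only [mul_assoc]
  rw [L.add ((d1.add d2).add d3) d4, L.add (d1.add d2) d3, L.add d1 d2, e2,
    stripInt_weight_congr k6 (bm.mul h.bc_g) (bm.mul h.bc_u.dG) (fun ξ => by
      rw [e3, e3]
      exact stripInt_weight_congr hρ (h.bc_u.mul (h.bc_g.slice ξ))
        (h.bc_u.mul (h.bc_u.dG.slice ξ)) fun x => h.integral_u_g x ξ)] at e1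
  linarith

/-- A bound of `u` on lines. -/
theorem lineInt_u_sq_le (h : SmoothSol ω s I u v θ w g uτ vτ gξ) (hω : ω ≠ 0) {a : ℝ} (ha : 0 < a)
    (τ : ℝ) :
    lineInt (fun ξ τ => wt 3 ξ * u ξ τ ^ 2) τ ≤
      (2 * Real.pi)⁻¹ * stripInt (fun ξ τ => wt 3 ξ * u ξ τ ^ 2) +
      |ω|⁻¹ * ((3 * |s| + 3) * stripInt (fun ξ τ => wt 3 ξ * u ξ τ ^ 2) +
        (3 + a) * stripInt (fun ξ τ => wt 3 ξ * w ξ τ ^ 2) +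
        a⁻¹ * stripInt fun ξ τ => wt 3 ξ * v ξ τ ^ 2) := by
  have k := isWeight_wt (show 1 ≤ 3 by norm_num)
  have k' := isWeight_wt' (show 1 ≤ 3 by norm_num)
  have du := k.mul (h.bc_u.pow 2)
  have dw := k.mul (h.bc_w.pow 2)
  have dv := k.mul (h.bc_v.pow 2)
  have d1 := k.mul ((h.bc_u.mul h.bc_uτ).const_mul 2)
  have dH := (((du.const_mul (3 * |s| + 3)).add (dw.const_mul (3 + a))).add
    (dv.const_mul a⁻¹)).const_mul |ω|⁻¹
  have key : ∀ τ, |lineInt (fun ξ τ => wt 3 ξ * (2 * (u ξ τ * uτ ξ τ))) τ| ≤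
      lineInt (fun ξ τ => |ω|⁻¹ * ((3 * |s| + 3) * (wt 3 ξ * u ξ τ ^ 2) +
        (3 + a) * (wt 3 ξ * w ξ τ ^ 2) + a⁻¹ * (wt 3 ξ * v ξ τ ^ 2))) τ := by
    intro τ
    have L := posLinear_lineInt τ
    have f1 := k'.mul (((h.bc_u.pow 2).const_mul s).sub ((h.bc_u.mul h.bc_w).const_mul 2))
    have f2 := k.mul ((h.bc_v.mul h.bc_w).const_mul 2)
    have f3 := d1.const_mul ω
    -- The transport equation gives `2 ω u u_τ = (s u² - 2 u w)_ξ + 2 v w`, so the `τ`-derivative of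
    -- the line integral of `u²` is expressed without `u_τ`.
    have e1 := lineInt_deriv (k.mul (((h.bc_u.pow 2).const_mul s).sub
      ((h.bc_u.mul h.bc_w).const_mul 2))) ((f1.sub f2).add f3) (fun ξ τ =>
        ((hasDerivAt_wt 3 ξ).mul ((((h.u_ξ ξ τ).fun_pow 2).const_mul s).sub
          (((h.u_ξ ξ τ).mul (h.w_ξ ξ τ)).const_mul 2))).congr_deriv (by
            simp only [Pi.sub_apply, Pi.mul_apply, Nat.cast_ofNat, Nat.add_one_sub_one, pow_one]
            ring)) τ
    rw [L.add (f1.sub f2) f3, L.const_mul] at e1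
    have e2 : lineInt (fun ξ τ => wt 3 ξ * (2 * (u ξ τ * uτ ξ τ))) τ = ω⁻¹ *
        -lineInt (fun ξ τ => wt' 3 ξ * (s * u ξ τ ^ 2 - 2 * (u ξ τ * w ξ τ)) -
          wt 3 ξ * (2 * (v ξ τ * w ξ τ))) τ := by
      rw [eq_inv_mul_iff_mul_eq₀ hω]; linarith
    have pt : ∀ ξ τ, |wt' 3 ξ * (s * u ξ τ ^ 2 - 2 * (u ξ τ * w ξ τ)) -
          wt 3 ξ * (2 * (v ξ τ * w ξ τ))| ≤ (3 * |s| + 3) * (wt 3 ξ * u ξ τ ^ 2) +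
        (3 + a) * (wt 3 ξ * w ξ τ ^ 2) + a⁻¹ * (wt 3 ξ * v ξ τ ^ 2) := by
      intro ξ τ
      have hk := wt_pos 3 ξ
      have hk' := abs_wt'_le 3 ξ
      push_cast at hk'
      have y1 := young one_pos (u ξ τ) (w ξ τ)
      have y2 := young (inv_pos.2 ha) (v ξ τ) (w ξ τ)
      rw [inv_inv] at y2
      have a1 : |s * u ξ τ ^ 2 - 2 * (u ξ τ * w ξ τ)| ≤
          |s| * u ξ τ ^ 2 + (u ξ τ ^ 2 + w ξ τ ^ 2) := by
        refine (abs_sub _ _).trans ?_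
        rw [abs_mul, abs_of_nonneg (sq_nonneg (u ξ τ)), abs_mul, abs_two]
        linarith
      calc _ ≤ |wt' 3 ξ * (s * u ξ τ ^ 2 - 2 * (u ξ τ * w ξ τ))| +
            |wt 3 ξ * (2 * (v ξ τ * w ξ τ))| := abs_sub _ _
        _ = |wt' 3 ξ| * |s * u ξ τ ^ 2 - 2 * (u ξ τ * w ξ τ)| +
            wt 3 ξ * (2 * |v ξ τ * w ξ τ|) := by
          rw [abs_mul, abs_mul (wt 3 ξ), abs_of_pos hk, abs_mul 2, abs_two]
        _ ≤ (3 * wt 3 ξ) * (|s| * u ξ τ ^ 2 + (u ξ τ ^ 2 + w ξ τ ^ 2)) +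
            wt 3 ξ * (2 * (a⁻¹ / 2 * v ξ τ ^ 2 + a / 2 * w ξ τ ^ 2)) := by gcongr
        _ = _ := by ring
    rw [e2, L.const_mul, abs_mul, abs_inv, abs_neg]
    have hb := (((du.const_mul (3 * |s| + 3)).add (dw.const_mul (3 + a))).add (dv.const_mul a⁻¹))
    refine mul_le_mul_of_nonneg_left (abs_le.2 ⟨?_, ?_⟩) (inv_nonneg.2 (abs_nonneg _))
    · rw [← L.neg]
      exact L.mono hb.neg (f1.sub f2) fun ξ τ => by linarith [abs_le.1 (pt ξ τ)]
    · exact L.mono (f1.sub f2) hb fun ξ τ => (le_abs_self _).trans (pt ξ τ)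
  have h1 := le_mean_add_integral (hasDerivAt_lineInt du d1 (fun ξ τ =>
    (((h.u_τ ξ τ).fun_pow 2).const_mul (wt 3 ξ)).congr_deriv (by
      simp only [Nat.cast_ofNat, Nat.add_one_sub_one, pow_one]; ring)))
    (periodic_lineInt fun ξ τ => by simp only [h.per_u ξ τ])
    d1.continuous_lineInt dH.continuous_lineInt key τ
  have L := posLinear_stripInt
  have e := (L.const_mul |ω|⁻¹ _).trans (congrArg (|ω|⁻¹ * ·) (L.eq₃ (3 * |s| + 3) (3 + a) a⁻¹
    du dw dv fun _ _ => rfl))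
  refine h1.trans (add_le_add_right ?_ _)
  exact e.le

/-- A pointwise bound of `u`. -/
theorem wt_mul_u_sq_le (h : SmoothSol ω s I u v θ w g uτ vτ gξ) {j : ℕ} (hj : 1 ≤ j) {a : ℝ}
    (ha : 0 < a) (ξ τ : ℝ) :
    wt j ξ * u ξ τ ^ 2 ≤ lineInt (fun ξ τ => (j + a) * (wt j ξ * u ξ τ ^ 2) +
      a⁻¹ * (wt j ξ * v ξ τ ^ 2)) τ := by
  have k := isWeight_wt hj
  have du := k.mul (h.bc_u.pow 2)
  have dv := k.mul (h.bc_v.pow 2)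
  refine le_lineInt_of_deriv_le du (((isWeight_wt' hj).mul (h.bc_u.pow 2)).add
    (k.mul ((h.bc_u.mul h.bc_v).const_mul 2))) (fun ξ τ =>
      ((hasDerivAt_wt j ξ).mul ((h.u_ξ ξ τ).fun_pow 2)).congr_deriv (by
      simp only [Nat.cast_ofNat, Nat.add_one_sub_one, pow_one]; ring))
    ((du.const_mul (j + a)).add (dv.const_mul a⁻¹)) (fun ξ τ => ?_) (fun ξ τ => ?_) ξ τ
  · have := wt_pos j ξ
    positivity
  · have hk := wt_pos j ξ
    have h1 := (le_abs_self _).trans (abs_wt'_le j ξ)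
    have y := (le_abs_self _).trans (young ha (u ξ τ) (v ξ τ))
    calc _ ≤ (j * wt j ξ) * u ξ τ ^ 2 +
          wt j ξ * (2 * (a / 2 * u ξ τ ^ 2 + a⁻¹ / 2 * v ξ τ ^ 2)) := by gcongr
      _ = _ := by ring

/-- The growth of `θ` in `ξ`. -/
theorem wt_mul_θ_sub_sq_le (h : SmoothSol ω s I u v θ w g uτ vτ gξ) (ξ τ : ℝ) :
    wt 3 ξ * (θ ξ τ - θ 0 τ) ^ 2 ≤ 1 / 2 * (wt 1 ξ * lineInt (fun ξ τ => wt 1 ξ * w ξ τ ^ 2) τ) := by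
  set S := lineInt (fun ξ τ => wt 1 ξ * w ξ τ ^ 2) τ with hS
  have hd := (isWeight_wt le_rfl).mul (h.bc_w.pow 2)
  have cw : Continuous fun x => w x τ := h.bc_w.1.comp (Continuous.prodMk_left τ)
  have hS0 : 0 ≤ S := integral_nonneg fun x => mul_nonneg (wt_pos 1 x).le (sq_nonneg _)
  have int_le : ∀ a b : ℝ, a ≤ b → ∫ x in a..b, wt 1 x * w x τ ^ 2 ≤ S := by
    intro a b hab
    rw [intervalIntegral.integral_of_le hab]
    exact setIntegral_le_integral (hd.integrable τ)
      (Eventually.of_forall fun x => mul_nonneg (wt_pos 1 x).le (sq_nonneg _))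
  have cw2 : Continuous fun x => wt 1 x * w x τ ^ 2 := (continuous_wt 1).mul (cw.pow 2)
  have seg : ∀ a b : ℝ, a ≤ b → (∀ x ∈ Icc a b, |x| ≤ |ξ|) → ∀ c : ℝ,
      2 * c * (θ b τ - θ a τ) ≤ c ^ 2 * (b - a) + (1 + ξ ^ 2) * S := by
    intro a b hab hx c
    have e : ∫ x in a..b, w x τ = θ b τ - θ a τ :=
      intervalIntegral.integral_eq_sub_of_hasDerivAt (fun x _ => h.θ_ξ x τ)
        (cw.intervalIntegrable _ _)
    rw [← e, ← intervalIntegral.integral_const_mul]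
    calc _ ≤ ∫ x in a..b, (c ^ 2 + (1 + ξ ^ 2) * (wt 1 x * w x τ ^ 2)) := by
          refine intervalIntegral.integral_mono_on hab
            (Continuous.intervalIntegrable (by fun_prop) _ _)
            (Continuous.intervalIntegrable (by fun_prop) _ _) fun x hxm => ?_
          have h1 : x ^ 2 ≤ ξ ^ 2 := sq_le_sq.2 (hx x hxm)
          have h2 := one_add_sq_mul_wt 0 x
          rw [wt_zero] at h2
          have h3 : 1 ≤ (1 + ξ ^ 2) * wt 1 x := by
            rw [← h2]; exact mul_le_mul_of_nonneg_right (by linarith) (wt_pos 1 x).le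
          nlinarith [sq_nonneg (c - w x τ), sq_nonneg (w x τ)]
      _ = c ^ 2 * (b - a) + (1 + ξ ^ 2) * ∫ x in a..b, wt 1 x * w x τ ^ 2 := by
          rw [intervalIntegral.integral_add (continuous_const.intervalIntegrable _ _)
            ((cw2.const_mul _).intervalIntegrable _ _), intervalIntegral.integral_const_mul,
            intervalIntegral.integral_const, smul_eq_mul]
          ring
      _ ≤ _ := by
          have := int_le a b hab
          gcongr
  -- The Cauchy-Schwarz inequality for `θ(ξ) - θ(0) = ∫ w`, obtained from the discriminant of a
  -- nonnegative quadratic polynomial in `c`.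
  have quad : ∀ c : ℝ, 0 ≤ |ξ| * (c * c) + (-(2 * (θ ξ τ - θ 0 τ))) * c + (1 + ξ ^ 2) * S := by
    intro c
    rcases le_total 0 ξ with hξ | hξ
    · have := seg 0 ξ hξ (fun x hx => by rw [abs_of_nonneg hx.1, abs_of_nonneg hξ]; exact hx.2) c
      rw [abs_of_nonneg hξ]
      linarith
    · have := seg ξ 0 hξ (fun x hx => by
        rw [abs_of_nonpos hx.2, abs_of_nonpos hξ]; linarith [hx.1]) (-c)
      rw [abs_of_nonpos hξ]
      linarith
  have hdisc := discrim_le_zero quad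
  unfold discrim at hdisc
  have h1 : (θ ξ τ - θ 0 τ) ^ 2 ≤ |ξ| * ((1 + ξ ^ 2) * S) := by linarith
  have hk := wt_pos 3 ξ
  have h2 : 2 * |ξ| ≤ 1 + ξ ^ 2 := by nlinarith [sq_nonneg (|ξ| - 1), sq_abs ξ]
  have e1 := one_add_sq_mul_wt 1 ξ
  have e2 := one_add_sq_mul_wt 2 ξ
  calc _ ≤ wt 3 ξ * ((1 + ξ ^ 2) / 2 * ((1 + ξ ^ 2) * S)) := by
        refine mul_le_mul_of_nonneg_left (h1.trans ?_) hk.le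
        gcongr
        linarith
    _ = 1 / 2 * (((1 + ξ ^ 2) * ((1 + ξ ^ 2) * wt 3 ξ)) * S) := by ring
    _ = _ := by rw [e2, e1]

theorem stripInt_θ_sub_sq_le (h : SmoothSol ω s I u v θ w g uτ vτ gξ) :
    stripInt (fun ξ τ => wt 3 ξ * (θ ξ τ - θ 0 τ) ^ 2) ≤
      Real.pi / 2 * stripInt fun ξ τ => wt 1 ξ * w ξ τ ^ 2 := by
  have hd := (isWeight_wt le_rfl).mul (h.bc_w.pow 2)
  have := posLinear_stripInt.le₁ (1 / 2) ((isWeight_wt (show 1 ≤ 3 by norm_num)).mul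
    ((h.bc_θ.sub (h.bc_θ.slice 0)).pow 2)) ((isWeight_wt le_rfl).mul hd.bddCont₂_lineInt)
    h.wt_mul_θ_sub_sq_le
  rw [stripInt_wt_mul, integral_wt_one] at this
  refine this.trans (le_of_eq ?_)
  unfold stripInt
  ring

end SmoothSol

theorem BddCont₂.abs {f : ℝ → ℝ → ℝ} (hf : BddCont₂ f) : BddCont₂ fun ξ τ => |f ξ τ| := by
  obtain ⟨A, hA⟩ := hf.2
  exact ⟨hf.1.abs, A, fun ξ τ => by rw [abs_abs]; exact hA ξ τ⟩

namespace SmoothSol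

variable {ω s I : ℝ} {u v θ w g uτ vτ gξ : ℝ → ℝ → ℝ}

theorem stripInt_wt_w_le (h : SmoothSol ω s I u v θ w g uτ vτ gξ) {j : ℕ} (hj : 1 ≤ j) :
    stripInt (fun ξ τ => wt j ξ * w ξ τ ^ 2) ≤ stripInt fun ξ τ => wt 1 ξ * w ξ τ ^ 2 :=
  posLinear_stripInt.mono ((isWeight_wt hj).mul (h.bc_w.pow 2))
    ((isWeight_wt le_rfl).mul (h.bc_w.pow 2)) fun ξ _ =>
      mul_le_mul_of_nonneg_right (wt_anti hj ξ) (sq_nonneg _)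

section Interpolation

variable {B z : ℝ}

/-- In the interpolation lemmas `z ^ 8` dominates the local energy, the weighted integral of `v² +
u⁴`. Each lemma bounds another quantity by a smaller power of `z`; here the exponent 4 comes from
the Cauchy-Schwarz inequality in the form of Young's inequality with parameter `z ^ 4`. -/
theorem interpolation_sq (h : SmoothSol ω s I u v θ w g uτ vτ gξ) (hB : 1 ≤ B) (hz : 1 ≤ z)
    (hc : 2 * Real.pi * ∫ ξ, wt 3 ξ ≤ B)
    (hu : stripInt (fun ξ τ => wt 3 ξ * u ξ τ ^ 4) ≤ z ^ 8) :
    stripInt (fun ξ τ => wt 3 ξ * u ξ τ ^ 2) ≤ B * z ^ 4 := by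
  have k := isWeight_wt (show 1 ≤ 3 by norm_num)
  have hz4 : 0 < z ^ 4 := by positivity
  have h1 := posLinear_stripInt.le₂ (z ^ 4 / 2) ((z ^ 4)⁻¹ / 2) (k.mul (h.bc_u.pow 2))
    (k.mul (BddCont₂.const 1)) (k.mul (h.bc_u.pow 4)) (fun ξ τ => by
      have y := (le_abs_self _).trans (young hz4 1 (u ξ τ ^ 2))
      have hk := wt_pos 3 ξ
      calc wt 3 ξ * u ξ τ ^ 2 = wt 3 ξ * (1 * u ξ τ ^ 2) := by ring
        _ ≤ wt 3 ξ * (z ^ 4 / 2 * 1 ^ 2 + (z ^ 4)⁻¹ / 2 * (u ξ τ ^ 2) ^ 2) := by gcongr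
        _ = _ := by ring)
  rw [stripInt_wt] at h1
  have h2 : (z ^ 4)⁻¹ / 2 * stripInt (fun ξ τ => wt 3 ξ * u ξ τ ^ 4) ≤ z ^ 4 / 2 := by
    calc _ ≤ (z ^ 4)⁻¹ / 2 * z ^ 8 := by gcongr
      _ = _ := by field_simp
  have h3 : z ^ 4 / 2 * (2 * Real.pi * ∫ ξ, wt 3 ξ) ≤ z ^ 4 / 2 * B := by gcongr
  nlinarith

/-- `lineInt_u_sq_le` with `a = z ^ 4`: the term in `w²` is multiplied by `z ^ 4`, the term in `v²`
is divided by it. -/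
theorem interpolation_sup (h : SmoothSol ω s I u v θ w g uτ vτ gξ) (hB : 1 ≤ B) (hz : 1 ≤ z)
    (hω : ω ≠ 0) (hωB : |ω|⁻¹ ≤ B) (hs : |s| ≤ B)
    (hw : stripInt (fun ξ τ => wt 1 ξ * w ξ τ ^ 2) ≤ B)
    (hu : stripInt (fun ξ τ => wt 3 ξ * u ξ τ ^ 2) ≤ B * z ^ 4)
    (hv : stripInt (fun ξ τ => wt 3 ξ * v ξ τ ^ 2) ≤ z ^ 8) (τ : ℝ) :
    lineInt (fun ξ τ => wt 3 ξ * u ξ τ ^ 2) τ ≤ 12 * (B ^ 3 * z ^ 4) := by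
  have k := isWeight_wt (show 1 ≤ 3 by norm_num)
  have hz4 : 1 ≤ z ^ 4 := one_le_pow₀ hz
  have h1 := h.lineInt_u_sq_le hω (a := z ^ 4) (by positivity) τ
  have hw' := (h.stripInt_wt_w_le (show 1 ≤ 3 by norm_num)).trans hw
  have u0 : 0 ≤ stripInt (fun ξ τ => wt 3 ξ * u ξ τ ^ 2) :=
    posLinear_stripInt.nonneg (k.mul (h.bc_u.pow 2)) fun ξ τ =>
      mul_nonneg (wt_pos _ _).le (sq_nonneg _)
  have w0 : 0 ≤ stripInt (fun ξ τ => wt 3 ξ * w ξ τ ^ 2) :=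
    posLinear_stripInt.nonneg (k.mul (h.bc_w.pow 2)) fun ξ τ =>
      mul_nonneg (wt_pos _ _).le (sq_nonneg _)
  have v0 : 0 ≤ stripInt (fun ξ τ => wt 3 ξ * v ξ τ ^ 2) :=
    posLinear_stripInt.nonneg (k.mul (h.bc_v.pow 2)) fun ξ τ =>
      mul_nonneg (wt_pos _ _).le (sq_nonneg _)
  have a1 : (2 * Real.pi)⁻¹ * stripInt (fun ξ τ => wt 3 ξ * u ξ τ ^ 2) ≤ 1 * (B * z ^ 4) := by
    have : (2 * Real.pi)⁻¹ ≤ 1 := inv_le_one_of_one_le₀ (by linarith [Real.pi_gt_three])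
    gcongr
  have a2 : (z ^ 4)⁻¹ * stripInt (fun ξ τ => wt 3 ξ * v ξ τ ^ 2) ≤ z ^ 4 := by
    calc _ ≤ (z ^ 4)⁻¹ * z ^ 8 := by gcongr
      _ = _ := by field_simp
  have a3 : (3 * |s| + 3) * stripInt (fun ξ τ => wt 3 ξ * u ξ τ ^ 2) ≤
      (3 * B + 3 * B) * (B * z ^ 4) := by
    gcongr
    linarith
  have a4 : (3 + z ^ 4) * stripInt (fun ξ τ => wt 3 ξ * w ξ τ ^ 2) ≤ (4 * z ^ 4) * B :=
    mul_le_mul (by linarith) hw' w0 (by positivity)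
  have a5 : |ω|⁻¹ * ((3 * |s| + 3) * stripInt (fun ξ τ => wt 3 ξ * u ξ τ ^ 2) +
      (3 + z ^ 4) * stripInt (fun ξ τ => wt 3 ξ * w ξ τ ^ 2) +
      (z ^ 4)⁻¹ * stripInt fun ξ τ => wt 3 ξ * v ξ τ ^ 2) ≤
      B * ((3 * B + 3 * B) * (B * z ^ 4) + (4 * z ^ 4) * B + z ^ 4) :=
    mul_le_mul hωB (by linarith) (by positivity) (by linarith)
  have b1 : B ≤ B ^ 3 := le_self_pow₀ hB (by norm_num)
  have b2 : B ^ 2 ≤ B ^ 3 := pow_le_pow_right₀ hB (by norm_num)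
  have c1 := mul_le_mul_of_nonneg_right b1 (by positivity : 0 ≤ z ^ 4)
  have c2 := mul_le_mul_of_nonneg_right b2 (by positivity : 0 ≤ z ^ 4)
  calc _ ≤ _ := h1
    _ ≤ 1 * (B * z ^ 4) + B * ((3 * B + 3 * B) * (B * z ^ 4) + (4 * z ^ 4) * B + z ^ 4) :=
      add_le_add a1 a5
    _ = 2 * (B * z ^ 4) + 4 * (B ^ 2 * z ^ 4) + 6 * (B ^ 3 * z ^ 4) := by ring
    _ ≤ _ := by linarith

/-- Since `wt 6 = (wt 3)²`, the integrand is `wt 3 u²` times `wt 3 |u|`. The second factor is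
bounded by a function `m` of `τ` of integral `O(z ^ 3)`, from a one-dimensional Sobolev bound on
lines; the first has line integrals `O(z ^ 4)`. -/
theorem interpolation_cube (h : SmoothSol ω s I u v θ w g uτ vτ gξ) (hB : 1 ≤ B) (hz : 1 ≤ z)
    (hpi : 2 * Real.pi ≤ B)
    (hu : stripInt (fun ξ τ => wt 3 ξ * u ξ τ ^ 2) ≤ B * z ^ 4)
    (hv : stripInt (fun ξ τ => wt 3 ξ * v ξ τ ^ 2) ≤ z ^ 8)
    (hN : ∀ τ, lineInt (fun ξ τ => wt 3 ξ * u ξ τ ^ 2) τ ≤ 12 * (B ^ 3 * z ^ 4)) :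
    stripInt (fun ξ τ => wt 6 ξ * |u ξ τ| ^ 3) ≤ 36 * (B ^ 4 * z ^ 7) := by
  have k := isWeight_wt (show 1 ≤ 3 by norm_num)
  have L := posLinear_stripInt
  have du := k.mul (h.bc_u.pow 2)
  have dv := k.mul (h.bc_v.pow 2)
  have dT := (du.const_mul (3 + z ^ 2)).add (dv.const_mul (z ^ 2)⁻¹)
  set T : ℝ → ℝ := lineInt fun ξ τ => (3 + z ^ 2) * (wt 3 ξ * u ξ τ ^ 2) +
    (z ^ 2)⁻¹ * (wt 3 ξ * v ξ τ ^ 2) with hT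
  have cT : Continuous T := dT.continuous_lineInt
  have bT : BddCont₂ fun _ τ => T τ := dT.bddCont₂_lineInt
  have hz2 : 1 ≤ z ^ 2 := one_le_pow₀ hz
  have hT1 : ∀ ξ τ, wt 3 ξ * u ξ τ ^ 2 ≤ T τ := fun ξ τ => by
    have := h.wt_mul_u_sq_le (j := 3) (by norm_num) (a := z ^ 2) (by positivity) ξ τ
    exact_mod_cast this
  have iT : ∫ τ in (0 : ℝ)..(2 * Real.pi), T τ ≤ 5 * B * z ^ 6 := by
    have e : ∫ τ in (0 : ℝ)..(2 * Real.pi), T τ = (3 + z ^ 2) *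
        stripInt (fun ξ τ => wt 3 ξ * u ξ τ ^ 2) +
        (z ^ 2)⁻¹ * stripInt (fun ξ τ => wt 3 ξ * v ξ τ ^ 2) :=
      L.eq₂ _ _ du dv fun _ _ => rfl
    rw [e]
    have a1 : (z ^ 2)⁻¹ * stripInt (fun ξ τ => wt 3 ξ * v ξ τ ^ 2) ≤ z ^ 6 := by
      calc _ ≤ (z ^ 2)⁻¹ * z ^ 8 := by gcongr
        _ = _ := by field_simp
    have a2 : (3 + z ^ 2) * stripInt (fun ξ τ => wt 3 ξ * u ξ τ ^ 2) ≤
        (4 * z ^ 2) * (B * z ^ 4) := by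
      calc _ ≤ (3 + z ^ 2) * (B * z ^ 4) := by gcongr
        _ ≤ _ := by gcongr; linarith
    have a3 : z ^ 6 ≤ B * z ^ 6 := le_mul_of_one_le_left (by positivity) hB
    calc _ ≤ (4 * z ^ 2) * (B * z ^ 4) + z ^ 6 := add_le_add a2 a1
      _ ≤ _ := by linarith
  set m : ℝ → ℝ := fun τ => z ^ 3 / 2 + (z ^ 3)⁻¹ / 2 * T τ with hm
  have bm : BddCont₂ fun _ τ => m τ := (BddCont₂.const _).add (bT.const_mul _)
  have T0 : ∀ τ, 0 ≤ T τ := fun τ =>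
    (mul_nonneg (wt_pos 3 0).le (sq_nonneg _)).trans (hT1 0 τ)
  have m0 : ∀ τ, 0 ≤ m τ := fun τ => by have := T0 τ; positivity
  have h1 : stripInt (fun ξ τ => wt 6 ξ * |u ξ τ| ^ 3) ≤
      stripInt (fun ξ τ => wt 3 ξ * (u ξ τ ^ 2 * m τ)) := by
    refine L.mono ((isWeight_wt (by norm_num)).mul (h.bc_u.abs.pow 3))
      (k.mul ((h.bc_u.pow 2).mul bm)) fun ξ τ => ?_
    have hk := wt_pos 3 ξ
    have hk1 := wt_le_one 3 ξ
    have e : wt 6 ξ = wt 3 ξ * wt 3 ξ := wt_add 3 3 ξ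
    have y := (le_abs_self _).trans (young (a := z ^ 3) (by positivity) 1 (wt 3 ξ * |u ξ τ|))
    have y2 : (wt 3 ξ * |u ξ τ|) ^ 2 ≤ T τ := by
      rw [mul_pow, sq_abs]
      calc _ = wt 3 ξ * (wt 3 ξ * u ξ τ ^ 2) := by ring
        _ ≤ 1 * (wt 3 ξ * u ξ τ ^ 2) := by gcongr
        _ ≤ _ := by rw [one_mul]; exact hT1 ξ τ
    have y3 : wt 3 ξ * |u ξ τ| ≤ m τ := by
      rw [one_mul, one_pow, mul_one] at y
      refine y.trans (add_le_add_right ?_ _)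
      gcongr
    calc _ = (wt 3 ξ * u ξ τ ^ 2) * (wt 3 ξ * |u ξ τ|) := by rw [e, ← sq_abs (u ξ τ)]; ring
      _ ≤ (wt 3 ξ * u ξ τ ^ 2) * m τ := by gcongr
      _ = _ := by ring
  have h2 : stripInt (fun ξ τ => wt 3 ξ * (u ξ τ ^ 2 * m τ)) ≤
      ∫ τ in (0 : ℝ)..(2 * Real.pi), 12 * (B ^ 3 * z ^ 4) * m τ := by
    unfold stripInt
    have cm : Continuous m := by fun_prop
    refine intervalIntegral.integral_mono_on Real.two_pi_pos.le
      ((k.mul ((h.bc_u.pow 2).mul bm)).continuous_lineInt.intervalIntegrable _ _)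
      (Continuous.intervalIntegrable (by fun_prop) _ _) fun τ _ => ?_
    have e : lineInt (fun ξ τ => wt 3 ξ * (u ξ τ ^ 2 * m τ)) τ =
        lineInt (fun ξ τ => wt 3 ξ * u ξ τ ^ 2) τ * m τ := by
      unfold lineInt
      rw [← integral_mul_const]
      simp only [mul_assoc]
    rw [e]
    exact mul_le_mul_of_nonneg_right (hN τ) (m0 τ)
  have h3 : ∫ τ in (0 : ℝ)..(2 * Real.pi), 12 * (B ^ 3 * z ^ 4) * m τ ≤
      12 * (B ^ 3 * z ^ 4) * (z ^ 3 / 2 * B + (z ^ 3)⁻¹ / 2 * (5 * B * z ^ 6)) := by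
    rw [intervalIntegral.integral_const_mul, hm, intervalIntegral.integral_add
      (continuous_const.intervalIntegrable _ _) ((cT.const_mul _).intervalIntegrable _ _),
      intervalIntegral.integral_const_mul, intervalIntegral.integral_const, smul_eq_mul, sub_zero]
    have hB0 : 0 ≤ B := by linarith
    refine mul_le_mul_of_nonneg_left ?_ (by positivity)
    rw [mul_comm (2 * Real.pi)]
    gcongr
  refine h1.trans (h2.trans (h3.trans (le_of_eq ?_)))
  field_simp
  ring

end Interpolation

/-- The local energy bound. -/
theorem stripInt_v_u_le (h : SmoothSol ω s I u v θ w g uτ vτ gξ) {B p : ℝ} (hB : 1 ≤ B)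
    (hω : ω ≠ 0) (hωB : |ω|⁻¹ ≤ B) (hs : |s| ≤ B) (hp : p ≠ 0)
    (hq : (2 * (1 + p ^ 2)) ^ 3 ≤ B) (hpB : |p|⁻¹ ≤ B)
    (hm : ∀ τ, |lineInt (fun ξ τ => avgWt p 1 ξ * u ξ τ) τ| ≤ B)
    (hw : stripInt (fun ξ τ => wt 1 ξ * w ξ τ ^ 2) ≤ B)
    (hc : 2 * Real.pi * ∫ ξ, wt 3 ξ ≤ B) (hc6 : (∫ ξ, wt 6 ξ)⁻¹ ≤ B) (hpi : 2 * Real.pi ≤ B) :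
    stripInt (fun ξ τ => wt 3 ξ * v ξ τ ^ 2) + stripInt (fun ξ τ => wt 3 ξ * u ξ τ ^ 4) ≤
      (49 * B ^ 7) ^ 8 := by
  have k := isWeight_wt (show 1 ≤ 3 by norm_num)
  have k6 := isWeight_wt (show 1 ≤ 6 by norm_num)
  have L := posLinear_stripInt
  have hB0 : 0 < B := by linarith
  have du := k.mul (h.bc_u.pow 2)
  have dv := k.mul (h.bc_v.pow 2)
  have du4 := k.mul (h.bc_u.pow 4)
  have d1 := k.mul (BddCont₂.const 1)
  have bθ := h.bc_θ.sub (h.bc_θ.slice 0)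
  have dθ := k.mul (bθ.pow 2)
  have V0 : 0 ≤ stripInt (fun ξ τ => wt 3 ξ * v ξ τ ^ 2) :=
    L.nonneg dv fun ξ τ => mul_nonneg (wt_pos _ _).le (sq_nonneg _)
  have U0 : 0 ≤ stripInt (fun ξ τ => wt 3 ξ * u ξ τ ^ 4) :=
    L.nonneg du4 fun ξ τ => mul_nonneg (wt_pos _ _).le (by positivity)
  -- The unknown energy is written as an eighth power to make the interpolation exponents integers.
  -- The aim is to bound it by a multiple of `z ^ 7`.
  obtain ⟨z, hz, hz8⟩ : ∃ z : ℝ, 1 ≤ z ∧ z ^ 8 = 1 + (stripInt (fun ξ τ => wt 3 ξ * v ξ τ ^ 2) +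
      stripInt (fun ξ τ => wt 3 ξ * u ξ τ ^ 4)) := by
    refine ⟨(1 + (stripInt (fun ξ τ => wt 3 ξ * v ξ τ ^ 2) +
      stripInt (fun ξ τ => wt 3 ξ * u ξ τ ^ 4))) ^ ((8 : ℕ) : ℝ)⁻¹,
      Real.one_le_rpow (by linarith) (by positivity),
      Real.rpow_inv_natCast_pow (by linarith) (by norm_num)⟩
  have hv8 : stripInt (fun ξ τ => wt 3 ξ * v ξ τ ^ 2) ≤ z ^ 8 := by linarith
  have hu8 : stripInt (fun ξ τ => wt 3 ξ * u ξ τ ^ 4) ≤ z ^ 8 := by linarith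
  have hu2 := h.interpolation_sq hB hz hc hu8
  have hN := h.interpolation_sup hB hz hω hωB hs hw hu2 hv8
  have hX := h.interpolation_cube hB hz hpi hu2 hv8 hN
  have hΘ := h.stripInt_θ_sub_sq_le
  have mono : ∀ {i j : ℕ}, i ≤ 6 → j ≤ 7 → B ^ i * z ^ j ≤ B ^ 6 * z ^ 7 := fun hi hj =>
    mul_le_mul (pow_le_pow_right₀ hB hi) (pow_le_pow_right₀ hz hj) (by positivity) (by positivity)
  have mono5 : ∀ {i j : ℕ}, i ≤ 5 → j ≤ 7 → B ^ i * z ^ j ≤ B ^ 5 * z ^ 7 := fun hi hj =>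
    mul_le_mul (pow_le_pow_right₀ hB hi) (pow_le_pow_right₀ hz hj) (by positivity) (by positivity)
  have hΘ2 : stripInt (fun ξ τ => wt 3 ξ * (θ ξ τ - θ 0 τ) ^ 2) ≤ B ^ 2 := by
    refine hΘ.trans ?_
    calc _ ≤ Real.pi / 2 * B := by gcongr
      _ ≤ B * B := by gcongr; linarith [Real.pi_pos]
      _ = _ := by ring
  -- the part with `θ 0`
  set m : ℝ → ℝ := lineInt fun ξ τ => avgWt p 1 ξ * u ξ τ with hmdef
  have hρ := isWeight_avgWt hp 1
  have bm : BddCont₂ fun _ τ => m τ := (hρ.mul h.bc_u).bddCont₂_lineInt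
  have hm2 : ∀ τ, m τ ^ 2 ≤ B ^ 2 := fun τ => by
    rw [← sq_abs]; exact pow_le_pow_left₀ (abs_nonneg _) (hm τ) 2
  -- The function `θ(0, τ)` is not controlled by `w`. It enters the energy identity only through its
  -- integral against `m`, which is bounded; testing the equation of `v_ξ` with `wt 6 ξ * m τ`
  -- expresses this integral by controlled terms.
  have hJ := h.integral_wt_mul_stripInt_θ hρ hmdef
  have w63 : ∀ ξ, wt 6 ξ ≤ wt 3 ξ := wt_anti (by norm_num)
  have a1 : stripInt (fun ξ τ => wt' 6 ξ * (m τ * v ξ τ)) ≤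
      3 * z ^ 4 * B ^ 2 * stripInt (fun ξ _ => wt 3 ξ * 1) +
        3 * (z ^ 4)⁻¹ * stripInt (fun ξ τ => wt 3 ξ * v ξ τ ^ 2) := by
    refine L.le₂ _ _ ((isWeight_wt' (by norm_num)).mul (bm.mul h.bc_v)) d1 dv fun ξ τ => ?_
    have y := young (a := z ^ 4) (by positivity) (m τ) (v ξ τ)
    have hk := abs_wt'_le 6 ξ
    push_cast at hk
    have hk2 := w63 ξ
    have hk3 := wt_pos 3 ξ
    have := hm2 τ
    calc _ ≤ |wt' 6 ξ * (m τ * v ξ τ)| := le_abs_self _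
      _ = |wt' 6 ξ| * |m τ * v ξ τ| := abs_mul _ _
      _ ≤ (6 * wt 3 ξ) * (z ^ 4 / 2 * B ^ 2 + (z ^ 4)⁻¹ / 2 * v ξ τ ^ 2) :=
          mul_le_mul (by linarith) (y.trans (by gcongr)) (abs_nonneg _) (by positivity)
      _ = _ := by ring
  have a2 : stripInt (fun ξ τ => wt 6 ξ * (m τ * dG (u ξ τ))) ≤
      B ^ 2 / 2 * stripInt (fun ξ _ => wt 3 ξ * 1) +
        1 / 2 * stripInt (fun ξ τ => wt 3 ξ * u ξ τ ^ 2) +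
        B * stripInt (fun ξ τ => wt 6 ξ * |u ξ τ| ^ 3) := by
    refine L.le₃ _ _ _ (k6.mul (bm.mul h.bc_u.dG)) d1 du (k6.mul (h.bc_u.abs.pow 3))
      fun ξ τ => ?_
    have y := young one_pos (m τ) (u ξ τ)
    have hk2 := w63 ξ
    have hk6 := wt_pos 6 ξ
    have hm1 := hm2 τ
    have y1 : -(m τ * u ξ τ) ≤ B ^ 2 / 2 + u ξ τ ^ 2 / 2 := by
      have := neg_le_abs (m τ * u ξ τ)
      rw [inv_one] at y
      linarith
    have y2 : m τ * u ξ τ ^ 3 ≤ B * |u ξ τ| ^ 3 := by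
      calc _ ≤ |m τ * u ξ τ ^ 3| := le_abs_self _
        _ = |m τ| * |u ξ τ| ^ 3 := by rw [abs_mul, abs_pow]
        _ ≤ _ := by gcongr; exact hm τ
    calc _ = wt 6 ξ * (-(m τ * u ξ τ)) + wt 6 ξ * (m τ * u ξ τ ^ 3) := by unfold dG; ring
      _ ≤ wt 6 ξ * (B ^ 2 / 2 + u ξ τ ^ 2 / 2) + wt 6 ξ * (B * |u ξ τ| ^ 3) := by gcongr
      _ ≤ wt 3 ξ * (B ^ 2 / 2 + u ξ τ ^ 2 / 2) + wt 6 ξ * (B * |u ξ τ| ^ 3) := by gcongr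
      _ = _ := by ring
  have a3 : stripInt (fun ξ τ => wt 6 ξ * (m τ * (θ ξ τ - θ 0 τ))) ≤
      B ^ 2 / 2 * stripInt (fun ξ _ => wt 3 ξ * 1) +
        1 / 2 * stripInt (fun ξ τ => wt 3 ξ * (θ ξ τ - θ 0 τ) ^ 2) := by
    refine L.le₂ _ _ (k6.mul (bm.mul bθ)) d1 dθ fun ξ τ => ?_
    have y := (le_abs_self _).trans (young one_pos (m τ) (θ ξ τ - θ 0 τ))
    have hk2 := w63 ξ
    have hk6 := wt_pos 6 ξ
    have hm1 := hm2 τ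
    rw [inv_one] at y
    calc _ ≤ wt 6 ξ * (B ^ 2 / 2 + (θ ξ τ - θ 0 τ) ^ 2 / 2) := by gcongr; linarith
      _ ≤ wt 3 ξ * (B ^ 2 / 2 + (θ ξ τ - θ 0 τ) ^ 2 / 2) := by gcongr
      _ = _ := by ring
  rw [stripInt_wt] at a1 a2 a3
  have vz : (z ^ 4)⁻¹ * stripInt (fun ξ τ => wt 3 ξ * v ξ τ ^ 2) ≤ z ^ 4 := by
    calc _ ≤ (z ^ 4)⁻¹ * z ^ 8 := by gcongr
      _ = _ := by field_simp
  have cB : ∀ c : ℝ, 0 ≤ c → c * (2 * Real.pi * ∫ ξ, wt 3 ξ) ≤ c * B := fun c hc0 => by gcongr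
  have sumJ : -((∫ ξ, wt 6 ξ) * stripInt (fun ξ τ => avgWt p 1 ξ * (u ξ τ * θ 0 τ))) ≤
      44 * (B ^ 5 * z ^ 7) := by
    have b1 := cB (3 * z ^ 4 * B ^ 2) (by positivity)
    have b2 := cB (B ^ 2 / 2) (by positivity)
    have b3 : B * stripInt (fun ξ τ => wt 6 ξ * |u ξ τ| ^ 3) ≤ B * (36 * (B ^ 4 * z ^ 7)) := by
      gcongr
    have m1 := mono5 (i := 3) (j := 4) (by norm_num) (by norm_num)
    have m2 := mono5 (i := 0) (j := 4) (by norm_num) (by norm_num)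
    have m3 := mono5 (i := 3) (j := 0) (by norm_num) (by norm_num)
    have m4 := mono5 (i := 1) (j := 4) (by norm_num) (by norm_num)
    have m5 := mono5 (i := 2) (j := 0) (by norm_num) (by norm_num)
    rw [pow_zero] at m2 m3 m5
    rw [pow_one] at m4
    linarith
  have hJ' : -stripInt (fun ξ τ => avgWt p 1 ξ * (u ξ τ * θ 0 τ)) ≤ 44 * (B ^ 6 * z ^ 7) := by
    have c0 : 0 < ∫ ξ, wt 6 ξ := integral_wt_pos (by norm_num)
    rw [← mul_neg] at sumJ
    have := (le_div_iff₀' c0).2 sumJ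
    rw [div_eq_mul_inv] at this
    calc _ ≤ _ := this
      _ ≤ 44 * (B ^ 5 * z ^ 7) * B := by gcongr
      _ = _ := by ring
  -- the energy identity
  have hE := h.stripInt_energy hρ (isWeight_avgWt' 1) (hasDerivAt_avgWt (p := p) 1)
  have hsplit : stripInt (fun ξ τ => avgWt p 1 ξ * (u ξ τ * θ ξ τ)) =
      1 * stripInt (fun ξ τ => avgWt p 1 ξ * (u ξ τ * (θ ξ τ - θ 0 τ))) +
      1 * stripInt (fun ξ τ => avgWt p 1 ξ * (u ξ τ * θ 0 τ)) :=
    L.eq₂ 1 1 (hρ.mul (h.bc_u.mul bθ)) (hρ.mul (h.bc_u.mul (h.bc_θ.slice 0)))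
      fun ξ τ => by ring
  have ρle : ∀ ξ, avgWt p 1 ξ ≤ B * wt 3 ξ := fun ξ =>
    (avgWt_one_le hp ξ).trans (mul_le_mul_of_nonneg_right hq (wt_pos _ _).le)
  have leρ : ∀ ξ, wt 3 ξ ≤ B * avgWt p 1 ξ := fun ξ =>
    (le_avgWt_one hp ξ).trans (mul_le_mul_of_nonneg_right hq (avgWt_one_pos hp ξ).le)
  have e1 : stripInt (fun ξ τ => avgWt p 1 ξ * u ξ τ ^ 2) ≤
      B * stripInt (fun ξ τ => wt 3 ξ * u ξ τ ^ 2) :=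
    L.le₁ B (hρ.mul (h.bc_u.pow 2)) du fun ξ τ => by
      rw [← mul_assoc]; exact mul_le_mul_of_nonneg_right (ρle ξ) (sq_nonneg _)
  have e2 : -stripInt (fun ξ τ => (wt 3 ξ - wt 3 (ξ - p * 1)) / p * (u ξ τ * v ξ τ)) ≤
      B ^ 2 * z ^ 2 * stripInt (fun ξ τ => wt 3 ξ * u ξ τ ^ 2) +
        B ^ 2 * (z ^ 2)⁻¹ * stripInt (fun ξ τ => wt 3 ξ * v ξ τ ^ 2) := by
    rw [← L.neg]
    refine L.le₂ _ _ ((isWeight_avgWt' 1).mul (h.bc_u.mul h.bc_v)).neg du dv fun ξ τ => ?_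
    have y := young (a := z ^ 2) (by positivity) (u ξ τ) (v ξ τ)
    have hk := wt_pos 3 ξ
    have hk' := wt_pos 3 (ξ - p * 1)
    have s1 : wt 3 (ξ - p * 1) ≤ B * wt 3 ξ :=
      (wt_shift_le 3 (by rw [mul_one]) ξ).trans (mul_le_mul_of_nonneg_right hq hk.le)
    have s2 : |wt 3 ξ - wt 3 (ξ - p * 1)| ≤ B * wt 3 ξ := by
      have : wt 3 ξ ≤ B * wt 3 ξ := le_mul_of_one_le_left hk.le hB
      exact abs_le.2 ⟨by linarith, by linarith⟩
    have s3 : |(wt 3 ξ - wt 3 (ξ - p * 1)) / p| ≤ (B * wt 3 ξ) * B := by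
      rw [abs_div, div_eq_mul_inv]
      exact mul_le_mul s2 hpB (inv_nonneg.2 (abs_nonneg _)) (by positivity)
    calc _ ≤ |(wt 3 ξ - wt 3 (ξ - p * 1)) / p * (u ξ τ * v ξ τ)| := neg_le_abs _
      _ = |(wt 3 ξ - wt 3 (ξ - p * 1)) / p| * |u ξ τ * v ξ τ| := abs_mul _ _
      _ ≤ ((B * wt 3 ξ) * B) * (z ^ 2 * u ξ τ ^ 2 + (z ^ 2)⁻¹ * v ξ τ ^ 2) :=
          mul_le_mul s3 (y.trans (by
            have : 0 ≤ z ^ 2 * u ξ τ ^ 2 + (z ^ 2)⁻¹ * v ξ τ ^ 2 := by positivity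
            linarith)) (abs_nonneg _) (by positivity)
      _ = _ := by ring
  have e3 : -stripInt (fun ξ τ => avgWt p 1 ξ * (u ξ τ * (θ ξ τ - θ 0 τ))) ≤
      B / 2 * stripInt (fun ξ τ => wt 3 ξ * u ξ τ ^ 2) +
        B / 2 * stripInt (fun ξ τ => wt 3 ξ * (θ ξ τ - θ 0 τ) ^ 2) := by
    rw [← L.neg]
    refine L.le₂ _ _ (hρ.mul (h.bc_u.mul bθ)).neg du dθ fun ξ τ => ?_
    have y := young one_pos (u ξ τ) (θ ξ τ - θ 0 τ)
    rw [inv_one] at y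
    have hk := wt_pos 3 ξ
    calc _ ≤ |avgWt p 1 ξ * (u ξ τ * (θ ξ τ - θ 0 τ))| := neg_le_abs _
      _ = avgWt p 1 ξ * |u ξ τ * (θ ξ τ - θ 0 τ)| := by
          rw [abs_mul, abs_of_pos (avgWt_one_pos hp ξ)]
      _ ≤ (B * wt 3 ξ) * (1 / 2 * u ξ τ ^ 2 + 1 / 2 * (θ ξ τ - θ 0 τ) ^ 2) :=
          mul_le_mul (ρle ξ) y (abs_nonneg _) (by positivity)
      _ = _ := by ring
  have e4 : stripInt (fun ξ τ => wt 3 ξ * v ξ τ ^ 2) ≤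
      B * stripInt (fun ξ τ => avgWt p 1 ξ * v ξ τ ^ 2) :=
    L.le₁ B dv (hρ.mul (h.bc_v.pow 2)) fun ξ τ => by
      rw [← mul_assoc]; exact mul_le_mul_of_nonneg_right (leρ ξ) (sq_nonneg _)
  have e5 : stripInt (fun ξ τ => wt 3 ξ * u ξ τ ^ 4) ≤
      B * stripInt (fun ξ τ => avgWt p 1 ξ * u ξ τ ^ 4) :=
    L.le₁ B du4 (hρ.mul (h.bc_u.pow 4)) fun ξ τ => by
      rw [← mul_assoc]; exact mul_le_mul_of_nonneg_right (leρ ξ) (by positivity)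
  have vz2 : (z ^ 2)⁻¹ * stripInt (fun ξ τ => wt 3 ξ * v ξ τ ^ 2) ≤ z ^ 6 := by
    calc _ ≤ (z ^ 2)⁻¹ * z ^ 8 := by gcongr
      _ = _ := by field_simp
  have tot : stripInt (fun ξ τ => avgWt p 1 ξ * v ξ τ ^ 2) +
      stripInt (fun ξ τ => avgWt p 1 ξ * u ξ τ ^ 4) ≤ 48 * (B ^ 6 * z ^ 7) := by
    rw [hE, hsplit]
    have f1 : B * stripInt (fun ξ τ => wt 3 ξ * u ξ τ ^ 2) ≤ B * (B * z ^ 4) := by gcongr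
    have f2 : B ^ 2 * z ^ 2 * stripInt (fun ξ τ => wt 3 ξ * u ξ τ ^ 2) ≤
        B ^ 2 * z ^ 2 * (B * z ^ 4) := by gcongr
    have f3 : B ^ 2 * (z ^ 2)⁻¹ * stripInt (fun ξ τ => wt 3 ξ * v ξ τ ^ 2) ≤ B ^ 2 * z ^ 6 := by
      rw [mul_assoc]; gcongr
    have f4 : B / 2 * stripInt (fun ξ τ => wt 3 ξ * (θ ξ τ - θ 0 τ) ^ 2) ≤ B / 2 * B ^ 2 := by
      gcongr
    have m1 := mono (i := 2) (j := 4) (by norm_num) (by norm_num)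
    have m2 := mono (i := 3) (j := 6) (by norm_num) (by norm_num)
    have m3 := mono (i := 2) (j := 6) (by norm_num) (by norm_num)
    have m4 := mono (i := 3) (j := 0) (by norm_num) (by norm_num)
    rw [pow_zero] at m4
    linarith
  have fin : stripInt (fun ξ τ => wt 3 ξ * v ξ τ ^ 2) +
      stripInt (fun ξ τ => wt 3 ξ * u ξ τ ^ 4) ≤ 48 * B ^ 7 * z ^ 7 := by
    have := mul_le_mul_of_nonneg_left tot hB0.le
    linarith
  -- The energy is bounded by a strictly lower power of itself, which bounds `z`.
  have hz7 : z ^ 8 ≤ (49 * B ^ 7) * z ^ 7 := by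
    have : 1 ≤ B ^ 7 * z ^ 7 := one_le_mul_of_one_le_of_one_le (one_le_pow₀ hB) (one_le_pow₀ hz)
    linarith
  have hzle : z ≤ 49 * B ^ 7 := by
    have h7 : 0 < z ^ 7 := by positivity
    rw [pow_succ, mul_comm] at hz7
    exact le_of_mul_le_mul_right hz7 h7
  have : z ^ 8 ≤ (49 * B ^ 7) ^ 8 := pow_le_pow_left₀ (by linarith) hzle 8
  linarith

end SmoothSol

/-! ### From the local energy to local bounds of `θ`, `v_ξ`, and `u` itself. -/

theorem lineInt_mul (F : ℝ → ℝ → ℝ) (m : ℝ → ℝ) (τ : ℝ) :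
    lineInt (fun ξ τ => F ξ τ * m τ) τ = lineInt F τ * m τ := integral_mul_const _ _

theorem stripInt_mul_le {F : ℝ → ℝ → ℝ} {m : ℝ → ℝ} {A : ℝ} (hF : Decays F)
    (hm : BddCont₂ fun _ τ => m τ) (m0 : ∀ τ, 0 ≤ m τ) (hA : ∀ τ, lineInt F τ ≤ A) :
    stripInt (fun ξ τ => F ξ τ * m τ) ≤ A * ∫ τ in (0 : ℝ)..(2 * Real.pi), m τ := by
  have cm : Continuous m := continuous_uncurry_left hm.1 0
  unfold stripInt
  rw [← intervalIntegral.integral_const_mul]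
  refine intervalIntegral.integral_mono_on Real.two_pi_pos.le
    ((hF.mul_bdd hm).continuous_lineInt.intervalIntegrable _ _)
    ((cm.const_mul A).intervalIntegrable _ _) fun τ _ => ?_
  rw [lineInt_mul]
  exact mul_le_mul_of_nonneg_right (hA τ) (m0 τ)

theorem lineInt_nonneg {F : ℝ → ℝ → ℝ} (h : ∀ ξ τ, 0 ≤ F ξ τ) (τ : ℝ) : 0 ≤ lineInt F τ :=
  integral_nonneg fun ξ => h ξ τ

theorem wt_sq_nonneg (j : ℕ) (f : ℝ → ℝ → ℝ) (ξ τ : ℝ) : 0 ≤ wt j ξ * f ξ τ ^ 2 :=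
  mul_nonneg (wt_pos j ξ).le (sq_nonneg _)

namespace SmoothSol

variable {ω s I : ℝ} {u v θ w g uτ vτ gξ : ℝ → ℝ → ℝ} {A : ℝ}

theorem lineInt_wt_u_le (h : SmoothSol ω s I u v θ w g uτ vτ gξ)
    (hN : ∀ τ, lineInt (fun ξ τ => wt 3 ξ * u ξ τ ^ 2) τ ≤ A) {j : ℕ} (hj : 3 ≤ j) (τ : ℝ) :
    lineInt (fun ξ τ => wt j ξ * u ξ τ ^ 2) τ ≤ A :=
  ((posLinear_lineInt τ).mono ((isWeight_wt (by omega)).mul (h.bc_u.pow 2))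
    ((isWeight_wt (by norm_num)).mul (h.bc_u.pow 2)) fun ξ _ =>
      mul_le_mul_of_nonneg_right (wt_anti hj ξ) (sq_nonneg _)).trans (hN τ)

/-- A pointwise bound of `u ^ 4`. -/
theorem wt_mul_u_sq_sq_le (h : SmoothSol ω s I u v θ w g uτ vτ gξ) (hA : 1 ≤ A)
    (hN : ∀ τ, lineInt (fun ξ τ => wt 3 ξ * u ξ τ ^ 2) τ ≤ A) {j : ℕ} (hj : 3 ≤ j) (ξ τ : ℝ) :
    (wt j ξ * u ξ τ ^ 2) ^ 2 ≤
      ((j + 2) * A) ^ 2 * (1 + lineInt (fun ξ τ => wt j ξ * v ξ τ ^ 2) τ) := by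
  have k := isWeight_wt (show 1 ≤ j by omega)
  set D := lineInt (fun ξ τ => wt j ξ * v ξ τ ^ 2) τ with hD
  have D0 : 0 ≤ D := lineInt_nonneg (wt_sq_nonneg j v) τ
  -- This parameter balances the terms `a ∫ u²` and `a⁻¹ ∫ v²` of the pointwise bound.
  set a := √(1 + D) with ha
  have ha1 : 1 ≤ a := Real.one_le_sqrt.2 (by linarith)
  have ha2 : a ^ 2 = 1 + D := Real.sq_sqrt (by linarith)
  have h1 := h.wt_mul_u_sq_le (show 1 ≤ j by omega) (a := a) (by linarith) ξ τ
  rw [(posLinear_lineInt τ).eq₂ (j + a) a⁻¹ (k.mul (h.bc_u.pow 2)) (k.mul (h.bc_v.pow 2))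
    fun _ _ => rfl] at h1
  have h2 := h.lineInt_wt_u_le hN hj τ
  have h3 : a⁻¹ * D ≤ a := by
    rw [inv_mul_le_iff₀ (by linarith)]
    nlinarith
  have h4 : wt j ξ * u ξ τ ^ 2 ≤ ((j + 2) * A) * a := by
    have hj0 : (0 : ℝ) ≤ j := j.cast_nonneg
    calc _ ≤ _ := h1
      _ ≤ (j + a) * A + a := by gcongr
      _ ≤ (j * a + a) * (A) + a * A := by
          have : (j : ℝ) ≤ j * a := le_mul_of_one_le_right hj0 ha1
          have h5 : a ≤ a * A := le_mul_of_one_le_right (by linarith) hA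
          gcongr
      _ = _ := by ring
  calc _ ≤ (((j + 2) * A) * a) ^ 2 := pow_le_pow_left₀ (wt_sq_nonneg j u ξ τ) h4 2
    _ = _ := by rw [mul_pow, ha2]

/-- Bounds of the right-hand side of the second equation. -/
theorem stripInt_θ_le (h : SmoothSol ω s I u v θ w g uτ vτ gξ) (hA : 1 ≤ A)
    (hpi : 2 * Real.pi ≤ A) (hc : 2 * Real.pi * ∫ ξ, wt 3 ξ ≤ A) (hc6 : (∫ ξ, wt 6 ξ)⁻¹ ≤ A)
    (hw : stripInt (fun ξ τ => wt 1 ξ * w ξ τ ^ 2) ≤ A)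
    (hv : stripInt (fun ξ τ => wt 3 ξ * v ξ τ ^ 2) ≤ A)
    (hu : stripInt (fun ξ τ => wt 3 ξ * u ξ τ ^ 2) ≤ A)
    (hN : ∀ τ, lineInt (fun ξ τ => wt 3 ξ * u ξ τ ^ 2) τ ≤ A) :
    stripInt (fun ξ τ => wt 3 ξ * θ ξ τ ^ 2) ≤ 141 * A ^ 8 ∧
      stripInt (fun ξ τ => wt 9 ξ * (g ξ τ + θ ξ τ) ^ 2) ≤ 486 * A ^ 8 := by
  have k := isWeight_wt (show 1 ≤ 3 by norm_num)
  have k6 := isWeight_wt (show 1 ≤ 6 by norm_num)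
  have k9 := isWeight_wt (show 1 ≤ 9 by norm_num)
  have L := posLinear_stripInt
  have du := k.mul (h.bc_u.pow 2)
  have dv := k.mul (h.bc_v.pow 2)
  have bθ := h.bc_θ.sub (h.bc_θ.slice 0)
  have dθ := k.mul (bθ.pow 2)
  have w93 : ∀ ξ, wt 9 ξ ≤ wt 3 ξ := wt_anti (by norm_num)
  have A4 : A ≤ A ^ 4 := le_self_pow₀ hA (by norm_num)
  -- sixth powers
  have h6 : stripInt (fun ξ τ => wt 9 ξ * u ξ τ ^ 6) ≤ 50 * A ^ 4 := by
    set m : ℝ → ℝ := fun τ => ((3 + 2) * A) ^ 2 *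
      (1 + lineInt (fun ξ τ => wt 3 ξ * v ξ τ ^ 2) τ) with hm
    have bm : BddCont₂ fun _ τ => m τ := ((BddCont₂.const 1).add dv.bddCont₂_lineInt).const_mul _
    have m0 : ∀ τ, 0 ≤ m τ := fun τ => by
      have := lineInt_nonneg (wt_sq_nonneg 3 v) τ
      positivity
    have h1 : stripInt (fun ξ τ => wt 9 ξ * u ξ τ ^ 6) ≤
        stripInt fun ξ τ => (wt 3 ξ * u ξ τ ^ 2) * m τ := by
      refine L.mono (k9.mul (h.bc_u.pow 6)) (du.mul_bdd bm) fun ξ τ => ?_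
      have := h.wt_mul_u_sq_sq_le hA hN (le_refl 3) ξ τ
      push_cast at this
      calc _ = (wt 3 ξ * u ξ τ ^ 2) * (wt 3 ξ * u ξ τ ^ 2) ^ 2 := by
            rw [show 9 = 3 + 3 + 3 from rfl, wt_add, wt_add]; ring
        _ ≤ _ := mul_le_mul_of_nonneg_left this (wt_sq_nonneg 3 u ξ τ)
    have h2 := stripInt_mul_le du bm m0 hN
    have h3 : ∫ τ in (0 : ℝ)..(2 * Real.pi), m τ =
        ((3 + 2) * A) ^ 2 * (2 * Real.pi + stripInt fun ξ τ => wt 3 ξ * v ξ τ ^ 2) := by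
      rw [hm, intervalIntegral.integral_const_mul, intervalIntegral.integral_add
        (continuous_const.intervalIntegrable _ _) (dv.continuous_lineInt.intervalIntegrable _ _)]
      simp [stripInt]
    rw [h3] at h2
    calc _ ≤ _ := h1.trans h2
      _ ≤ A * (((3 + 2) * A) ^ 2 * (A + A)) := by gcongr
      _ = _ := by ring
  have hg : stripInt (fun ξ τ => wt 9 ξ * g ξ τ ^ 2) ≤ 102 * A ^ 4 := by
    have h1 := stripInt_weight_le k9 (fun x => (wt_pos 9 x).le) (h.bc_g.pow 2) (h.bc_u.dG.pow 2)
      h.integral_g_sq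
    have h2 := L.le₂ 2 2 (k9.mul (h.bc_u.dG.pow 2)) du (k9.mul (h.bc_u.pow 6)) (fun ξ τ => by
      have := w93 ξ
      have hk := wt_pos 9 ξ
      calc wt 9 ξ * dG (u ξ τ) ^ 2 ≤ wt 9 ξ * (2 * u ξ τ ^ 2 + 2 * u ξ τ ^ 6) := by
            refine mul_le_mul_of_nonneg_left ?_ hk.le
            unfold dG
            nlinarith [sq_nonneg (u ξ τ + u ξ τ ^ 3)]
        _ = 2 * (wt 9 ξ * u ξ τ ^ 2) + 2 * (wt 9 ξ * u ξ τ ^ 6) := by ring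
        _ ≤ _ := by gcongr)
    linarith
  have hΘ : stripInt (fun ξ τ => wt 3 ξ * (θ ξ τ - θ 0 τ) ^ 2) ≤ A ^ 2 := by
    refine h.stripInt_θ_sub_sq_le.trans ?_
    calc _ ≤ Real.pi / 2 * A := by gcongr
      _ ≤ A * A := by gcongr; linarith [Real.pi_pos]
      _ = _ := by ring
  -- the values at `0`
  have c0 : 0 < ∫ ξ, wt 6 ξ := integral_wt_pos (by norm_num)
  have c1 : 0 < ∫ ξ, wt 3 ξ := integral_wt_pos (by norm_num)
  have c1A : 3 * ∫ ξ, wt 3 ξ ≤ A := by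
    refine le_trans ?_ hc
    gcongr
    linarith [Real.pi_gt_three]
  have dv9 := k9.mul (h.bc_v.pow 2)
  have dg9 := k9.mul (h.bc_g.pow 2)
  have dθ9 := k9.mul (bθ.pow 2)
  set Q : ℝ → ℝ := lineInt fun ξ τ => (36 * (wt 9 ξ * v ξ τ ^ 2) + wt 9 ξ * g ξ τ ^ 2) +
    wt 9 ξ * (θ ξ τ - θ 0 τ) ^ 2 with hQ
  have dQ := ((dv9.const_mul 36).add dg9).add dθ9
  have hQ0 : ∀ τ, (θ 0 τ) ^ 2 ≤ A ^ 3 * Q τ := by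
    intro τ
    have Lτ := posLinear_lineInt τ
    have f1 := (isWeight_wt' (show 1 ≤ 6 by norm_num)).mul h.bc_v
    have f2 := k6.mul h.bc_g
    have f3 := k6.mul (h.bc_θ.slice 0)
    have f4 := k6.mul bθ
    have e1 := lineInt_deriv (k6.mul h.bc_v) (((f1.add f2).add f4).add f3)
      (fun ξ τ => ((hasDerivAt_wt 6 ξ).mul (h.v_ξ ξ τ)).congr_deriv (by ring)) τ
    rw [Lτ.add ((f1.add f2).add f4) f3, lineInt_wt_mul 6 fun τ => θ 0 τ] at e1
    -- Again the Cauchy-Schwarz inequality by a discriminant, for `θ(0, τ)` as expressed by the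
    -- integrated equation of `v_ξ` on the line of this `τ`. The weights split as `(wt 6)² = wt 3 *
    -- wt 9`.
    have quad : ∀ c : ℝ, 0 ≤ (3 * ∫ ξ, wt 3 ξ) * (c * c) +
        (-(2 * ((∫ ξ, wt 6 ξ) * θ 0 τ))) * c + Q τ := by
      intro c
      have d1 := k.mul (BddCont₂.const 1)
      have := Lτ.le₂ (3 * c ^ 2) 1 (((f1.add f2).add f4).const_mul (-(2 * c))) d1 dQ (fun ξ τ => by
        have hk3 := wt_pos 3 ξ
        have hk6 := wt_pos 6 ξ
        have e6 : wt 6 ξ = wt 3 ξ * wt 3 ξ := wt_add 3 3 ξ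
        have e9 : wt 9 ξ = wt 3 ξ * wt 6 ξ := wt_add 3 6 ξ
        have hb : ∀ x : ℝ, 2 * (|c| * |x|) * wt 6 ξ ≤ wt 3 ξ * c ^ 2 + wt 9 ξ * x ^ 2 := by
          intro x
          rw [e9, e6, ← sq_abs c, ← sq_abs x]
          nlinarith [mul_nonneg hk3.le (sq_nonneg (|c| - wt 3 ξ * |x|))]
        have b1 := hb (6 * v ξ τ)
        have b2 := hb (g ξ τ)
        have b3 := hb (θ ξ τ - θ 0 τ)
        have w6 := abs_wt'_le 6 ξ
        push_cast at w6
        rw [abs_mul, abs_of_pos (show (0 : ℝ) < 6 by norm_num)] at b1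
        have t1 : -(2 * c) * (wt' 6 ξ * v ξ τ) ≤ 2 * (|c| * (6 * |v ξ τ|)) * wt 6 ξ := by
          calc _ ≤ |-(2 * c) * (wt' 6 ξ * v ξ τ)| := le_abs_self _
            _ = 2 * |c| * |v ξ τ| * |wt' 6 ξ| := by
                rw [abs_mul, abs_neg, abs_mul, abs_mul, abs_two]; ring
            _ ≤ 2 * |c| * |v ξ τ| * (6 * wt 6 ξ) := by gcongr
            _ = _ := by ring
        have t2 : ∀ x : ℝ, -(2 * c) * (wt 6 ξ * x) ≤ 2 * (|c| * |x|) * wt 6 ξ := by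
          intro x
          calc _ ≤ |-(2 * c) * (wt 6 ξ * x)| := le_abs_self _
            _ = _ := by
                rw [abs_mul, abs_neg, abs_mul, abs_mul, abs_two, abs_of_pos hk6]; ring
        have t3 := t2 (g ξ τ)
        have t4 := t2 (θ ξ τ - θ 0 τ)
        linarith)
      rw [Lτ.const_mul, lineInt_wt_mul 3 fun _ => 1, eq_neg_of_add_eq_zero_left e1, ← hQ] at this
      linarith
    have hd := discrim_le_zero quad
    unfold discrim at hd
    have h1 : ((∫ ξ, wt 6 ξ) * θ 0 τ) ^ 2 ≤ (3 * ∫ ξ, wt 3 ξ) * Q τ := by linarith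
    have Q0 : 0 ≤ Q τ := lineInt_nonneg (fun ξ τ => by
      have := wt_pos 9 ξ
      positivity) τ
    calc θ 0 τ ^ 2 = ((∫ ξ, wt 6 ξ)⁻¹) ^ 2 * ((∫ ξ, wt 6 ξ) * θ 0 τ) ^ 2 := by field_simp
      _ ≤ A ^ 2 * (A * Q τ) := by
          gcongr
          exact h1.trans (by gcongr)
      _ = _ := by ring
  have iQ : ∫ τ in (0 : ℝ)..(2 * Real.pi), Q τ ≤ 139 * A ^ 4 := by
    have e : ∫ τ in (0 : ℝ)..(2 * Real.pi), Q τ =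
        36 * stripInt (fun ξ τ => wt 9 ξ * v ξ τ ^ 2) +
        1 * stripInt (fun ξ τ => wt 9 ξ * g ξ τ ^ 2) +
        1 * stripInt (fun ξ τ => wt 9 ξ * (θ ξ τ - θ 0 τ) ^ 2) :=
      L.eq₃ 36 1 1 dv9 dg9 dθ9 fun ξ τ => by ring
    have e1 : stripInt (fun ξ τ => wt 9 ξ * v ξ τ ^ 2) ≤ A :=
      (L.mono dv9 dv fun ξ τ => mul_le_mul_of_nonneg_right (w93 ξ) (sq_nonneg _)).trans hv
    have e2 : stripInt (fun ξ τ => wt 9 ξ * (θ ξ τ - θ 0 τ) ^ 2) ≤ A ^ 2 :=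
      (L.mono dθ9 dθ fun ξ τ => mul_le_mul_of_nonneg_right (w93 ξ) (sq_nonneg _)).trans hΘ
    have A24 : A ^ 2 ≤ A ^ 4 := pow_le_pow_right₀ hA (by norm_num)
    rw [e]
    linarith
  have cθ0 : Continuous fun τ => θ 0 τ := continuous_uncurry_left h.bc_θ.1 0
  have iθ0 : ∫ τ in (0 : ℝ)..(2 * Real.pi), θ 0 τ ^ 2 ≤ 139 * A ^ 7 := by
    calc _ ≤ ∫ τ in (0 : ℝ)..(2 * Real.pi), A ^ 3 * Q τ :=
          intervalIntegral.integral_mono_on Real.two_pi_pos.le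
            ((cθ0.pow 2).intervalIntegrable _ _)
            ((dQ.continuous_lineInt.const_mul _).intervalIntegrable _ _) fun τ _ => hQ0 τ
      _ = A ^ 3 * ∫ τ in (0 : ℝ)..(2 * Real.pi), Q τ := intervalIntegral.integral_const_mul _ _
      _ ≤ A ^ 3 * (139 * A ^ 4) := by gcongr
      _ = _ := by ring
  have hθ : stripInt (fun ξ τ => wt 3 ξ * θ ξ τ ^ 2) ≤ 141 * A ^ 8 := by
    have h1 := L.le₂ 2 2 (k.mul (h.bc_θ.pow 2)) dθ (k.mul ((h.bc_θ.slice 0).pow 2))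
      (fun ξ τ => by
        have hk := wt_pos 3 ξ
        nlinarith [mul_nonneg hk.le (sq_nonneg (θ ξ τ - θ 0 τ - θ 0 τ))])
    rw [stripInt_wt_mul 3 fun τ => θ 0 τ ^ 2] at h1
    have h2 : 2 * ((∫ ξ, wt 3 ξ) * ∫ τ in (0 : ℝ)..(2 * Real.pi), θ 0 τ ^ 2) ≤
        A * (139 * A ^ 7) := by
      calc _ = (2 * ∫ ξ, wt 3 ξ) * ∫ τ in (0 : ℝ)..(2 * Real.pi), θ 0 τ ^ 2 := by ring
        _ ≤ A * (139 * A ^ 7) :=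
          mul_le_mul (by linarith) iθ0 (intervalIntegral.integral_nonneg Real.two_pi_pos.le
            fun τ _ => sq_nonneg _) (by linarith)
    have A28 : A ^ 2 ≤ A ^ 8 := pow_le_pow_right₀ hA (by norm_num)
    linarith
  refine ⟨hθ, ?_⟩
  have h1 := L.le₂ 2 2 (k9.mul ((h.bc_g.add h.bc_θ).pow 2)) dg9 (k.mul (h.bc_θ.pow 2))
    (fun ξ τ => by
      have hk := wt_pos 9 ξ
      have := mul_le_mul_of_nonneg_right (w93 ξ) (sq_nonneg (θ ξ τ))
      nlinarith [mul_nonneg hk.le (sq_nonneg (g ξ τ - θ ξ τ))])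
  have A48 : A ^ 4 ≤ A ^ 8 := pow_le_pow_right₀ hA (by norm_num)
  linarith

/-- Square integrability of the line integrals of `v ^ 2`. -/
theorem integral_lineInt_v_sq_le (h : SmoothSol ω s I u v θ w g uτ vτ gξ) (hA : 1 ≤ A)
    (hpi : 2 * Real.pi ≤ A) (hv : stripInt (fun ξ τ => wt 3 ξ * v ξ τ ^ 2) ≤ A)
    (hvξ : stripInt (fun ξ τ => wt 9 ξ * (g ξ τ + θ ξ τ) ^ 2) ≤ A)
    (hN : ∀ τ, lineInt (fun ξ τ => wt 3 ξ * u ξ τ ^ 2) τ ≤ A) :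
    ∫ τ in (0 : ℝ)..(2 * Real.pi), lineInt (fun ξ τ => wt 6 ξ * v ξ τ ^ 2) τ ^ 2 ≤
      125 * A ^ 3 := by
  have k := isWeight_wt (show 1 ≤ 3 by norm_num)
  have k6 := isWeight_wt (show 1 ≤ 6 by norm_num)
  have k9 := isWeight_wt (show 1 ≤ 9 by norm_num)
  have L := posLinear_stripInt
  have bvξ := h.bc_g.add h.bc_θ
  have du := k.mul (h.bc_u.pow 2)
  have dv := k.mul (h.bc_v.pow 2)
  have dv6 := k6.mul (h.bc_v.pow 2)
  have dvξ := k9.mul (bvξ.pow 2)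
  have dE := (dv.const_mul 3).add (dvξ.const_mul (1 / 2))
  set E : ℝ → ℝ := lineInt fun ξ τ => 3 * (wt 3 ξ * v ξ τ ^ 2) +
    1 / 2 * (wt 9 ξ * (g ξ τ + θ ξ τ) ^ 2) with hE
  have E0 : ∀ τ, 0 ≤ E τ := lineInt_nonneg fun ξ τ => by
    have h3 := wt_pos 3 ξ
    have h9 := wt_pos 9 ξ
    positivity
  have key : ∀ τ, lineInt (fun ξ τ => wt 6 ξ * v ξ τ ^ 2) τ ^ 2 ≤ (5 * A) ^ 2 * (1 + E τ) := by
    intro τ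
    have Lτ := posLinear_lineInt τ
    set a := √(1 + E τ) with ha
    have ha1 : 1 ≤ a := Real.one_le_sqrt.2 (by linarith [E0 τ])
    have ha0 : 0 < a := by linarith
    have ha2 : a ^ 2 = 1 + E τ := Real.sq_sqrt (by linarith [E0 τ])
    have f1 := (isWeight_wt' (show 1 ≤ 6 by norm_num)).mul (h.bc_u.mul h.bc_v)
    have f2 := k6.mul (h.bc_u.mul bvξ)
    -- Interpolation on a line: the integral of `v²` is that of `-u v_ξ`, up to the derivative of
    -- the weight. The bounded line integral of `u²` makes the integral of `v²` at most of the order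
    -- of the square root of `1 + E`, so its square is integrable in `τ`.
    have e1 := lineInt_deriv (k6.mul (h.bc_u.mul h.bc_v)) ((f1.add f2).add dv6)
      (fun ξ τ => ((hasDerivAt_wt 6 ξ).mul ((h.u_ξ ξ τ).mul (h.v_ξ ξ τ))).congr_deriv
        (by simp only [Pi.mul_apply]; ring)) τ
    rw [Lτ.add (f1.add f2) dv6] at e1
    have e2 := Lτ.le₂ (4 * a) a⁻¹ (f1.add f2).neg du dE (fun ξ τ => by
      have y1 := young ha0 (u ξ τ) (v ξ τ)
      have y2 := young ha0 (u ξ τ) (wt 3 ξ * (g ξ τ + θ ξ τ))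
      have w6 := abs_wt'_le 6 ξ
      push_cast at w6
      have hk3 := wt_pos 3 ξ
      have w63 : wt 6 ξ ≤ wt 3 ξ := wt_anti (by norm_num) ξ
      have e6 : wt 6 ξ = wt 3 ξ * wt 3 ξ := wt_add 3 3 ξ
      have e9 : wt 9 ξ = wt 3 ξ * (wt 3 ξ * wt 3 ξ) := by rw [← e6]; exact wt_add 3 6 ξ
      have t1 : -(wt' 6 ξ * (u ξ τ * v ξ τ)) ≤
          (6 * wt 3 ξ) * (a / 2 * u ξ τ ^ 2 + a⁻¹ / 2 * v ξ τ ^ 2) := by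
        calc _ ≤ |wt' 6 ξ * (u ξ τ * v ξ τ)| := neg_le_abs _
          _ = |wt' 6 ξ| * |u ξ τ * v ξ τ| := abs_mul _ _
          _ ≤ _ := mul_le_mul (by linarith) y1 (abs_nonneg _) (by positivity)
      have t2 : -(wt 6 ξ * (u ξ τ * (g ξ τ + θ ξ τ))) ≤
          wt 3 ξ * (a / 2 * u ξ τ ^ 2 + a⁻¹ / 2 * (wt 3 ξ * (g ξ τ + θ ξ τ)) ^ 2) := by
        calc _ = wt 3 ξ * -(u ξ τ * (wt 3 ξ * (g ξ τ + θ ξ τ))) := by rw [e6]; ring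
          _ ≤ _ := mul_le_mul_of_nonneg_left ((neg_le_abs _).trans y2) hk3.le
      have hu : 0 ≤ a * (wt 3 ξ * u ξ τ ^ 2) := by positivity
      rw [e9]
      calc _ = -(wt' 6 ξ * (u ξ τ * v ξ τ)) + -(wt 6 ξ * (u ξ τ * (g ξ τ + θ ξ τ))) := by ring
        _ ≤ _ := add_le_add t1 t2
        _ ≤ _ := by linarith)
    rw [Lτ.neg] at e2
    have h1 : a⁻¹ * E τ ≤ a := by
      rw [inv_mul_le_iff₀ ha0]; nlinarith
    have h2 : lineInt (fun ξ τ => wt 6 ξ * v ξ τ ^ 2) τ ≤ 5 * A * a := by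
      have h3 : 4 * a * lineInt (fun ξ τ => wt 3 ξ * u ξ τ ^ 2) τ ≤ 4 * a * A := by
        gcongr; exact hN τ
      have h4 : a ≤ a * A := le_mul_of_one_le_right ha0.le hA
      linarith
    calc _ ≤ (5 * A * a) ^ 2 := pow_le_pow_left₀ (lineInt_nonneg (wt_sq_nonneg 6 v) τ) h2 2
      _ = _ := by rw [mul_pow, ha2]
  have cE : Continuous E := dE.continuous_lineInt
  have iE : ∫ τ in (0 : ℝ)..(2 * Real.pi), E τ = 3 * stripInt (fun ξ τ => wt 3 ξ * v ξ τ ^ 2) +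
      1 / 2 * stripInt (fun ξ τ => wt 9 ξ * (g ξ τ + θ ξ τ) ^ 2) :=
    L.eq₂ _ _ dv dvξ fun _ _ => rfl
  calc _ ≤ ∫ τ in (0 : ℝ)..(2 * Real.pi), (5 * A) ^ 2 * (1 + E τ) :=
        intervalIntegral.integral_mono_on Real.two_pi_pos.le
          ((dv6.continuous_lineInt.pow 2).intervalIntegrable _ _)
          (Continuous.intervalIntegrable (by fun_prop) _ _) fun τ _ => key τ
    _ = (5 * A) ^ 2 * (2 * Real.pi + ∫ τ in (0 : ℝ)..(2 * Real.pi), E τ) := by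
        rw [intervalIntegral.integral_const_mul, intervalIntegral.integral_add
          (continuous_const.intervalIntegrable _ _) (cE.intervalIntegrable _ _)]
        simp
    _ ≤ (5 * A) ^ 2 * (5 * A) := by
        rw [iE]
        gcongr
        linarith
    _ = _ := by ring

/-- `v_ξξ = g_ξ + w`, and in `L²` `g_ξ` is no larger than `G''(u) v`. In `u⁴ v²` the pointwise bound
of `u⁴` contributes the factor `1 + D`, and the line integral of `v²` is `D`; this explains the
assumption on the integral of `D²`. -/
theorem stripInt_vξξ_le (h : SmoothSol ω s I u v θ w g uτ vτ gξ) (hA : 1 ≤ A)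
    (hpi : 2 * Real.pi ≤ A) (hw : stripInt (fun ξ τ => wt 1 ξ * w ξ τ ^ 2) ≤ A)
    (hv : stripInt (fun ξ τ => wt 3 ξ * v ξ τ ^ 2) ≤ A)
    (hD : ∫ τ in (0 : ℝ)..(2 * Real.pi), lineInt (fun ξ τ => wt 6 ξ * v ξ τ ^ 2) τ ^ 2 ≤ A)
    (hN : ∀ τ, lineInt (fun ξ τ => wt 3 ξ * u ξ τ ^ 2) τ ≤ A) :
    stripInt (fun ξ τ => wt 18 ξ * (gξ ξ τ + w ξ τ) ^ 2) ≤ 7000 * A ^ 3 := by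
  have k := isWeight_wt (show 1 ≤ 3 by norm_num)
  have k6 := isWeight_wt (show 1 ≤ 6 by norm_num)
  have k18 := isWeight_wt (show 1 ≤ 18 by norm_num)
  have L := posLinear_stripInt
  have dv := k.mul (h.bc_v.pow 2)
  have dv6 := k6.mul (h.bc_v.pow 2)
  set D : ℝ → ℝ := lineInt fun ξ τ => wt 6 ξ * v ξ τ ^ 2 with hDdef
  have cD : Continuous D := dv6.continuous_lineInt
  have bD : BddCont₂ fun _ τ => D τ := dv6.bddCont₂_lineInt
  have D0 : ∀ τ, 0 ≤ D τ := lineInt_nonneg (wt_sq_nonneg 6 v)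
  have h4 : stripInt (fun ξ τ => wt 18 ξ * (u ξ τ ^ 4 * v ξ τ ^ 2)) ≤ 192 * A ^ 3 := by
    have h1 : stripInt (fun ξ τ => wt 18 ξ * (u ξ τ ^ 4 * v ξ τ ^ 2)) ≤
        stripInt fun ξ τ => (wt 6 ξ * v ξ τ ^ 2) * (((6 + 2) * A) ^ 2 * (1 + D τ)) := by
      refine L.mono (k18.mul ((h.bc_u.pow 4).mul (h.bc_v.pow 2)))
        (dv6.mul_bdd (((BddCont₂.const 1).add bD).const_mul _)) fun ξ τ => ?_
      have := h.wt_mul_u_sq_sq_le hA hN (show 3 ≤ 6 by norm_num) ξ τ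
      push_cast at this
      calc _ = (wt 6 ξ * v ξ τ ^ 2) * (wt 6 ξ * u ξ τ ^ 2) ^ 2 := by
            rw [show 18 = 6 + 6 + 6 from rfl, wt_add, wt_add]; ring
        _ ≤ _ := mul_le_mul_of_nonneg_left this (wt_sq_nonneg 6 v ξ τ)
    have h2 : stripInt (fun ξ τ => (wt 6 ξ * v ξ τ ^ 2) * (((6 + 2) * A) ^ 2 * (1 + D τ))) ≤
        ∫ τ in (0 : ℝ)..(2 * Real.pi), ((6 + 2) * A) ^ 2 * (1 + 2 * D τ ^ 2) := by
      unfold stripInt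
      refine intervalIntegral.integral_mono_on Real.two_pi_pos.le
        ((dv6.mul_bdd (((BddCont₂.const 1).add bD).const_mul _)).continuous_lineInt.intervalIntegrable
          _ _) (Continuous.intervalIntegrable (by fun_prop) _ _) fun τ _ => ?_
      rw [lineInt_mul _ fun τ => ((6 + 2) * A) ^ 2 * (1 + D τ), ← hDdef]
      have : 0 ≤ ((6 + 2) * A) ^ 2 := sq_nonneg _
      calc D τ * (((6 + 2) * A) ^ 2 * (1 + D τ)) = ((6 + 2) * A) ^ 2 * (D τ + D τ ^ 2) := by ring
        _ ≤ _ := mul_le_mul_of_nonneg_left (by nlinarith [sq_nonneg (D τ - 1)]) this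
    have h3 : ∫ τ in (0 : ℝ)..(2 * Real.pi), ((6 + 2) * A) ^ 2 * (1 + 2 * D τ ^ 2) =
        ((6 + 2) * A) ^ 2 * (2 * Real.pi + 2 * ∫ τ in (0 : ℝ)..(2 * Real.pi), D τ ^ 2) := by
      rw [intervalIntegral.integral_const_mul, intervalIntegral.integral_add
        (continuous_const.intervalIntegrable _ _)
        (Continuous.intervalIntegrable (by fun_prop) _ _), intervalIntegral.integral_const_mul]
      simp
    calc _ ≤ _ := h1.trans h2
      _ = _ := h3
      _ ≤ ((6 + 2) * A) ^ 2 * (A + 2 * A) := by gcongr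
      _ = _ := by ring
  have bG : BddCont₂ fun ξ τ => (-1 + 3 * u ξ τ ^ 2) * v ξ τ :=
    ((BddCont₂.const (-1)).add ((h.bc_u.pow 2).const_mul 3)).mul h.bc_v
  have h5 := stripInt_weight_le k18 (fun x => (wt_pos 18 x).le) (h.bc_gξ.pow 2) (bG.pow 2)
    h.integral_gξ_sq
  have w183 : ∀ ξ, wt 18 ξ ≤ wt 3 ξ := wt_anti (by norm_num)
  have w181 : ∀ ξ, wt 18 ξ ≤ wt 1 ξ := wt_anti (by norm_num)
  have h6 := L.le₂ 2 18 (k18.mul (bG.pow 2)) dv (k18.mul ((h.bc_u.pow 4).mul (h.bc_v.pow 2)))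
    (fun ξ τ => by
      have hk := wt_pos 18 ξ
      have hk2 := mul_le_mul_of_nonneg_right (w183 ξ) (sq_nonneg (v ξ τ))
      calc wt 18 ξ * ((-1 + 3 * u ξ τ ^ 2) * v ξ τ) ^ 2 ≤
            wt 18 ξ * (2 * v ξ τ ^ 2 + 18 * (u ξ τ ^ 4 * v ξ τ ^ 2)) := by
            refine mul_le_mul_of_nonneg_left ?_ hk.le
            nlinarith [sq_nonneg ((1 + 3 * u ξ τ ^ 2) * v ξ τ)]
        _ = 2 * (wt 18 ξ * v ξ τ ^ 2) + 18 * (wt 18 ξ * (u ξ τ ^ 4 * v ξ τ ^ 2)) := by ring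
        _ ≤ _ := by gcongr)
  have h7 := L.le₂ 2 2 (k18.mul ((h.bc_gξ.add h.bc_w).pow 2)) (k18.mul (h.bc_gξ.pow 2))
    ((isWeight_wt le_rfl).mul (h.bc_w.pow 2)) (fun ξ τ => by
      have hk := wt_pos 18 ξ
      have := mul_le_mul_of_nonneg_right (w181 ξ) (sq_nonneg (w ξ τ))
      nlinarith [mul_nonneg hk.le (sq_nonneg (gξ ξ τ - w ξ τ))])
  have A3 : A ≤ A ^ 3 := le_self_pow₀ hA (by norm_num)
  linarith

/-- A bound of `v` on lines. -/
theorem lineInt_v_sq_le (h : SmoothSol ω s I u v θ w g uτ vτ gξ) (hA : 1 ≤ A) (hω : ω ≠ 0)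
    (hωA : |ω|⁻¹ ≤ A) (hs : |s| ≤ A)
    (hw : stripInt (fun ξ τ => wt 1 ξ * w ξ τ ^ 2) ≤ A)
    (hv : stripInt (fun ξ τ => wt 3 ξ * v ξ τ ^ 2) ≤ A)
    (hvξ : stripInt (fun ξ τ => wt 9 ξ * (g ξ τ + θ ξ τ) ^ 2) ≤ A)
    (hvξξ : stripInt (fun ξ τ => wt 18 ξ * (gξ ξ τ + w ξ τ) ^ 2) ≤ A) (τ : ℝ) :
    lineInt (fun ξ τ => wt 18 ξ * v ξ τ ^ 2) τ ≤ 2901 * A ^ 3 := by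
  have k := isWeight_wt (show 1 ≤ 3 by norm_num)
  have k1 := isWeight_wt (le_refl 1)
  have k9 := isWeight_wt (show 1 ≤ 9 by norm_num)
  have k18 := isWeight_wt (show 1 ≤ 18 by norm_num)
  have k18' := isWeight_wt' (show 1 ≤ 18 by norm_num)
  have k18'' := isWeight_wt'' 18
  have L := posLinear_stripInt
  have bvξ := h.bc_g.add h.bc_θ
  have bvξξ := h.bc_gξ.add h.bc_w
  have dv := k.mul (h.bc_v.pow 2)
  have dw := k1.mul (h.bc_w.pow 2)
  have dvξ := k9.mul (bvξ.pow 2)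
  have dvξξ := k18.mul (bvξξ.pow 2)
  have dv18 := k18.mul (h.bc_v.pow 2)
  have d1 := k18.mul ((h.bc_v.mul h.bc_vτ).const_mul 2)
  have dS := (((dv.const_mul (18 * |s| + 1404)).add (dw.const_mul 1441)).add
    (dvξ.const_mul 36)).add dvξξ
  -- Since `ω v_τ = s v_ξ - w_ξξ`, two integrations by parts express the integral of `v v_τ` through
  -- `v`, `v_ξ`, `v_ξξ` and an undifferentiated `w`.
  have key : ∀ τ, |lineInt (fun ξ τ => wt 18 ξ * (2 * (v ξ τ * vτ ξ τ))) τ| ≤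
      lineInt (fun ξ τ => |ω|⁻¹ * ((18 * |s| + 1404) * (wt 3 ξ * v ξ τ ^ 2) +
        1441 * (wt 1 ξ * w ξ τ ^ 2) + 36 * (wt 9 ξ * (g ξ τ + θ ξ τ) ^ 2) +
        wt 18 ξ * (gξ ξ τ + w ξ τ) ^ 2)) τ := by
    intro τ
    have Lτ := posLinear_lineInt τ
    have q1 := k18'.mul ((h.bc_v.pow 2).const_mul s)
    have q2 := k18''.mul ((h.bc_v.mul h.bc_w).const_mul 2)
    have q3 := k18'.mul ((bvξ.mul h.bc_w).const_mul 4)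
    have q4 := k18.mul ((bvξξ.mul h.bc_w).const_mul 2)
    have f := ((q1.add q2).add q3).add q4
    have hvd : ∀ ξ τ, HasDerivAt (fun x => g x τ + θ x τ) (gξ ξ τ + w ξ τ) ξ :=
      fun ξ τ => (h.g_ξ ξ τ).add (h.θ_ξ ξ τ)
    -- a primitive
    have p1 := k18.mul ((h.bc_v.mul h.bc_uτ).const_mul (2 * ω))
    have p2 := k18'.mul ((h.bc_v.mul h.bc_w).const_mul 2)
    have p3 := k18.mul ((bvξ.mul h.bc_w).const_mul 2)
    have p4 := k18.mul ((h.bc_v.pow 2).const_mul (-s))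
    have e1 := lineInt_deriv (((p1.add p2).add p3).add p4) (f.add (d1.const_mul ω)) (fun ξ τ => by
      have r1 := (hasDerivAt_wt 18 ξ).mul (((h.v_ξ ξ τ).mul (h.uτ_ξ ξ τ)).const_mul (2 * ω))
      have r2 := (hasDerivAt_wt' 18 ξ).mul (((h.v_ξ ξ τ).mul (h.w_ξ ξ τ)).const_mul 2)
      have r3 := (hasDerivAt_wt 18 ξ).mul (((hvd ξ τ).mul (h.w_ξ ξ τ)).const_mul 2)
      have r4 := (hasDerivAt_wt 18 ξ).mul (((h.v_ξ ξ τ).fun_pow 2).const_mul (-s))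
      refine (((r1.add r2).add r3).add r4).congr_deriv ?_
      simp only [Pi.mul_apply, Nat.cast_ofNat, Nat.add_one_sub_one, pow_one]
      ring) τ
    rw [Lτ.add f (d1.const_mul ω), Lτ.const_mul] at e1
    have e2 : lineInt (fun ξ τ => wt 18 ξ * (2 * (v ξ τ * vτ ξ τ))) τ = ω⁻¹ *
        -lineInt (fun ξ τ => wt' 18 ξ * (s * v ξ τ ^ 2) + wt'' 18 ξ * (2 * (v ξ τ * w ξ τ)) +
          wt' 18 ξ * (4 * ((g ξ τ + θ ξ τ) * w ξ τ)) +
          wt 18 ξ * (2 * ((gξ ξ τ + w ξ τ) * w ξ τ))) τ := by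
      rw [eq_inv_mul_iff_mul_eq₀ hω]; linarith
    have pt : ∀ ξ τ, |wt' 18 ξ * (s * v ξ τ ^ 2) + wt'' 18 ξ * (2 * (v ξ τ * w ξ τ)) +
          wt' 18 ξ * (4 * ((g ξ τ + θ ξ τ) * w ξ τ)) +
          wt 18 ξ * (2 * ((gξ ξ τ + w ξ τ) * w ξ τ))| ≤
        (18 * |s| + 1404) * (wt 3 ξ * v ξ τ ^ 2) +
        1441 * (wt 1 ξ * w ξ τ ^ 2) + 36 * (wt 9 ξ * (g ξ τ + θ ξ τ) ^ 2) +
        wt 18 ξ * (gξ ξ τ + w ξ τ) ^ 2 := by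
      intro ξ τ
      have w0 := wt_pos 18 ξ
      have w1 := abs_wt'_le 18 ξ
      have w2 := abs_wt''_le 18 ξ
      push_cast at w1 w2
      have w3 : wt 18 ξ ≤ wt 3 ξ := wt_anti (by norm_num) ξ
      have w4 : wt 18 ξ ≤ wt 1 ξ := wt_anti (by norm_num) ξ
      have w5 : wt 18 ξ ≤ wt 9 ξ := wt_anti (by norm_num) ξ
      have w6 : wt 19 ξ ≤ wt 18 ξ := wt_anti (by norm_num) ξ
      have w7 : |wt'' 18 ξ| ≤ 1404 * wt 18 ξ := by norm_num at w2; linarith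
      have y : ∀ a b : ℝ, |a * b| ≤ (a ^ 2 + b ^ 2) / 2 := fun a b => by
        have := young one_pos a b
        rw [inv_one] at this; linarith
      have t1 : |wt' 18 ξ * (s * v ξ τ ^ 2)| ≤ 18 * |s| * (wt 3 ξ * v ξ τ ^ 2) := by
        rw [abs_mul, abs_mul, abs_of_nonneg (sq_nonneg (v ξ τ))]
        calc _ ≤ (18 * wt 3 ξ) * (|s| * v ξ τ ^ 2) := by gcongr; linarith
          _ = _ := by ring
      have t2 : |wt'' 18 ξ * (2 * (v ξ τ * w ξ τ))| ≤
          1404 * (wt 3 ξ * v ξ τ ^ 2 + wt 1 ξ * w ξ τ ^ 2) := by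
        rw [abs_mul, abs_mul 2, abs_two]
        calc _ ≤ (1404 * wt 18 ξ) * (2 * ((v ξ τ ^ 2 + w ξ τ ^ 2) / 2)) := by
              gcongr; exact y _ _
          _ = 1404 * (wt 18 ξ * v ξ τ ^ 2 + wt 18 ξ * w ξ τ ^ 2) := by ring
          _ ≤ _ := by gcongr
      have t3 : |wt' 18 ξ * (4 * ((g ξ τ + θ ξ τ) * w ξ τ))| ≤
          36 * (wt 9 ξ * (g ξ τ + θ ξ τ) ^ 2 + wt 1 ξ * w ξ τ ^ 2) := by
        rw [abs_mul, abs_mul 4, abs_of_pos (show (0 : ℝ) < 4 by norm_num)]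
        calc _ ≤ (18 * wt 18 ξ) * (4 * (((g ξ τ + θ ξ τ) ^ 2 + w ξ τ ^ 2) / 2)) := by
              gcongr; exact y _ _
          _ = 36 * (wt 18 ξ * (g ξ τ + θ ξ τ) ^ 2 + wt 18 ξ * w ξ τ ^ 2) := by ring
          _ ≤ _ := by gcongr
      have t4 : |wt 18 ξ * (2 * ((gξ ξ τ + w ξ τ) * w ξ τ))| ≤
          wt 18 ξ * (gξ ξ τ + w ξ τ) ^ 2 + wt 1 ξ * w ξ τ ^ 2 := by
        rw [abs_mul, abs_mul 2, abs_two, abs_of_pos w0]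
        calc _ ≤ wt 18 ξ * (2 * (((gξ ξ τ + w ξ τ) ^ 2 + w ξ τ ^ 2) / 2)) := by
              gcongr; exact y _ _
          _ = wt 18 ξ * (gξ ξ τ + w ξ τ) ^ 2 + wt 18 ξ * w ξ τ ^ 2 := by ring
          _ ≤ _ := by gcongr
      refine (abs_add_le _ _).trans ?_
      refine (add_le_add_left (abs_add_le _ _) _).trans ?_
      refine (add_le_add_left (add_le_add_left (abs_add_le _ _) _) _).trans ?_
      linarith
    rw [e2, Lτ.const_mul, abs_mul, abs_inv, abs_neg]
    refine mul_le_mul_of_nonneg_left (abs_le.2 ⟨?_, ?_⟩) (inv_nonneg.2 (abs_nonneg _))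
    · rw [← Lτ.neg]
      exact Lτ.mono dS.neg f fun ξ τ => by linarith [abs_le.1 (pt ξ τ)]
    · exact Lτ.mono f dS fun ξ τ => (le_abs_self _).trans (pt ξ τ)
  have h1 := le_mean_add_integral (hasDerivAt_lineInt dv18 d1 (fun ξ τ =>
    (((h.v_τ ξ τ).fun_pow 2).const_mul (wt 18 ξ)).congr_deriv (by
      simp only [Nat.cast_ofNat, Nat.add_one_sub_one, pow_one]; ring)))
    (periodic_lineInt fun ξ τ => by simp only [h.per_v ξ τ])
    d1.continuous_lineInt (dS.const_mul |ω|⁻¹).continuous_lineInt key τ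
  have e := (L.const_mul |ω|⁻¹ _).trans (congrArg (|ω|⁻¹ * ·) (L.eq₄ (18 * |s| + 1404) 1441 36 1
    dv dw dvξ dvξξ fun ξ τ => by rw [one_mul]))
  have hP : stripInt (fun ξ τ => wt 18 ξ * v ξ τ ^ 2) ≤ A :=
    (L.mono dv18 dv fun ξ τ => mul_le_mul_of_nonneg_right (wt_anti (by norm_num) ξ)
      (sq_nonneg _)).trans hv
  have P0 : 0 ≤ stripInt (fun ξ τ => wt 18 ξ * v ξ τ ^ 2) := L.nonneg dv18 (wt_sq_nonneg 18 v)
  have V0 : 0 ≤ stripInt (fun ξ τ => wt 3 ξ * v ξ τ ^ 2) := L.nonneg dv (wt_sq_nonneg 3 v)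
  have W0 : 0 ≤ stripInt (fun ξ τ => wt 1 ξ * w ξ τ ^ 2) := L.nonneg dw (wt_sq_nonneg 1 w)
  have X0 : 0 ≤ stripInt (fun ξ τ => wt 9 ξ * (g ξ τ + θ ξ τ) ^ 2) :=
    L.nonneg dvξ fun ξ τ => mul_nonneg (wt_pos _ _).le (sq_nonneg _)
  have Y0 : 0 ≤ stripInt (fun ξ τ => wt 18 ξ * (gξ ξ τ + w ξ τ) ^ 2) :=
    L.nonneg dvξξ fun ξ τ => mul_nonneg (wt_pos _ _).le (sq_nonneg _)
  have m1 : (2 * Real.pi)⁻¹ * stripInt (fun ξ τ => wt 18 ξ * v ξ τ ^ 2) ≤ 1 * A := by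
    have : (2 * Real.pi)⁻¹ ≤ 1 := inv_le_one_of_one_le₀ (by linarith [Real.pi_gt_three])
    gcongr
  have m2 : |ω|⁻¹ * ((18 * |s| + 1404) * stripInt (fun ξ τ => wt 3 ξ * v ξ τ ^ 2) +
      1441 * stripInt (fun ξ τ => wt 1 ξ * w ξ τ ^ 2) +
      36 * stripInt (fun ξ τ => wt 9 ξ * (g ξ τ + θ ξ τ) ^ 2) +
      1 * stripInt (fun ξ τ => wt 18 ξ * (gξ ξ τ + w ξ τ) ^ 2)) ≤
      A * ((18 * A + 1404) * A + 1441 * A + 36 * A + 1 * A) := by gcongr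
  have A13 : A ≤ A ^ 3 := le_self_pow₀ hA (by norm_num)
  have A23 : A ^ 2 ≤ A ^ 3 := pow_le_pow_right₀ hA (by norm_num)
  refine h1.trans ((add_le_add m1 (e.le.trans m2)).trans ?_)
  linarith

end SmoothSol

/-! ### The local bound in terms of the dissipation. -/

/-- Parameters in a compact subset of the parameter space. -/
structure ParamBound (R ω s I : ℝ) : Prop where
  one_le : 1 ≤ R
  ω_ne : ω ≠ 0
  s_ne : s ≠ 0
  ω_le : |ω| ≤ R
  ω_inv_le : |ω|⁻¹ ≤ R
  s_le : |s| ≤ R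
  s_inv_le : |s|⁻¹ ≤ R
  I_le : |I| ≤ R

/-- Local bounds of a solution near `ξ = 0`. -/
structure LocalBound (C : ℝ) (u v θ g : ℝ → ℝ → ℝ) : Prop where
  u_sq_le τ : u 0 τ ^ 2 ≤ C
  v_le : stripInt (fun ξ τ => wt 3 ξ * v ξ τ ^ 2) ≤ C
  u_le : stripInt (fun ξ τ => wt 3 ξ * u ξ τ ^ 2) ≤ C
  u_four_le : stripInt (fun ξ τ => wt 3 ξ * u ξ τ ^ 4) ≤ C
  θ_le : stripInt (fun ξ τ => wt 3 ξ * θ ξ τ ^ 2) ≤ C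
  vξ_le : stripInt (fun ξ τ => wt 9 ξ * (g ξ τ + θ ξ τ) ^ 2) ≤ C

namespace SmoothSol

/-- The constant depends on `R` and `K` only. The chain of bounds is: averages of `u`, energy, line
integrals of `u²`, then `θ` and `v_ξ`, the squares of the line integrals of `v²`, `v_ξξ`, line
integrals of `v²`, and finally the values of `u` at `ξ = 0`. Each `A_i` below exceeds the previous
one, so that one constant serves as bound for all earlier quantities. -/
theorem exists_localBound {R K : ℝ} (hR : 1 ≤ R) (hK : 0 ≤ K) :
    ∃ C : ℝ, 1 ≤ C ∧ ∀ {ω s I : ℝ} {u v θ w g uτ vτ gξ : ℝ → ℝ → ℝ},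
      ParamBound R ω s I → SmoothSol ω s I u v θ w g uτ vτ gξ →
      stripInt (fun ξ τ => wt 1 ξ * w ξ τ ^ 2) ≤ K → LocalBound C u v θ g := by
  have hpi := Real.two_pi_pos
  have c3 : 0 < ∫ ξ, wt 3 ξ := integral_wt_pos (by norm_num)
  have c6 : 0 < ∫ ξ, wt 6 ξ := integral_wt_pos (by norm_num)
  obtain ⟨q, hq⟩ : ∃ x : ℝ, x = (2 * (1 + (2 * Real.pi * R ^ 2) ^ 2)) ^ 3 := ⟨_, rfl⟩
  have hq0 : 0 < q := by rw [hq]; positivity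
  obtain ⟨M, hM⟩ : ∃ x : ℝ, x = R ^ 2 * (∫ ξ, wt 3 ξ) + R * q * ((∫ ξ, wt 3 ξ) + K) := ⟨_, rfl⟩
  have hM0 : 0 ≤ M := by rw [hM]; positivity
  have hR0 : 0 < R := by linarith
  have hR2 : 0 < R ^ 2 := by positivity
  obtain ⟨B, hB⟩ : ∃ x : ℝ, x = 1 + R + q + R ^ 2 + M + K +
    2 * Real.pi * (∫ ξ, wt 3 ξ) + (∫ ξ, wt 6 ξ)⁻¹ +    2 * Real.pi := ⟨_, rfl⟩
  have c3' : 0 < 2 * Real.pi * ∫ ξ, wt 3 ξ := by positivity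
  have c6' : 0 < (∫ ξ, wt 6 ξ)⁻¹ := by positivity
  have hB1 : 1 ≤ B := by linarith
  obtain ⟨A₀, hA₀⟩ : ∃ x : ℝ, x = (49 * B ^ 7) ^ 8 := ⟨_, rfl⟩
  have hBA : B ≤ A₀ := by
    have h1 : B ≤ B ^ 7 := le_self_pow₀ hB1 (by norm_num)
    have h2 : 49 * B ^ 7 ≤ (49 * B ^ 7) ^ 8 := le_self_pow₀ (by linarith) (by norm_num)
    linarith
  have h₀ : 1 ≤ A₀ := hB1.trans hBA
  obtain ⟨A₁, hA₁⟩ : ∃ x : ℝ, x = 12 * A₀ ^ 7 := ⟨_, rfl⟩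
  have p₀ : ∀ n : ℕ, n ≠ 0 → A₀ ≤ A₀ ^ n := fun n hn => le_self_pow₀ h₀ hn
  have h01 : A₀ ≤ A₁ := by have := p₀ 7 (by norm_num); linarith
  have h₁ : 1 ≤ A₁ := h₀.trans h01
  obtain ⟨A₂, hA₂⟩ : ∃ x : ℝ, x = 486 * A₁ ^ 8 := ⟨_, rfl⟩
  have h12 : A₁ ≤ A₂ := by have := le_self_pow₀ h₁ (show 8 ≠ 0 by norm_num); linarith
  have h₂ : 1 ≤ A₂ := h₁.trans h12
  obtain ⟨A₃, hA₃⟩ : ∃ x : ℝ, x = 125 * A₂ ^ 3 := ⟨_, rfl⟩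
  have h23 : A₂ ≤ A₃ := by have := le_self_pow₀ h₂ (show 3 ≠ 0 by norm_num); linarith
  have h₃ : 1 ≤ A₃ := h₂.trans h23
  obtain ⟨A₄, hA₄⟩ : ∃ x : ℝ, x = 7000 * A₃ ^ 3 := ⟨_, rfl⟩
  have h34 : A₃ ≤ A₄ := by have := le_self_pow₀ h₃ (show 3 ≠ 0 by norm_num); linarith
  have h₄ : 1 ≤ A₄ := h₃.trans h34
  have hA43 : 0 < A₄ ^ 3 := by positivity
  refine ⟨19 * A₁ + A₂ + 2901 * A₄ ^ 3, by linarith, fun {ω s I u v θ w g uτ vτ gξ} P h hw => ?_⟩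
  have hω := P.ω_ne
  have hs := P.s_ne
  set p : ℝ := 2 * Real.pi * s / ω with hp
  have hp0 : p ≠ 0 := by positivity
  have hsp : 0 < |s| := abs_pos.2 hs
  have hωp : 0 < |ω| := abs_pos.2 hω
  have hpabs : |p| = 2 * Real.pi * (|s| * |ω|⁻¹) := by
    rw [hp, abs_div, abs_mul, abs_of_pos hpi, div_eq_mul_inv]; ring
  have hpR : |p| ≤ 2 * Real.pi * R ^ 2 := by
    rw [hpabs, sq]
    have := mul_le_mul P.s_le P.ω_inv_le (by positivity) (by positivity)
    gcongr
  have hpinv : |p|⁻¹ ≤ B := by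
    have e : |p|⁻¹ = (2 * Real.pi)⁻¹ * (|s|⁻¹ * |ω|) := by
      rw [hpabs]; field_simp
    have h1 : (2 * Real.pi)⁻¹ ≤ 1 := inv_le_one_of_one_le₀ (by linarith [Real.pi_gt_three])
    have h2 := mul_le_mul P.s_inv_le P.ω_le (by positivity) (by positivity)
    rw [e]
    calc _ ≤ 1 * (R * R) := mul_le_mul h1 h2 (by positivity) (by norm_num)
      _ = R ^ 2 := by ring
      _ ≤ B := by linarith
  have hqp : (2 * (1 + p ^ 2)) ^ 3 ≤ q := by
    have : p ^ 2 ≤ (2 * Real.pi * R ^ 2) ^ 2 := by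
      rw [← sq_abs]; exact pow_le_pow_left₀ (abs_nonneg _) hpR 2
    rw [hq]
    gcongr
  have hm : ∀ τ, |lineInt (fun ξ τ => avgWt p 1 ξ * u ξ τ) τ| ≤ B := by
    intro τ
    refine (h.abs_lineInt_avgWt_u_le hω hs hp τ).trans ?_
    have w3 : stripInt (fun ξ τ => wt 3 ξ * w ξ τ ^ 2) ≤ K :=
      (h.stripInt_wt_w_le (by norm_num)).trans hw
    have w30 : 0 ≤ stripInt (fun ξ τ => wt 3 ξ * w ξ τ ^ 2) :=
      posLinear_stripInt.nonneg ((isWeight_wt (by norm_num)).mul (h.bc_w.pow 2))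
        (wt_sq_nonneg 3 w)
    have i1 : |I / s| ≤ R ^ 2 := by
      rw [abs_div, div_eq_mul_inv, sq]
      exact mul_le_mul P.I_le P.s_inv_le (by positivity) (by positivity)
    have i2 : (2 * |s|)⁻¹ ≤ R := by
      rw [mul_inv]
      have := P.s_inv_le
      have h0 : 0 < |s|⁻¹ := by positivity
      linarith
    have i3 : (2 * Real.pi)⁻¹ * stripInt (fun ξ τ => wt 3 ξ * w ξ τ ^ 2) ≤ K := by
      have h1 : (2 * Real.pi)⁻¹ ≤ 1 := inv_le_one_of_one_le₀ (by linarith [Real.pi_gt_three])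
      calc _ ≤ 1 * K := mul_le_mul h1 w3 w30 (by norm_num)
        _ = K := one_mul K
    calc _ ≤ R ^ 2 * (∫ ξ, wt 3 ξ) + R * q * ((∫ ξ, wt 3 ξ) + K) := by gcongr
      _ ≤ B := by rw [← hM]; linarith
  have hωB : |ω|⁻¹ ≤ B := P.ω_inv_le.trans (by linarith)
  have hsB : |s| ≤ B := P.s_le.trans (by linarith)
  have hE := h.stripInt_v_u_le hB1 hω hωB hsB hp0 (hqp.trans (by linarith)) hpinv hm
    (hw.trans (by linarith)) (by linarith) (by linarith) (by linarith)
  have k := isWeight_wt (show 1 ≤ 3 by norm_num)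
  have V0 : 0 ≤ stripInt (fun ξ τ => wt 3 ξ * v ξ τ ^ 2) :=
    posLinear_stripInt.nonneg (k.mul (h.bc_v.pow 2)) (wt_sq_nonneg 3 v)
  have U0 : 0 ≤ stripInt (fun ξ τ => wt 3 ξ * u ξ τ ^ 4) :=
    posLinear_stripInt.nonneg (k.mul (h.bc_u.pow 4)) fun ξ τ =>
      mul_nonneg (wt_pos _ _).le (by positivity)
  have hv : stripInt (fun ξ τ => wt 3 ξ * v ξ τ ^ 2) ≤ A₀ := by linarith
  have hu4 : stripInt (fun ξ τ => wt 3 ξ * u ξ τ ^ 4) ≤ A₀ := by linarith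
  have p8 := p₀ 8 (by norm_num)
  -- The interpolation lemmas are reused with `z = A₀`; this is permitted because the energy is at
  -- most `A₀ ≤ A₀ ^ 8`.
  have hu := h.interpolation_sq h₀ h₀ (by linarith) (hu4.trans p8)
  have hw₀ : stripInt (fun ξ τ => wt 1 ξ * w ξ τ ^ 2) ≤ A₀ := by linarith
  have hN : ∀ τ, lineInt (fun ξ τ => wt 3 ξ * u ξ τ ^ 2) τ ≤ A₁ := fun τ =>
    (h.interpolation_sup h₀ h₀ hω (hωB.trans hBA) (hsB.trans hBA) hw₀ hu (hv.trans p8) τ).trans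
      (le_of_eq (by rw [hA₁]; ring))
  have hu₁ : stripInt (fun ξ τ => wt 3 ξ * u ξ τ ^ 2) ≤ A₁ := by
    have : A₀ ^ 5 ≤ A₀ ^ 7 := pow_le_pow_right₀ h₀ (by norm_num)
    linarith
  obtain ⟨hθ, hvξ⟩ := h.stripInt_θ_le h₁ (by linarith) (by linarith) (by linarith)
    (hw₀.trans h01) (hv.trans h01) hu₁ hN
  have hD := h.integral_lineInt_v_sq_le h₂ (by linarith) (by linarith) (hvξ.trans_eq hA₂.symm)
    fun τ => (hN τ).trans h12
  have hvξξ := h.stripInt_vξξ_le h₃ (by linarith) (by linarith) (by linarith) (hD.trans_eq hA₃.symm)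
    fun τ => (hN τ).trans (h12.trans h23)
  have hP := h.lineInt_v_sq_le h₄ hω (by linarith) (by linarith) (by linarith) (by linarith)
    (by linarith) (hvξξ.trans_eq hA₄.symm)
  have hA18 : 0 < A₁ ^ 8 := by positivity
  refine ⟨fun τ => ?_, by linarith, by linarith, by linarith, by linarith, by linarith⟩
  have k18 := isWeight_wt (show 1 ≤ 18 by norm_num)
  -- At `ξ = 0` every weight is one, so `u(0, τ)²` is bounded by line integrals of `u²` and `v²`.
  have h1 := h.wt_mul_u_sq_le (j := 18) (by norm_num) one_pos 0 τ
  rw [wt_apply_zero, one_mul, (posLinear_lineInt τ).eq₂ ((18 : ℕ) + 1) 1⁻¹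
    (k18.mul (h.bc_u.pow 2)) (k18.mul (h.bc_v.pow 2)) fun _ _ => rfl, inv_one, one_mul] at h1
  have h2 := h.lineInt_wt_u_le hN (show 3 ≤ 18 by norm_num) τ
  have h3 := hP τ
  push_cast at h1
  linarith

end SmoothSol

/-! ### The Lyapunov function and the a priori bound. -/

/-- The density of the Lyapunov function. -/
def lyapunovDensity (ω s : ℝ) (u v θ w uτ : ℝ → ℝ → ℝ) (ξ τ : ℝ) : ℝ :=
  θ ξ τ * w ξ τ + s / 2 * v ξ τ ^ 2 + s * potential (u ξ τ) -
    (s * v ξ τ - ω * uτ ξ τ) * v ξ τ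

/-- The Lyapunov function. -/
def lyapunov (ω s : ℝ) (u v θ w uτ : ℝ → ℝ → ℝ) (ξ : ℝ) : ℝ :=
  ∫ τ in (0 : ℝ)..(2 * Real.pi), lyapunovDensity ω s u v θ w uτ ξ τ

namespace SmoothSol

variable {ω s I : ℝ} {u v θ w g uτ vτ gξ : ℝ → ℝ → ℝ}

theorem bc_potential (h : SmoothSol ω s I u v θ w g uτ vτ gξ) :
    BddCont₂ fun ξ τ => potential (u ξ τ) := by
  have := ((h.bc_u.pow 2).const_mul (-1 / 2)).add ((h.bc_u.pow 4).const_mul (1 / 4))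
  convert this using 3
  unfold potential; ring

theorem bc_lyapunovDensity (h : SmoothSol ω s I u v θ w g uτ vτ gξ) :
    BddCont₂ (lyapunovDensity ω s u v θ w uτ) :=
  (((h.bc_θ.mul h.bc_w).add ((h.bc_v.pow 2).const_mul _)).add (h.bc_potential.const_mul s)).sub
    (((h.bc_v.const_mul s).sub (h.bc_uτ.const_mul ω)).mul h.bc_v)

/-- The last term of the density is `-w_ξ v`. Differentiation yields `w²` plus `s v (G'(u) - g)`, `ω
v v_τ` and `ω u_τ g`; these three have zero integral over a period, the first and the last because
`v` and `u_τ` do not see the projection. -/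
theorem hasDerivAt_lyapunov (h : SmoothSol ω s I u v θ w g uτ vτ gξ) (ξ : ℝ) :
    HasDerivAt (lyapunov ω s u v θ w uτ) (∫ τ in (0 : ℝ)..(2 * Real.pi), w ξ τ ^ 2) ξ := by
  have b1 := h.bc_w.pow 2
  have b2 := (h.bc_v.mul h.bc_u.dG).const_mul s
  have b3 := (h.bc_v.mul h.bc_g).const_mul (-s)
  have b4 := (h.bc_v.mul h.bc_vτ).const_mul ω
  have b5 := (h.bc_uτ.mul h.bc_g).const_mul ω
  have ct : ∀ {f : ℝ → ℝ → ℝ}, BddCont₂ f →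
      IntervalIntegrable (f ξ) volume 0 (2 * Real.pi) := fun hf =>
    (continuous_uncurry_left hf.1 ξ).intervalIntegrable _ _
  have key := hasDerivAt_intervalIntegral_param 0 (2 * Real.pi)
    (fun x => continuous_uncurry_left h.bc_lyapunovDensity.1 x)
    ((((b1.add b2).add b3).add b4).add b5).1 (fun x τ => by
      have d1 := (h.θ_ξ x τ).mul (h.w_ξ x τ)
      have d2 := ((h.v_ξ x τ).fun_pow 2).const_mul (s / 2)
      have d3 := (HasDerivAt.comp (h₂ := potential) (h := fun x => u x τ) x
        (hasDerivAt_potential _) (h.u_ξ x τ)).const_mul s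
      have d4 := (((h.v_ξ x τ).const_mul s).sub ((h.uτ_ξ x τ).const_mul ω)).mul (h.v_ξ x τ)
      refine (((d1.add d2).add d3).sub d4).congr_deriv ?_
      simp only [Pi.sub_apply, Nat.cast_ofNat, Nat.add_one_sub_one, pow_one]
      ring) ξ
  refine key.congr_deriv ?_
  have e4 : ∫ τ in (0 : ℝ)..(2 * Real.pi), v ξ τ * vτ ξ τ = 0 :=
    integral_deriv_periodic (F := fun τ => v ξ τ ^ 2 / 2) (fun τ =>
      (((h.v_τ ξ τ).fun_pow 2).div_const 2).congr_deriv (by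
        simp only [Nat.cast_ofNat, Nat.add_one_sub_one, pow_one]; ring))
      (continuous_uncurry_left (h.bc_v.mul h.bc_vτ).1 ξ) fun τ => by simp only [h.per_v ξ τ]
  rw [intervalIntegral.integral_add (ct (((b1.add b2).add b3).add b4)) (ct b5),
    intervalIntegral.integral_add (ct ((b1.add b2).add b3)) (ct b4),
    intervalIntegral.integral_add (ct (b1.add b2)) (ct b3),
    intervalIntegral.integral_add (ct b1) (ct b2)]
  simp only [intervalIntegral.integral_const_mul]
  rw [e4, h.integral_uτ_g, h.integral_v_g]
  ring

theorem bc_lyapunov (h : SmoothSol ω s I u v θ w g uτ vτ gξ) :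
    BddCont₂ fun ξ _ => lyapunov ω s u v θ w uτ ξ := by
  have hc : Continuous (lyapunov ω s u v θ w uτ) :=
    continuous_iff_continuousAt.2 fun ξ => (h.hasDerivAt_lyapunov ξ).continuousAt
  obtain ⟨B, hB⟩ := h.bc_lyapunovDensity.2
  exact ⟨hc.comp continuous_fst, B * |2 * Real.pi - 0|, fun ξ _ => by
    rw [← Real.norm_eq_abs]
    exact intervalIntegral.norm_integral_le_of_norm_le_const fun τ _ => hB ξ τ⟩

theorem monotone_lyapunov (h : SmoothSol ω s I u v θ w g uτ vτ gξ) :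
    Monotone (lyapunov ω s u v θ w uτ) :=
  monotone_of_deriv_nonneg (fun ξ => (h.hasDerivAt_lyapunov ξ).differentiableAt) fun ξ => by
    rw [(h.hasDerivAt_lyapunov ξ).deriv]
    exact intervalIntegral.integral_nonneg Real.two_pi_pos.le fun τ _ => sq_nonneg _

theorem bc_int_w_sq (h : SmoothSol ω s I u v θ w g uτ vτ gξ) :
    BddCont₂ fun ξ _ => ∫ τ in (0 : ℝ)..(2 * Real.pi), w ξ τ ^ 2 := by
  obtain ⟨B, hB⟩ := (h.bc_w.pow 2).2
  have hc : Continuous fun ξ => ∫ τ in (0 : ℝ)..(2 * Real.pi), w ξ τ ^ 2 :=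
    intervalIntegral.continuous_parametric_intervalIntegral_of_continuous' (h.bc_w.pow 2).1 _ _
  exact ⟨hc.comp continuous_fst, B * |2 * Real.pi - 0|, fun ξ _ => by
    rw [← Real.norm_eq_abs]
    exact intervalIntegral.norm_integral_le_of_norm_le_const fun τ _ => hB ξ τ⟩

/-- The weighted dissipation in terms of the Lyapunov function. -/
theorem stripInt_w_sq_eq (h : SmoothSol ω s I u v θ w g uτ vτ gξ) :
    stripInt (fun ξ τ => wt 1 ξ * w ξ τ ^ 2) =
      -∫ ξ, wt' 1 ξ * lyapunov ω s u v θ w uτ ξ := by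
  have k := isWeight_wt (le_refl 1)
  have d1 := (isWeight_wt' (le_refl 1)).mul h.bc_lyapunov
  have d2 := k.mul h.bc_int_w_sq
  have e := lineInt_deriv (k.mul h.bc_lyapunov) (d1.add d2)
    (fun ξ _ => ((hasDerivAt_wt 1 ξ).mul (h.hasDerivAt_lyapunov ξ)).congr_deriv rfl) 0
  rw [(posLinear_lineInt 0).add d1 d2] at e
  rw [stripInt_eq (k.mul (h.bc_w.pow 2))]
  simp only [intervalIntegral.integral_const_mul]
  unfold lineInt at e
  linarith

/-- Uses `|wt' 1| ≤ wt 1` and `∫ wt 1 = π`. -/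
theorem stripInt_w_sq_le (h : SmoothSol ω s I u v θ w g uτ vτ gξ) {E : ℝ}
    (hE : ∀ ξ, |lyapunov ω s u v θ w uτ ξ| ≤ E) :
    stripInt (fun ξ τ => wt 1 ξ * w ξ τ ^ 2) ≤ E * Real.pi := by
  rw [h.stripInt_w_sq_eq, ← integral_neg, ← integral_wt_one, ← integral_const_mul]
  refine integral_mono (((isWeight_wt' (le_refl 1)).mul h.bc_lyapunov).integrable 0).neg
    ((integrable_wt le_rfl).const_mul E) fun ξ => ?_
  have w1 := abs_wt'_le 1 ξ
  rw [Nat.cast_one, one_mul] at w1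
  calc _ ≤ |wt' 1 ξ * lyapunov ω s u v θ w uτ ξ| := neg_le_abs _
    _ = |wt' 1 ξ| * |lyapunov ω s u v θ w uτ ξ| := abs_mul _ _
    _ ≤ wt 1 ξ * E := mul_le_mul w1 (hE ξ) (abs_nonneg _) (wt_pos 1 ξ).le
    _ = _ := mul_comm _ _

/-- The weighted Lyapunov function is controlled by the local bounds. -/
theorem abs_integral_lyapunov_le (h : SmoothSol ω s I u v θ w g uτ vτ gξ) {C R : ℝ}
    (hC : LocalBound C u v θ g) (hR : 1 ≤ R) (hs : |s| ≤ R)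
    (hw : stripInt (fun ξ τ => wt 1 ξ * w ξ τ ^ 2) ≤ C) :
    |∫ ξ, wt 9 ξ * lyapunov ω s u v θ w uτ ξ| ≤ 20 * R * C := by
  have k1 := isWeight_wt (le_refl 1)
  have k := isWeight_wt (show 1 ≤ 3 by norm_num)
  have k9 := isWeight_wt (show 1 ≤ 9 by norm_num)
  have k9' := isWeight_wt' (show 1 ≤ 9 by norm_num)
  have L := posLinear_stripInt
  have bvξ := h.bc_g.add h.bc_θ
  have e0 : ∫ ξ, wt 9 ξ * lyapunov ω s u v θ w uτ ξ =
      stripInt fun ξ τ => wt 9 ξ * lyapunovDensity ω s u v θ w uτ ξ τ := by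
    rw [stripInt_eq (k9.mul h.bc_lyapunovDensity)]
    simp only [intervalIntegral.integral_const_mul]
    rfl
  have d0 := k9.mul ((h.bc_θ.mul h.bc_w).add (((h.bc_v.pow 2).const_mul (s / 2)).add
    (h.bc_potential.const_mul s)))
  have d1 := k9.mul (((h.bc_v.const_mul s).sub (h.bc_uτ.const_mul ω)).mul h.bc_v)
  have d2 := k9'.mul (h.bc_w.mul h.bc_v)
  have d3 := k9.mul (h.bc_w.mul bvξ)
  -- The local bounds do not contain `u_τ`. The term `w_ξ v` of the density is therefore integrated
  -- by parts, which leaves `w v` and `w v_ξ`; this is also why only a `ξ`-average of the Lyapunov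
  -- function is estimated.
  have e1 := stripInt_deriv (k9.mul (h.bc_w.mul h.bc_v)) ((d1.add d2).add d3) (fun ξ τ =>
    ((hasDerivAt_wt 9 ξ).mul ((h.w_ξ ξ τ).mul (h.v_ξ ξ τ))).congr_deriv (by
      simp only [Pi.mul_apply]; ring))
  rw [L.add (d1.add d2) d3, L.add d1 d2] at e1
  have e2 : stripInt (fun ξ τ => wt 9 ξ * lyapunovDensity ω s u v θ w uτ ξ τ) =
      stripInt fun ξ τ => (wt 9 ξ * (θ ξ τ * w ξ τ + (s / 2 * v ξ τ ^ 2 +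
        s * potential (u ξ τ))) + wt' 9 ξ * (w ξ τ * v ξ τ)) +
        wt 9 ξ * (w ξ τ * (g ξ τ + θ ξ τ)) := by
    rw [L.add (d0.add d2) d3, L.add d0 d2]
    have : stripInt (fun ξ τ => wt 9 ξ * lyapunovDensity ω s u v θ w uτ ξ τ) =
        1 * stripInt (fun ξ τ => wt 9 ξ * (θ ξ τ * w ξ τ + (s / 2 * v ξ τ ^ 2 +
        s * potential (u ξ τ)))) + (-1) * stripInt (fun ξ τ => wt 9 ξ *
          ((s * v ξ τ - ω * uτ ξ τ) * v ξ τ)) :=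
      L.eq₂ 1 (-1) d0 d1 fun ξ τ => by unfold lyapunovDensity; ring
    linarith
  have dS := (((((k.mul (h.bc_θ.pow 2)).const_mul (1 / 2)).add
    ((k1.mul (h.bc_w.pow 2)).const_mul (11 / 2))).add
    ((k.mul (h.bc_v.pow 2)).const_mul (5 * R))).add (((k.mul (h.bc_u.pow 2)).const_mul R).add
    ((k.mul (h.bc_u.pow 4)).const_mul R))).add ((k9.mul (bvξ.pow 2)).const_mul (1 / 2))
  have pt : ∀ ξ τ, |(wt 9 ξ * (θ ξ τ * w ξ τ + (s / 2 * v ξ τ ^ 2 +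
        s * potential (u ξ τ))) + wt' 9 ξ * (w ξ τ * v ξ τ)) +
        wt 9 ξ * (w ξ τ * (g ξ τ + θ ξ τ))| ≤
      1 / 2 * (wt 3 ξ * θ ξ τ ^ 2) + 11 / 2 * (wt 1 ξ * w ξ τ ^ 2) +
        5 * R * (wt 3 ξ * v ξ τ ^ 2) +
        (R * (wt 3 ξ * u ξ τ ^ 2) + R * (wt 3 ξ * u ξ τ ^ 4)) +
        1 / 2 * (wt 9 ξ * (g ξ τ + θ ξ τ) ^ 2) := by
    intro ξ τ
    have w0 := wt_pos 9 ξ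
    have w1 := abs_wt'_le 9 ξ
    push_cast at w1
    have w3 : wt 9 ξ ≤ wt 3 ξ := wt_anti (by norm_num) ξ
    have w4 : wt 9 ξ ≤ wt 1 ξ := wt_anti (by norm_num) ξ
    have y : ∀ a b : ℝ, |a * b| ≤ (a ^ 2 + b ^ 2) / 2 := fun a b => by
      have := young one_pos a b
      rw [inv_one] at this; linarith
    have s1 : |s / 2 * v ξ τ ^ 2| ≤ R / 2 * v ξ τ ^ 2 := by
      rw [abs_mul, abs_of_nonneg (sq_nonneg (v ξ τ)), abs_div, abs_two]
      gcongr
    have s2 : |s * potential (u ξ τ)| ≤ R * (u ξ τ ^ 2 + u ξ τ ^ 4) := by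
      have : |potential (u ξ τ)| ≤ u ξ τ ^ 2 + u ξ τ ^ 4 := by
        have h2 := sq_nonneg (u ξ τ)
        have h4 : 0 ≤ u ξ τ ^ 4 := by positivity
        unfold potential
        exact abs_le.2 ⟨by linarith, by linarith⟩
      rw [abs_mul]
      gcongr
    have t1 : |wt 9 ξ * (θ ξ τ * w ξ τ + (s / 2 * v ξ τ ^ 2 + s * potential (u ξ τ)))| ≤
        1 / 2 * (wt 3 ξ * θ ξ τ ^ 2) + 1 / 2 * (wt 1 ξ * w ξ τ ^ 2) +
        R / 2 * (wt 3 ξ * v ξ τ ^ 2) +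
        (R * (wt 3 ξ * u ξ τ ^ 2) + R * (wt 3 ξ * u ξ τ ^ 4)) := by
      rw [abs_mul, abs_of_pos w0]
      calc _ ≤ wt 9 ξ * ((θ ξ τ ^ 2 + w ξ τ ^ 2) / 2 + (R / 2 * v ξ τ ^ 2 +
            R * (u ξ τ ^ 2 + u ξ τ ^ 4))) := by
            refine mul_le_mul_of_nonneg_left ?_ w0.le
            exact (abs_add_le _ _).trans (add_le_add (y _ _) ((abs_add_le _ _).trans
              (add_le_add s1 s2)))
        _ = 1 / 2 * (wt 9 ξ * θ ξ τ ^ 2) + 1 / 2 * (wt 9 ξ * w ξ τ ^ 2) +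
            R / 2 * (wt 9 ξ * v ξ τ ^ 2) +
            (R * (wt 9 ξ * u ξ τ ^ 2) + R * (wt 9 ξ * u ξ τ ^ 4)) := by ring
        _ ≤ _ := by gcongr
    have t2 : |wt' 9 ξ * (w ξ τ * v ξ τ)| ≤
        9 / 2 * (wt 1 ξ * w ξ τ ^ 2) + 9 / 2 * (wt 3 ξ * v ξ τ ^ 2) := by
      rw [abs_mul]
      calc _ ≤ (9 * wt 9 ξ) * ((w ξ τ ^ 2 + v ξ τ ^ 2) / 2) := by gcongr; exact y _ _
        _ = 9 / 2 * (wt 9 ξ * w ξ τ ^ 2) + 9 / 2 * (wt 9 ξ * v ξ τ ^ 2) := by ring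
        _ ≤ _ := by gcongr
    have t3 : |wt 9 ξ * (w ξ τ * (g ξ τ + θ ξ τ))| ≤
        1 / 2 * (wt 1 ξ * w ξ τ ^ 2) + 1 / 2 * (wt 9 ξ * (g ξ τ + θ ξ τ) ^ 2) := by
      rw [abs_mul, abs_of_pos w0]
      calc _ ≤ wt 9 ξ * ((w ξ τ ^ 2 + (g ξ τ + θ ξ τ) ^ 2) / 2) := by gcongr; exact y _ _
        _ = 1 / 2 * (wt 9 ξ * w ξ τ ^ 2) + 1 / 2 * (wt 9 ξ * (g ξ τ + θ ξ τ) ^ 2) := by ring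
        _ ≤ _ := by gcongr
    have hv0 : 0 ≤ wt 3 ξ * v ξ τ ^ 2 := wt_sq_nonneg 3 v ξ τ
    have hRv : wt 3 ξ * v ξ τ ^ 2 ≤ R * (wt 3 ξ * v ξ τ ^ 2) := le_mul_of_one_le_left hv0 hR
    have := (abs_add_le (wt 9 ξ * (θ ξ τ * w ξ τ + (s / 2 * v ξ τ ^ 2 +
        s * potential (u ξ τ))) + wt' 9 ξ * (w ξ τ * v ξ τ))
        (wt 9 ξ * (w ξ τ * (g ξ τ + θ ξ τ)))).trans (add_le_add_left (abs_add_le _ _) _)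
    linarith
  have hS : stripInt (fun ξ τ => 1 / 2 * (wt 3 ξ * θ ξ τ ^ 2) + 11 / 2 * (wt 1 ξ * w ξ τ ^ 2) +
        5 * R * (wt 3 ξ * v ξ τ ^ 2) +
        (R * (wt 3 ξ * u ξ τ ^ 2) + R * (wt 3 ξ * u ξ τ ^ 4)) +
        1 / 2 * (wt 9 ξ * (g ξ τ + θ ξ τ) ^ 2)) ≤ 20 * R * C := by
    have e := L.eq₄ 1 1 1 1 (((k.mul (h.bc_θ.pow 2)).const_mul (1 / 2)).add
      ((k1.mul (h.bc_w.pow 2)).const_mul (11 / 2)))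
      ((k.mul (h.bc_v.pow 2)).const_mul (5 * R)) (((k.mul (h.bc_u.pow 2)).const_mul R).add
      ((k.mul (h.bc_u.pow 4)).const_mul R)) ((k9.mul (bvξ.pow 2)).const_mul (1 / 2))
      (F := fun ξ τ => 1 / 2 * (wt 3 ξ * θ ξ τ ^ 2) + 11 / 2 * (wt 1 ξ * w ξ τ ^ 2) +
        5 * R * (wt 3 ξ * v ξ τ ^ 2) +
        (R * (wt 3 ξ * u ξ τ ^ 2) + R * (wt 3 ξ * u ξ τ ^ 4)) +
        1 / 2 * (wt 9 ξ * (g ξ τ + θ ξ τ) ^ 2)) fun ξ τ => by ring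
    rw [e, L.eq₂ (1 / 2) (11 / 2) (k.mul (h.bc_θ.pow 2)) (k1.mul (h.bc_w.pow 2))
      fun _ _ => rfl, L.eq₂ R R (k.mul (h.bc_u.pow 2)) (k.mul (h.bc_u.pow 4)) fun _ _ => rfl,
      L.const_mul, L.const_mul]
    have h1 := hC.θ_le
    have h2 := hC.vξ_le
    have h3 := mul_le_mul_of_nonneg_left hC.v_le (show 0 ≤ R by linarith)
    have h4 := mul_le_mul_of_nonneg_left hC.u_le (show 0 ≤ R by linarith)
    have h5 := mul_le_mul_of_nonneg_left hC.u_four_le (show 0 ≤ R by linarith)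
    have C0 : 0 ≤ C := (sq_nonneg _).trans (hC.u_sq_le 0)
    have h6 : C ≤ R * C := le_mul_of_one_le_left C0 hR
    linarith
  rw [e0, e2]
  refine abs_le.2 ⟨?_, ?_⟩
  · have := L.mono dS.neg ((d0.add d2).add d3) fun ξ τ => by linarith [abs_le.1 (pt ξ τ)]
    rw [L.neg] at this
    linarith
  · exact (L.mono ((d0.add d2).add d3) dS fun ξ τ => (le_abs_self _).trans (pt ξ τ)).trans hS

theorem tendsto_integral_weight_shift {φ : ℝ → ℝ} (hφ : IsWeight φ) {V : ℝ → ℝ}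
    (hV : BddCont₂ fun ξ _ => V ξ) {l : Filter ℝ} [l.IsCountablyGenerated] {c : ℝ}
    (hl : ∀ x : ℝ, Tendsto (fun a => x + a) l l) (hc : Tendsto V l (𝓝 c)) :
    Tendsto (fun a => ∫ ξ, φ ξ * V (ξ + a)) l (𝓝 ((∫ ξ, φ ξ) * c)) := by
  obtain ⟨B, hB⟩ := hV.2
  have cV : Continuous V := hV.1.comp (Continuous.prodMk_left 0)
  have hi : Integrable φ := by
    simpa using (hφ.mul (BddCont₂.const 1)).integrable 0
  rw [← integral_mul_const]
  refine tendsto_integral_filter_of_dominated_convergence (fun ξ => |φ ξ| * B) ?_ ?_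
    (hi.abs.mul_const B) ?_
  · exact Eventually.of_forall fun a =>
      (hφ.1.mul (cV.comp (continuous_add_const a))).aestronglyMeasurable
  · refine Eventually.of_forall fun a => Eventually.of_forall fun ξ => ?_
    rw [norm_mul]
    exact mul_le_mul_of_nonneg_left (hB _ 0) (abs_nonneg _)
  · exact Eventually.of_forall fun ξ => (hc.comp (hl ξ)).const_mul _

theorem integral_wt'_one : ∫ ξ, wt' 1 ξ = 0 := by
  have := lineInt_deriv ((isWeight_wt (le_refl 1)).mul (BddCont₂.const 1))
    ((isWeight_wt' (le_refl 1)).mul (BddCont₂.const 1))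
    (fun ξ _ => by simpa using hasDerivAt_wt 1 ξ) 0
  simpa [lineInt] using this

/-- The a priori bound of bounded solutions. -/
theorem exists_bound {R : ℝ} (hR : 1 ≤ R) :
    ∃ M : ℝ, ∀ {ω s I : ℝ} {u v θ w g uτ vτ gξ : ℝ → ℝ → ℝ}, ParamBound R ω s I →
      SmoothSol ω s I u v θ w g uτ vτ gξ → ∀ ξ τ, |u ξ τ| ≤ M := by
  obtain ⟨C, hC1, hC⟩ := exists_localBound hR zero_le_one
  have c9 : 0 < ∫ ξ, wt 9 ξ := integral_wt_pos (by norm_num)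
  set E : ℝ := 20 * R * C / ∫ ξ, wt 9 ξ with hE
  have hE0 : 0 ≤ E := by positivity
  obtain ⟨D, hD1, hD⟩ := exists_localBound hR (mul_nonneg hE0 Real.pi_pos.le)
  refine ⟨√D, fun {ω s I u v θ w g uτ vτ gξ} P h => ?_⟩
  set V := lyapunov ω s u v θ w uτ with hV
  -- If `V` converges along the translations `a`, the weighted dissipation of the translated
  -- solutions, which is `-∫ wt' V`, tends to zero because `wt'` has integral zero. Eventually it is
  -- below 1, and the local bound with `K = 1` bounds the average of `V`, hence its limit,
  -- independently of the solution.
  have limit : ∀ {l : Filter ℝ} [l.IsCountablyGenerated] [l.NeBot] {c : ℝ},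
      (∀ x : ℝ, Tendsto (fun a => x + a) l l) → Tendsto V l (𝓝 c) → |c| ≤ E := by
    intro l _ _ c hl hc
    have t1 := tendsto_integral_weight_shift (isWeight_wt' (le_refl 1)) h.bc_lyapunov hl hc
    rw [integral_wt'_one, zero_mul] at t1
    have t2 := tendsto_integral_weight_shift (isWeight_wt (show 1 ≤ 9 by norm_num))
      h.bc_lyapunov hl hc
    have ev : ∀ᶠ a in l, |∫ ξ, wt 9 ξ * V (ξ + a)| ≤ 20 * R * C := by
      have h1 : ∀ᶠ a in l, -1 < ∫ ξ, wt' 1 ξ * V (ξ + a) :=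
        t1.eventually (lt_mem_nhds (by norm_num))
      filter_upwards [h1] with a ha
      have ha' := h.shift a
      have hw : stripInt (fun ξ τ => wt 1 ξ * w (ξ + a) τ ^ 2) ≤ 1 := by
        rw [ha'.stripInt_w_sq_eq]
        exact (neg_lt.1 ha).le
      exact ha'.abs_integral_lyapunov_le (hC P ha' hw) hR P.s_le (hw.trans hC1)
    have := le_of_tendsto t2.abs ev
    rw [abs_mul, abs_of_pos c9] at this
    rw [hE, le_div_iff₀ c9]
    linarith
  have hmono := h.monotone_lyapunov
  obtain ⟨B, hB⟩ := h.bc_lyapunov.2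
  have top := tendsto_atTop_ciSup hmono ⟨B, by
    rintro _ ⟨ξ, rfl⟩; exact (abs_le.1 (hB ξ 0)).2⟩
  have bot := tendsto_atBot_ciInf hmono ⟨-B, by
    rintro _ ⟨ξ, rfl⟩; exact (abs_le.1 (hB ξ 0)).1⟩
  have l1 := limit (fun x => tendsto_atTop_add_const_left _ x tendsto_id) top
  have l2 := limit (fun x => tendsto_atBot_add_const_left _ x tendsto_id) bot
  -- `V` is monotone and lies between its limits at infinity.
  have hVE : ∀ ξ, |V ξ| ≤ E := fun ξ => abs_le.2
    ⟨(abs_le.1 l2).1.trans (hmono.le_of_tendsto bot ξ),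
      (hmono.ge_of_tendsto top ξ).trans (abs_le.1 l1).2⟩
  intro ξ τ
  have hξ := h.shift ξ
  -- The dissipation near every point is now bounded uniformly, so the local bound applies with `K =
  -- E π` to every translate.
  have hw : stripInt (fun x τ => wt 1 x * w (x + ξ) τ ^ 2) ≤ E * Real.pi :=
    hξ.stripInt_w_sq_le fun x => hVE (x + ξ)
  have := (hD P hξ hw).u_sq_le τ
  rw [zero_add] at this
  exact Real.abs_le_sqrt this

end SmoothSol

/-! ### Uniform derivative bounds and a continuous choice of constants. -/

/-- The bounded solutions with parameters bounded by `R`. -/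
def solutionBox (R : ℝ) : Set (ℝ → ℝ → ℝ) :=
  {u | ∃ ω s I : ℝ, ∃ n : ℕ∞, ParamBound R ω s I ∧ u ∈ boundedSolutions ω s n I}

theorem ParamBound.mono {R R' ω s I : ℝ} (h : ParamBound R ω s I) (hR : R ≤ R') :
    ParamBound R' ω s I :=
  ⟨h.one_le.trans hR, h.ω_ne, h.s_ne, h.ω_le.trans hR, h.ω_inv_le.trans hR, h.s_le.trans hR,
    h.s_inv_le.trans hR, h.I_le.trans hR⟩

theorem solutionBox_mono {R R' : ℝ} (hR : R ≤ R') : solutionBox R ⊆ solutionBox R' :=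
  fun _ ⟨ω, s, I, n, hp, hu⟩ => ⟨ω, s, I, n, hp.mono hR, hu⟩

/-- The solutions are indexed by themselves, with chosen parameters and components `v`, `θ`, `w`.
`SmoothSol.exists_bound` replaces the individual sup bounds by a common one, and the uniform
regularity theory applies to the whole family. -/
theorem regular_solutionBox (R : ℝ) :
    Regular (Subtype.val : solutionBox R → ℝ → ℝ → ℝ) := by
  by_cases hR : 1 ≤ R
  · obtain ⟨M, hM⟩ := SmoothSol.exists_bound hR
    choose ω s I n hp v θ w hsol hbd hI using fun u : solutionBox R => u.2
    have hF : SolFamily R M ω s n Subtype.val v θ w := {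
      hR := hR
      le_ω := fun i => (inv_le_comm₀ (abs_pos.2 (hp i).ω_ne) (by linarith)).1 (hp i).ω_inv_le
      ω_le := fun i => (hp i).ω_le
      s_le := fun i => (hp i).s_le
      sol := hsol
      bdd := fun i => by
        obtain ⟨K, hK⟩ := hbd i
        obtain ⟨ξ, hξ⟩ := hI i
        obtain ⟨g, uτ, vτ, gξ, h⟩ := (hsol i).exists_smoothSol (hp i).ω_ne hK hξ
        exact hM (hp i) h }
    exact hF.regular_u
  -- For `R < 1` the box is empty, and any data form a family of solutions vacuously.
  · have : IsEmpty (solutionBox R) := ⟨fun ⟨_, _, _, _, _, hp, _⟩ => hR hp.one_le⟩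
    obtain ⟨ω, s, v, θ, w, n, -⟩ : ∃ (ω s : solutionBox R → ℝ)
      (v θ w : solutionBox R → ℝ → ℝ → ℝ) (n : solutionBox R → ℕ∞), True :=
      ⟨isEmptyElim, isEmptyElim, isEmptyElim, isEmptyElim, isEmptyElim, isEmptyElim, trivial⟩
    exact SolFamily.regular_u (R := 1) (M := 0) (ω := ω) (s := s) (n := n) (v := v) (θ := θ)
      (w := w) ⟨le_rfl, isEmptyElim, isEmptyElim, isEmptyElim, isEmptyElim, isEmptyElim⟩

/-- Upper bounds of all derivatives of order at most `k` of the solutions in a box. -/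
def derivBounds (k : ℕ) (R : ℝ) : Set ℝ :=
  {c | 0 ≤ c ∧ ∀ u ∈ solutionBox R, ∀ a b, a + b ≤ k → ∀ ξ τ, |mixedDeriv a b u ξ τ| ≤ c}

theorem derivBounds_nonempty (k : ℕ) (R : ℝ) : (derivBounds k R).Nonempty := by
  choose B hB using (regular_solutionBox R).exists_mixedDeriv_le
  refine ⟨∑ a ∈ Finset.range (k + 1), ∑ b ∈ Finset.range (k + 1), |B a b|, by positivity,
    fun u hu a b hab ξ τ => ?_⟩
  calc |mixedDeriv a b u ξ τ| ≤ |B a b| := (hB a b ⟨u, hu⟩ ξ τ).trans (le_abs_self _)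
    _ ≤ ∑ b ∈ Finset.range (k + 1), |B a b| :=
      Finset.single_le_sum (f := fun b => |B a b|) (fun _ _ => abs_nonneg _)
        (Finset.mem_range.2 (by omega))
    _ ≤ _ := Finset.single_le_sum (f := fun a => ∑ b ∈ Finset.range (k + 1), |B a b|)
        (fun _ _ => by positivity) (Finset.mem_range.2 (by omega))

/-- A continuous selection by partitions of unity: the admissible constants form a convex set, and a
constant for the box of size `R + 1` serves all sizes near `R`. -/
theorem exists_continuous_derivBound (k : ℕ) : ∃ F : C(ℝ, ℝ), ∀ R, F R ∈ derivBounds k R := by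
  refine exists_continuous_forall_mem_convex_of_local_const (fun R => ?_) fun R => ?_
  · intro c hc d hd a b ha hb hab
    refine ⟨add_nonneg (mul_nonneg ha hc.1) (mul_nonneg hb hd.1), fun u hu i j hij ξ τ => ?_⟩
    have h1 := mul_le_mul_of_nonneg_left (hc.2 u hu i j hij ξ τ) ha
    have h2 := mul_le_mul_of_nonneg_left (hd.2 u hu i j hij ξ τ) hb
    rw [smul_eq_mul, smul_eq_mul]
    calc _ = (a + b) * |mixedDeriv i j u ξ τ| := by rw [hab, one_mul]
      _ ≤ _ := by linarith
  · obtain ⟨c, hc⟩ := derivBounds_nonempty k (R + 1)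
    refine ⟨c, ?_⟩
    filter_upwards [gt_mem_nhds (lt_add_one R)] with R' hR'
    exact ⟨hc.1, fun u hu => hc.2 u (solutionBox_mono hR'.le hu)⟩

/-- The size of a box that contains given parameters. -/
def paramSize (ω s I : ℝ) : ℝ := 1 + |ω| + |ω|⁻¹ + |s| + |s|⁻¹ + |I|

theorem paramBound_paramSize {ω s I : ℝ} (hω : ω ≠ 0) (hs : s ≠ 0) :
    ParamBound (paramSize ω s I) ω s I := by
  have h1 := abs_nonneg ω
  have h2 := abs_nonneg s
  have h3 := abs_nonneg I
  have h4 := inv_nonneg.2 h1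
  have h5 := inv_nonneg.2 h2
  constructor <;> first | assumption | (unfold paramSize; linarith)

/-- The constant is a continuous function of `paramSize`, for each `k`, and does not depend on `n`.
Joint continuity and boundedness in `n` follow from this. -/
theorem exists_bcNorm_bound : ∃ C : ℝ → ℝ → ℕ∞ → ℝ → ℕ → ℝ≥0,
    ContinuousOn
      (fun p : ℝ × ℝ × ℕ∞ × ℝ × ℕ => C p.1 p.2.1 p.2.2.1 p.2.2.2.1 p.2.2.2.2)
      {p | p.1 ≠ 0 ∧ p.2.1 ≠ 0} ∧
    (∀ ω s : ℝ, ω ≠ 0 → s ≠ 0 → ∀ (I : ℝ) (k : ℕ),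
      BddAbove (Set.range fun n : ℕ∞ => C ω s n I k)) ∧
    ∀ ω s : ℝ, ω ≠ 0 → s ≠ 0 → ∀ (n : ℕ∞) (I : ℝ), ∀ u ∈ boundedSolutions ω s n I,
      ContDiff ℝ ((⊤ : ℕ∞) : WithTop ℕ∞) (Function.uncurry u) ∧
        ∀ k : ℕ, bcNorm k u ≤ (C ω s n I k : ℝ≥0∞) := by
  choose F hF using exists_continuous_derivBound
  refine ⟨fun ω s _ I k => (F k (paramSize ω s I)).toNNReal, ?_, ?_, ?_⟩
  · have hc : Continuous fun q : ℝ × ℕ => F q.2 q.1 :=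
      continuous_prod_of_discrete_right.2 fun k => (F k).continuous
    have hp : ContinuousOn (fun p : ℝ × ℝ × ℕ∞ × ℝ × ℕ => paramSize p.1 p.2.1 p.2.2.2.1)
        {p | p.1 ≠ 0 ∧ p.2.1 ≠ 0} := by
      unfold paramSize
      have i1 : ContinuousOn (fun p : ℝ × ℝ × ℕ∞ × ℝ × ℕ => |p.1|⁻¹)
          {p | p.1 ≠ 0 ∧ p.2.1 ≠ 0} :=
        continuous_fst.abs.continuousOn.inv₀ fun p hp => abs_ne_zero.2 hp.1
      have i2 : ContinuousOn (fun p : ℝ × ℝ × ℕ∞ × ℝ × ℕ => |p.2.1|⁻¹)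
          {p | p.1 ≠ 0 ∧ p.2.1 ≠ 0} :=
        continuous_snd.fst.abs.continuousOn.inv₀ fun p hp => abs_ne_zero.2 hp.2
      fun_prop
    exact (continuous_real_toNNReal.comp hc).comp_continuousOn
      (hp.prodMk continuous_snd.snd.snd.snd.continuousOn)
  · intro ω s _ _ I k
    exact ⟨_, by rintro _ ⟨n, rfl⟩; exact le_rfl⟩
  · intro ω s hω hs n I u hu
    have hbox : u ∈ solutionBox (paramSize ω s I) :=
      ⟨ω, s, I, n, paramBound_paramSize hω hs, hu⟩
    refine ⟨(regular_solutionBox _).contDiff ⟨u, hbox⟩, fun k => ?_⟩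
    unfold bcNorm
    refine iSup_le fun i => iSup_le fun j => iSup_le fun hij => iSup_le fun ξ => iSup_le fun τ => ?_
    rw [Real.enorm_eq_ofReal_abs]
    exact ENNReal.ofReal_le_ofReal ((hF k _).2 u hbox i j hij ξ τ)

/-! ### Jets and precompactness. -/

/-- The functions `g i j`, `i + j ≤ k`, are the continuous partial derivatives of `g 0 0`. -/
structure IsJet (k : ℕ) (g : ℕ → ℕ → ℝ → ℝ → ℝ) : Prop where
  continuous i j : i + j ≤ k → Continuous (Function.uncurry (g i j))
  hasDerivAt_fst i j : i + j < k → ∀ ξ τ, HasDerivAt (fun x => g i j x τ) (g (i + 1) j ξ τ) ξ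
  hasDerivAt_snd i j : i + j < k → ∀ ξ τ, HasDerivAt (g i j ξ) (g i (j + 1) ξ τ) τ

namespace IsJet

variable {k : ℕ} {g : ℕ → ℕ → ℝ → ℝ → ℝ}

theorem mono {m : ℕ} (h : IsJet k g) (hm : m ≤ k) : IsJet m g :=
  ⟨fun i j hij => h.continuous i j (hij.trans hm),
    fun i j hij => h.hasDerivAt_fst i j (hij.trans_le hm),
    fun i j hij => h.hasDerivAt_snd i j (hij.trans_le hm)⟩

theorem hasFDerivAt (h : IsJet k g) {i j : ℕ} (hij : i + j < k) (p : ℝ × ℝ) :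
    HasFDerivAt (Function.uncurry (g i j)) (g (i + 1) j p.1 p.2 • ContinuousLinearMap.fst ℝ ℝ ℝ +
      g i (j + 1) p.1 p.2 • ContinuousLinearMap.snd ℝ ℝ ℝ) p :=
  hasFDerivAt_uncurry_of_partials (h.continuous _ _ (by omega)) (h.continuous _ _ (by omega))
    (h.hasDerivAt_fst i j hij) (h.hasDerivAt_snd i j hij) p

theorem contDiff (h : IsJet k g) : ∀ m i j : ℕ, i + j + m ≤ k →
    ContDiff ℝ m (Function.uncurry (g i j))
  | 0, i, j, hm => contDiff_zero.2 (h.continuous i j hm)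
  | m + 1, i, j, hm => by
    have h1 := h.contDiff m (i + 1) j (by omega)
    have h2 := h.contDiff m i (j + 1) (by omega)
    push_cast
    rw [contDiff_succ_iff_hasFDerivAt]
    exact ⟨_, (h1.smul contDiff_const).add (h2.smul contDiff_const), h.hasFDerivAt (by omega)⟩

theorem mixedDeriv_eq (h : IsJet k g) {i j : ℕ} (hij : i + j ≤ k) :
    mixedDeriv i j (g 0 0) = g i j := by
  have h1 : ∀ j ≤ k, ∀ ξ, iteratedDeriv j (g 0 0 ξ) = g 0 j ξ := by
    intro j
    induction j with
    | zero => intro _ ξ; simp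
    | succ j ih =>
      intro hj ξ
      rw [iteratedDeriv_succ, ih (by omega)]
      ext τ
      exact (h.hasDerivAt_snd 0 j (by omega) ξ τ).deriv
  ext ξ τ
  unfold mixedDeriv
  simp only [h1 j (by omega)]
  have h2 : ∀ i, i + j ≤ k → iteratedDeriv i (fun x => g 0 j x τ) = fun x => g i j x τ := by
    intro i
    induction i with
    | zero => simp
    | succ i ih =>
      intro hi
      rw [iteratedDeriv_succ, ih (by omega)]
      ext x
      exact (h.hasDerivAt_fst i j (by omega) x τ).deriv
  rw [h2 i hij]

/-- Locally uniform convergence of functions and of their partial derivatives passes to the limit in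
the relations of differentiation. -/
theorem of_tendsto {α : Type*} {l : Filter α} [l.NeBot] {F : α → ℕ → ℕ → ℝ → ℝ → ℝ}
    (hF : ∀ a, IsJet k (F a))
    (hl : ∀ i j, i + j ≤ k → TendstoLocallyUniformly (fun a => Function.uncurry (F a i j))
      (Function.uncurry (g i j)) l) : IsJet k g := by
  have pt : ∀ i j, i + j ≤ k → ∀ ξ τ, Tendsto (fun a => F a i j ξ τ) l (𝓝 (g i j ξ τ)) :=
    fun i j hij ξ τ => (tendstoLocallyUniformlyOn_univ.2 (hl i j hij)).tendsto_at
      (mem_univ (ξ, τ))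
  refine ⟨fun i j hij => (hl i j hij).continuous
    (Eventually.of_forall fun a => (hF a).continuous i j hij).frequently,
    fun i j hij ξ τ => ?_, fun i j hij ξ τ => ?_⟩
  · exact hasDerivAt_of_tendstoLocallyUniformlyOn isOpen_univ
      (tendstoLocallyUniformlyOn_univ.2 ((hl (i + 1) j (by omega)).comp (fun x => (x, τ))
        (by fun_prop)))
      (Eventually.of_forall fun a x _ => (hF a).hasDerivAt_fst i j hij x τ)
      (fun x _ => pt i j hij.le x τ) (mem_univ ξ)
  · exact hasDerivAt_of_tendstoLocallyUniformlyOn isOpen_univ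
      (tendstoLocallyUniformlyOn_univ.2 ((hl i (j + 1) (by omega)).comp (fun x => (ξ, x))
        (by fun_prop)))
      (Eventually.of_forall fun a x _ => (hF a).hasDerivAt_snd i j hij ξ x)
      (fun x _ => pt i j hij.le ξ x) (mem_univ τ)

theorem lipschitzWith (h : IsJet k g) {i j : ℕ} (hij : i + j < k) {B₁ B₂ : ℝ≥0}
    (h₁ : ∀ ξ τ, |g (i + 1) j ξ τ| ≤ B₁) (h₂ : ∀ ξ τ, |g i (j + 1) ξ τ| ≤ B₂) :
    LipschitzWith (B₁ + B₂) (Function.uncurry (g i j)) := by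
  refine lipschitzWith_of_nnnorm_fderiv_le (𝕜 := ℝ)
    (fun p => (h.hasFDerivAt hij p).differentiableAt) fun p => ?_
  rw [(h.hasFDerivAt hij p).fderiv, ← NNReal.coe_le_coe, coe_nnnorm, NNReal.coe_add]
  refine (norm_add_le _ _).trans (add_le_add ?_ ?_) <;> rw [norm_smul, Real.norm_eq_abs]
  · exact (mul_le_of_le_one_right (abs_nonneg _) (ContinuousLinearMap.norm_fst_le ..)).trans
      (h₁ _ _)
  · exact (mul_le_of_le_one_right (abs_nonneg _) (ContinuousLinearMap.norm_snd_le ..)).trans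
      (h₂ _ _)

end IsJet

theorem Regular.isJet {ι : Type*} {f : ι → ℝ → ℝ → ℝ} (h : Regular f) (k : ℕ) (i : ι) :
    IsJet k fun a b => mixedDeriv a b (f i) := by
  have r : ∀ a b, Regular (ModulatedWave.dξ^[a] (ModulatedWave.dτ^[b] f)) := fun a b =>
    (h.iterate_dτ b).iterate_dξ a
  simp only [Regular.mixedDeriv_eq]
  refine ⟨fun a b _ => (r a b).continuous i, fun a b _ ξ τ => ?_, fun a b _ ξ τ => ?_⟩
  · rw [Function.iterate_succ_apply']
    exact (r a b).hasDerivAt_fst i ξ τ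
  · rw [Function.iterate_succ_apply', ← (h.iterate_dτ b).dτ_iterate_dξ a]
    exact (r a b).hasDerivAt_snd i ξ τ

namespace CkLoc

variable {k : ℕ}

theorem sUnion_isCompact : ⋃₀ {K : Set (ℝ × ℝ) | IsCompact K} = univ :=
  eq_univ_of_forall fun x => mem_sUnion_of_mem (mem_singleton x) isCompact_singleton

theorem isInducing_jet : IsInducing (jet : CkLoc k → _) := ⟨rfl⟩

/-- A set of `k`-jets with bounded derivatives of order at most `k + 1` is precompact. -/
theorem isCompact_closure_image_jet {S : Set (CkLoc k)}
    (hj : ∀ f ∈ S, IsJet (k + 1) fun i j => mixedDeriv i j f.1)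
    (hb : ∀ i j, ∃ B : ℝ, ∀ f ∈ S, ∀ ξ τ, |mixedDeriv i j f.1 ξ τ| ≤ B) :
    IsCompact (closure (jet '' S)) := by
  have := UniformOnFun.t2Space_of_covering (β := ℝ) sUnion_isCompact
  have comp : ∀ p : {p : ℕ × ℕ // p.1 + p.2 ≤ k},
      IsCompact (closure ((fun f : CkLoc k => jet f p) '' S)) := by
    rintro ⟨⟨i, j⟩, hij⟩
    obtain ⟨B, hB⟩ := hb i j
    obtain ⟨B₁, hB₁⟩ := hb (i + 1) j
    obtain ⟨B₂, hB₂⟩ := hb i (j + 1)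
    refine ArzelaAscoli.isCompact_closure_of_isClosedEmbedding
      (F := UniformOnFun.toFun {K : Set (ℝ × ℝ) | IsCompact K}) (fun K hK => hK)
      IsClosedEmbedding.id (fun K _ => ?_) fun K _ x _ => ?_
    -- Derivatives of one order more, up to `k + 1`, give a common Lipschitz constant and so
    -- equicontinuity.
    · refine (LipschitzWith.uniformEquicontinuous _ (B₁.toNNReal + B₂.toNNReal)
        ?_).equicontinuous.equicontinuousOn K
      rintro ⟨_, f, hf, rfl⟩
      exact (hj f hf).lipschitzWith (i := i) (j := j) (Nat.lt_succ_of_le hij)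
        (fun ξ τ => (hB₁ f hf ξ τ).trans (Real.le_coe_toNNReal _))
        (fun ξ τ => (hB₂ f hf ξ τ).trans (Real.le_coe_toNNReal _))
    · refine ⟨Icc (-B) B, isCompact_Icc, ?_⟩
      rintro _ ⟨f, hf, rfl⟩
      exact abs_le.1 (hB f hf x.1 x.2)
  -- The jets lie in a product of compact sets, one for each derivative.
  refine (isCompact_univ_pi comp).closure_of_subset ?_
  rintro _ ⟨f, hf, rfl⟩ p -
  exact subset_closure ⟨f, hf, rfl⟩

/-- A limit of jets is the jet of a periodic `C^k` function, so nothing is lost by taking the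
closure among all tuples of functions. -/
theorem closure_image_jet_subset_range {S : Set (CkLoc k)}
    (hj : ∀ f ∈ S, IsJet k fun i j => mixedDeriv i j f.1) :
    closure (jet '' S) ⊆ range (jet : CkLoc k → _) := by
  intro G hG
  have hne : (comap (fun f : S => jet f.1) (𝓝 G)).NeBot := by
    rw [mem_closure_iff_nhds] at hG
    refine comap_neBot fun t ht => ?_
    obtain ⟨_, h1, f, hf, rfl⟩ := hG t ht
    exact ⟨⟨f, hf⟩, h1⟩
  set l := comap (fun f : S => jet f.1) (𝓝 G)
  have hl : Tendsto (fun f : S => jet f.1) l (𝓝 G) := tendsto_comap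
  set g : ℕ → ℕ → ℝ → ℝ → ℝ := fun i j ξ τ => if h : i + j ≤ k then
    UniformOnFun.toFun {K : Set (ℝ × ℝ) | IsCompact K} (G ⟨(i, j), h⟩) (ξ, τ) else 0 with hg
  have lim : ∀ i j, i + j ≤ k → TendstoLocallyUniformly
      (fun f : S => Function.uncurry (mixedDeriv i j f.1.1)) (Function.uncurry (g i j)) l := by
    intro i j hij
    rw [tendstoLocallyUniformly_iff_forall_isCompact]
    intro K hK
    have h1 := UniformOnFun.tendsto_iff_tendstoUniformlyOn.1
      (tendsto_pi_nhds.1 hl ⟨(i, j), hij⟩) K hK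
    have h2 : Function.uncurry (g i j) =
        UniformOnFun.toFun {K : Set (ℝ × ℝ) | IsCompact K} (G ⟨(i, j), hij⟩) := by
      ext ⟨ξ, τ⟩
      simp only [hg, Function.uncurry_apply_pair, dif_pos hij]
    rw [h2]
    exact h1
  have hJ : IsJet k g := IsJet.of_tendsto (fun f : S => hj f.1 f.2) lim
  have pt : ∀ ξ τ, Tendsto (fun f : S => f.1.1 ξ τ) l (𝓝 (g 0 0 ξ τ)) := fun ξ τ =>
    (tendstoLocallyUniformlyOn_univ.2 (lim 0 0 (Nat.zero_le k))).tendsto_at (mem_univ (ξ, τ))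
  refine ⟨⟨g 0 0, hJ.contDiff k 0 0 (by omega), fun ξ τ =>
    tendsto_nhds_unique (pt ξ (τ + 2 * Real.pi)) ?_⟩, ?_⟩
  · refine (pt ξ τ).congr fun f => (f.1.2.2 ξ τ).symm
  · funext ⟨⟨i, j⟩, hij⟩
    unfold jet
    simp only [hJ.mixedDeriv_eq hij]
    simp only [hg, dif_pos hij]
    rfl

/-- The topology is induced by `jet`, so compactness can be tested on images; the image of the
closure is the full closure of the image by the preceding lemma. -/
theorem isCompact_closure {S : Set (CkLoc k)}
    (hj : ∀ f ∈ S, IsJet (k + 1) fun i j => mixedDeriv i j f.1)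
    (hb : ∀ i j, ∃ B : ℝ, ∀ f ∈ S, ∀ ξ τ, |mixedDeriv i j f.1 ξ τ| ≤ B) :
    IsCompact (closure S) := by
  rw [isInducing_jet.closure_eq_preimage_closure_image, isInducing_jet.isCompact_iff,
    image_preimage_eq_of_subset
      (closure_image_jet_subset_range fun f hf => (hj f hf).mono k.le_succ)]
  exact isCompact_closure_image_jet hj hb

end CkLoc

theorem isCompact_closure_boundedSolutions {ω s : ℝ} (hω : ω ≠ 0) (hs : s ≠ 0) (I₁ I₂ : ℝ)
    (n₀ : ℕ∞) (k : ℕ) :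
    IsCompact (closure {f : CkLoc k | ∃ n : ℕ∞, n₀ ≤ n ∧ ∃ I ∈ Icc I₁ I₂,
      f.1 ∈ boundedSolutions ω s n I}) := by
  -- A single box contains all parameters: `|I| ≤ J` on the interval, and the box does not restrict
  -- `n`.
  set J := max |I₁| |I₂|
  set R := paramSize ω s J
  have hr := regular_solutionBox R
  have hbox : ∀ f ∈ {f : CkLoc k | ∃ n : ℕ∞, n₀ ≤ n ∧ ∃ I ∈ Icc I₁ I₂,
      f.1 ∈ boundedSolutions ω s n I}, f.1 ∈ solutionBox R := by
    rintro f ⟨n, -, I, hI, hf⟩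
    refine ⟨ω, s, I, n, (paramBound_paramSize hω hs).mono ?_, hf⟩
    have : |I| ≤ |J| := (abs_le_max_abs_abs hI.1 hI.2).trans (le_abs_self _)
    simp only [R, paramSize]
    linarith
  refine CkLoc.isCompact_closure (fun f hf => hr.isJet (k + 1) ⟨f.1, hbox f hf⟩) fun i j => ?_
  obtain ⟨B, hB⟩ := hr.exists_mixedDeriv_le i j
  exact ⟨B, fun f hf => hB ⟨f.1, hbox f hf⟩⟩

end ModulatedWave

end

theorem corollary2p6 :
    (∃ C : ℝ → ℝ → ℕ∞ → ℝ → ℕ → ℝ≥0,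
      ContinuousOn
        (fun p : ℝ × ℝ × ℕ∞ × ℝ × ℕ => C p.1 p.2.1 p.2.2.1 p.2.2.2.1 p.2.2.2.2)
        {p | p.1 ≠ 0 ∧ p.2.1 ≠ 0} ∧
      (∀ ω s : ℝ, ω ≠ 0 → s ≠ 0 → ∀ (I : ℝ) (k : ℕ),
        BddAbove (Set.range fun n : ℕ∞ => C ω s n I k)) ∧
      ∀ ω s : ℝ, ω ≠ 0 → s ≠ 0 → ∀ (n : ℕ∞) (I : ℝ),
        ∀ u ∈ ModulatedWave.boundedSolutions ω s n I,
          ContDiff ℝ ((⊤ : ℕ∞) : WithTop ℕ∞) (Function.uncurry u) ∧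
            ∀ k : ℕ, ModulatedWave.bcNorm k u ≤ (C ω s n I k : ℝ≥0∞)) ∧
    ∀ ω s : ℝ, ω ≠ 0 → s ≠ 0 → ∀ (I₁ I₂ : ℝ) (n₀ : ℕ∞) (k : ℕ),
      IsCompact (closure {f : ModulatedWave.CkLoc k |
        ∃ n : ℕ∞, n₀ ≤ n ∧ ∃ I ∈ Set.Icc I₁ I₂,
          f.1 ∈ ModulatedWave.boundedSolutions ω s n I}) := by
  exact ⟨ModulatedWave.exists_bcNorm_bound, fun _ _ hω hs I₁ I₂ n₀ k =>
    ModulatedWave.isCompact_closure_boundedSolutions hω hs I₁ I₂ n₀ k⟩
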